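/- **Setting.** All manifolds, maps and forms are smooth and finite dimensional; sums over repeated indices $i=1,\dots,k$ are understood. A nonholonomic system on a manifold $Q$ is given by a lagrangian $L=\frac12\kappa-U$ ($\kappa$ a Riemannian metric, $U$ a function on $Q$) and a constraint distribution $D\subseteq TQ$ of constant rank. Let $H$ be the hamiltonian on $T^*Q$, $\Theta$ the Liouville 1-form, $\Omega=-d\Theta$, $\tau:T^*Q\to Q$ the projection, $\mathcal M=\kappa^\sharp(D)\subseteq T^*Q$ the constraint manifold ($\kappa^\sharp:TQ\to T^*Q$ the Legendre transformation) and $\mathcal C_m=\{v\in T_m\mathcal M: T\tau(v)\in D\}$. The nonholonomic vector field $X_{nh}$ on $\mathcal M$ is determined by $X_{nh}(m)\in\mathcal C_m$ and $\Omega(X_{nh},w)=dH(w)$ for all $w\in\mathcal C_m$. A Lie group $G$ with Lie algebra $\mathfrak g$ acts freely and properly on $Q$, and its tangent lift leaves $L$ and $D$ invariant ($G$-symmetry). Write $\xi_Q$ for the infinitesimal generator of $\xi\in\mathfrak g$, $V$ for the distribution tangent to the $G$-orbits, $S=D\cap V$, and $J:T^*Q\to\mathfrak g^*$ for the canonical momentum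 map, $\langle J,\xi\rangle=\mathbf i_{\xi_{T^*Q}}\Theta$. Assume: * (dimension assumption) $TQ=D+V$; * (horizontal gauge momenta) with $k=\operatorname{rank}S$, there are functions $\zeta_1,\dots,\zeta_k:Q\to\mathfrak g$ with $(\zeta_i(q))_Q(q)\in S_q$ such that the functions $J_i(m)=\langle J(m),\zeta_i(\tau(m))\rangle$ on $\mathcal M$ are $G$-invariant, functionally independent (at every point) and satisfy $X_{nh}(J_i)=0$; * (vertical symmetry condition) there are a distribution $W\subseteq V$ with $TQ=D\oplus W$ and a closed normal subgroup $G_W\subseteq G$ such that $W_q=T_q(\mathrm{Orb}_{G_W}(q))$ for all $q$. Fix moreover a $G$-invariant distribution $Hor\subseteq D$ with $TQ=Hor\oplus V$. **The 2-forms.** Let $P_D:TQ\to D$ be the projection along $W$, and let $P_{Hor}$, $P_V$ be the projections of $TQ=Hor\oplus V$. For a form $\theta$ on $Q$ put $d^D\theta=d\theta(P_D\cdot,P_D\cdot)$. Let $A_W$ be the $\mathfrak g$-valued 1-form with $A_W|_D=0$ and $A_W(\xi_Q(q))=\xi$ whenever $\xi_Q(q)\in W_q$, and let $K_W=d^DA_W$.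 Let $A$ be the principal connection on $Q\to Q/G$ with horizontal space $Hor$, and let $K_V=-dA(P_{Hor}\cdot,P_{Hor}\cdot)$ be its curvature, with the sign convention $K_V(X,Y)=A([X,Y])$ for horizontal vector fields. Let $Y^i$ be the 1-forms on $Q$ with $Y^i|_{Hor}=Y^i|_W=0$ and $Y^i((\zeta_j)_Q)=\delta_{ij}$. Let $\kappa_{\mathfrak g}(u)(\xi)=\kappa(u,\xi_Q)$, and for a $\mathfrak g$-valued 1-form $\beta$ let $(\kappa_{\mathfrak g}\wedge\beta)(u,v)=\kappa_{\mathfrak g}(u)(\beta(v))-\kappa_{\mathfrak g}(v)(\beta(u))$. Define on $\mathcal M$ the following forms (forms on $Q$ are pulled back to $\mathcal M$ by $\tau$, and $|_{Hor}$ means composition of both arguments with $P_{Hor}$): $$B_1=\langle J,K_W\rangle+J_i\,d^DY^i,\qquad \mathcal B=\langle J,K_V\rangle-\tfrac12\bigl(\kappa_{\mathfrak g}\wedge\mathbf i_{P_V(T\tau X_{nh})}[K_W+d^DY^i\otimes\zeta_i]\bigr)\big|_{Hor},\qquad \mathbf B=B_1+\mathcal B.$$ **Partial reduction.** Let $\widetilde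 Q=Q/G_W$, $F=G/G_W$, $\mathfrak f=\mathfrak g/\mathfrak w$ with $\mathfrak w$ the Lie algebra of $G_W$. The group $F$ acts on $\widetilde Q$ by $[g][q]=[gq]$ and on $T^*\widetilde Q$ by cotangent lift. The map $R:\mathcal M\to T^*\widetilde Q$ that sends $\alpha\in\mathcal M$ over $q$ to the covector $w\mapsto\langle\alpha,w^h\rangle$ at $[q]$, where $w^h\in D_q$ is the vector projecting to $w\in T_{[q]}\widetilde Q$, identifies $\mathcal M/G_W$ with $T^*\widetilde Q$. Hence $H|_{\mathcal M}$, $X_{nh}$, $\langle J,K_W\rangle$, $\mathbf B$ descend along $R$ to a function $\widetilde H$, a vector field $\widetilde X_{nh}$ and 2-forms $B_{\langle J,K\rangle}$, $\widetilde{\mathbf B}$ on $T^*\widetilde Q$. Put $$\widetilde\Omega=\Omega_{\widetilde Q}-B_{\langle J,K\rangle},\qquad \widetilde\Omega_{\mathbf B}=\widetilde\Omega+\widetilde{\mathbf B},$$ where $\Omega_{\widetilde Q}$ is the canonical 2-form. The $\zeta_i$ induce $\eta_i:\widetilde Q\to\mathfrak f$, $\eta_i([q])=[\zeta_i(q)]$.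 Let $\widetilde J:T^*\widetilde Q\to\mathfrak f^*$ be the canonical momentum map, let $\widetilde J_i(\alpha_x)=\langle\widetilde J(\alpha_x),\eta_i(x)\rangle$ be the partially reduced horizontal gauge momenta, and let $\mu^i:\widetilde Q\to\mathfrak f^*$ be dual to the $\eta_i$: $\langle\mu^i,\eta_j\rangle=\delta_{ij}$. For $\mu=c_i\mu^i$ with $c\in\mathbb R^k$ put $\widetilde J^{-1}(\mu)=\{\alpha_x\in T^*\widetilde Q:\widetilde J(\alpha_x)=\mu(x)\}$. Finally $\mathcal M/G=T^*\widetilde Q/F$, with orbit projection $\rho_F:T^*\widetilde Q\to T^*\widetilde Q/F$, and $H_{red}$, $X_{red}$ are the function and the vector field induced there by $H|_{\mathcal M}$ and $X_{nh}$. **Theorem.** The objects above are well defined, and: (i) $\widetilde\Omega_{\mathbf B}$ is almost symplectic (a nondegenerate 2-form, not necessarily closed) and $\mathbf i_{\widetilde X_{nh}}\widetilde\Omega_{\mathbf B}=d\widetilde H$. The system $(T^*\widetilde Q,\widetilde\Omega_{\mathbf B},\widetilde H)$ is $F$-invariant. The $k$ functions $\widetilde J_1,\dots,\widetilde J_k$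 are smooth, functionally independent at every point and $F$-invariant, satisfy $\widetilde J_i\circ R=J_i|_{\mathcal M}$, and are conserved by $\widetilde X_{nh}$. (ii) For each $c\in\mathbb R^k$ and $\mu=c_i\mu^i$, the set $\widetilde J^{-1}(\mu)$ is an $F$-invariant embedded submanifold of $T^*\widetilde Q$, with inclusion $\iota_\mu$; the quotient $\widetilde J^{-1}(\mu)/F$ is a manifold such that the orbit projection $\rho_\mu:\widetilde J^{-1}(\mu)\to\widetilde J^{-1}(\mu)/F$ is a submersion and the inclusion $\iota_\mu^{red}:\widetilde J^{-1}(\mu)/F\to T^*\widetilde Q/F$ is an embedding; and there is an almost symplectic form $\omega_\mu^{\mathbf B}$ on $\widetilde J^{-1}(\mu)/F$ with $$\iota_\mu^*\widetilde\Omega_{\mathbf B}=\rho_\mu^*\,\omega_\mu^{\mathbf B}.$$ (iii) For each such $\mu$ the vector field $X_{red}$ is tangent to $\widetilde J^{-1}(\mu)/F$, and its restriction $X^\mu_{red}$ is the hamiltonian vector field of $H_\mu=(\iota_\mu^{red})^*H_{red}$ for $\omega_\mu^{\mathbf B}$: $\ \mathbf i_{X^\mu_{red}}\omega_\mu^{\mathbf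 B}=dH_\mu$. -/

import Mathlib

open scoped Manifold ContDiff Topology
open Bundle

noncomputable section

namespace NH

/-! ### Generalities on manifolds

All manifolds are boundaryless, finite dimensional and smooth. In Mathlib the tangent space
`TangentSpace I x` is, by definition, the model vector space; forms at a point are therefore written
as continuous (bi)linear maps on the model vector space. -/

section General

variable {E : Type*} [NormedAddCommGroup E] [NormedSpace ℝ E]
  {H : Type*} [TopologicalSpace H] (I : ModelWithCorners ℝ E H)
  {X : Type*} [TopologicalSpace X] [ChartedSpace H X]
  {E' : Type*} [NormedAddCommGroup E'] [NormedSpace ℝ E']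
  {H' : Type*} [TopologicalSpace H'] (I' : ModelWithCorners ℝ E' H')
  {Y : Type*} [TopologicalSpace Y] [ChartedSpace H' Y]
  {V : Type*} [NormedAddCommGroup V] [NormedSpace ℝ V]
  {V' : Type*} [NormedAddCommGroup V'] [NormedSpace ℝ V']

/-- The tangent map `T_x f` of `f : X → Y`, as a map between the model spaces. -/
def tmap (f : X → Y) (x : X) : E →L[ℝ] E' := mfderiv I I' f x

/-- The differential `df` of a real function. -/
def dfun (f : X → ℝ) (x : X) : E →L[ℝ] ℝ := mfderiv I 𝓘(ℝ, ℝ) f x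

/-- The tangent space at `x` of a subset `N` (in practice an embedded submanifold): all velocities
of smooth curves in `N` passing through `x`. -/
def tangentTo (N : Set X) (x : X) : Set E :=
  {v | ∃ γ : ℝ → X, ContMDiff 𝓘(ℝ, ℝ) I ∞ γ ∧ (∀ t, γ t ∈ N) ∧ γ 0 = x ∧
    tmap 𝓘(ℝ, ℝ) I γ 0 1 = v}

/-- The exterior derivative of a (vector-valued) 1-form `θ` at `x`, computed in the chart at `x`:
`dθ(u, v) = ∂_u (θ̂ v) - ∂_v (θ̂ u)`, where `θ̂` is the expression of `θ` in the chart. -/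
def extD (θ : X → E →L[ℝ] V) (x : X) : E →L[ℝ] E →L[ℝ] V :=
  let φ := extChartAt I x
  let θhat : E → E →L[ℝ] V := fun y => (θ (φ.symm y)).comp (tmap 𝓘(ℝ, E) I φ.symm y)
  let D := fderiv ℝ θhat (φ x)
  (D - D.flip).bilinearComp (tmap I 𝓘(ℝ, E) φ x) (tmap I 𝓘(ℝ, E) φ x)

/-- Composition of a vector-valued bilinear form with a linear map of the values. -/
def postcomp (l : V →L[ℝ] V') (B : E →L[ℝ] E →L[ℝ] V) : E →L[ℝ] E →L[ℝ] V' :=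
  (ContinuousLinearMap.compL ℝ E V V' l).comp B

/-- The difference of two bilinear forms. -/
def subForm (A B : E →L[ℝ] E →L[ℝ] ℝ) : E →L[ℝ] E →L[ℝ] ℝ := A - B

/-- The sum of two bilinear forms. -/
def addForm (A B : E →L[ℝ] E →L[ℝ] ℝ) : E →L[ℝ] E →L[ℝ] ℝ := A + B

/-- Smooth submersions. -/
def IsSubmersion (f : X → Y) : Prop :=
  ContMDiff I I' ∞ f ∧ ∀ x, Function.Surjective (tmap I I' f x)

/-- Smooth embeddings. -/
def IsSmoothEmbedding (f : X → Y) : Prop :=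
  ContMDiff I I' ∞ f ∧ (∀ x, Function.Injective (tmap I I' f x)) ∧ Topology.IsEmbedding f

/-- Smooth vector fields on a set. -/
def IsSmoothVectorFieldOn [IsManifold I ∞ X] (Z : X → E) (s : Set X) : Prop :=
  ContMDiffOn I I.tangent ∞ (fun x => (⟨x, Z x⟩ : TangentBundle I X)) s

/-- A field of subspaces `D_x ⊆ T_x X` of the tangent spaces (each `T_x X` is the model space). -/
abbrev PlaneField (E X : Type*) [NormedAddCommGroup E] [NormedSpace ℝ E] : Type _ :=
  X → Submodule ℝ E

/-- A distribution: a smooth subbundle (of constant rank) of the tangent bundle. -/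
def IsDistribution [IsManifold I ∞ X] (D : PlaneField E X) : Prop :=
  ∃ r : ℕ, ∀ x₀ : X, ∃ s ∈ 𝓝 x₀, ∃ Z : Fin r → X → E,
    (∀ i, IsSmoothVectorFieldOn I (Z i) s) ∧
    ∀ x ∈ s, LinearIndependent ℝ (fun i => Z i x) ∧
      Submodule.span ℝ (Set.range fun i => Z i x) = D x

/-- An almost symplectic form: a smooth nondegenerate 2-form, not necessarily closed. -/
structure IsAlmostSymplectic [IsManifold I ∞ X]
    (σ : (x : X) → TangentSpace I x →L[ℝ] TangentSpace I x →L[ℝ] ℝ) : Prop where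
  smooth : ContMDiff I (I.prod 𝓘(ℝ, E →L[ℝ] E →L[ℝ] ℝ)) ∞
    (fun x => TotalSpace.mk' (E →L[ℝ] E →L[ℝ] ℝ)
      (E := fun x : X => TangentSpace I x →L[ℝ] TangentSpace I x →L[ℝ] ℝ) x (σ x))
  alt : ∀ x v, σ x v v = 0
  nondegenerate : ∀ x v, (∀ w, σ x v w = 0) → v = 0

/-- The projection of `E` onto `K` along the complementary subspace `R`. -/
def projAlong [FiniteDimensional ℝ E] (K R : Submodule ℝ E) : E →L[ℝ] E :=
  open Classical in
  if h : IsCompl K R then (K.projection R h).toContinuousLinearMap else 0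

end General

/-! ### Cotangent bundles -/

section Cotangent

variable (E : Type*) [NormedAddCommGroup E] [NormedSpace ℝ E]
  (X : Type*) [TopologicalSpace X] [ChartedSpace E X] [IsManifold 𝓘(ℝ, E) ∞ X]

/-- The cotangent bundle `T*X`. -/
abbrev Cot : Type _ :=
  TotalSpace (E →L[ℝ] ℝ) (fun x : X => TangentSpace 𝓘(ℝ, E) x →L[ℝ] ℝ)

/-- The model with corners of the cotangent bundle. -/
abbrev cotI : ModelWithCorners ℝ (E × (E →L[ℝ] ℝ)) (ModelProd E (E →L[ℝ] ℝ)) :=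
  𝓘(ℝ, E).prod 𝓘(ℝ, E →L[ℝ] ℝ)

variable {E X}

/-- The covector at `x` given by the linear form `l`. -/
def mkCot (x : X) (l : E →L[ℝ] ℝ) : Cot E X := ⟨x, l⟩

/-- The covector `α ∈ T*_q X`, as a linear form on the model space. -/
def covec (α : Cot E X) : E →L[ℝ] ℝ := α.2

/-- The tangent map of the bundle projection `τ : T*X → X`. -/
def tτ (α : Cot E X) : E × (E →L[ℝ] ℝ) →L[ℝ] E :=
  tmap (cotI E) 𝓘(ℝ, E) (fun β : Cot E X => β.1) α

/-- The Liouville 1-form `Θ` on `T*X`. -/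
def liouville (α : Cot E X) : E × (E →L[ℝ] ℝ) →L[ℝ] ℝ := (covec α).comp (tτ α)

/-- The canonical 2-form `Ω = -dΘ` on `T*X`. -/
def canonicalForm (α : Cot E X) :
    E × (E →L[ℝ] ℝ) →L[ℝ] E × (E →L[ℝ] ℝ) →L[ℝ] ℝ :=
  - extD (cotI E) (liouville (E := E) (X := X)) α

/-- The cotangent lift of an action on `X`: `g • α_x = α_x ∘ T(g⁻¹) ∈ T*_{g x} X`. -/
def cotAct {K : Type*} [Group K] [MulAction K X] (g : K) (α : Cot E X) : Cot E X :=
  mkCot (g • α.1) ((covec α).comp (tmap 𝓘(ℝ, E) 𝓘(ℝ, E) (fun x : X => g⁻¹ • x) (g • α.1)))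

end Cotangent

/-! ### Nonholonomic systems -/

section System

variable (E : Type*) [NormedAddCommGroup E] [NormedSpace ℝ E]
  (Q : Type*) [TopologicalSpace Q] [ChartedSpace E Q] [IsManifold 𝓘(ℝ, E) ∞ Q]

/-- A nonholonomic system on `Q`: a lagrangian of mechanical type, given by the kinetic energy
metric `κ` and the potential `U`, and a constraint distribution `D`. -/
structure System where
  κ : ContMDiffRiemannianMetric 𝓘(ℝ, E) ∞ E (fun q : Q => TangentSpace 𝓘(ℝ, E) q)
  U : Q → ℝ
  U_smooth : ContMDiff 𝓘(ℝ, E) 𝓘(ℝ, ℝ) ∞ U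
  D : PlaneField E Q
  D_distribution : IsDistribution 𝓘(ℝ, E) D

variable {E Q} (sys : System E Q)

/-- The metric as a bilinear form; it is also the Legendre transformation `κ♯ : TQ → T*Q`. -/
def System.metric (q : Q) : E →L[ℝ] E →L[ℝ] ℝ := sys.κ.inner q

/-- The lagrangian `L = ½ κ - U`. -/
def System.lagrangian (q : Q) (v : E) : ℝ := 1 / 2 * sys.metric q v v - sys.U q

/-- The hamiltonian `H(α) = ⟨α, v⟩ - L(v)`, where `v` is the Legendre preimage of `α`. -/
def System.hamiltonian (α : Cot E Q) : ℝ :=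
  let v := (sys.metric α.1).inverse (covec α)
  covec α v - sys.lagrangian α.1 v

/-- The constraint submanifold `M = κ♯(D) ⊆ T*Q`. -/
def System.M : Set (Cot E Q) := {α | ∃ v ∈ sys.D α.1, sys.metric α.1 v = covec α}

/-- The distribution `C` on `M`: the fibre `C_m` consists of the vectors in `T_m M` that project
to `D`. -/
def System.C (m : Cot E Q) : Set (E × (E →L[ℝ] ℝ)) :=
  {v | v ∈ tangentTo (cotI E) sys.M m ∧ tτ m v ∈ sys.D m.1}

/-- The nonholonomic vector field on `M`: the vector `X(m) ∈ C_m` such that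
`Ω(X(m), w) = dH(w)` for all `w ∈ C_m`. -/
def System.Xnh (m : Cot E Q) : E × (E →L[ℝ] ℝ) :=
  Classical.epsilon fun v => v ∈ sys.C m ∧
    ∀ w ∈ sys.C m, canonicalForm m v w = dfun (cotI E) sys.hamiltonian m w

end System

/-! ### Symmetries, vertical complements, horizontal gauge momenta -/

section Symmetry

variable {E : Type*} [NormedAddCommGroup E] [NormedSpace ℝ E]
  {Q : Type*} [TopologicalSpace Q] [ChartedSpace E Q] [IsManifold 𝓘(ℝ, E) ∞ Q]
  {𝔤 : Type*} [NormedAddCommGroup 𝔤] [NormedSpace ℝ 𝔤]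
  {G : Type*} [Group G] [TopologicalSpace G] [ChartedSpace 𝔤 G] [MulAction G Q]
  (sys : System E Q)

/-- The tangent map of the action of `g`. -/
def tact (g : G) (q : Q) : E →L[ℝ] E := tmap 𝓘(ℝ, E) 𝓘(ℝ, E) (fun x : Q => g • x) q

variable (G) in
/-- The infinitesimal generators at `q`: `ξ ↦ ξ_Q(q)`, for `ξ` in the Lie algebra `T_1 G = 𝔤`. -/
def gen (q : Q) : 𝔤 →L[ℝ] E := tmap 𝓘(ℝ, 𝔤) 𝓘(ℝ, E) (fun g : G => g • q) 1

variable (G) in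
/-- The vertical space `V_q`, tangent to the `G`-orbit. -/
def vert (q : Q) : Submodule ℝ E :=
  LinearMap.range (gen (E := E) (𝔤 := 𝔤) G q).toLinearMap

/-- Invariance of a distribution under the tangent lifted action. -/
def InvariantDistribution (G : Type*) [Group G] [MulAction G Q]
    (D : PlaneField E Q) : Prop :=
  ∀ (g : G) (q : Q), ∀ v ∈ D q, tact g q v ∈ D (g • q)

variable (G) in
/-- The `G`-action is free, and its tangent lift leaves the lagrangian and the constraint
distribution invariant. -/
structure IsSymmetry : Prop where
  free : ∀ (g : G) (q : Q), g • q = q → g = 1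
  lagrangian : ∀ (g : G) (q : Q) (v : E),
    sys.lagrangian (g • q) (tact g q v) = sys.lagrangian q v
  constraints : InvariantDistribution G sys.D

variable (𝔤 G) in
/-- The dimension assumption `TQ = D + V`. -/
def DimensionAssumption : Prop := ∀ q : Q, sys.D q ⊔ vert (𝔤 := 𝔤) G q = ⊤

variable (𝔤 G) in
/-- The distribution `S = D ∩ V`. -/
def distS (q : Q) : Submodule ℝ E := sys.D q ⊓ vert (𝔤 := 𝔤) G q

variable (𝔤 G) in
/-- Vertical complements of the constraints: `TQ = D ⊕ W` with `W ⊆ V`. -/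
structure IsVerticalComplement (W : PlaneField E Q) : Prop where
  distribution : IsDistribution 𝓘(ℝ, E) W
  compl : ∀ q, IsCompl (sys.D q) (W q)
  le_vert : ∀ q, W q ≤ vert (𝔤 := 𝔤) G q

/-- The vertical symmetry condition for `W`, with respect to the subgroup `N` (called `G_W` in the
literature): `N` is closed and normal and `W` is tangent to the `N`-orbits. -/
structure VerticalSymmetry (W : PlaneField E Q)
    (N : Subgroup G) : Prop where
  closed : IsClosed (N : Set G)
  normal : N.Normal
  tangent_orbit : ∀ q, (W q : Set E) =
    tangentTo 𝓘(ℝ, E) (MulAction.orbit N q) q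

variable (𝔤 G) in
/-- Horizontal spaces: `G`-invariant distributions `Hor ⊆ D` with `TQ = Hor ⊕ V`. -/
structure IsHorizontal (Hor : PlaneField E Q) : Prop where
  distribution : IsDistribution 𝓘(ℝ, E) Hor
  le_D : ∀ q, Hor q ≤ sys.D q
  compl : ∀ q, IsCompl (Hor q) (vert (𝔤 := 𝔤) G q)
  invariant : InvariantDistribution G Hor

variable (G) in
/-- The canonical momentum map `J : T*Q → 𝔤*`, `⟨J(α), ξ⟩ = (i_{ξ_{T*Q}} Θ)(α)`. -/
def momentum (α : Cot E Q) : 𝔤 →L[ℝ] ℝ :=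
  (liouville α).comp (tmap 𝓘(ℝ, 𝔤) (cotI E) (fun g : G => cotAct g α) 1)

variable (G) in
/-- The function `J_ξ = ⟨J, ξ⟩` attached to a `𝔤`-valued function `ξ` on `Q`. -/
def momentumOf (ξ : Q → 𝔤) (α : Cot E Q) : ℝ := momentum (𝔤 := 𝔤) G α (ξ α.1)

variable (G) in
/-- The sections `ζ_1, …, ζ_k` of `𝔤_S → Q` are horizontal gauge symmetries for which the horizontal
gauge momenta `J_i = ⟨J, ζ_i⟩` on `M` are `G`-invariant and functionally independent. -/
structure IsGaugeMomenta {k : ℕ} (ζ : Fin k → Q → 𝔤) : Prop where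
  smooth : ∀ i, ContMDiff 𝓘(ℝ, E) 𝓘(ℝ, 𝔤) ∞ (ζ i)
  mem_S : ∀ i q, gen G q (ζ i q) ∈ distS 𝔤 G sys q
  conserved : ∀ i, ∀ m ∈ sys.M, dfun (cotI E) (momentumOf G (ζ i)) m (sys.Xnh m) = 0
  invariant : ∀ i (g : G), ∀ m ∈ sys.M, momentumOf G (ζ i) (cotAct g m) = momentumOf G (ζ i) m
  independent : ∀ m ∈ sys.M, ∀ c : Fin k → ℝ,
    (∀ v ∈ tangentTo (cotI E) sys.M m,
      ∑ i, c i * dfun (cotI E) (momentumOf G (ζ i)) m v = 0) → c = 0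

/-! ### The 2-forms `⟨J, K_W⟩`, `B₁` and `𝓑` on `M`

They are semi-basic with respect to `M → Q`; at `m ∈ M` over `q` such a form is given by a bilinear
form on `T_q Q`, whose pull-back by `T_m τ` it is. -/

variable [FiniteDimensional ℝ E] [FiniteDimensional ℝ 𝔤]
  (W Hor : PlaneField E Q)
  {k : ℕ} (ζ : Fin k → Q → 𝔤)

/-- The projection `P_D : TQ → D` along `W`. -/
def PD (q : Q) : E →L[ℝ] E := projAlong (sys.D q) (W q)

variable (𝔤 G) in
/-- The projection `TQ → Hor` along `V`. -/
def PH (q : Q) : E →L[ℝ] E := projAlong (Hor q) (vert (𝔤 := 𝔤) G q)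

variable (𝔤 G) in
/-- The projection `TQ → V` along `Hor`. -/
def PV (q : Q) : E →L[ℝ] E := projAlong (vert (𝔤 := 𝔤) G q) (Hor q)

variable (G) in
/-- The `𝔤`-valued 1-form `A` on `Q` with kernel `K` such that `A(ξ_Q(q)) = ξ` whenever
`ξ_Q(q) ∈ R_q`, where `TQ = K ⊕ R` and `R ⊆ V`. -/
def connForm (K R : PlaneField E Q) (q : Q) : E →L[ℝ] 𝔤 :=
  Classical.epsilon fun A : E →L[ℝ] 𝔤 =>
    (∀ v ∈ K q, A v = 0) ∧ ∀ ξ : 𝔤, gen G q ξ ∈ R q → A (gen G q ξ) = ξ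

variable (G) in
/-- The 2-form `K_W = d^D A_W`, where `A_W` is the connection with kernel `D`. -/
def KW (q : Q) : E →L[ℝ] E →L[ℝ] 𝔤 :=
  (extD 𝓘(ℝ, E) (connForm G sys.D W) q).bilinearComp (PD sys W q) (PD sys W q)

variable (G) in
/-- The 2-form `dA(P_Hor ·, P_Hor ·)`, where `A` is the principal connection on `Q → Q/G` with
horizontal space `Hor`. -/
def dHorA (q : Q) : E →L[ℝ] E →L[ℝ] 𝔤 :=
  (extD 𝓘(ℝ, E) (connForm G Hor (vert (𝔤 := 𝔤) G)) q).bilinearComp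
    (PH 𝔤 G Hor q) (PH 𝔤 G Hor q)

variable (G) in
/-- The 1-forms `Y^i` on `Q` with `Y^i|_Hor = Y^i|_W = 0` and `Y^i((ζ_j)_Q) = δ_ij`. -/
def Yform (i : Fin k) (q : Q) : E →L[ℝ] ℝ :=
  Classical.epsilon fun θ : E →L[ℝ] ℝ => (∀ v ∈ Hor q, θ v = 0) ∧ (∀ v ∈ W q, θ v = 0) ∧
    ∀ j, θ (gen G q (ζ j q)) = if i = j then 1 else 0

variable (G) in
/-- The 2-forms `d^D Y^i`. -/
def dDY (i : Fin k) (q : Q) : E →L[ℝ] E →L[ℝ] ℝ :=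
  (extD 𝓘(ℝ, E) (Yform G W Hor ζ i) q).bilinearComp (PD sys W q) (PD sys W q)

variable (G) in
/-- The 2-form `⟨J, K_W⟩`. -/
def JKW (m : Cot E Q) : E →L[ℝ] E →L[ℝ] ℝ := postcomp (momentum G m) (KW (𝔤 := 𝔤) G sys W m.1)

variable (G) in
/-- The 2-form `B₁ = ⟨J, K_W⟩ + ∑ J_i d^D Y^i`. -/
def B1 (m : Cot E Q) : E →L[ℝ] E →L[ℝ] ℝ :=
  JKW (𝔤 := 𝔤) G sys W m + ∑ i, momentumOf G (ζ i) m • dDY G sys W Hor ζ i m.1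

variable (G) in
/-- The `𝔤`-valued 2-form `K_W + ∑ d^D Y^i ⊗ ζ_i`. -/
def Ktot (q : Q) : E →L[ℝ] E →L[ℝ] 𝔤 :=
  KW G sys W q +
    ∑ i, postcomp (ContinuousLinearMap.toSpanSingleton ℝ (ζ i q)) (dDY G sys W Hor ζ i q)

/-- The wedge product `κ_𝔤 ∧ β` of the `𝔤*`-valued 1-form `κ_𝔤(u)(ξ) = κ(u, ξ_Q)` with a `𝔤`-valued
1-form `β`: `(u, v) ↦ κ_𝔤(u)(β(v)) - κ_𝔤(v)(β(u))`. -/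
def wedgeκ (G : Type*) [Group G] [TopologicalSpace G] [ChartedSpace 𝔤 G] [MulAction G Q]
    (q : Q) (β : E →L[ℝ] 𝔤) : E →L[ℝ] E →L[ℝ] ℝ :=
  let T := (sys.metric q).bilinearComp (ContinuousLinearMap.id ℝ E) ((gen G q).comp β)
  T - T.flip

variable (G) in
/-- The 2-form `𝓑 = ⟨J, 𝓚_V⟩ - ½ (κ_𝔤 ∧ i_{P_V(X_nh)} [K_W + d^D Y^i ⊗ ζ_i])|_Hor`. Here
`𝓚_V` is the curvature of the connection `A` with horizontal space `Hor`, with the sign convention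
`𝓚_V(X, Y) = A([X, Y])` for horizontal vector fields `X`, `Y`, that is,
`𝓚_V = - dA(P_Hor ·, P_Hor ·)`. -/
def calB (m : Cot E Q) : E →L[ℝ] E →L[ℝ] ℝ :=
  postcomp (momentum G m) (- dHorA (𝔤 := 𝔤) G Hor m.1) -
    (1 / 2 : ℝ) •
      (wedgeκ (𝔤 := 𝔤) sys G m.1
        (Ktot G sys W Hor ζ m.1 (PV 𝔤 G Hor m.1 (tτ m (sys.Xnh m))))).bilinearComp
          (PH 𝔤 G Hor m.1) (PH 𝔤 G Hor m.1)

variable (G) in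
/-- The 2-form `𝐁 = B₁ + 𝓑`. -/
def formB (m : Cot E Q) : E →L[ℝ] E →L[ℝ] ℝ :=
  B1 G sys W Hor ζ m + calB G sys W Hor ζ m

end Symmetry

/-! ### First reduction: `Q̃ = Q/N`, `F = G/N`, and `T*Q̃ = M/N` -/

section OrbitSpace

variable {G : Type*} [Group G] {Q : Type*} [MulAction G Q] (N : Subgroup G)

variable (Q) in
/-- The orbit space `Q̃ = Q/N`, with the quotient topology. -/
abbrev OrbitSpace : Type _ := MulAction.orbitRel.Quotient N Q

/-- The orbit projection `Q → Q̃`. -/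
def proj (q : Q) : OrbitSpace Q N := Quotient.mk _ q

theorem proj_eq_iff (q q' : Q) : proj N q = proj N q' ↔ ∃ n ∈ N, n • q' = q := by
  unfold proj
  rw [Quotient.eq]
  change q ∈ MulAction.orbit N q' ↔ _
  constructor
  · rintro ⟨⟨n, hn⟩, h⟩; exact ⟨n, hn, h⟩
  · rintro ⟨n, hn, h⟩; exact ⟨⟨n, hn⟩, h⟩

/-- The action of the quotient group `F = G/N` on `Q̃`, `[g] • [q] = [g • q]`. -/
instance quotientAction [hN : N.Normal] : MulAction (G ⧸ N) (OrbitSpace Q N) where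
  smul h x := Quotient.liftOn₂ h x (fun g q => proj N (g • q)) (by
    intro g q g' q' hg hq
    have hg' : g⁻¹ * g' ∈ N := QuotientGroup.leftRel_apply.mp hg
    have hq' : proj N q = proj N q' := Quotient.sound hq
    rw [proj_eq_iff] at hq' ⊢
    obtain ⟨n, hn, rfl⟩ := hq'
    refine ⟨g' * ((g⁻¹ * g')⁻¹ * n) * g'⁻¹, hN.conj_mem _ (N.mul_mem (N.inv_mem hg') hn) _, ?_⟩
    simp only [smul_smul]
    congr 1
    group)
  one_smul x := by
    induction x using Quotient.inductionOn with
    | h q => change proj N ((1 : G) • q) = proj N q; rw [one_smul]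
  mul_smul a b x := by
    induction a using Quotient.inductionOn with
    | h g => induction b using Quotient.inductionOn with
      | h g' => induction x using Quotient.inductionOn with
        | h q => change proj N ((g * g') • q) = proj N (g • g' • q); rw [mul_smul]

end OrbitSpace

section Reduction

variable {E : Type*} [NormedAddCommGroup E] [NormedSpace ℝ E]
  {Q : Type*} [TopologicalSpace Q] [ChartedSpace E Q] [IsManifold 𝓘(ℝ, E) ∞ Q]
  {𝔤 : Type*} [NormedAddCommGroup 𝔤] [NormedSpace ℝ 𝔤]
  {G : Type*} [Group G] [TopologicalSpace G] [ChartedSpace 𝔤 G] [MulAction G Q]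
  (sys : System E Q) (N : Subgroup G)

variable (𝔤) in
/-- The Lie algebra `𝔴 ⊆ 𝔤` of the closed subgroup `N`: velocities at `1` of smooth curves in `N`. -/
def lieN : Submodule ℝ 𝔤 := Submodule.span ℝ (tangentTo 𝓘(ℝ, 𝔤) (N : Set G) 1)

variable (𝔤) in
/-- The Lie algebra `𝔣 = 𝔤/𝔴` of the quotient group `F = G/N`. -/
abbrev lieF : Type _ := 𝔤 ⧸ lieN 𝔤 N

theorem tmap_quotient_eq_zero {E' H' Y : Type*} [NormedAddCommGroup E'] [NormedSpace ℝ E']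
    [TopologicalSpace H'] (I' : ModelWithCorners ℝ E' H') [TopologicalSpace Y] [ChartedSpace H' Y]
    (f : G ⧸ N → Y) : lieN 𝔤 N ≤
      LinearMap.ker (tmap 𝓘(ℝ, 𝔤) I' (fun g : G => f (g : G ⧸ N)) 1).toLinearMap := by
  refine Submodule.span_le.mpr ?_
  rintro v ⟨γ, hγ, hN, h0, rfl⟩
  by_cases hd : MDifferentiableAt 𝓘(ℝ, 𝔤) I' (fun g : G => f (g : G ⧸ N)) 1
  · have hγd : MDifferentiableAt 𝓘(ℝ, ℝ) 𝓘(ℝ, 𝔤) γ 0 := hγ.mdifferentiable (by simp) 0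
    have hc : (fun g : G => f (g : G ⧸ N)) ∘ γ = fun _ => f ((1 : G) : G ⧸ N) := by
      funext t
      have : ((γ t : G) : G ⧸ N) = ((1 : G) : G ⧸ N) := by
        rw [eq_comm, QuotientGroup.eq]; simpa using hN t
      simp [this]
    have hcomp := mfderiv_comp (x := (0 : ℝ)) (I := 𝓘(ℝ, ℝ)) (I' := 𝓘(ℝ, 𝔤)) (I'' := I')
      (g := fun g : G => f (g : G ⧸ N)) (f := γ) (by rw [h0]; exact hd) hγd
    rw [hc, mfderiv_const] at hcomp
    have := congrArg (fun L : ℝ →L[ℝ] E' => L 1) hcomp.symm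
    simp only [SetLike.mem_coe, LinearMap.mem_ker]
    rw [h0] at this
    refine this.trans ?_
    rfl
  · have h0' : tmap 𝓘(ℝ, 𝔤) I' (fun g : G => f (g : G ⧸ N)) 1 = 0 :=
      mfderiv_zero_of_not_mdifferentiableAt hd
    rw [h0']
    simp

variable [FiniteDimensional ℝ E] [FiniteDimensional ℝ 𝔤]
  {E₁ : Type*} [NormedAddCommGroup E₁] [NormedSpace ℝ E₁]
  [ChartedSpace E₁ (OrbitSpace Q N)] [IsManifold 𝓘(ℝ, E₁) ∞ (OrbitSpace Q N)]
  (W Hor : PlaneField E Q)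
  {k : ℕ} (ζ : Fin k → Q → 𝔤)

/-- The tangent map of the orbit projection `Q → Q̃`. -/
def tproj (q : Q) : E →L[ℝ] E₁ := tmap 𝓘(ℝ, E) 𝓘(ℝ, E₁) (proj N) q

/-- The horizontal lift `T_{[q]} Q̃ → D_q`, inverse of the restriction of `T_q proj` to `D_q`. -/
def hlift (q : Q) : E₁ →L[ℝ] E :=
  (sys.D q).subtypeL.comp ((tproj (E₁ := E₁) N q).comp (sys.D q).subtypeL).inverse

/-- The map `T*Q → T*Q̃`, `⟨R(α_q), w⟩ = ⟨α_q, hlift_q w⟩`. Its restriction to `M` is the orbit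
projection `M → M/N = T*Q̃`. -/
def redMap (α : Cot E Q) : Cot E₁ (OrbitSpace Q N) :=
  mkCot (proj N α.1) ((covec α).comp (hlift sys N α.1))

/-- The tangent map of `redMap`. -/
def tredMap (α : Cot E Q) : E × (E →L[ℝ] ℝ) →L[ℝ] E₁ × (E₁ →L[ℝ] ℝ) :=
  tmap (cotI E) (cotI E₁) (redMap (E₁ := E₁) sys N) α

/-- A point of `M` over the given point of `T*Q̃ = M/N`. -/
def rep (a : Cot E₁ (OrbitSpace Q N)) : Cot E Q :=
  haveI : Nonempty (Cot E Q) := ⟨mkCot (Quotient.out a.1) 0⟩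
  Classical.epsilon fun m => m ∈ sys.M ∧ redMap sys N m = a

/-- The partially reduced hamiltonian `H̃`, with `H̃ ∘ redMap = H` on `M`. -/
def Htilde (a : Cot E₁ (OrbitSpace Q N)) : ℝ := sys.hamiltonian (rep sys N a)

/-- The partially reduced nonholonomic vector field `X̃_nh = T redMap (X_nh)`. -/
def Xtilde (a : Cot E₁ (OrbitSpace Q N)) : E₁ × (E₁ →L[ℝ] ℝ) :=
  tredMap sys N (rep sys N a) (sys.Xnh (rep sys N a))

/-- The 2-form on `T*Q̃` whose pull-back to `M` is the given semi-basic 2-form `b`. -/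
def descend (b : Cot E Q → E →L[ℝ] E →L[ℝ] ℝ) (a : Cot E₁ (OrbitSpace Q N)) :
    E₁ × (E₁ →L[ℝ] ℝ) →L[ℝ] E₁ × (E₁ →L[ℝ] ℝ) →L[ℝ] ℝ :=
  (b (rep sys N a)).bilinearComp ((hlift sys N (rep sys N a).1).comp (tτ a))
    ((hlift sys N (rep sys N a).1).comp (tτ a))

/-- The 2-form `Ω̃ = Ω_Q̃ - B_⟨J,K⟩` on `T*Q̃`, where `B_⟨J,K⟩` is induced by `⟨J, K_W⟩`. -/
def OmegaTilde (a : Cot E₁ (OrbitSpace Q N)) :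
    E₁ × (E₁ →L[ℝ] ℝ) →L[ℝ] E₁ × (E₁ →L[ℝ] ℝ) →L[ℝ] ℝ :=
  subForm (canonicalForm a) (descend sys N (JKW (𝔤 := 𝔤) G sys W) a)

/-- The 2-form `Ω̃_B = Ω̃ + B̃` on `T*Q̃`, where `B̃` is induced by `𝐁 = B₁ + 𝓑`. -/
def OmegaB (a : Cot E₁ (OrbitSpace Q N)) :
    E₁ × (E₁ →L[ℝ] ℝ) →L[ℝ] E₁ × (E₁ →L[ℝ] ℝ) →L[ℝ] ℝ :=
  addForm (OmegaTilde (𝔤 := 𝔤) sys N W a) (descend sys N (formB G sys W Hor ζ) a)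

variable {N} in
/-- The partially reduced gauge symmetries `η_i : Q̃ → 𝔣`, with `η_i([q]) = [ζ_i(q)]`. -/
def eta (i : Fin k) (x : OrbitSpace Q N) : lieF 𝔤 N :=
  Submodule.Quotient.mk (ζ i (Quotient.out x))

section Faction

variable [N.Normal]

variable (𝔤) in
/-- The infinitesimal generators at `a ∈ T*Q̃` of the lifted `F`-action: `ν ↦ ν_{T*Q̃}(a)`, `ν ∈ 𝔣`. -/
def genF (a : Cot E₁ (OrbitSpace Q N)) : lieF 𝔤 N →ₗ[ℝ] E₁ × (E₁ →L[ℝ] ℝ) :=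
  (lieN 𝔤 N).liftQ _
    (tmap_quotient_eq_zero (𝔤 := 𝔤) N (cotI E₁) (fun h : G ⧸ N => cotAct h a))

variable (𝔤) in
/-- The canonical momentum map `J̃ : T*Q̃ → 𝔣*`, `⟨J̃(a), ν⟩ = (i_{ν_{T*Q̃}} Θ)(a)`. -/
def Jtilde (a : Cot E₁ (OrbitSpace Q N)) : Module.Dual ℝ (lieF 𝔤 N) :=
  (liouville a).toLinearMap ∘ₗ genF 𝔤 N a

/-- The partially reduced horizontal gauge momenta `J̃_i = ⟨J̃, η_i⟩`. -/
def Jt (i : Fin k) (a : Cot E₁ (OrbitSpace Q N)) : ℝ := Jtilde 𝔤 N a (eta ζ i a.1)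

variable {N} in
/-- The `𝔣*`-valued functions `μ^i` on `Q̃` dual to the `η_i`: `⟨μ^i, η_j⟩ = δ_ij`. -/
def muDual (i : Fin k) (x : OrbitSpace Q N) : Module.Dual ℝ (lieF 𝔤 N) :=
  Classical.epsilon fun l => ∀ j, l (eta ζ j x) = if i = j then 1 else 0

/-- The level set `J̃⁻¹(μ) ⊆ T*Q̃` of `μ = ∑ c_i μ^i`. -/
def level (c : Fin k → ℝ) : Set (Cot E₁ (OrbitSpace Q N)) :=
  {a | Jtilde 𝔤 N a = ∑ i, c i • muDual ζ i a.1}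

/-! ### Second reduction: `M/G = T*Q̃/F` and `J̃⁻¹(μ)/F` -/

variable (Q E₁) in
/-- The orbit space `T*Q̃/F`, with the quotient topology; it is the reduced space `M/G`. -/
abbrev RedSpace : Type _ :=
  Quot fun a b : Cot E₁ (OrbitSpace Q N) => ∃ h : G ⧸ N, cotAct h a = b

/-- The orbit projection `ρ_F : T*Q̃ → T*Q̃/F`. -/
def rhoF (a : Cot E₁ (OrbitSpace Q N)) : RedSpace Q N E₁ := Quot.mk _ a

/-- The reduced hamiltonian on `M/G`. -/
def Hred (z : RedSpace Q N E₁) : ℝ := Htilde sys N (Quot.out z)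

/-- The reduced nonholonomic vector field `X_red` on `M/G`, the push-forward of `X_nh`. -/
def Xred {E₂ : Type*} [NormedAddCommGroup E₂] [NormedSpace ℝ E₂]
    [ChartedSpace E₂ (RedSpace Q N E₁)] (z : RedSpace Q N E₁) : E₂ :=
  tmap (cotI E₁) 𝓘(ℝ, E₂) (rhoF N) (Quot.out z) (Xtilde sys N (Quot.out z))

/-- The orbit space `J̃⁻¹(μ)/F`, with the quotient topology. -/
abbrev LevelQuot (c : Fin k → ℝ) : Type _ :=
  Quot fun a b : level (E₁ := E₁) N ζ c => ∃ h : G ⧸ N, cotAct h a.1 = b.1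

/-- The orbit projection `ρ_μ : J̃⁻¹(μ) → J̃⁻¹(μ)/F`. -/
def rhoMu (c : Fin k → ℝ) (a : level (E₁ := E₁) N ζ c) : LevelQuot (E₁ := E₁) N ζ c := Quot.mk _ a

/-- The inclusion `J̃⁻¹(μ)/F → T*Q̃/F`. -/
def iotaRed (c : Fin k → ℝ) : LevelQuot (E₁ := E₁) N ζ c → RedSpace Q N E₁ :=
  Quot.map Subtype.val fun _ _ h => h

end Faction

end Reduction

end NH

open NH

set_option linter.unusedSectionVars false

noncomputable section

namespace NH

/-- A shortcut instance. -/
local instance instTopologicalSpaceOrbitSpace {G : Type*} [Group G] {Q : Type*}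
    [TopologicalSpace Q] [MulAction G Q]
    (N : Subgroup G) : TopologicalSpace (OrbitSpace Q N) := inferInstance

/-- A shortcut instance. -/
local instance instTopologicalSpaceCot {E : Type*} [NormedAddCommGroup E] [NormedSpace ℝ E]
    {Q : Type*} [TopologicalSpace Q] [ChartedSpace E Q] [IsManifold 𝓘(ℝ, E) ∞ Q] :
    TopologicalSpace (Cot E Q) := inferInstance

/-! ### Tangent maps and coordinate frames -/


section Frames

variable {E : Type*} [NormedAddCommGroup E] [NormedSpace ℝ E]
  {H : Type*} [TopologicalSpace H] {I : ModelWithCorners ℝ E H}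
  {X : Type*} [TopologicalSpace X] [ChartedSpace H X]
  {E' : Type*} [NormedAddCommGroup E'] [NormedSpace ℝ E']
  {H' : Type*} [TopologicalSpace H'] {I' : ModelWithCorners ℝ E' H'}
  {Y : Type*} [TopologicalSpace Y] [ChartedSpace H' Y]
  {E'' : Type*} [NormedAddCommGroup E''] [NormedSpace ℝ E'']
  {H'' : Type*} [TopologicalSpace H''] {I'' : ModelWithCorners ℝ E'' H''}
  {Z : Type*} [TopologicalSpace Z] [ChartedSpace H'' Z]
  {V : Type*} [NormedAddCommGroup V] [NormedSpace ℝ V]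
  {V' : Type*} [NormedAddCommGroup V'] [NormedSpace ℝ V']

theorem tmap_comp {g : Y → Z} {f : X → Y} {x : X} (hg : MDifferentiableAt I' I'' g (f x))
    (hf : MDifferentiableAt I I' f x) :
    tmap I I'' (fun x => g (f x)) x = (tmap I' I'' g (f x)).comp (tmap I I' f x) :=
  mfderiv_comp x hg hf

theorem tmap_comp_apply {g : Y → Z} {f : X → Y} {x : X} (hg : MDifferentiableAt I' I'' g (f x))
    (hf : MDifferentiableAt I I' f x) (v : E) :
    tmap I I'' (fun x => g (f x)) x v = tmap I' I'' g (f x) (tmap I I' f x v) := by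
  rw [tmap_comp hg hf]; rfl

theorem tmap_congr {f g : X → Y} {x : X} (h : f =ᶠ[𝓝 x] g) : tmap I I' f x = tmap I I' g x :=
  Filter.EventuallyEq.mfderiv_eq h

theorem tmap_id (x : X) : tmap I I (fun x : X => x) x = ContinuousLinearMap.id ℝ E := mfderiv_id

theorem tmap_const (c : Y) (x : X) : tmap I I' (fun _ : X => c) x = 0 := mfderiv_const

theorem tmap_eq_fderiv (f : E → E') (x : E) : tmap 𝓘(ℝ, E) 𝓘(ℝ, E') f x = fderiv ℝ f x :=
  mfderiv_eq_fderiv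

variable (I) in
/-- The coordinate map `T_x X → E` of the chart at `x₀`. -/
def cf (x₀ x : X) : E →L[ℝ] E := tmap I 𝓘(ℝ, E) (extChartAt I x₀) x

variable (I) in
/-- The coordinate frame `E → T_x X` of the chart at `x₀`. -/
def cfi (x₀ x : X) : E →L[ℝ] E := tmap 𝓘(ℝ, E) I (extChartAt I x₀).symm (extChartAt I x₀ x)

theorem eventually_mem_source (H : Type*) [TopologicalSpace H] [ChartedSpace H X] (x₀ : X) :
    ∀ᶠ x in 𝓝 x₀, x ∈ (chartAt H x₀).source :=
  chart_source_mem_nhds H x₀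

variable [IsManifold I ∞ X] [IsManifold I' ∞ Y]

theorem mdiff_ext {x₀ x : X} (h : x ∈ (chartAt H x₀).source) :
    MDifferentiableAt I 𝓘(ℝ, E) (extChartAt I x₀) x :=
  have : IsManifold I 1 X := .of_le (n := ∞) (by simp)
  mdifferentiableAt_extChartAt h

theorem smooth_ext {x₀ x : X} (h : x ∈ (chartAt H x₀).source) :
    ContMDiffAt I 𝓘(ℝ, E) ∞ (extChartAt I x₀) x := contMDiffAt_extChartAt' h

theorem ext_target_mem [I.Boundaryless] {x₀ : X} {y : E}
    (h : y ∈ (extChartAt I x₀).target) : (extChartAt I x₀).target ∈ 𝓝 y :=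
  (isOpen_extChartAt_target x₀).mem_nhds h

theorem smooth_ext_symm [I.Boundaryless] {x₀ : X} {y : E}
    (h : y ∈ (extChartAt I x₀).target) : ContMDiffAt 𝓘(ℝ, E) I ∞ (extChartAt I x₀).symm y :=
  (contMDiffOn_extChartAt_symm x₀).contMDiffAt (ext_target_mem h)

theorem mdiff_ext_symm [I.Boundaryless] {x₀ : X} {y : E}
    (h : y ∈ (extChartAt I x₀).target) : MDifferentiableAt 𝓘(ℝ, E) I (extChartAt I x₀).symm y :=
  (smooth_ext_symm h).mdifferentiableAt (by simp)

theorem cf_cfi [I.Boundaryless] {x₀ x : X} (h : x ∈ (chartAt H x₀).source) (v : E) :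
    cf I x₀ x (cfi I x₀ x v) = v := by
  have hx : x ∈ (extChartAt I x₀).source := by simpa using h
  have ht := (extChartAt I x₀).map_source hx
  have h1 := tmap_comp_apply (I := 𝓘(ℝ, E)) (I' := I) (I'' := 𝓘(ℝ, E)) (g := extChartAt I x₀)
    (f := (extChartAt I x₀).symm) (x := extChartAt I x₀ x)
    (by rw [(extChartAt I x₀).left_inv hx]; exact mdiff_ext h) (mdiff_ext_symm ht) v
  rw [(extChartAt I x₀).left_inv hx] at h1
  refine h1.symm.trans ?_
  have : (fun y => extChartAt I x₀ ((extChartAt I x₀).symm y)) =ᶠ[𝓝 (extChartAt I x₀ x)]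
      fun y => y := by
    filter_upwards [ext_target_mem ht] with y hy using (extChartAt I x₀).right_inv hy
  rw [tmap_congr this, tmap_id]; rfl

theorem cfi_cf [I.Boundaryless] {x₀ x : X} (h : x ∈ (chartAt H x₀).source) (v : E) :
    cfi I x₀ x (cf I x₀ x v) = v := by
  have hx : x ∈ (extChartAt I x₀).source := by simpa using h
  have ht := (extChartAt I x₀).map_source hx
  have h1 := tmap_comp_apply (I := I) (I' := 𝓘(ℝ, E)) (I'' := I) (f := extChartAt I x₀)
    (g := (extChartAt I x₀).symm) (x := x) (mdiff_ext_symm ht) (mdiff_ext h) v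
  refine h1.symm.trans ?_
  have : (fun y => (extChartAt I x₀).symm (extChartAt I x₀ y)) =ᶠ[𝓝 x] fun y => y := by
    filter_upwards [(chartAt H x₀).open_source.mem_nhds h] with y hy
    exact (extChartAt I x₀).left_inv (by simpa using hy)
  rw [tmap_congr this, tmap_id]; rfl

theorem cf_self (x : X) : cf I x x = ContinuousLinearMap.id ℝ E :=
  have : IsManifold I 1 X := .of_le (n := ∞) (by simp)
  mfderiv_extChartAt_self

theorem cfi_self [I.Boundaryless] (x : X) : cfi I x x = ContinuousLinearMap.id ℝ E := by
  ext v
  have := cfi_cf (I := I) (mem_chart_source H x) v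
  rwa [cf_self] at this

theorem trivializationAt_snd {x₀ x : X} (h : x ∈ (chartAt H x₀).source) (v : E) :
    (trivializationAt E (TangentSpace I : X → Type _) x₀ ⟨x, v⟩).2 = cf I x₀ x v := by
  have : IsManifold I 1 X := .of_le (n := ∞) (by simp)
  have := TangentBundle.continuousLinearMapAt_trivializationAt (I := I) h
  have h2 := congrArg (fun L : E →L[ℝ] E => L v) this
  refine Eq.trans ?_ h2
  exact (congrFun ((trivializationAt E (TangentSpace I : X → Type _) x₀).coe_linearMapAt_of_mem
    (R := ℝ) (by simpa using h)) v).symm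

theorem symmL_eq_cfi {x₀ x : X} [I.Boundaryless] (h : x ∈ (chartAt H x₀).source) (v : E) :
    (trivializationAt E (TangentSpace I : X → Type _) x₀).symmL ℝ x v = cfi I x₀ x v := by
  have : IsManifold I 1 X := .of_le (n := ∞) (by simp)
  have hb : x ∈ (trivializationAt E (TangentSpace I : X → Type _) x₀).baseSet := by simpa using h
  have h3 := (trivializationAt E (TangentSpace I : X → Type _) x₀).symmL_continuousLinearMapAt
    (R := ℝ) hb (cfi I x₀ x v)
  refine Eq.trans ?_ h3
  congr 1
  have h4 := congrArg (fun L : E →L[ℝ] E => L (cfi I x₀ x v))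
    (TangentBundle.continuousLinearMapAt_trivializationAt (I := I) h)
  exact ((h4.trans (cf_cfi h v))).symm

/-! ### Smooth vector fields along maps -/

variable (I I') in
/-- The vectors `z y ∈ T_{f y} X` depend smoothly on `y`, near `y₀`. -/
def SmAt (f : Y → X) (z : Y → E) (y₀ : Y) : Prop :=
  ContMDiffAt I' I.tangent ∞ (fun y => (⟨f y, z y⟩ : TangentBundle I X)) y₀

omit [IsManifold I' ∞ Y] in
theorem smAt_iff {f : Y → X} {z : Y → E} {y₀ : Y} : SmAt I I' f z y₀ ↔
    ContMDiffAt I' I ∞ f y₀ ∧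
      ContMDiffAt I' 𝓘(ℝ, E) ∞ (fun y => cf I (f y₀) (f y) (z y)) y₀ := by
  unfold SmAt
  rw [contMDiffAt_totalSpace]
  refine and_congr_right fun hf => ?_
  refine Filter.EventuallyEq.contMDiffAt_iff ?_
  filter_upwards [hf.continuousAt.eventually (eventually_mem_source H (f y₀))] with y hy
  exact trivializationAt_snd hy (z y)

end Frames

/-! ### Calculus of smooth vector fields along maps and of smooth forms -/

section Calculus

variable {E : Type*} [NormedAddCommGroup E] [NormedSpace ℝ E]
  {H : Type*} [TopologicalSpace H] {I : ModelWithCorners ℝ E H}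
  {X : Type*} [TopologicalSpace X] [ChartedSpace H X] [IsManifold I ∞ X]
  {E' : Type*} [NormedAddCommGroup E'] [NormedSpace ℝ E']
  {H' : Type*} [TopologicalSpace H'] {I' : ModelWithCorners ℝ E' H'}
  {Y : Type*} [TopologicalSpace Y] [ChartedSpace H' Y]
  {E'' : Type*} [NormedAddCommGroup E''] [NormedSpace ℝ E'']
  {H'' : Type*} [TopologicalSpace H''] {I'' : ModelWithCorners ℝ E'' H''}
  {Z : Type*} [TopologicalSpace Z] [ChartedSpace H'' Z]
  {V : Type*} [NormedAddCommGroup V] [NormedSpace ℝ V]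
  {V' : Type*} [NormedAddCommGroup V'] [NormedSpace ℝ V']

theorem SmAt.base {f : Y → X} {z : Y → E} {y₀ : Y} (h : SmAt I I' f z y₀) :
    ContMDiffAt I' I ∞ f y₀ := (smAt_iff.mp h).1

theorem SmAt.coord {f : Y → X} {z : Y → E} {y₀ : Y} (h : SmAt I I' f z y₀) :
    ContMDiffAt I' 𝓘(ℝ, E) ∞ (fun y => cf I (f y₀) (f y) (z y)) y₀ := (smAt_iff.mp h).2

theorem SmAt.congr {f f' : Y → X} {z z' : Y → E} {y₀ : Y} (h : SmAt I I' f z y₀)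
    (hf : f' =ᶠ[𝓝 y₀] f) (hz : z' =ᶠ[𝓝 y₀] z) : SmAt I I' f' z' y₀ := by
  refine ContMDiffAt.congr_of_eventuallyEq h ?_
  filter_upwards [hf, hz] with y h1 h2
  rw [h1, h2]

theorem SmAt.comp {f : Y → X} {z : Y → E} {g : Z → Y} {w₀ : Z} (h : SmAt I I' f z (g w₀))
    (hg : ContMDiffAt I'' I' ∞ g w₀) : SmAt I I'' (fun w => f (g w)) (fun w => z (g w)) w₀ :=
  ContMDiffAt.comp w₀ h hg

theorem SmAt.add {f : Y → X} {z z' : Y → E} {y₀ : Y} (h : SmAt I I' f z y₀)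
    (h' : SmAt I I' f z' y₀) : SmAt I I' f (fun y => z y + z' y) y₀ := by
  refine smAt_iff.mpr ⟨h.base, ?_⟩
  exact (h.coord.add h'.coord).congr_of_eventuallyEq (.of_forall fun y => map_add _ _ _)

theorem SmAt.sub {f : Y → X} {z z' : Y → E} {y₀ : Y} (h : SmAt I I' f z y₀)
    (h' : SmAt I I' f z' y₀) : SmAt I I' f (fun y => z y - z' y) y₀ := by
  refine smAt_iff.mpr ⟨h.base, ?_⟩
  simpa only [map_sub] using h.coord.sub h'.coord

theorem SmAt.smul {f : Y → X} {z : Y → E} {c : Y → ℝ} {y₀ : Y}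
    (hc : ContMDiffAt I' 𝓘(ℝ, ℝ) ∞ c y₀) (h : SmAt I I' f z y₀) :
    SmAt I I' f (fun y => c y • z y) y₀ := by
  refine smAt_iff.mpr ⟨h.base, ?_⟩
  exact (hc.smul h.coord).congr_of_eventuallyEq (.of_forall fun y => map_smul _ _ _)

theorem SmAt.zero {f : Y → X} {y₀ : Y} (h : ContMDiffAt I' I ∞ f y₀) :
    SmAt I I' f (fun _ => 0) y₀ := by
  refine smAt_iff.mpr ⟨h, ?_⟩
  simpa only [map_zero] using contMDiffAt_const

theorem SmAt.sum {ι : Type*} {f : Y → X} {z : ι → Y → E} {y₀ : Y} (s : Finset ι)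
    (hf : ContMDiffAt I' I ∞ f y₀) (h : ∀ i, SmAt I I' f (z i) y₀) :
    SmAt I I' f (fun y => ∑ i ∈ s, z i y) y₀ := by
  classical
  induction s using Finset.induction_on with
  | empty => simpa using SmAt.zero hf
  | insert a s ha ih => simpa only [Finset.sum_insert ha] using (h a).add ih

theorem SmAt.of_cfi [I.Boundaryless] {f : Y → X} {e : Y → E} {y₀ : Y}
    (hf : ContMDiffAt I' I ∞ f y₀) (he : ContMDiffAt I' 𝓘(ℝ, E) ∞ e y₀) :
    SmAt I I' f (fun y => cfi I (f y₀) (f y) (e y)) y₀ := by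
  refine smAt_iff.mpr ⟨hf, he.congr_of_eventuallyEq ?_⟩
  filter_upwards [hf.continuousAt.eventually (eventually_mem_source H (f y₀))] with y hy
  exact cf_cfi hy _

theorem coord_tmap [I.Boundaryless] [IsManifold I'' ∞ Z] {c : X → Z} {x₀ : X}
    (hc : ContMDiffAt I I'' ∞ c x₀) :
    ContMDiffAt I 𝓘(ℝ, E →L[ℝ] E'') ∞
      (fun x => ((cf I'' (c x₀) (c x)).comp (tmap I I'' c x)).comp (cfi I x₀ x)) x₀ := by
  have : IsManifold I 1 X := .of_le (n := ∞) (by simp)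
  have : IsManifold I'' 1 Z := .of_le (n := ∞) (by simp)
  refine (hc.mfderiv_const (m := ∞) (by simp)).congr_of_eventuallyEq ?_
  filter_upwards [eventually_mem_source H x₀,
    hc.continuousAt.eventually (eventually_mem_source H'' (c x₀))] with x hx hcx
  rw [inTangentCoordinates_eq_mfderiv_comp hx hcx]
  have h1 : cfi I x₀ x = mfderivWithin 𝓘(ℝ, E) I (extChartAt I x₀).symm (Set.range I)
      (extChartAt I x₀ x) := by
    rw [I.range_eq_univ, mfderivWithin_univ]; rfl
  rw [h1]; rfl

theorem SmAt.tmap [I.Boundaryless] [IsManifold I'' ∞ Z] {c : X → Z} {f : Y → X} {z : Y → E}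
    {y₀ : Y} (hc : ContMDiffAt I I'' ∞ c (f y₀)) (h : SmAt I I' f z y₀) :
    SmAt I'' I' (fun y => c (f y)) (fun y => NH.tmap I I'' c (f y) (z y)) y₀ := by
  refine smAt_iff.mpr ⟨hc.comp y₀ h.base, ?_⟩
  refine (((coord_tmap hc).comp y₀ h.base).clm_apply h.coord).congr_of_eventuallyEq ?_
  filter_upwards [h.base.continuousAt.eventually (eventually_mem_source H (f y₀))] with y hy
  change _ = cf I'' _ _ (NH.tmap I I'' c (f y) (cfi I (f y₀) (f y) (cf I (f y₀) (f y) (z y))))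
  rw [cfi_cf hy]

theorem smAt_vectorSpace_iff {f : Y → V} {z : Y → V} {y₀ : Y} : SmAt 𝓘(ℝ, V) I' f z y₀ ↔
    ContMDiffAt I' 𝓘(ℝ, V) ∞ f y₀ ∧ ContMDiffAt I' 𝓘(ℝ, V) ∞ z y₀ := by
  rw [smAt_iff]
  have : ∀ a b : V, cf 𝓘(ℝ, V) a b = ContinuousLinearMap.id ℝ V := fun a b => by
    unfold cf
    simp only [extChartAt_model_space_eq_id, PartialEquiv.refl_coe]
    exact mfderiv_id
  simp [this]

/-! ### Forms -/

variable (I) in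
/-- Smoothness at `x₀` of a vector-valued 1-form. -/
def FormAt (θ : X → E →L[ℝ] V) (x₀ : X) : Prop :=
  ContMDiffAt I 𝓘(ℝ, E →L[ℝ] V) ∞ (fun x => (θ x).comp (cfi I x₀ x)) x₀

variable (I) in
/-- Smoothness at `x₀` of a vector-valued field of bilinear forms. -/
def Form2At (B : X → E →L[ℝ] E →L[ℝ] V) (x₀ : X) : Prop :=
  ContMDiffAt I 𝓘(ℝ, E →L[ℝ] E →L[ℝ] V) ∞
    (fun x => (B x).bilinearComp (cfi I x₀ x) (cfi I x₀ x)) x₀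

theorem FormAt.apply [I.Boundaryless] {θ : X → E →L[ℝ] V} {f : Y → X} {z : Y → E} {y₀ : Y}
    (h : FormAt I θ (f y₀)) (hz : SmAt I I' f z y₀) :
    ContMDiffAt I' 𝓘(ℝ, V) ∞ (fun y => θ (f y) (z y)) y₀ := by
  refine ((ContMDiffAt.comp y₀ h hz.base).clm_apply hz.coord).congr_of_eventuallyEq ?_
  filter_upwards [hz.base.continuousAt.eventually (eventually_mem_source H (f y₀))] with y hy
  change _ = θ (f y) (cfi I (f y₀) (f y) (cf I (f y₀) (f y) (z y)))
  rw [cfi_cf hy]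

theorem Form2At.apply [I.Boundaryless] {B : X → E →L[ℝ] E →L[ℝ] V} {f : Y → X} {z w : Y → E}
    {y₀ : Y} (h : Form2At I B (f y₀)) (hz : SmAt I I' f z y₀) (hw : SmAt I I' f w y₀) :
    ContMDiffAt I' 𝓘(ℝ, V) ∞ (fun y => B (f y) (z y) (w y)) y₀ := by
  refine (((ContMDiffAt.comp y₀ h hz.base).clm_apply hz.coord).clm_apply
    hw.coord).congr_of_eventuallyEq ?_
  filter_upwards [hz.base.continuousAt.eventually (eventually_mem_source H (f y₀))] with y hy
  change _ = B (f y) (cfi I (f y₀) (f y) (cf I (f y₀) (f y) (z y)))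
    (cfi I (f y₀) (f y) (cf I (f y₀) (f y) (w y)))
  rw [cfi_cf hy, cfi_cf hy]

theorem contMDiffAt_clm_iff [FiniteDimensional ℝ E] {L : Y → E →L[ℝ] V} {y₀ : Y} :
    ContMDiffAt I' 𝓘(ℝ, E →L[ℝ] V) ∞ L y₀ ↔
      ∀ e, ContMDiffAt I' 𝓘(ℝ, V) ∞ (fun y => L y e) y₀ := by
  refine ⟨fun h e => h.clm_apply contMDiffAt_const, fun h => ?_⟩
  let b := Module.finBasis ℝ E
  have : L = fun y => ∑ i, ((ContinuousLinearMap.smulRightL ℝ E V)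
      (LinearMap.toContinuousLinearMap (b.coord i))) (L y (b i)) := by
    funext y; ext v
    simp only [sum_apply, ContinuousLinearMap.smulRightL_apply_apply]
    conv_lhs => rw [← b.sum_repr v, map_sum]
    simp
  rw [this]
  refine ContMDiffAt.sum fun i _ => ?_
  exact ((ContinuousLinearMap.smulRightL ℝ E V
    (LinearMap.toContinuousLinearMap (b.coord i))).contMDiff.contMDiffAt).comp y₀ (h (b i))

theorem FormAt.of_apply [FiniteDimensional ℝ E] [I.Boundaryless] {θ : X → E →L[ℝ] V} {x₀ : X}
    (h : ∀ z : X → E, SmAt I I (fun x => x) z x₀ →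
      ContMDiffAt I 𝓘(ℝ, V) ∞ (fun x => θ x (z x)) x₀) : FormAt I θ x₀ :=
  contMDiffAt_clm_iff.mpr fun e => h (fun x => cfi I x₀ x e)
    (SmAt.of_cfi (f := fun x : X => x) contMDiffAt_id contMDiffAt_const)

theorem Form2At.of_apply [FiniteDimensional ℝ E] [I.Boundaryless]
    {B : X → E →L[ℝ] E →L[ℝ] V} {x₀ : X}
    (h : ∀ z w : X → E, SmAt I I (fun x => x) z x₀ → SmAt I I (fun x => x) w x₀ →
      ContMDiffAt I 𝓘(ℝ, V) ∞ (fun x => B x (z x) (w x)) x₀) : Form2At I B x₀ :=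
  contMDiffAt_clm_iff.mpr fun e => contMDiffAt_clm_iff.mpr fun e' =>
    h (fun x => cfi I x₀ x e) (fun x => cfi I x₀ x e')
    (SmAt.of_cfi (f := fun x : X => x) contMDiffAt_id contMDiffAt_const)
    (SmAt.of_cfi (f := fun x : X => x) contMDiffAt_id contMDiffAt_const)

/-! ### Solving linear equations smoothly -/

theorem contMDiffAt_of_clm_apply [CompleteSpace E] {T : Y → E →L[ℝ] V} {z : Y → E} {y₀ : Y}
    (hT : ContMDiffAt I' 𝓘(ℝ, E →L[ℝ] V) ∞ T y₀) (hinv : (T y₀).IsInvertible)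
    (hz : ContMDiffAt I' 𝓘(ℝ, V) ∞ (fun y => T y (z y)) y₀) :
    ContMDiffAt I' 𝓘(ℝ, E) ∞ z y₀ := by
  have h1 : ContMDiffAt I' 𝓘(ℝ, V →L[ℝ] E) ∞ (fun y => (T y).inverse) y₀ :=
    ContMDiffAt.comp y₀ (hinv.contDiffAt_map_inverse (n := ∞)).contMDiffAt hT
  refine (h1.clm_apply hz).congr_of_eventuallyEq ?_
  obtain ⟨e, he⟩ := hinv
  have h2 : ∀ᶠ y in 𝓝 y₀, T y ∈ Set.range ((↑) : (E ≃L[ℝ] V) → E →L[ℝ] V) :=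
    hT.continuousAt.eventually (by rw [← he]; exact ContinuousLinearEquiv.nhds e)
  filter_upwards [h2] with y ⟨e', he'⟩
  rw [← he']; simp

theorem isInvertible_of_bijective [FiniteDimensional ℝ E] {T : E →L[ℝ] V}
    (h : Function.Bijective T) : T.IsInvertible :=
  ⟨(LinearEquiv.ofBijective T.toLinearMap h).toContinuousLinearEquiv, by ext; rfl⟩

theorem cfi_bijective [I.Boundaryless] {x₀ x : X} (h : x ∈ (chartAt H x₀).source) :
    Function.Bijective (cfi I x₀ x) :=
  Function.bijective_iff_has_inverse.mpr ⟨cf I x₀ x, cf_cfi h, cfi_cf h⟩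

theorem SmAt.of_form [I.Boundaryless] [FiniteDimensional ℝ E] {θ : X → E →L[ℝ] V} {f : Y → X}
    {z : Y → E} {y₀ : Y} (hθ : FormAt I θ (f y₀)) (hb : Function.Bijective (θ (f y₀)))
    (hf : ContMDiffAt I' I ∞ f y₀)
    (hz : ContMDiffAt I' 𝓘(ℝ, V) ∞ (fun y => θ (f y) (z y)) y₀) : SmAt I I' f z y₀ := by
  refine smAt_iff.mpr ⟨hf, ?_⟩
  have := FiniteDimensional.complete ℝ E
  refine contMDiffAt_of_clm_apply (ContMDiffAt.comp y₀ hθ hf) ?_ (hz.congr_of_eventuallyEq ?_)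
  · refine isInvertible_of_bijective ?_
    exact hb.comp (cfi_bijective (mem_chart_source H _))
  · filter_upwards [hf.continuousAt.eventually (eventually_mem_source H (f y₀))] with y hy
    change θ (f y) (cfi I (f y₀) (f y) (cf I (f y₀) (f y) (z y))) = _
    rw [cfi_cf hy]

theorem injective_bilin_bijective [FiniteDimensional ℝ E] {B : E →L[ℝ] E →L[ℝ] ℝ}
    (h : ∀ v, (∀ w, B v w = 0) → v = 0) : Function.Bijective B := by
  have hinj : Function.Injective B.toLinearMap :=
    (injective_iff_map_eq_zero _).mpr fun v hv => h v fun w => by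
      change B v = 0 at hv
      rw [hv]; rfl
  have hd : Module.finrank ℝ E = Module.finrank ℝ (E →L[ℝ] ℝ) := by
    rw [← (LinearMap.toContinuousLinearMap (𝕜 := ℝ) (E := E) (F' := ℝ)).finrank_eq]
    exact (Subspace.dual_finrank_eq).symm
  exact ⟨hinj, (LinearMap.injective_iff_surjective_of_finrank_eq_finrank hd).mp hinj⟩

theorem SmAt.of_form2 [I.Boundaryless] [FiniteDimensional ℝ E] {B : X → E →L[ℝ] E →L[ℝ] ℝ}
    {f : Y → X} {z : Y → E} {y₀ : Y} (hB : Form2At I B (f y₀))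
    (hb : ∀ v, (∀ w, B (f y₀) v w = 0) → v = 0) (hf : ContMDiffAt I' I ∞ f y₀)
    (hz : ∀ w : Y → E, SmAt I I' f w y₀ →
      ContMDiffAt I' 𝓘(ℝ, ℝ) ∞ (fun y => B (f y) (z y) (w y)) y₀) : SmAt I I' f z y₀ := by
  refine smAt_iff.mpr ⟨hf, ?_⟩
  have := FiniteDimensional.complete ℝ E
  have hs := (cfi_bijective (I := I) (mem_chart_source H (f y₀)))
  refine contMDiffAt_of_clm_apply (ContMDiffAt.comp y₀ hB hf) ?_ ?_
  · refine isInvertible_of_bijective (injective_bilin_bijective fun v hv => ?_)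
    have : cfi I (f y₀) (f y₀) v = 0 := hb _ fun w => by
      obtain ⟨w', rfl⟩ := hs.2 w
      exact hv w'
    exact (map_eq_zero_iff _ hs.1).mp this
  · refine contMDiffAt_clm_iff.mpr fun e => ?_
    refine (hz (fun y => cfi I (f y₀) (f y) e) (SmAt.of_cfi hf contMDiffAt_const))
      |>.congr_of_eventuallyEq ?_
    filter_upwards [hf.continuousAt.eventually (eventually_mem_source H (f y₀))] with y hy
    change B (f y) (cfi I (f y₀) (f y) (cf I (f y₀) (f y) (z y))) _ = _
    rw [cfi_cf hy]; rfl

/-- The coefficients of a smooth vector field with respect to a smooth frame are smooth. -/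
theorem coeff_smoothAt [I.Boundaryless] [FiniteDimensional ℝ E] {ι : Type*} [Fintype ι]
    {f : Y → X} {F : ι → Y → E} {c : ι → Y → ℝ} {y₀ : Y} (hf : ContMDiffAt I' I ∞ f y₀)
    (hF : ∀ i, SmAt I I' f (F i) y₀) (hli : LinearIndependent ℝ fun i => F i y₀)
    (hsp : ⊤ ≤ Submodule.span ℝ (Set.range fun i => F i y₀))
    (hz : SmAt I I' f (fun y => ∑ i, c i y • F i y) y₀) (i : ι) :
    ContMDiffAt I' 𝓘(ℝ, ℝ) ∞ (c i) y₀ := by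
  classical
  let T : Y → (ι → ℝ) →L[ℝ] E := fun y => ∑ i,
    (ContinuousLinearMap.proj (R := ℝ) (φ := fun _ : ι => ℝ) i).smulRight (cf I (f y₀) (f y) (F i y))
  have hTa : ∀ y v, T y v = cf I (f y₀) (f y) (∑ i, v i • F i y) := fun y v => by
    simp [T, map_sum]
  have hT : ContMDiffAt I' 𝓘(ℝ, (ι → ℝ) →L[ℝ] E) ∞ T y₀ := by
    refine contMDiffAt_clm_iff.mpr fun e => ?_
    simp only [hTa]
    have : SmAt I I' f (fun y => ∑ i, e i • F i y) y₀ :=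
      SmAt.sum _ hf fun i => SmAt.smul contMDiffAt_const (hF i)
    exact this.coord
  have h2 : ContMDiffAt I' 𝓘(ℝ, ι → ℝ) ∞ (fun y i => c i y) y₀ := by
    refine contMDiffAt_of_clm_apply hT ?_ ?_
    · refine isInvertible_of_bijective ?_
      have h0 : ⇑(T y₀) = fun v => ∑ i, v i • F i y₀ := by
        funext v; rw [hTa, cf_self]; rfl
      let b := Module.Basis.mk hli hsp
      rw [h0]
      refine ⟨fun v w hvw => ?_, fun z => ⟨b.repr z, ?_⟩⟩
      · have := Fintype.linearIndependent_iff.mp hli (fun i => v i - w i) (by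
          simpa [sub_smul, sub_eq_zero] using hvw)
        exact funext fun i => sub_eq_zero.mp (this i)
      · have := b.sum_repr z
        simpa [b] using this
    · simp only [hTa]
      exact hz.coord
  exact contMDiffAt_pi_space.mp h2 i

end Calculus

/-! ### The exterior derivative -/

section ExteriorDerivative

variable {E : Type*} [NormedAddCommGroup E] [NormedSpace ℝ E]
  {H : Type*} [TopologicalSpace H] {I : ModelWithCorners ℝ E H} [I.Boundaryless]
  {X : Type*} [TopologicalSpace X] [ChartedSpace H X] [IsManifold I ∞ X]
  {E' : Type*} [NormedAddCommGroup E'] [NormedSpace ℝ E']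
  {H' : Type*} [TopologicalSpace H'] {I' : ModelWithCorners ℝ E' H'} [I'.Boundaryless]
  {Y : Type*} [TopologicalSpace Y] [ChartedSpace H' Y] [IsManifold I' ∞ Y]
  {V : Type*} [NormedAddCommGroup V] [NormedSpace ℝ V]
  {V' : Type*} [NormedAddCommGroup V'] [NormedSpace ℝ V']
  {F : Type*} [NormedAddCommGroup F] [NormedSpace ℝ F]

theorem eventually_mdiff {f : X → Y} {x : X} (hf : ContMDiffAt I I' ∞ f x) :
    ∀ᶠ x' in 𝓝 x, MDifferentiableAt I I' f x' := by
  have : IsManifold I 1 X := .of_le (n := ∞) (by simp)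
  have : IsManifold I' 1 Y := .of_le (n := ∞) (by simp)
  have h1 : ContMDiffAt I I' 1 f x := hf.of_le (by simp)
  filter_upwards [(contMDiffAt_iff_contMDiffAt_nhds (by simp)).mp h1] with x' hx'
  exact hx'.mdifferentiableAt (by simp)

/-- The expression of a 1-form in the chart at `x₀`. -/
def formHat (I : ModelWithCorners ℝ E H) (θ : X → E →L[ℝ] V) (x₀ : X) (y : E) : E →L[ℝ] V :=
  (θ ((extChartAt I x₀).symm y)).comp (tmap 𝓘(ℝ, E) I (extChartAt I x₀).symm y)

theorem FormAt.formHat {θ : X → E →L[ℝ] V} {x₀ : X} (h : FormAt I θ x₀) :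
    ContDiffAt ℝ ∞ (formHat I θ x₀) (extChartAt I x₀ x₀) := by
  have hm := mem_extChartAt_target (I := I) x₀
  have h1 : ContMDiffAt 𝓘(ℝ, E) 𝓘(ℝ, E →L[ℝ] V) ∞ (fun y => (θ ((extChartAt I x₀).symm y)).comp
      (cfi I x₀ ((extChartAt I x₀).symm y))) (extChartAt I x₀ x₀) := by
    refine ContMDiffAt.comp (g := fun x => (θ x).comp (cfi I x₀ x)) _ ?_ (smooth_ext_symm hm)
    rw [extChartAt_to_inv]; exact h
  refine (contMDiffAt_iff_contDiffAt.mp h1).congr_of_eventuallyEq ?_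
  filter_upwards [ext_target_mem hm] with y hy
  simp only [NH.formHat, cfi]
  rw [(extChartAt I x₀).right_inv hy]

theorem extD_param_aux {θ : X → E →L[ℝ] V} {c : F → X} {p : F} (hθ : FormAt I θ (c p))
    (hc : ContMDiffAt 𝓘(ℝ, F) I ∞ c p) (a b : F) :
    DifferentiableAt ℝ (fun v => (θ (c v)).comp (tmap 𝓘(ℝ, F) I c v)) p ∧
    extD I θ (c p) (tmap 𝓘(ℝ, F) I c p a) (tmap 𝓘(ℝ, F) I c p b) =
      fderiv ℝ (fun v => (θ (c v)).comp (tmap 𝓘(ℝ, F) I c v)) p a b -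
      fderiv ℝ (fun v => (θ (c v)).comp (tmap 𝓘(ℝ, F) I c v)) p b a := by
  set x₀ := c p with hx₀
  set φ := extChartAt I x₀ with hφ
  have hch : ContDiffAt ℝ ∞ (fun v => φ (c v)) p :=
    contMDiffAt_iff_contDiffAt.mp (ContMDiffAt.comp p (smooth_ext (mem_chart_source H x₀)) hc)
  have hev : ∀ᶠ v in 𝓝 p, (θ (c v)).comp (tmap 𝓘(ℝ, F) I c v) =
      (formHat I θ x₀ (φ (c v))).comp (fderiv ℝ (fun v => φ (c v)) v) := by
    filter_upwards [hc.continuousAt.eventually (eventually_mem_source H x₀),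
      eventually_mdiff hc] with v hv hd
    have hs : c v ∈ φ.source := by simpa [hφ] using hv
    ext w
    have h1 := tmap_comp_apply (I'' := 𝓘(ℝ, E)) (g := φ) (mdiff_ext hv) hd w
    rw [tmap_eq_fderiv] at h1
    simp only [ContinuousLinearMap.comp_apply, formHat]
    rw [h1, φ.left_inv hs]
    exact congrArg _ (cfi_cf (I := I) hv _).symm
  have hθd : HasFDerivAt (formHat I θ x₀) (fderiv ℝ (formHat I θ x₀) (φ x₀)) (φ (c p)) :=
    (hθ.formHat.differentiableAt (by simp)).hasFDerivAt
  have hcd : HasFDerivAt (fun v => φ (c v)) (fderiv ℝ (fun v => φ (c v)) p) p :=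
    (hch.differentiableAt (by simp)).hasFDerivAt
  have hc2 : HasFDerivAt (fderiv ℝ (fun v => φ (c v)))
      (fderiv ℝ (fderiv ℝ (fun v => φ (c v))) p) p :=
    ((hch.fderiv_right (m := ∞) (by simp)).differentiableAt (by simp)).hasFDerivAt
  have hg := (hθd.comp p hcd).clm_comp hc2
  have hg' := hg.congr_of_eventuallyEq (f₁ := fun v => (θ (c v)).comp (tmap 𝓘(ℝ, F) I c v)) hev
  refine ⟨hg'.differentiableAt, ?_⟩
  have hsymm : fderiv ℝ (fderiv ℝ (fun v => φ (c v))) p a b =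
      fderiv ℝ (fderiv ℝ (fun v => φ (c v))) p b a :=
    (hch.isSymmSndFDerivAt (by simpa using ENat.LEInfty.out)).eq a b
  rw [hg'.fderiv]
  have hT : ∀ w, fderiv ℝ (fun v => φ (c v)) p w = tmap 𝓘(ℝ, F) I c p w := fun w => by
    have h1 := tmap_comp_apply (I'' := 𝓘(ℝ, E)) (g := φ) (mdiff_ext (mem_chart_source H x₀))
      (hc.mdifferentiableAt (by simp)) w
    rw [tmap_eq_fderiv] at h1
    rw [h1]
    change cf I x₀ x₀ _ = _
    rw [cf_self]; rfl
  have hD : ∀ u v : E, extD I θ x₀ u v = fderiv ℝ (formHat I θ x₀) (φ x₀) u v -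
      fderiv ℝ (formHat I θ x₀) (φ x₀) v u := fun u v => by
    have h1 : extD I θ x₀ u v = fderiv ℝ (formHat I θ x₀) (φ x₀) (cf I x₀ x₀ u) (cf I x₀ x₀ v) -
      fderiv ℝ (formHat I θ x₀) (φ x₀) (cf I x₀ x₀ v) (cf I x₀ x₀ u) := rfl
    rw [h1, cf_self]; rfl
  rw [hD]
  simp [hT, hsymm]

/-- The exterior derivative of a 1-form in terms of a parametrization. -/
theorem extD_param {θ : X → E →L[ℝ] V} {c : F → X} {p : F} (hθ : FormAt I θ (c p))
    (hc : ContMDiffAt 𝓘(ℝ, F) I ∞ c p) (a b : F) :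
    extD I θ (c p) (tmap 𝓘(ℝ, F) I c p a) (tmap 𝓘(ℝ, F) I c p b) =
      fderiv ℝ (fun v => θ (c v) (tmap 𝓘(ℝ, F) I c v b)) p a -
      fderiv ℝ (fun v => θ (c v) (tmap 𝓘(ℝ, F) I c v a)) p b := by
  obtain ⟨h1, h2⟩ := extD_param_aux hθ hc a b
  rw [h2]
  have h3 : ∀ w, fderiv ℝ (fun v => θ (c v) (tmap 𝓘(ℝ, F) I c v w)) p =
      (fderiv ℝ (fun v => (θ (c v)).comp (tmap 𝓘(ℝ, F) I c v)) p).flip w := fun w => by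
    have := (h1.hasFDerivAt.clm_apply (hasFDerivAt_const w p)).fderiv
    simp only [ContinuousLinearMap.comp_zero, zero_add] at this
    exact this
  rw [h3, h3]; rfl

theorem extD_self_chart {θ : X → E →L[ℝ] V} {x₀ x : X} (hθ : FormAt I θ x)
    (hx : x ∈ (chartAt H x₀).source) (u v : E) :
    extD I θ x (cfi I x₀ x u) (cfi I x₀ x v) =
      fderiv ℝ (formHat I θ x₀) (extChartAt I x₀ x) u v -
      fderiv ℝ (formHat I θ x₀) (extChartAt I x₀ x) v u := by
  have hs : x ∈ (extChartAt I x₀).source := by simpa using hx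
  have h := (extD_param_aux (θ := θ) (c := (extChartAt I x₀).symm) (p := extChartAt I x₀ x)
    (by rwa [(extChartAt I x₀).left_inv hs])
    (smooth_ext_symm ((extChartAt I x₀).map_source hs)) u v).2
  rw [(extChartAt I x₀).left_inv hs] at h
  exact h

set_option synthInstance.maxHeartbeats 200000 in
theorem Form2At.extD {θ : X → E →L[ℝ] V} (hθ : ∀ x, FormAt I θ x) (x₀ : X) :
    Form2At I (extD I θ) x₀ := by
  have h1 : ContDiffAt ℝ ∞ (fun y => fderiv ℝ (NH.formHat I θ x₀) y -
      (fderiv ℝ (NH.formHat I θ x₀) y).flip) (extChartAt I x₀ x₀) := by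
    have h := (hθ x₀).formHat.fderiv_right (m := ∞) (by simp)
    have hfl : ContDiff ℝ ∞ (fun L : E →L[ℝ] E →L[ℝ] V => L.flip) :=
      IsBoundedLinearMap.contDiff (IsLinearMap.with_bound ⟨fun _ _ => rfl, fun _ _ => rfl⟩ 1
        fun L => by rw [ContinuousLinearMap.opNorm_flip, one_mul])
    exact h.sub (hfl.contDiffAt.comp _ h)
  refine (ContMDiffAt.comp x₀ (contMDiffAt_iff_contDiffAt.mpr h1)
    (smooth_ext (mem_chart_source H x₀))).congr_of_eventuallyEq ?_
  filter_upwards [eventually_mem_source H x₀] with x hx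
  ext u v
  exact extD_self_chart (hθ x) hx u v

/-- Naturality of the exterior derivative. -/
theorem extD_pullback {θ' : Y → E' →L[ℝ] V} {θ : X → E →L[ℝ] V} {f : X → Y} {x : X}
    (hθ' : FormAt I' θ' (f x)) (hθ : FormAt I θ x) (hf : ContMDiffAt I I' ∞ f x)
    (h : ∀ᶠ x' in 𝓝 x, ∀ v, θ x' v = θ' (f x') (tmap I I' f x' v)) (u v : E) :
    extD I θ x u v = extD I' θ' (f x) (tmap I I' f x u) (tmap I I' f x v) := by
  have hs := mem_extChartAt_source (I := I) x
  have ht := mem_extChartAt_target (I := I) x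
  set φ := extChartAt I x with hφ
  have hxx : φ.symm (φ x) = x := φ.left_inv hs
  have hid : ∀ w, tmap 𝓘(ℝ, E) I φ.symm (φ x) w = w := fun w => by
    change cfi I x x w = w; rw [cfi_self]; rfl
  have hcs := smooth_ext_symm ht
  have hcs' : ContMDiffAt 𝓘(ℝ, E) I' ∞ (fun y => f (φ.symm y)) (φ x) :=
    ContMDiffAt.comp _ (by rwa [hxx]) hcs
  have h1 := extD_param (θ := θ) (c := φ.symm) (p := φ x) (by rwa [hxx]) hcs u v
  have h2 := extD_param (θ := θ') (c := fun y => f (φ.symm y)) (p := φ x) (by rwa [hxx]) hcs' u v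
  have hc : ∀ w, tmap 𝓘(ℝ, E) I' (fun y => f (φ.symm y)) (φ x) w = tmap I I' f x w := fun w => by
    rw [tmap_comp_apply (g := f) (f := φ.symm) (by rw [hxx]; exact hf.mdifferentiableAt (by simp))
      (mdiff_ext_symm ht), hid, hxx]
  rw [hc, hc, hxx] at h2
  rw [hid, hid, hxx] at h1
  rw [h1, h2]
  have hev : ∀ w, (fun y => θ (φ.symm y) (tmap 𝓘(ℝ, E) I φ.symm y w)) =ᶠ[𝓝 (φ x)]
      fun y => θ' (f (φ.symm y)) (tmap 𝓘(ℝ, E) I' (fun y => f (φ.symm y)) y w) := fun w => by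
    have hx' : Filter.Tendsto φ.symm (𝓝 (φ x)) (𝓝 x) := by
      have := hcs.continuousAt; rwa [ContinuousAt, hxx] at this
    filter_upwards [hx'.eventually h, hx'.eventually (eventually_mdiff hf),
      ext_target_mem ht] with y hy hy' hyt
    rw [hy, tmap_comp_apply (g := f) (f := φ.symm) hy' (mdiff_ext_symm hyt)]
  rw [(hev v).fderiv_eq, (hev u).fderiv_eq]

/-- Cartan's formula for 1-forms whose value on a vector is invariant under a
one-parameter family of maps. -/
theorem extD_invariant {θ : X → E →L[ℝ] V} {x : X} (hθ : FormAt I θ x) {a : ℝ × X → X}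
    (ha : ContMDiffAt (𝓘(ℝ, ℝ).prod I) I ∞ a (0, x)) (ha0 : ∀ x', a (0, x') = x')
    {v : E}
    (hinv : ∀ᶠ t in 𝓝 (0 : ℝ), θ (a (t, x)) (tmap I I (fun x' => a (t, x')) x v) = θ x v)
    {ν : X → E} (hν : ∀ᶠ x' in 𝓝 x, ν x' = tmap 𝓘(ℝ, ℝ) I (fun t => a (t, x')) 0 1)
    (hd : MDifferentiableAt I 𝓘(ℝ, V) (fun x' => θ x' (ν x')) x) :
    extD I θ x (ν x) v = - tmap I 𝓘(ℝ, V) (fun x' => θ x' (ν x')) x v := by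
  have hs := mem_extChartAt_source (I := I) x
  have ht := mem_extChartAt_target (I := I) x
  set φ := extChartAt I x with hφ
  have hxx : φ.symm (φ x) = x := φ.left_inv hs
  have hid : ∀ w, tmap 𝓘(ℝ, E) I φ.symm (φ x) w = w := fun w => by
    change cfi I x x w = w; rw [cfi_self]; rfl
  have hcs := smooth_ext_symm ht
  let c : ℝ × E → X := fun w => a (w.1, φ.symm w.2)
  have hin : ContMDiffAt 𝓘(ℝ, ℝ × E) (𝓘(ℝ, ℝ).prod I) ∞ (fun w : ℝ × E => (w.1, φ.symm w.2))
      (0, φ x) :=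
    ContMDiffAt.prodMk contDiff_fst.contMDiff.contMDiffAt
      (ContMDiffAt.comp (0, φ x) (g := φ.symm) hcs contDiff_snd.contMDiff.contMDiffAt)
  have hc : ContMDiffAt 𝓘(ℝ, ℝ × E) I ∞ c (0, φ x) :=
    ContMDiffAt.comp (0, φ x) (g := a) (by simpa [hxx] using ha) hin
  have hc0 : c (0, φ x) = x := by simp [c, ha0, hxx]
  have hmd := eventually_mdiff hc
  have e1 : ∀ t : ℝ, ∀ y : E, MDifferentiableAt 𝓘(ℝ, ℝ) 𝓘(ℝ, ℝ × E) (fun t : ℝ => (t, y)) t :=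
    fun t y => (differentiableAt_id.prodMk (differentiableAt_const y)).mdifferentiableAt
  have e2 : ∀ t : ℝ, ∀ y : E, MDifferentiableAt 𝓘(ℝ, E) 𝓘(ℝ, ℝ × E) (fun y : E => (t, y)) y :=
    fun t y => ((differentiableAt_const t).prodMk differentiableAt_id).mdifferentiableAt
  have f1 : ∀ t : ℝ, ∀ y : E, tmap 𝓘(ℝ, ℝ) 𝓘(ℝ, ℝ × E) (fun t : ℝ => (t, y)) t 1 = (1, 0) :=
    fun t y => by
      rw [tmap_eq_fderiv]
      rw [HasFDerivAt.fderiv (f := fun t : ℝ => (t, y))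
        ((hasFDerivAt_id t).prodMk (hasFDerivAt_const y t))]
      simp
  have f2 : ∀ t : ℝ, ∀ y w : E, tmap 𝓘(ℝ, E) 𝓘(ℝ, ℝ × E) (fun y : E => (t, y)) y w = (0, w) :=
    fun t y w => by
      rw [tmap_eq_fderiv]
      rw [HasFDerivAt.fderiv (f := fun y : E => (t, y))
        ((hasFDerivAt_const t y).prodMk (hasFDerivAt_id y))]
      simp
  have hT1 : ∀ᶠ w in 𝓝 ((0 : ℝ), φ x), tmap 𝓘(ℝ, ℝ × E) I c w (1, 0) =
      tmap 𝓘(ℝ, ℝ) I (fun t => a (t, φ.symm w.2)) w.1 1 := by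
    filter_upwards [hmd] with w hw
    have := tmap_comp_apply (g := c) (f := fun t : ℝ => (t, w.2)) (x := w.1) hw (e1 w.1 w.2) 1
    rw [f1] at this
    exact this.symm
  have hT2 : ∀ᶠ w in 𝓝 ((0 : ℝ), φ x), tmap 𝓘(ℝ, ℝ × E) I c w (0, v) =
      tmap 𝓘(ℝ, E) I (fun y => a (w.1, φ.symm y)) w.2 v := by
    filter_upwards [hmd] with w hw
    have := tmap_comp_apply (g := c) (f := fun y : E => (w.1, y)) (x := w.2) hw (e2 w.1 w.2) v
    rw [f2] at this
    exact this.symm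
  have hp := extD_param (θ := θ) (c := c) (p := (0, φ x)) (by rwa [hc0]) hc (1, 0) (0, v)
  have hz1 : tmap 𝓘(ℝ, ℝ × E) I c (0, φ x) (1, 0) = ν x := by
    rw [hT1.self_of_nhds, hν.self_of_nhds]
    simp only [hxx]
  have hz2 : tmap 𝓘(ℝ, ℝ × E) I c (0, φ x) (0, v) = v := by
    rw [hT2.self_of_nhds]; simp only [ha0]; exact hid v
  rw [hz1, hz2, hc0] at hp
  rw [hp]
  have hdiff : ∀ w, DifferentiableAt ℝ
      (fun z => θ (c z) (tmap 𝓘(ℝ, ℝ × E) I c z w)) (0, φ x) := fun w =>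
    (extD_param_aux (θ := θ) (c := c) (p := (0, φ x)) (by rwa [hc0]) hc w w).1.clm_apply
      (differentiableAt_const w)
  have hA : fderiv ℝ (fun z => θ (c z) (tmap 𝓘(ℝ, ℝ × E) I c z (0, v))) (0, φ x) (1, 0) = 0 := by
    have h1 := tmap_comp_apply (I' := 𝓘(ℝ, ℝ × E)) (I'' := 𝓘(ℝ, V)) (x := (0 : ℝ))
      (g := fun z => θ (c z) (tmap 𝓘(ℝ, ℝ × E) I c z (0, v)))
      (f := fun t : ℝ => (t, φ x)) (hdiff (0, v)).mdifferentiableAt (e1 0 (φ x)) 1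
    rw [f1, tmap_eq_fderiv (E := ℝ × E)] at h1
    rw [← h1]
    have hct : Filter.Tendsto (fun t : ℝ => (t, φ x)) (𝓝 0) (𝓝 (0, φ x)) :=
      (Continuous.prodMk continuous_id continuous_const).tendsto' _ _ rfl
    have hct' : Filter.Tendsto (fun t : ℝ => (t, x)) (𝓝 0) (𝓝 (0, x)) :=
      (Continuous.prodMk continuous_id continuous_const).tendsto' _ _ rfl
    have : (fun t : ℝ => θ (c (t, φ x)) (tmap 𝓘(ℝ, ℝ × E) I c (t, φ x) (0, v))) =ᶠ[𝓝 0]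
        fun _ => θ x v := by
      filter_upwards [hct.eventually hT2, hct'.eventually (eventually_mdiff ha), hinv]
        with t h1 h2 h3
      rw [h1]
      simp only [c, hxx]
      rw [← h3]
      have h4 : MDifferentiableAt I (𝓘(ℝ, ℝ).prod I) (fun x' : X => (t, x')) x :=
        mdifferentiableAt_const.prodMk mdifferentiableAt_id
      have h5 : MDifferentiableAt I I (fun x' => a (t, x')) (φ.symm (φ x)) := by
        rw [hxx]; exact h2.comp x h4
      rw [tmap_comp_apply (g := fun x' => a (t, x')) (f := φ.symm) h5 (mdiff_ext_symm ht), hid,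
        hxx]
    rw [tmap_congr this, tmap_const]; rfl
  have hB : fderiv ℝ (fun z => θ (c z) (tmap 𝓘(ℝ, ℝ × E) I c z (1, 0))) (0, φ x) (0, v) =
      tmap I 𝓘(ℝ, V) (fun x' => θ x' (ν x')) x v := by
    have h1 := tmap_comp_apply (I' := 𝓘(ℝ, ℝ × E)) (I'' := 𝓘(ℝ, V)) (x := φ x)
      (g := fun z => θ (c z) (tmap 𝓘(ℝ, ℝ × E) I c z (1, 0)))
      (f := fun y : E => ((0 : ℝ), y)) (hdiff (1, 0)).mdifferentiableAt (e2 0 (φ x)) v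
    rw [f2, tmap_eq_fderiv (E := ℝ × E)] at h1
    rw [← h1]
    have hct : Filter.Tendsto (fun y : E => ((0 : ℝ), y)) (𝓝 (φ x)) (𝓝 (0, φ x)) :=
      (Continuous.prodMk continuous_const continuous_id).tendsto' _ _ rfl
    have hx' : Filter.Tendsto φ.symm (𝓝 (φ x)) (𝓝 x) := by
      have := hcs.continuousAt; rwa [ContinuousAt, hxx] at this
    have : (fun y : E => θ (c (0, y)) (tmap 𝓘(ℝ, ℝ × E) I c (0, y) (1, 0))) =ᶠ[𝓝 (φ x)]
        fun y => θ (φ.symm y) (ν (φ.symm y)) := by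
      filter_upwards [hct.eventually hT1, hx'.eventually hν] with y h1 h2
      rw [h1, h2]
      simp only [c, ha0]
    rw [tmap_congr this]
    rw [tmap_comp_apply (g := fun x' => θ x' (ν x')) (f := φ.symm) (by rwa [hxx])
      (mdiff_ext_symm ht), hid, hxx]
  rw [hA, hB, zero_sub]

end ExteriorDerivative

/-! ### The cotangent bundle -/

section CotangentBundle

variable {E : Type*} [NormedAddCommGroup E] [NormedSpace ℝ E]
  {X : Type*} [TopologicalSpace X] [ChartedSpace E X] [IsManifold 𝓘(ℝ, E) ∞ X]
  {E' : Type*} [NormedAddCommGroup E'] [NormedSpace ℝ E']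
  {H' : Type*} [TopologicalSpace H'] {I' : ModelWithCorners ℝ E' H'}
  {Y : Type*} [TopologicalSpace Y] [ChartedSpace H' Y]

theorem cot_trivializationAt_snd {x₀ : X} {α : Cot E X} (h : α.1 ∈ (chartAt E x₀).source) :
    (trivializationAt (E →L[ℝ] ℝ) (fun x : X => TangentSpace 𝓘(ℝ, E) x →L[ℝ] ℝ) x₀ α).2 =
      (covec α).comp (cfi 𝓘(ℝ, E) x₀ α.1) := by
  have h1 : (trivializationAt (E →L[ℝ] ℝ) (fun x : X => TangentSpace 𝓘(ℝ, E) x →L[ℝ] ℝ) x₀ α).2 =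
      ContinuousLinearMap.inCoordinates E (TangentSpace 𝓘(ℝ, E) : X → Type _) ℝ
        (Bundle.Trivial X ℝ) x₀ α.1 x₀ α.1 α.2 := rfl
  rw [h1]
  ext v
  have h2 : ContinuousLinearMap.inCoordinates E (TangentSpace 𝓘(ℝ, E) : X → Type _) ℝ
        (Bundle.Trivial X ℝ) x₀ α.1 x₀ α.1 α.2 v = covec α
          ((trivializationAt E (TangentSpace 𝓘(ℝ, E) : X → Type _) x₀).symmL ℝ α.1 v) := by
    simp only [ContinuousLinearMap.inCoordinates, ContinuousLinearMap.comp_apply]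
    have h3 : ∀ r : ℝ, (trivializationAt ℝ (Bundle.Trivial X ℝ) x₀).continuousLinearMapAt ℝ α.1 r =
        r := fun r => by
      change (Bundle.Trivial.trivialization X ℝ).continuousLinearMapAt ℝ α.1 r = r
      rw [Bundle.Trivial.continuousLinearMapAt_trivialization]
      rfl
    exact h3 _
  rw [h2, symmL_eq_cfi h]
  rfl

theorem cotAt_iff {α : Y → Cot E X} {y₀ : Y} : ContMDiffAt I' (cotI E) ∞ α y₀ ↔
    ContMDiffAt I' 𝓘(ℝ, E) ∞ (fun y => (α y).1) y₀ ∧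
      ContMDiffAt I' 𝓘(ℝ, E →L[ℝ] ℝ) ∞
        (fun y => (covec (α y)).comp (cfi 𝓘(ℝ, E) (α y₀).1 (α y).1)) y₀ := by
  rw [contMDiffAt_totalSpace]
  refine and_congr_right fun hf => Filter.EventuallyEq.contMDiffAt_iff ?_
  filter_upwards [hf.continuousAt.eventually (eventually_mem_source E (α y₀).1)] with y hy
  exact cot_trivializationAt_snd hy

theorem cot_base {α : Y → Cot E X} {y₀ : Y} (h : ContMDiffAt I' (cotI E) ∞ α y₀) :
    ContMDiffAt I' 𝓘(ℝ, E) ∞ (fun y => (α y).1) y₀ := (cotAt_iff.mp h).1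

theorem covec_apply_smoothAt {α : Y → Cot E X} {z : Y → E} {y₀ : Y}
    (h : ContMDiffAt I' (cotI E) ∞ α y₀) (hz : SmAt 𝓘(ℝ, E) I' (fun y => (α y).1) z y₀) :
    ContMDiffAt I' 𝓘(ℝ, ℝ) ∞ (fun y => covec (α y) (z y)) y₀ := by
  refine ((cotAt_iff.mp h).2.clm_apply hz.coord).congr_of_eventuallyEq ?_
  filter_upwards [hz.base.continuousAt.eventually (eventually_mem_source E (α y₀).1)] with y hy
  change _ = covec (α y) (cfi 𝓘(ℝ, E) (α y₀).1 (α y).1 (cf 𝓘(ℝ, E) (α y₀).1 (α y).1 (z y)))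
  rw [cfi_cf hy]

theorem cotAt_of_apply [FiniteDimensional ℝ E] {α : Y → Cot E X} {y₀ : Y}
    (h : ContMDiffAt I' 𝓘(ℝ, E) ∞ (fun y => (α y).1) y₀)
    (hz : ∀ z : Y → E, SmAt 𝓘(ℝ, E) I' (fun y => (α y).1) z y₀ →
      ContMDiffAt I' 𝓘(ℝ, ℝ) ∞ (fun y => covec (α y) (z y)) y₀) :
    ContMDiffAt I' (cotI E) ∞ α y₀ := by
  refine cotAt_iff.mpr ⟨h, contMDiffAt_clm_iff.mpr fun e => ?_⟩
  exact hz (fun y => cfi 𝓘(ℝ, E) (α y₀).1 (α y).1 e) (SmAt.of_cfi h contMDiffAt_const)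

theorem smooth_pr (a : Cot E X) :
    ContMDiffAt (cotI E) 𝓘(ℝ, E) ∞ (fun β : Cot E X => β.1) a :=
  cot_base contMDiffAt_id

theorem cot_extChartAt {a b : Cot E X} (h : b.1 ∈ (chartAt E a.1).source) :
    extChartAt (cotI E) a b =
      (extChartAt 𝓘(ℝ, E) a.1 b.1, (covec b).comp (cfi 𝓘(ℝ, E) a.1 b.1)) := by
  rw [← cot_trivializationAt_snd h]
  rw [FiberBundle.extChartAt]
  simp only [mfld_simps]
  refine Prod.ext ?_ rfl
  change chartAt E a.1 (trivializationAt (E →L[ℝ] ℝ)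
    (fun x : X => TangentSpace 𝓘(ℝ, E) x →L[ℝ] ℝ) a.1 b).1 = _
  rw [Trivialization.coe_fst]
  rw [Trivialization.mem_source]
  simpa using h

theorem tτ_apply (a : Cot E X) (w : E × (E →L[ℝ] ℝ)) : tτ a w = w.1 := by
  have hev : (fun b : Cot E X => extChartAt 𝓘(ℝ, E) a.1 b.1) =ᶠ[𝓝 a]
      fun b => (extChartAt (cotI E) a b).1 := by
    filter_upwards [(smooth_pr a).continuousAt.eventually (eventually_mem_source E a.1)] with b hb
    rw [cot_extChartAt hb]
  have h1 := tmap_comp_apply (I := cotI E) (I'' := 𝓘(ℝ, E)) (g := extChartAt 𝓘(ℝ, E) a.1)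
    (f := fun b : Cot E X => b.1) (x := a) (mdiff_ext (mem_chart_source E a.1))
    ((smooth_pr a).mdifferentiableAt (by simp)) w
  have h2 := tmap_comp_apply (I := cotI E) (I' := 𝓘(ℝ, E × (E →L[ℝ] ℝ))) (I'' := 𝓘(ℝ, E))
    (g := Prod.fst) (f := extChartAt (cotI E) a) (x := a)
    differentiableAt_fst.mdifferentiableAt (mdiff_ext (mem_chart_source _ a)) w
  rw [tmap_congr hev, h2] at h1
  have h3 : tmap (cotI E) 𝓘(ℝ, E × (E →L[ℝ] ℝ)) (extChartAt (cotI E) a) a w = w := by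
    change cf (cotI E) a a w = w
    rw [cf_self]; rfl
  have h4 : tmap 𝓘(ℝ, E) 𝓘(ℝ, E) (extChartAt 𝓘(ℝ, E) a.1) a.1
      (tmap (cotI E) 𝓘(ℝ, E) (fun b : Cot E X => b.1) a w) = tτ a w := by
    change cf 𝓘(ℝ, E) a.1 a.1 (tτ a w) = tτ a w
    rw [cf_self]; rfl
  rw [h4, h3, tmap_eq_fderiv, fderiv_fst] at h1
  exact h1.symm

/-- The parametrization of the cotangent bundle by a chart. -/
def cotParam (x₀ : X) (w : E × (E →L[ℝ] ℝ)) : Cot E X :=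
  mkCot ((extChartAt 𝓘(ℝ, E) x₀).symm w.1)
    (w.2.comp (cf 𝓘(ℝ, E) x₀ ((extChartAt 𝓘(ℝ, E) x₀).symm w.1)))

theorem covec_mkCot (x : X) (l : E →L[ℝ] ℝ) : covec (mkCot x l) = l := rfl

theorem mkCot_fst (x : X) (l : E →L[ℝ] ℝ) : (mkCot x l).1 = x := rfl

theorem cot_ext {a b : Cot E X} (h : a.1 = b.1) (h' : covec a = covec b) : a = b := by
  obtain ⟨x, l⟩ := a
  obtain ⟨x', l'⟩ := b
  obtain rfl : x = x' := h
  exact congrArg (TotalSpace.mk x) h'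

theorem cotParam_smoothAt {x₀ : X} {w : E × (E →L[ℝ] ℝ)}
    (h : w.1 = extChartAt 𝓘(ℝ, E) x₀ x₀) :
    ContMDiffAt 𝓘(ℝ, E × (E →L[ℝ] ℝ)) (cotI E) ∞ (cotParam x₀) w := by
  have hm := mem_extChartAt_target (I := 𝓘(ℝ, E)) x₀
  have hb : ContMDiffAt 𝓘(ℝ, E × (E →L[ℝ] ℝ)) 𝓘(ℝ, E) ∞
      (fun w : E × (E →L[ℝ] ℝ) => (extChartAt 𝓘(ℝ, E) x₀).symm w.1) w :=
    ContMDiffAt.comp w (g := (extChartAt 𝓘(ℝ, E) x₀).symm) (smooth_ext_symm (by rwa [h]))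
      contDiff_fst.contMDiff.contMDiffAt
  refine cotAt_iff.mpr ⟨hb, ?_⟩
  refine (contDiff_snd.contMDiff.contMDiffAt (n := ∞)).congr_of_eventuallyEq ?_
  have h0 : (extChartAt 𝓘(ℝ, E) x₀).symm w.1 = x₀ := by rw [h, extChartAt_to_inv]
  filter_upwards [hb.continuousAt.eventually (eventually_mem_source E _)] with w' hw'
  rw [h0] at hw'
  ext v
  change w'.2 (cf 𝓘(ℝ, E) x₀ _ (cfi 𝓘(ℝ, E) ((extChartAt 𝓘(ℝ, E) x₀).symm w.1) _ v)) = _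
  rw [h0]
  exact congrArg _ (cf_cfi hw' v)

theorem cotParam_center (a : Cot E X) :
    cotParam a.1 (extChartAt 𝓘(ℝ, E) a.1 a.1, covec a) = a := by
  refine cot_ext (by simp [cotParam, mkCot]) ?_
  simp only [cotParam, covec_mkCot, extChartAt_to_inv, cf_self]
  rfl

theorem eventually_cotParam_mem (a : Cot E X) :
    ∀ᶠ w in 𝓝 (extChartAt 𝓘(ℝ, E) a.1 a.1, covec a), w.1 ∈ (extChartAt 𝓘(ℝ, E) a.1).target :=
  continuous_fst.continuousAt.eventually (ext_target_mem (mem_extChartAt_target a.1))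

theorem tmap_cotParam (a : Cot E X) (w : E × (E →L[ℝ] ℝ)) :
    tmap 𝓘(ℝ, E × (E →L[ℝ] ℝ)) (cotI E) (cotParam a.1)
      (extChartAt 𝓘(ℝ, E) a.1 a.1, covec a) w = w := by
  set p := (extChartAt 𝓘(ℝ, E) a.1 a.1, covec a) with hp
  have hev : (fun w => extChartAt (cotI E) a (cotParam a.1 w)) =ᶠ[𝓝 p] fun w => w := by
    filter_upwards [eventually_cotParam_mem a] with w hw
    have hs : (cotParam a.1 w).1 ∈ (chartAt E a.1).source := by
      have := (extChartAt 𝓘(ℝ, E) a.1).map_target hw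
      rwa [extChartAt_source] at this
    rw [cot_extChartAt hs]
    refine Prod.ext ((extChartAt 𝓘(ℝ, E) a.1).right_inv hw) ?_
    ext v
    exact congrArg w.2 (cf_cfi hs v)
  have h1 := tmap_comp_apply (I' := cotI E) (I'' := 𝓘(ℝ, E × (E →L[ℝ] ℝ)))
    (g := extChartAt (cotI E) a) (f := cotParam a.1) (x := p)
    (by rw [hp, cotParam_center]; exact mdiff_ext (mem_chart_source _ a))
    ((cotParam_smoothAt rfl).mdifferentiableAt (by simp)) w
  rw [tmap_congr hev, tmap_id] at h1
  have h2 : ∀ v, tmap (cotI E) 𝓘(ℝ, E × (E →L[ℝ] ℝ)) (extChartAt (cotI E) a)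
      (cotParam a.1 p) v = v := fun v => by
    rw [hp, cotParam_center]
    change cf (cotI E) a a v = v
    rw [cf_self]; rfl
  rw [h2] at h1
  exact h1.symm

theorem liouville_apply (a : Cot E X) (w : E × (E →L[ℝ] ℝ)) : liouville a w = covec a w.1 :=
  congrArg (covec a) (tτ_apply a w)

theorem SmAt.fst {α : Y → Cot E X} {z : Y → E × (E →L[ℝ] ℝ)} {y₀ : Y}
    (hz : SmAt (cotI E) I' α z y₀) :
    SmAt 𝓘(ℝ, E) I' (fun y => (α y).1) (fun y => (z y).1) y₀ :=
  (SmAt.tmap (c := fun b : Cot E X => b.1) (smooth_pr (α y₀)) hz).congr .rfl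
    (.of_forall fun y => (tτ_apply (α y) (z y)).symm)

theorem liouville_formAt [FiniteDimensional ℝ E] (a : Cot E X) :
    FormAt (cotI E) (liouville (E := E) (X := X)) a := by
  refine FormAt.of_apply fun z hz => ?_
  simp only [liouville_apply]
  exact covec_apply_smoothAt contMDiffAt_id hz.fst

theorem canonicalForm_apply [FiniteDimensional ℝ E] (a : Cot E X) (v w : E × (E →L[ℝ] ℝ)) :
    canonicalForm a v w = w.2 v.1 - v.2 w.1 := by
  set p := (extChartAt 𝓘(ℝ, E) a.1 a.1, covec a) with hp
  have hc : cotParam a.1 p = a := cotParam_center a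
  have hs := cotParam_smoothAt (x₀ := a.1) (w := p) rfl
  have h1 := extD_param (I := cotI E) (θ := liouville (E := E) (X := X)) (c := cotParam a.1)
    (p := p) (liouville_formAt _) hs v w
  rw [tmap_cotParam, tmap_cotParam, hc] at h1
  have hev : ∀ u : E × (E →L[ℝ] ℝ), (fun q => liouville (cotParam a.1 q)
      (tmap 𝓘(ℝ, E × (E →L[ℝ] ℝ)) (cotI E) (cotParam a.1) q u)) =ᶠ[𝓝 p] fun q => q.2 u.1 := by
    intro u
    filter_upwards [eventually_mdiff hs, eventually_cotParam_mem a] with q hq hqt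
    have h2 := tmap_comp_apply (I' := cotI E) (I'' := 𝓘(ℝ, E)) (g := fun b : Cot E X => b.1)
      (f := cotParam a.1) (x := q) ((smooth_pr _).mdifferentiableAt (by simp)) hq u
    have h3 := tmap_comp_apply (I := 𝓘(ℝ, E × (E →L[ℝ] ℝ))) (I' := 𝓘(ℝ, E)) (I'' := 𝓘(ℝ, E))
      (g := (extChartAt 𝓘(ℝ, E) a.1).symm)
      (f := Prod.fst) (x := q) (mdiff_ext_symm hqt) differentiableAt_fst.mdifferentiableAt u
    rw [tmap_eq_fderiv, fderiv_fst] at h3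
    have h4 : ((extChartAt 𝓘(ℝ, E) a.1).symm q.1) ∈ (chartAt E a.1).source := by
      have := (extChartAt 𝓘(ℝ, E) a.1).map_target hqt
      rwa [extChartAt_source] at this
    have h5 := cf_cfi (I := 𝓘(ℝ, E)) h4 u.1
    unfold cfi at h5
    rw [(extChartAt 𝓘(ℝ, E) a.1).right_inv hqt] at h5
    refine Eq.trans (congrArg (covec (cotParam a.1 q)) (h2.symm.trans h3)) ?_
    exact congrArg q.2 h5
  have hd : ∀ u u' : E × (E →L[ℝ] ℝ),
      fderiv ℝ (fun q : E × (E →L[ℝ] ℝ) => q.2 u.1) p u' = u'.2 u.1 := fun u u' => by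
    rw [HasFDerivAt.fderiv ((hasFDerivAt_snd (p := p)).clm_apply (hasFDerivAt_const u.1 p))]
    simp
  rw [(hev v).fderiv_eq, (hev w).fderiv_eq, hd, hd] at h1
  unfold canonicalForm
  change - (extD (cotI E) liouville a v w) = _
  rw [h1]; ring

theorem canonicalForm_form2At [FiniteDimensional ℝ E] (a : Cot E X) :
    Form2At (cotI E) (canonicalForm (E := E) (X := X)) a := by
  have h := Form2At.extD (I := cotI E) (θ := liouville (E := E) (X := X)) liouville_formAt a
  refine Form2At.of_apply fun z w hz hw => ?_
  exact (h.apply (f := fun x => x) hz hw).neg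

end CotangentBundle

/-! ### Straightening of submersions -/

section InverseFunction

variable {E : Type*} [NormedAddCommGroup E] [NormedSpace ℝ E]
  {H : Type*} [TopologicalSpace H] {I : ModelWithCorners ℝ E H} [I.Boundaryless]
  {X : Type*} [TopologicalSpace X] [ChartedSpace H X] [IsManifold I ∞ X]
  {E' : Type*} [NormedAddCommGroup E'] [NormedSpace ℝ E']
  {H' : Type*} [TopologicalSpace H'] {I' : ModelWithCorners ℝ E' H'} [I'.Boundaryless]
  {Y : Type*} [TopologicalSpace Y] [ChartedSpace H' Y] [IsManifold I' ∞ Y]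
  {E'' : Type*} [NormedAddCommGroup E''] [NormedSpace ℝ E'']
  {H'' : Type*} [TopologicalSpace H''] {I'' : ModelWithCorners ℝ E'' H''}
  {Z : Type*} [TopologicalSpace Z] [ChartedSpace H'' Z]

theorem exists_local_inverse [CompleteSpace E] {Φ : E → E} {y₀ : E} {U : Set E} (hU : IsOpen U)
    (hy : y₀ ∈ U) (hΦ : ContDiffOn ℝ ∞ Φ U)
    (hd : HasFDerivAt Φ (ContinuousLinearMap.id ℝ E) y₀) :
    ∃ e : OpenPartialHomeomorph E E, y₀ ∈ e.source ∧ e.source ⊆ U ∧ (e : E → E) = Φ ∧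
      ContDiffOn ℝ ∞ e.symm e.target := by
  have hat : ContDiffAt ℝ ∞ Φ y₀ := hΦ.contDiffAt (hU.mem_nhds hy)
  let e₀ := hat.toOpenPartialHomeomorph Φ (f' := ContinuousLinearEquiv.refl ℝ E) hd (by simp)
  have he₀ : (e₀ : E → E) = Φ := rfl
  have hy₀ : y₀ ∈ e₀.source := hat.mem_toOpenPartialHomeomorph_source _ _
  let R := Set.range ((↑) : (E ≃L[ℝ] E) → E →L[ℝ] E)
  have hR : IsOpen R := ContinuousLinearEquiv.isOpen
  have hcont : ContinuousOn (fderiv ℝ Φ) U := hΦ.continuousOn_fderiv_of_isOpen hU (by simp)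
  have hO : IsOpen (U ∩ fderiv ℝ Φ ⁻¹' R) := hcont.isOpen_inter_preimage hU hR
  refine ⟨e₀.restr (U ∩ fderiv ℝ Φ ⁻¹' R), ?_, ?_, he₀, ?_⟩
  · rw [OpenPartialHomeomorph.restr_source, hO.interior_eq]
    exact ⟨hy₀, hy, ⟨ContinuousLinearEquiv.refl ℝ E, hd.fderiv.symm⟩⟩
  · rw [OpenPartialHomeomorph.restr_source, hO.interior_eq]
    exact fun y hy => hy.2.1
  · intro z hz
    have hz' := (e₀.restr (U ∩ fderiv ℝ Φ ⁻¹' R)).map_target hz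
    rw [OpenPartialHomeomorph.restr_source, hO.interior_eq] at hz'
    obtain ⟨h1, h2, f', h3⟩ := hz'
    have hzt : z ∈ e₀.target := hz.1
    have h4 : ContDiffAt ℝ ∞ Φ (e₀.symm z) := hΦ.contDiffAt (hU.mem_nhds h2)
    have h5 : HasFDerivAt Φ (f' : E →L[ℝ] E) (e₀.symm z) := by
      rw [h3]
      exact (h4.differentiableAt (by simp)).hasFDerivAt
    exact (e₀.contDiffAt_symm hzt h5 h4).contDiffWithinAt

/-- Local normal form of a map near a point where it is a submersion. -/
theorem exists_straightening [FiniteDimensional ℝ E] {f : X → Y} (hf : ContMDiff I I' ∞ f) (x₀ : X)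
    {r : E' →L[ℝ] E} (hr : ∀ w, tmap I I' f x₀ (r w) = w) :
    ∃ e : OpenPartialHomeomorph X E, x₀ ∈ e.source ∧ e x₀ = 0 ∧
      ContMDiffOn I 𝓘(ℝ, E) ∞ e e.source ∧ ContMDiffOn 𝓘(ℝ, E) I ∞ e.symm e.target ∧
      (∀ v, tmap 𝓘(ℝ, E) I e.symm 0 v = v) ∧
      ∀ x ∈ e.source, f x ∈ (extChartAt I' (f x₀)).source ∧
        extChartAt I' (f x₀) (f x) = extChartAt I' (f x₀) (f x₀) + tmap I I' f x₀ (e x) := by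
  have := FiniteDimensional.complete ℝ E
  set A := tmap I I' f x₀ with hA
  set φ := extChartAt I x₀ with hφ
  set φ' := extChartAt I' (f x₀) with hφ'
  let ψ : OpenPartialHomeomorph X E := (chartAt H x₀).trans I.toHomeomorph.toOpenPartialHomeomorph
  have hψ : ∀ x, ψ x = φ x := fun x => rfl
  have hψs : ∀ x, ψ.symm x = φ.symm x := fun x => rfl
  have hψsrc : ψ.source = φ.source := by simp [ψ, hφ]
  let U : Set E := φ.target ∩ φ.symm ⁻¹' (f ⁻¹' φ'.source)
  have hO : IsOpen (f ⁻¹' φ'.source) := (isOpen_extChartAt_source _).preimage hf.continuous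
  have hUo : IsOpen U :=
    (continuousOn_extChartAt_symm x₀).isOpen_inter_preimage (isOpen_extChartAt_target x₀) hO
  have hx₀ : φ x₀ ∈ U := ⟨mem_extChartAt_target x₀, by
    change f (φ.symm (φ x₀)) ∈ φ'.source
    rw [extChartAt_to_inv]; exact mem_extChartAt_source _⟩
  let fh : E → E' := fun y => φ' (f (φ.symm y))
  have hfh : ContDiffOn ℝ ∞ fh U := by
    intro y hy
    refine ContDiffAt.contDiffWithinAt (contMDiffAt_iff_contDiffAt.mp ?_)
    refine ContMDiffAt.comp (I' := I') y (g := φ') (smooth_ext (by simpa [hφ'] using hy.2)) ?_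
    exact ContMDiffAt.comp y (g := f) hf.contMDiffAt (smooth_ext_symm hy.1)
  have hfhd : HasFDerivAt fh A (φ x₀) := by
    have h1 := (hfh.contDiffAt (hUo.mem_nhds hx₀)).differentiableAt (by simp) |>.hasFDerivAt
    convert h1 using 1
    ext v
    have hfm : MDifferentiableAt I I' f (φ.symm (φ x₀)) := hf.mdifferentiable (by simp) _
    have h2 : MDifferentiableAt 𝓘(ℝ, E) I' (fun y => f (φ.symm y)) (φ x₀) :=
      MDifferentiableAt.comp (φ x₀) hfm (mdiff_ext_symm hx₀.1)
    have h3 := tmap_comp_apply (g := φ') (f := fun y => f (φ.symm y)) (x := φ x₀)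
      (mdiff_ext (by simpa [hφ'] using hx₀.2)) h2 v
    rw [tmap_eq_fderiv] at h3
    refine Eq.trans ?_ h3.symm
    rw [tmap_comp_apply (g := f) (f := φ.symm) hfm (mdiff_ext_symm hx₀.1)]
    have h4 : tmap 𝓘(ℝ, E) I φ.symm (φ x₀) v = v := by
      change cfi I x₀ x₀ v = v; rw [cfi_self]; rfl
    rw [h4, hφ, extChartAt_to_inv]
    change A v = cf I' (f x₀) (f x₀) (A v)
    rw [cf_self]; rfl
  let Φ : E → E := fun y => y - φ x₀ + r (fh y - fh (φ x₀) - A (y - φ x₀))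
  have hΦ : ContDiffOn ℝ ∞ Φ U := by
    refine (contDiffOn_id.sub contDiffOn_const).add (r.contDiff.comp_contDiffOn ?_)
    exact (hfh.sub contDiffOn_const).sub
      (A.contDiff.comp_contDiffOn (contDiffOn_id.sub contDiffOn_const))
  have hΦd : HasFDerivAt Φ (ContinuousLinearMap.id ℝ E) (φ x₀) := by
    have h1 : HasFDerivAt (fun y => y - φ x₀) (ContinuousLinearMap.id ℝ E) (φ x₀) :=
      (hasFDerivAt_id _).sub_const _
    have h2 := h1.add (r.hasFDerivAt.comp (φ x₀)
      ((hfhd.sub_const (fh (φ x₀))).sub (A.hasFDerivAt.comp (φ x₀) h1)))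
    refine HasFDerivAt.congr_fderiv (f := Φ) h2 ?_
    rw [ContinuousLinearMap.comp_id, sub_self, ContinuousLinearMap.comp_zero, add_zero]
  obtain ⟨e, he1, he2, he3, he4⟩ := exists_local_inverse hUo hx₀ hΦ hΦd
  have hsrc : ∀ x, x ∈ (ψ.trans e).source ↔ x ∈ φ.source ∧ φ x ∈ e.source := fun x => by
    rw [OpenPartialHomeomorph.trans_source, hψsrc]; rfl
  have hmem : x₀ ∈ (ψ.trans e).source := (hsrc x₀).mpr ⟨mem_extChartAt_source x₀, he1⟩
  have hΦ0 : Φ (φ x₀) = 0 := by simp [Φ]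
  have he0 : e (φ x₀) = 0 := by rw [he3, hΦ0]
  have hes0 : e.symm 0 = φ x₀ := by rw [← he0, e.left_inv he1]
  have h0t : (0 : E) ∈ e.target := by rw [← he0]; exact e.map_source he1
  refine ⟨ψ.trans e, hmem, he0, ?_, ?_, ?_, ?_⟩
  · intro x hx
    obtain ⟨hx1, hx2⟩ := (hsrc x).mp hx
    refine ContMDiffAt.contMDiffWithinAt ?_
    refine ContMDiffAt.comp (I' := 𝓘(ℝ, E)) x (g := e) (f := φ) ?_
      (smooth_ext (by simpa [hφ] using hx1))
    rw [he3]
    exact (hΦ.contDiffAt (hUo.mem_nhds (he2 hx2))).contMDiffAt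
  · intro z hz
    have hz1 : z ∈ e.target := hz.1
    have hz2 : e.symm z ∈ φ.target := (he2 (e.map_target hz1)).1
    refine ContMDiffAt.contMDiffWithinAt ?_
    refine ContMDiffAt.comp (I' := 𝓘(ℝ, E)) z (g := φ.symm) (f := e.symm) (smooth_ext_symm hz2) ?_
    exact (he4.contDiffAt (e.open_target.mem_nhds hz1)).contMDiffAt
  · intro v
    have h1 : DifferentiableAt ℝ e.symm 0 :=
      (he4.contDiffAt (e.open_target.mem_nhds h0t)).differentiableAt (by simp)
    have h2 := tmap_comp_apply (g := φ.symm) (f := e.symm) (x := (0 : E)) (I'' := I)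
      (by rw [hes0]; exact mdiff_ext_symm hx₀.1) h1.mdifferentiableAt v
    refine h2.trans ?_
    rw [hes0]
    refine Eq.trans (b := cfi I x₀ x₀ (tmap 𝓘(ℝ, E) 𝓘(ℝ, E) e.symm 0 v)) rfl ?_
    rw [cfi_self, tmap_eq_fderiv]
    have h3 := e.hasFDerivAt_symm (f' := ContinuousLinearEquiv.refl ℝ E) h0t
      (by rw [hes0, he3]; exact hΦd)
    rw [h3.fderiv]; rfl
  · intro x hx
    obtain ⟨hx1, hx2⟩ := (hsrc x).mp hx
    have hxU := (he2 hx2)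
    have hxx : φ.symm (φ x) = x := φ.left_inv hx1
    have hfs : f x ∈ φ'.source := by
      have := hxU.2
      simpa [hxx] using this
    refine ⟨hfs, ?_⟩
    change φ' (f x) = φ' (f x₀) + A (e (φ x))
    rw [he3]
    have h5 : fh (φ x₀) = φ' (f x₀) := by simp [fh, hφ]
    have h6 : fh (φ x) = φ' (f x) := by simp only [fh, hxx]
    simp only [Φ, map_add, hr, h5, h6]
    abel

theorem exists_right_inverse [FiniteDimensional ℝ E] [FiniteDimensional ℝ E'] {A : E →L[ℝ] E'}
    (h : Function.Surjective A) : ∃ r : E' →L[ℝ] E, ∀ w, A (r w) = w := by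
  obtain ⟨r, hr⟩ := A.toLinearMap.exists_rightInverse_of_surjective (LinearMap.range_eq_top.mpr h)
  exact ⟨LinearMap.toContinuousLinearMap r, fun w => LinearMap.congr_fun hr w⟩

/-- Local sections of submersions, with prescribed tangent map. -/
theorem exists_local_section [FiniteDimensional ℝ E] {f : X → Y} (hf : ContMDiff I I' ∞ f) (x₀ : X)
    {r : E' →L[ℝ] E} (hr : ∀ w, tmap I I' f x₀ (r w) = w) :
    ∃ s : Y → X, ∃ U : Set Y, IsOpen U ∧ f x₀ ∈ U ∧ ContMDiffOn I' I ∞ s U ∧ (∀ y ∈ U, f (s y) = y) ∧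
      s (f x₀) = x₀ ∧ ∀ w, tmap I' I s (f x₀) w = r w := by
  obtain ⟨e, he1, he2, he3, he4, he5, he6⟩ := exists_straightening hf x₀ hr
  set φ' := extChartAt I' (f x₀) with hφ'
  let j : Y → E := fun y => r (φ' y - φ' (f x₀))
  have hj0 : j (f x₀) = 0 := by simp [j]
  have hjs : ∀ y ∈ φ'.source, ContMDiffAt I' 𝓘(ℝ, E) ∞ j y := fun y hy => by
    have h1 : ContDiff ℝ ∞ (fun z => r (z - φ' (f x₀))) :=
      r.contDiff.comp (contDiff_id.sub contDiff_const)
    exact ContMDiffAt.comp y (I' := 𝓘(ℝ, E')) (g := fun z => r (z - φ' (f x₀))) (f := φ')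
      h1.contMDiff.contMDiffAt (smooth_ext (by simpa [hφ'] using hy))
  have h0t : (0 : E) ∈ e.target := by rw [← he2]; exact e.map_source he1
  let U : Set Y := φ'.source ∩ j ⁻¹' e.target
  have hU : IsOpen U := ContinuousOn.isOpen_inter_preimage
    (fun y hy => (hjs y hy).continuousAt.continuousWithinAt) (isOpen_extChartAt_source _) e.open_target
  have hs0 : e.symm 0 = x₀ := by rw [← he2, e.left_inv he1]
  have hxU : f x₀ ∈ U := ⟨mem_extChartAt_source _, by simpa [hj0] using h0t⟩
  refine ⟨fun y => e.symm (j y), U, hU, hxU, ?_, ?_, ?_, ?_⟩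
  · intro y hy
    refine ContMDiffAt.contMDiffWithinAt ?_
    exact ContMDiffAt.comp y (g := e.symm) (he4.contMDiffAt (e.open_target.mem_nhds hy.2))
      (hjs y hy.1)
  · intro y hy
    obtain ⟨h1, h2⟩ := he6 _ (e.map_target hy.2)
    rw [e.right_inv hy.2] at h2
    refine φ'.injOn h1 hy.1 ?_
    rw [h2]
    simp only [j, hr]
    abel
  · change e.symm (j (f x₀)) = x₀
    rw [hj0, hs0]
  · intro w
    have h1 := tmap_comp_apply (I := I') (I' := 𝓘(ℝ, E)) (I'' := I) (g := e.symm) (f := j)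
      (x := f x₀) (by
        rw [hj0]
        exact (he4.contMDiffAt (e.open_target.mem_nhds h0t)).mdifferentiableAt (by simp))
      ((hjs _ (mem_extChartAt_source _)).mdifferentiableAt (by simp)) w
    refine h1.trans ?_
    rw [hj0, he5]
    have h2 : HasFDerivAt (fun z => r (z - φ' (f x₀))) r (φ' (f x₀)) := by
      have := r.hasFDerivAt.comp (φ' (f x₀)) ((hasFDerivAt_id (φ' (f x₀))).sub_const (φ' (f x₀)))
      exact HasFDerivAt.congr_fderiv (f := fun z => r (z - φ' (f x₀))) this
        (ContinuousLinearMap.comp_id r)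
    have h3 := tmap_comp_apply (I := I') (I' := 𝓘(ℝ, E')) (I'' := 𝓘(ℝ, E))
      (g := fun z => r (z - φ' (f x₀))) (f := φ')
      (x := f x₀) h2.differentiableAt.mdifferentiableAt
      (mdiff_ext (mem_chart_source H' _)) w
    refine h3.trans ?_
    rw [tmap_eq_fderiv, h2.fderiv]
    refine congrArg r ?_
    change cf I' (f x₀) (f x₀) w = w
    rw [cf_self]; rfl

theorem sine_reparam (ε : ℝ) (hε : 0 < ε) : ContDiff ℝ ∞ (fun t : ℝ => ε * Real.sin (t / ε)) ∧
    (∀ t : ℝ, |ε * Real.sin (t / ε)| ≤ ε) ∧ HasDerivAt (fun t : ℝ => ε * Real.sin (t / ε)) 1 0 := by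
  refine ⟨contDiff_const.mul (Real.contDiff_sin.comp (contDiff_id.div_const ε)), fun t => ?_, ?_⟩
  · rw [abs_mul, abs_of_pos hε]
    exact mul_le_of_le_one_right hε.le (Real.abs_sin_le_one _)
  · have h := (((hasDerivAt_id (0 : ℝ)).div_const ε).sin).const_mul ε
    refine HasDerivAt.congr_deriv (f := fun t : ℝ => ε * Real.sin (t / ε)) h ?_
    simp [hε.ne']

/-- A velocity of a locally defined smooth curve is the velocity of a globally defined one. -/
theorem exists_global_curve {c : E' → X} {O : Set E'} (hO : IsOpen O) (h0 : (0 : E') ∈ O)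
    (hc : ContMDiffOn 𝓘(ℝ, E') I ∞ c O) (v : E') :
    ∃ γ : ℝ → X, ContMDiff 𝓘(ℝ, ℝ) I ∞ γ ∧ γ 0 = c 0 ∧
      tmap 𝓘(ℝ, ℝ) I γ 0 1 = tmap 𝓘(ℝ, E') I c 0 v ∧
      ∀ t, ∃ r : ℝ, r • v ∈ O ∧ γ t = c (r • v) := by
  have h1 : ∀ᶠ r in 𝓝 (0 : ℝ), r • v ∈ O := by
    have : Filter.Tendsto (fun r : ℝ => r • v) (𝓝 0) (𝓝 0) :=
      (continuous_id.smul continuous_const).tendsto' _ _ (by simp)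
    exact this.eventually (hO.mem_nhds h0)
  obtain ⟨ε, hε, hball⟩ := Metric.eventually_nhds_iff.mp h1
  obtain ⟨hs1, hs2, hs3⟩ := sine_reparam (ε / 2) (by positivity)
  set ρ : ℝ → ℝ := fun t => ε / 2 * Real.sin (t / (ε / 2)) with hρ
  have hρ0 : ρ 0 = 0 := by simp [hρ]
  have hmem : ∀ t, ρ t • v ∈ O := fun t => hball (by
    rw [dist_zero_right, Real.norm_eq_abs]; exact lt_of_le_of_lt (hs2 t) (by linarith))
  have hl : ContDiff ℝ ∞ (fun t => ρ t • v) := hs1.smul contDiff_const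
  have hat : ∀ t, ContMDiffAt 𝓘(ℝ, E') I ∞ c (ρ t • v) :=
    fun t => hc.contMDiffAt (hO.mem_nhds (hmem t))
  refine ⟨fun t => c (ρ t • v), fun t => ContMDiffAt.comp t (g := c) (hat t) hl.contMDiff.contMDiffAt,
    by simp [hρ0], ?_, fun t => ⟨ρ t, hmem t, rfl⟩⟩
  have h2 := tmap_comp_apply (I := 𝓘(ℝ, ℝ)) (I' := 𝓘(ℝ, E')) (I'' := I) (g := c)
    (f := fun t : ℝ => ρ t • v) (x := (0 : ℝ))
    ((hat 0).mdifferentiableAt (by simp))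
    (hl.contMDiff.mdifferentiable (by simp) 0) 1
  rw [h2]
  have h3 : tmap 𝓘(ℝ, ℝ) 𝓘(ℝ, E') (fun t : ℝ => ρ t • v) 0 1 = v := by
    rw [tmap_eq_fderiv, (hs3.smul_const v).hasFDerivAt.fderiv]; simp
  rw [h3, hρ0, zero_smul]

theorem exists_curve {O : Set X} {x : X} (hO : O ∈ 𝓝 x) (v : E) :
    ∃ γ : ℝ → X, ContMDiff 𝓘(ℝ, ℝ) I ∞ γ ∧ (∀ t, γ t ∈ O) ∧ γ 0 = x ∧
      tmap 𝓘(ℝ, ℝ) I γ 0 1 = v := by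
  set φ := extChartAt I x with hφ
  obtain ⟨O', hO'O, hO', hxO'⟩ := mem_nhds_iff.mp hO
  have hso : IsOpen (φ.target ∩ φ.symm ⁻¹' O') :=
    (continuousOn_extChartAt_symm x).isOpen_inter_preimage (isOpen_extChartAt_target x) hO'
  let c : E → X := fun y => φ.symm (φ x + y)
  have hsh : Continuous (fun y : E => φ x + y) := by fun_prop
  have hc : ContMDiffOn 𝓘(ℝ, E) I ∞ c ((fun y => φ x + y) ⁻¹' (φ.target ∩ φ.symm ⁻¹' O')) := by
    intro y hy
    refine ContMDiffAt.contMDiffWithinAt (ContMDiffAt.comp y (g := φ.symm) (smooth_ext_symm hy.1) ?_)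
    exact (contDiff_const.add contDiff_id).contMDiff.contMDiffAt
  obtain ⟨γ, h1, h2, h3, h4⟩ := exists_global_curve (hso.preimage hsh)
    (by simpa [hφ] using hxO') hc v
  refine ⟨γ, h1, fun t => ?_, by rw [h2]; simp [c, hφ], ?_⟩
  · obtain ⟨r, hr, hγ⟩ := h4 t
    rw [hγ]; exact hO'O hr.2
  · rw [h3]
    have h5 := tmap_comp_apply (I := 𝓘(ℝ, E)) (I' := 𝓘(ℝ, E)) (I'' := I) (g := φ.symm)
      (f := fun y : E => φ x + y) (x := (0 : E))
      (by rw [add_zero]; exact mdiff_ext_symm (mem_extChartAt_target x))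
      ((differentiableAt_const _).add differentiableAt_id).mdifferentiableAt v
    refine h5.trans ?_
    have h6 : tmap 𝓘(ℝ, E) 𝓘(ℝ, E) (fun y : E => φ x + y) 0 v = v := by
      rw [tmap_eq_fderiv, HasFDerivAt.fderiv (f := fun y : E => φ x + y)
        ((hasFDerivAt_id (0 : E)).const_add (φ x))]
      rfl
    rw [h6, add_zero]
    change cfi I x x v = v
    rw [cfi_self]; rfl

/-- Kernel vectors of the tangent map of a submersion are velocities of curves in the fibre. -/
theorem exists_fibre_curve [FiniteDimensional ℝ E] [FiniteDimensional ℝ E'] {f : X → Y}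
    (hf : ContMDiff I I' ∞ f) (x₀ : X) (hs : Function.Surjective (tmap I I' f x₀)) {v : E}
    (hv : tmap I I' f x₀ v = 0) :
    ∃ γ : ℝ → X, ContMDiff 𝓘(ℝ, ℝ) I ∞ γ ∧ (∀ t, f (γ t) = f x₀) ∧ γ 0 = x₀ ∧
      tmap 𝓘(ℝ, ℝ) I γ 0 1 = v := by
  obtain ⟨r, hr⟩ := exists_right_inverse hs
  obtain ⟨e, he1, he2, he3, he4, he5, he6⟩ := exists_straightening hf x₀ hr
  have h0t : (0 : E) ∈ e.target := by rw [← he2]; exact e.map_source he1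
  obtain ⟨γ, h1, h2, h3, h4⟩ := exists_global_curve e.open_target h0t he4 v
  refine ⟨γ, h1, fun t => ?_, by rw [h2, ← he2, e.left_inv he1], by rw [h3, he5]⟩
  obtain ⟨a, ha, hγ⟩ := h4 t
  obtain ⟨h5, h6⟩ := he6 _ (e.map_target ha)
  rw [e.right_inv ha, map_smul, hv, smul_zero, add_zero] at h6
  rw [hγ]
  exact (extChartAt I' (f x₀)).injOn h5 (mem_extChartAt_source _) h6

/-- A continuous map whose composition with an immersion is smooth is smooth. -/
theorem contMDiffAt_of_immersion [FiniteDimensional ℝ E] [FiniteDimensional ℝ E'] {f : X → Y}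
    {g : Z → X} {z₀ : Z} (hf : ContMDiffAt I I' ∞ f (g z₀))
    (hinj : Function.Injective (tmap I I' f (g z₀))) (hg : ContinuousAt g z₀)
    (hfg : ContMDiffAt I'' I' ∞ (fun z => f (g z)) z₀) : ContMDiffAt I'' I ∞ g z₀ := by
  have := FiniteDimensional.complete ℝ E
  set x₀ := g z₀ with hx₀
  set φ := extChartAt I x₀ with hφ
  set φ' := extChartAt I' (f x₀) with hφ'
  obtain ⟨P, hP⟩ := (tmap I I' f x₀).toLinearMap.exists_leftInverse_of_injective
    (LinearMap.ker_eq_bot.mpr hinj)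
  let P' : E' →L[ℝ] E := LinearMap.toContinuousLinearMap P
  let h : E → E := fun y => P' (φ' (f (φ.symm y)))
  have hxx : φ.symm (φ x₀) = x₀ := extChartAt_to_inv x₀
  have hxt := mem_extChartAt_target (I := I) x₀
  have h1 : ContMDiffAt 𝓘(ℝ, E) I' ∞ (fun y => f (φ.symm y)) (φ x₀) :=
    ContMDiffAt.comp (φ x₀) (g := f) (by rwa [hxx]) (smooth_ext_symm hxt)
  have h2 : ContMDiffAt 𝓘(ℝ, E) 𝓘(ℝ, E') ∞ (fun y => φ' (f (φ.symm y))) (φ x₀) :=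
    ContMDiffAt.comp (φ x₀) (g := φ') (smooth_ext (by rw [hxx]; exact mem_chart_source _ _)) h1
  have h2' := contMDiffAt_iff_contDiffAt.mp h2
  have h3 : ContDiffAt ℝ ∞ h (φ x₀) := P'.contDiff.contDiffAt.comp _ h2'
  have h4 : HasFDerivAt h ((ContinuousLinearEquiv.refl ℝ E : E ≃L[ℝ] E) : E →L[ℝ] E) (φ x₀) := by
    have h5 := P'.hasFDerivAt.comp (φ x₀) (h2'.differentiableAt (by simp)).hasFDerivAt
    refine HasFDerivAt.congr_fderiv (f := h) h5 (ContinuousLinearMap.ext fun v => Eq.symm ?_)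
    have h6 := tmap_comp_apply (I'' := 𝓘(ℝ, E')) (g := φ') (f := fun y => f (φ.symm y))
      (x := φ x₀) (mdiff_ext (by rw [hxx]; exact mem_chart_source _ _))
      (h1.mdifferentiableAt (by simp)) v
    rw [tmap_eq_fderiv] at h6
    have h7 := tmap_comp_apply (I' := I) (g := f) (f := φ.symm) (x := φ x₀)
      (by rw [hxx]; exact hf.mdifferentiableAt (by simp)) (mdiff_ext_symm hxt) v
    change v = P' (fderiv ℝ (fun y => φ' (f (φ.symm y))) (φ x₀) v)
    rw [h6, h7]
    have h8 : tmap 𝓘(ℝ, E) I φ.symm (φ x₀) v = v := by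
      change cfi I x₀ x₀ v = v; rw [cfi_self]; rfl
    rw [h8, hxx]
    have h9 : ∀ u, tmap I' 𝓘(ℝ, E') φ' (f x₀) u = u := fun u => by
      change cf I' (f x₀) (f x₀) u = u; rw [cf_self]; rfl
    rw [h9]
    exact (LinearMap.congr_fun hP v).symm
  have hn : (∞ : WithTop ℕ∞) ≠ 0 := by simp
  have h5 := h3.to_localInverse h4 hn
  have h6 : ∀ᶠ y in 𝓝 (φ x₀), h3.localInverse h4 hn (h y) = y :=
    (h3.hasStrictFDerivAt' h4 hn).eventually_left_inverse
  have hφg : ContinuousAt (fun z => φ (g z)) z₀ :=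
    ContinuousAt.comp (g := φ) (continuousAt_extChartAt x₀) hg
  have h7 : (fun z => φ.symm (h3.localInverse h4 hn (P' (φ' (f (g z)))))) =ᶠ[𝓝 z₀] g := by
    filter_upwards [hφg.eventually h6, hg.eventually (eventually_mem_source H x₀)] with z hz hzs
    have hgz : φ.symm (φ (g z)) = g z := φ.left_inv (by simpa [hφ] using hzs)
    simp only [h, hgz] at hz
    rw [hz, hgz]
  refine ContMDiffAt.congr_of_eventuallyEq ?_ h7.symm
  have h8 : h3.localInverse h4 hn (P' (φ' (f (g z₀)))) = φ x₀ := by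
    have := h6.self_of_nhds
    simpa only [h, hxx] using this
  refine ContMDiffAt.comp z₀ (g := φ.symm) (by rw [h8]; exact smooth_ext_symm hxt) ?_
  refine ContMDiffAt.comp z₀ (I' := 𝓘(ℝ, E)) (g := h3.localInverse h4 hn)
    (f := fun z => P' (φ' (f (g z)))) ?_ ?_
  · have h9 : h (φ x₀) = P' (φ' (f (g z₀))) := by simp only [h, hxx]; rfl
    rw [← h9]
    exact h5.contMDiffAt
  · refine ContMDiffAt.comp z₀ (I' := 𝓘(ℝ, E')) (g := P') P'.contDiff.contMDiff.contMDiffAt ?_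
    exact ContMDiffAt.comp z₀ (g := φ') (smooth_ext (mem_chart_source _ _)) hfg

end InverseFunction

/-! ### Regular level sets -/

section LevelSets

variable {E : Type*} [NormedAddCommGroup E] [NormedSpace ℝ E] [FiniteDimensional ℝ E]
  {H : Type*} [TopologicalSpace H] {I : ModelWithCorners ℝ E H} [I.Boundaryless]
  {X : Type*} [TopologicalSpace X] [ChartedSpace H X] [IsManifold I ∞ X]
  {S : Type*} [TopologicalSpace S] {k : ℕ}

theorem exists_slice_chart {ι : S → X} (hι : Topology.IsEmbedding ι) {F : X → Fin k → ℝ}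
    (hF : ContMDiff I 𝓘(ℝ, Fin k → ℝ) ∞ F) {c : Fin k → ℝ} (hr : Set.range ι = {x | F x = c})
    (s₀ : S) (hs : Function.Surjective (tmap I 𝓘(ℝ, Fin k → ℝ) F (ι s₀))) {d : ℕ}
    (hd : d = Module.finrank ℝ E - k) :
    ∃ (κ : OpenPartialHomeomorph S (EuclideanSpace ℝ (Fin d))) (O : Set X)
      (a : X → EuclideanSpace ℝ (Fin d)) (b : EuclideanSpace ℝ (Fin d) → X),
      s₀ ∈ κ.source ∧ IsOpen O ∧ κ.source = ι ⁻¹' O ∧ ContMDiffOn I 𝓘(ℝ, EuclideanSpace ℝ (Fin d)) ∞ a O ∧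
      (∀ s, κ s = a (ι s)) ∧ ContMDiffOn 𝓘(ℝ, EuclideanSpace ℝ (Fin d)) I ∞ b κ.target ∧
      ∀ z ∈ κ.target, ι (κ.symm z) = b z := by
  set A := tmap I 𝓘(ℝ, Fin k → ℝ) F (ι s₀) with hA
  obtain ⟨r, hr'⟩ := exists_right_inverse hs
  obtain ⟨e, he1, he2, he3, he4, he5, he6⟩ := exists_straightening hF (ι s₀) hr'
  have hFι : ∀ s, F (ι s) = c := fun s => by
    have : ι s ∈ {x | F x = c} := hr ▸ Set.mem_range_self s
    exact this
  have he6' : ∀ x ∈ e.source, F x = c + A (e x) := fun x hx => by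
    have := (he6 x hx).2
    rw [hFι, extChartAt_model_space_eq_id] at this
    exact this
  let K := LinearMap.ker A.toLinearMap
  have hdK : Module.finrank ℝ K = d := by
    have h1 := A.toLinearMap.finrank_range_add_finrank_ker
    have h2 : LinearMap.range A.toLinearMap = ⊤ := LinearMap.range_eq_top.mpr hs
    rw [h2, finrank_top, Module.finrank_fin_fun] at h1
    change k + Module.finrank ℝ K = _ at h1
    omega
  let L : K ≃L[ℝ] EuclideanSpace ℝ (Fin d) :=
    ContinuousLinearEquiv.ofFinrankEq (by rw [hdK]; simp)
  obtain ⟨P, hP⟩ := K.subtype.exists_leftInverse_of_injective (LinearMap.ker_eq_bot.mpr K.injective_subtype)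
  let P' : E →L[ℝ] K := LinearMap.toContinuousLinearMap P
  have hP' : ∀ v : E, A v = 0 → ((P' v : K) : E) = v := fun v hv =>
    congrArg Subtype.val (LinearMap.congr_fun hP (⟨v, hv⟩ : K))
  let a : X → EuclideanSpace ℝ (Fin d) := fun x => L (P' (e x))
  let j : EuclideanSpace ℝ (Fin d) →L[ℝ] E := K.subtypeL.comp (L.symm : EuclideanSpace ℝ (Fin d) →L[ℝ] K)
  have hj : ∀ z, A (j z) = 0 := fun z => (L.symm z).2
  have hPj : ∀ z, L (P' (j z)) = z := fun z => by
    have : P' (j z) = L.symm z := Subtype.ext (hP' _ (hj z))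
    rw [this, L.apply_symm_apply]
  have hjP : ∀ v, A v = 0 → j (L (P' v)) = v := fun v hv => by
    change ((L.symm (L (P' v)) : K) : E) = v
    rw [L.symm_apply_apply, hP' v hv]
  have hAe : ∀ s, ι s ∈ e.source → A (e (ι s)) = 0 := fun s hs => by
    have := he6' _ hs
    rw [hFι] at this
    exact add_eq_left.mp this.symm
  let b : EuclideanSpace ℝ (Fin d) → X := fun z => e.symm (j z)
  have : Nonempty S := ⟨s₀⟩
  have hb : ∀ z, j z ∈ e.target → ι (Function.invFun ι (b z)) = b z := fun z hz => by
    refine Function.invFun_eq ?_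
    have h1 : b z ∈ Set.range ι := by
      rw [hr, Set.mem_ofPred_eq, he6' _ (e.map_target hz), e.right_inv hz, hj, add_zero]
    exact h1
  have hbs : ContinuousOn b (j ⁻¹' e.target) :=
    e.continuousOn_symm.comp j.continuous.continuousOn fun z hz => hz
  refine ⟨{
    toFun := fun s => a (ι s)
    invFun := fun z => Function.invFun ι (b z)
    source := ι ⁻¹' e.source
    target := j ⁻¹' e.target
    map_source' := fun s hs => by
      change j (L (P' (e (ι s)))) ∈ e.target
      rw [hjP _ (hAe s hs)]
      exact e.map_source hs
    map_target' := fun z hz => by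
      change ι _ ∈ e.source
      rw [hb z hz]; exact e.map_target hz
    left_inv' := fun s hs => by
      refine hι.injective ?_
      have h1 : j (a (ι s)) = e (ι s) := hjP _ (hAe s hs)
      rw [hb _ (by rw [h1]; exact e.map_source hs)]
      change e.symm (j (a (ι s))) = ι s
      rw [h1, e.left_inv hs]
    right_inv' := fun z hz => by
      rw [hb z hz]
      change L (P' (e (e.symm (j z)))) = z
      rw [e.right_inv hz, hPj]
    open_source := e.open_source.preimage hι.continuous
    open_target := e.open_target.preimage j.continuous
    continuousOn_toFun := by
      have : ContinuousOn (fun s => e (ι s)) (ι ⁻¹' e.source) :=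
        e.continuousOn.comp hι.continuous.continuousOn fun s hs => hs
      exact L.continuous.comp_continuousOn (P'.continuous.comp_continuousOn this)
    continuousOn_invFun := by
      rw [hι.isInducing.continuousOn_iff]
      exact hbs.congr fun z hz => hb z hz }, e.source, a, b, he1, e.open_source, rfl, ?_,
      fun _ => rfl, ?_, fun z hz => hb z hz⟩
  · have h1 : ContDiff ℝ ∞ (fun v : E => L (P' v)) := L.contDiff.comp P'.contDiff
    exact h1.contMDiff.comp_contMDiffOn he3
  · exact he4.comp j.contDiff.contMDiff.contMDiffOn fun z hz => hz

/-- An embedded regular level set is a submanifold. -/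
theorem exists_manifold_level {ι : S → X} (hι : Topology.IsEmbedding ι) {F : X → Fin k → ℝ}
    (hF : ContMDiff I 𝓘(ℝ, Fin k → ℝ) ∞ F) {c : Fin k → ℝ} (hr : Set.range ι = {x | F x = c})
    (hs : ∀ s, Function.Surjective (tmap I 𝓘(ℝ, Fin k → ℝ) F (ι s))) {d : ℕ}
    (hd : d = Module.finrank ℝ E - k) :
    ∃ (_ : ChartedSpace (EuclideanSpace ℝ (Fin d)) S)
      (_ : IsManifold 𝓘(ℝ, EuclideanSpace ℝ (Fin d)) ∞ S),
      IsSmoothEmbedding 𝓘(ℝ, EuclideanSpace ℝ (Fin d)) I ι ∧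
      ∀ s v, tmap I 𝓘(ℝ, Fin k → ℝ) F (ι s) v = 0 ↔
        ∃ u, tmap 𝓘(ℝ, EuclideanSpace ℝ (Fin d)) I ι s u = v := by
  choose κ O a b h1 h2 h3 h4 h5 h6 h7 using fun s => exists_slice_chart hι hF hr s (hs s) hd
  let cs : ChartedSpace (EuclideanSpace ℝ (Fin d)) S :=
    { atlas := Set.range κ
      chartAt := κ
      mem_chart_source := h1
      chart_mem_atlas := fun s => ⟨s, rfl⟩ }
  have hm : IsManifold 𝓘(ℝ, EuclideanSpace ℝ (Fin d)) ∞ S := by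
    refine isManifold_of_contDiffOn _ _ _ ?_
    rintro _ _ ⟨s, rfl⟩ ⟨s', rfl⟩
    simp only [modelWithCornersSelf_coe, modelWithCornersSelf_coe_symm, Function.id_comp,
      Function.comp_id, Set.preimage_id, Set.range_id, Set.inter_univ]
    intro z hz
    have hz1 : z ∈ (κ s).target := hz.1
    have hz2 : (κ s).symm z ∈ (κ s').source := hz.2
    have hbO : b s z ∈ O s' := by
      rw [h3] at hz2
      rw [← h7 s z hz1]; exact hz2
    have hsm : ContMDiffAt 𝓘(ℝ, EuclideanSpace ℝ (Fin d)) 𝓘(ℝ, EuclideanSpace ℝ (Fin d)) ∞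
        (fun z => a s' (b s z)) z :=
      ContMDiffAt.comp z (g := a s') ((h4 s').contMDiffAt ((h2 s').mem_nhds hbO))
        ((h6 s).contMDiffAt ((κ s).open_target.mem_nhds hz1))
    refine (contMDiffAt_iff_contDiffAt.mp hsm).contDiffWithinAt.congr_of_eventuallyEq_of_mem ?_ hz
    filter_upwards [self_mem_nhdsWithin] with w hw
    change κ s' ((κ s).symm w) = _
    rw [h5, h7 s w hw.1]
  have hκ : ∀ s, ContMDiffAt 𝓘(ℝ, EuclideanSpace ℝ (Fin d)) 𝓘(ℝ, EuclideanSpace ℝ (Fin d)) ∞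
      (κ s) s := fun s =>
    contMDiffAt_of_mem_maximalAtlas (IsManifold.chart_mem_maximalAtlas s) (h1 s)
  have hιs : ContMDiff 𝓘(ℝ, EuclideanSpace ℝ (Fin d)) I ∞ ι := fun s => by
    have h8 : ContMDiffAt 𝓘(ℝ, EuclideanSpace ℝ (Fin d)) I ∞ (fun s' => b s (κ s s')) s :=
      ContMDiffAt.comp s (g := b s)
        ((h6 s).contMDiffAt ((κ s).open_target.mem_nhds ((κ s).map_source (h1 s)))) (hκ s)
    refine h8.congr_of_eventuallyEq ?_
    filter_upwards [(κ s).open_source.mem_nhds (h1 s)] with s' hs'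
    rw [← h7 s _ ((κ s).map_source hs'), (κ s).left_inv hs']
  have hinj : ∀ s, Function.Injective (tmap 𝓘(ℝ, EuclideanSpace ℝ (Fin d)) I ι s) := fun s => by
    have h8 : ∀ v, tmap I 𝓘(ℝ, EuclideanSpace ℝ (Fin d)) (a s) (ι s)
        (tmap 𝓘(ℝ, EuclideanSpace ℝ (Fin d)) I ι s v) = v := fun v => by
      have hO : ι s ∈ O s := by have := h1 s; rwa [h3] at this
      rw [← tmap_comp_apply (g := a s) (f := ι)
        (((h4 s).contMDiffAt ((h2 s).mem_nhds hO)).mdifferentiableAt (by simp))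
        (hιs.mdifferentiable (by simp) s)]
      have h9 : (fun s' => a s (ι s')) =ᶠ[𝓝 s] extChartAt 𝓘(ℝ, EuclideanSpace ℝ (Fin d)) s :=
        .of_forall fun s' => (h5 s s').symm
      rw [tmap_congr h9]
      change cf 𝓘(ℝ, EuclideanSpace ℝ (Fin d)) s s v = v
      rw [cf_self]; rfl
    exact Function.LeftInverse.injective h8
  refine ⟨cs, hm, ⟨hιs, hinj, hι⟩, fun s => ?_⟩
  set A := tmap I 𝓘(ℝ, Fin k → ℝ) F (ι s) with hA
  set B := tmap 𝓘(ℝ, EuclideanSpace ℝ (Fin d)) I ι s with hB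
  have hAB : ∀ u, A (B u) = 0 := fun u => by
    rw [hA, hB, ← tmap_comp_apply (g := F) (f := ι) (hF.mdifferentiable (by simp) _)
      (hιs.mdifferentiable (by simp) s)]
    have h9 : (fun s' => F (ι s')) =ᶠ[𝓝 s] fun _ => c := .of_forall fun s' => by
      have : ι s' ∈ {x | F x = c} := hr ▸ Set.mem_range_self s'
      exact this
    rw [tmap_congr h9, tmap_const]; rfl
  have hle : LinearMap.range B.toLinearMap ≤ LinearMap.ker A.toLinearMap := by
    rintro _ ⟨u, rfl⟩; exact hAB u
  have hfr : Module.finrank ℝ (LinearMap.range B.toLinearMap) =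
      Module.finrank ℝ (LinearMap.ker A.toLinearMap) := by
    have e1 := A.toLinearMap.finrank_range_add_finrank_ker
    have e2 : LinearMap.range A.toLinearMap = ⊤ := LinearMap.range_eq_top.mpr (hs s)
    rw [e2, finrank_top, Module.finrank_fin_fun] at e1
    have e3 := LinearMap.finrank_range_of_inj (f := B.toLinearMap) (hinj s)
    rw [finrank_euclideanSpace_fin] at e3
    omega
  have heq := Submodule.eq_of_le_of_finrank_eq hle hfr
  intro v
  constructor
  · intro hv
    have : v ∈ LinearMap.range B.toLinearMap := by rw [heq]; exact hv
    exact this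
  · rintro ⟨u, rfl⟩; exact hAB u

end LevelSets

/-! ### Smooth actions and their cotangent lifts -/

section Products

variable {E : Type*} [NormedAddCommGroup E] [NormedSpace ℝ E]
  {H : Type*} [TopologicalSpace H] {I : ModelWithCorners ℝ E H}
  {X : Type*} [TopologicalSpace X] [ChartedSpace H X] [IsManifold I ∞ X]
  {E' : Type*} [NormedAddCommGroup E'] [NormedSpace ℝ E']
  {H' : Type*} [TopologicalSpace H'] {I' : ModelWithCorners ℝ E' H'}
  {Y : Type*} [TopologicalSpace Y] [ChartedSpace H' Y] [IsManifold I' ∞ Y]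
  {E'' : Type*} [NormedAddCommGroup E''] [NormedSpace ℝ E'']
  {H'' : Type*} [TopologicalSpace H''] {I'' : ModelWithCorners ℝ E'' H''}
  {Z : Type*} [TopologicalSpace Z] [ChartedSpace H'' Z]

theorem SmAt.prodMk {f : Z → X} {g : Z → Y} {u : Z → E} {v : Z → E'} {z₀ : Z}
    (hu : SmAt I I'' f u z₀) (hv : SmAt I' I'' g v z₀) :
    SmAt (I.prod I') I'' (fun z => (f z, g z)) (fun z => (u z, v z)) z₀ := by
  have : IsManifold I 1 X := .of_le (n := ∞) (by simp)
  have : IsManifold I' 1 Y := .of_le (n := ∞) (by simp)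
  have h1 := contMDiff_equivTangentBundleProd_symm (I := I) (M := X) (I' := I') (M' := Y) (n := ∞)
  exact ContMDiffAt.comp z₀ (h1.contMDiffAt) (ContMDiffAt.prodMk hu hv)

theorem SmAt.const {f : Z → E} {x₀ : X} {z₀ : Z} (h : ContMDiffAt I'' 𝓘(ℝ, E) ∞ f z₀) :
    SmAt I I'' (fun _ => x₀) f z₀ := by
  refine smAt_iff.mpr ⟨contMDiffAt_const, ?_⟩
  exact h.congr_of_eventuallyEq (.of_forall fun z => by rw [cf_self]; rfl)

theorem tmap_mk_left {a : X × Y → Z} {x : X} {y : Y}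
    (ha : MDifferentiableAt (I.prod I') I'' a (x, y)) (u : E) :
    tmap I I'' (fun x' => a (x', y)) x u = tmap (I.prod I') I'' a (x, y) (u, 0) := by
  have h1 : MDifferentiableAt I (I.prod I') (fun x' : X => (x', y)) x :=
    mdifferentiableAt_id.prodMk mdifferentiableAt_const
  rw [tmap_comp_apply (g := a) (f := fun x' : X => (x', y)) ha h1]
  refine congrArg _ ?_
  exact congrArg (fun L : E →L[ℝ] E × E' => L u) (mfderiv_prod_left (I := I) (I' := I'))

theorem tmap_mk_right {a : X × Y → Z} {x : X} {y : Y}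
    (ha : MDifferentiableAt (I.prod I') I'' a (x, y)) (v : E') :
    tmap I' I'' (fun y' => a (x, y')) y v = tmap (I.prod I') I'' a (x, y) (0, v) := by
  have h1 : MDifferentiableAt I' (I.prod I') (fun y' : Y => (x, y')) y :=
    mdifferentiableAt_const.prodMk mdifferentiableAt_id
  rw [tmap_comp_apply (g := a) (f := fun y' : Y => (x, y')) ha h1]
  refine congrArg _ ?_
  exact congrArg (fun L : E' →L[ℝ] E × E' => L v) (mfderiv_prod_right (I := I) (I' := I'))

end Products

section Actions

variable {E : Type*} [NormedAddCommGroup E] [NormedSpace ℝ E]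
  {H : Type*} [TopologicalSpace H] {I : ModelWithCorners ℝ E H} [I.Boundaryless]
  {X : Type*} [TopologicalSpace X] [ChartedSpace H X] [IsManifold I ∞ X]
  {E' : Type*} [NormedAddCommGroup E'] [NormedSpace ℝ E']
  {H' : Type*} [TopologicalSpace H'] {I' : ModelWithCorners ℝ E' H'}
  {Y : Type*} [TopologicalSpace Y] [ChartedSpace H' Y]
  {𝔤 : Type*} [NormedAddCommGroup 𝔤] [NormedSpace ℝ 𝔤]
  {G : Type*} [Group G] [TopologicalSpace G] [ChartedSpace 𝔤 G] [LieGroup 𝓘(ℝ, 𝔤) ∞ G]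
  {V : Type*} [NormedAddCommGroup V] [NormedSpace ℝ V]

/-- The infinitesimal generators of a family `a` of maps depending on `g ∈ G`. -/
def agen (I : ModelWithCorners ℝ E H) (a : G × X → X) (x : X) : 𝔤 →L[ℝ] E :=
  tmap 𝓘(ℝ, 𝔤) I (fun g => a (g, x)) 1

theorem SmAt.agen {a : G × X → X} (ha : ContMDiff (𝓘(ℝ, 𝔤).prod I) I ∞ a) (ha1 : ∀ x, a (1, x) = x)
    {f : Y → X} {ξ : Y → 𝔤} {y₀ : Y} (hf : ContMDiffAt I' I ∞ f y₀)
    (hξ : ContMDiffAt I' 𝓘(ℝ, 𝔤) ∞ ξ y₀) :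
    SmAt I I' f (fun y => NH.agen I a (f y) (ξ y)) y₀ := by
  have : IsManifold 𝓘(ℝ, 𝔤) ∞ G := ContMDiffMul.toIsManifold (I := 𝓘(ℝ, 𝔤))
  have h1 : SmAt (𝓘(ℝ, 𝔤).prod I) I' (fun y => ((1 : G), f y)) (fun y => (ξ y, (0 : E))) y₀ :=
    (SmAt.const hξ).prodMk (SmAt.zero hf)
  refine (SmAt.tmap ha.contMDiffAt h1).congr (.of_forall fun y => (ha1 _).symm)
    (.of_forall fun y => ?_)
  exact tmap_mk_left (ha.mdifferentiable (by simp) _) _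

theorem SmAt.act {a : G × X → X} (ha : ContMDiff (𝓘(ℝ, 𝔤).prod I) I ∞ a)
    {f : Y → X} {g : Y → G} {z : Y → E} {y₀ : Y} (hg : ContMDiffAt I' 𝓘(ℝ, 𝔤) ∞ g y₀)
    (hz : SmAt I I' f z y₀) :
    SmAt I I' (fun y => a (g y, f y)) (fun y => NH.tmap I I (fun x => a (g y, x)) (f y) (z y)) y₀ := by
  have : IsManifold 𝓘(ℝ, 𝔤) ∞ G := ContMDiffMul.toIsManifold (I := 𝓘(ℝ, 𝔤))
  have h1 : SmAt (𝓘(ℝ, 𝔤).prod I) I' (fun y => (g y, f y)) (fun y => ((0 : 𝔤), z y)) y₀ :=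
    (SmAt.zero hg).prodMk hz
  refine (SmAt.tmap ha.contMDiffAt h1).congr .rfl (.of_forall fun y => ?_)
  exact tmap_mk_right (ha.mdifferentiable (by simp) _) _

theorem extD_invariant_act [FiniteDimensional ℝ 𝔤] {θ : X → E →L[ℝ] V} {x : X} (hθ : FormAt I θ x)
    {a : G × X → X} (ha : ContMDiff (𝓘(ℝ, 𝔤).prod I) I ∞ a) (ha1 : ∀ x, a (1, x) = x)
    {v : E} (hinv : ∀ g, θ (a (g, x)) (tmap I I (fun x' => a (g, x')) x v) = θ x v) (ξ : 𝔤) :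
    extD I θ x (agen I a x ξ) v = - tmap I 𝓘(ℝ, V) (fun x' => θ x' (agen I a x' ξ)) x v := by
  have : IsManifold 𝓘(ℝ, 𝔤) ∞ G := ContMDiffMul.toIsManifold (I := 𝓘(ℝ, 𝔤))
  obtain ⟨γ, h1, -, h3, h4⟩ := exists_curve (I := 𝓘(ℝ, 𝔤)) (x := (1 : G)) Filter.univ_mem ξ
  have hd : MDifferentiableAt I 𝓘(ℝ, V) (fun x' => θ x' (agen I a x' ξ)) x :=
    (FormAt.apply (f := fun x' : X => x') hθ
      (SmAt.agen ha ha1 contMDiffAt_id contMDiffAt_const)).mdifferentiableAt (by simp)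
  refine extD_invariant (a := fun p => a (γ p.1, p.2)) hθ ?_ (fun x' => by simp only [h3, ha1])
    (.of_forall fun t => hinv (γ t)) (ν := fun x' => agen I a x' ξ) (.of_forall fun x' => ?_)
    hd
  · exact ContMDiffAt.comp (0, x) (g := a) ha.contMDiffAt
      ((h1.contMDiffAt.comp (0, x) contMDiffAt_fst).prodMk contMDiffAt_snd)
  · have := tmap_comp_apply (I := 𝓘(ℝ, ℝ)) (I' := 𝓘(ℝ, 𝔤)) (I'' := I) (g := fun g => a (g, x'))
      (f := γ) (x := (0 : ℝ))
      ((ha.comp (contMDiff_id.prodMk contMDiff_const)).mdifferentiable (by simp) _)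
      (h1.mdifferentiable (by simp) 0) 1
    rw [this, h3, h4]; rfl

end Actions

section CotangentLift

variable {E : Type*} [NormedAddCommGroup E] [NormedSpace ℝ E] [FiniteDimensional ℝ E]
  {X : Type*} [TopologicalSpace X] [ChartedSpace E X] [IsManifold 𝓘(ℝ, E) ∞ X]
  {𝔤 : Type*} [NormedAddCommGroup 𝔤] [NormedSpace ℝ 𝔤] [FiniteDimensional ℝ 𝔤]
  {G : Type*} [Group G] [TopologicalSpace G] [ChartedSpace 𝔤 G] [LieGroup 𝓘(ℝ, 𝔤) ∞ G]
  {K : Type*} [Group K] [MulAction K X]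

omit [FiniteDimensional ℝ E] [FiniteDimensional ℝ 𝔤] [IsManifold 𝓘(ℝ, E) ∞ X] [LieGroup 𝓘(ℝ, 𝔤) ∞ G] in
variable (E X 𝔤) in
/-- The group `G` acts smoothly on `X` through the homomorphism `ρ`. -/
def SmoothAct (ρ : G →* K) : Prop :=
  ContMDiff (𝓘(ℝ, 𝔤).prod 𝓘(ℝ, E)) 𝓘(ℝ, E) ∞ (fun p : G × X => ρ p.1 • p.2)

variable {ρ : G →* K}

/-- The infinitesimal generators of the action of `G` on `X` through `ρ`. -/
def rgen (ρ : G →* K) (x : X) : 𝔤 →L[ℝ] E := tmap 𝓘(ℝ, 𝔤) 𝓘(ℝ, E) (fun g : G => ρ g • x) 1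

/-- The infinitesimal generators of the cotangent lifted action of `G` on `T*X` through `ρ`. -/
def cgen (ρ : G →* K) (a : Cot E X) : 𝔤 →L[ℝ] E × (E →L[ℝ] ℝ) :=
  tmap 𝓘(ℝ, 𝔤) (cotI E) (fun g : G => cotAct (ρ g) a) 1

theorem canonicalForm_eq (a : Cot E X) (u v : E × (E →L[ℝ] ℝ)) :
    canonicalForm a u v = - extD (cotI E) liouville a u v := rfl

theorem cotAct_fst (h : K) (a : Cot E X) : (cotAct h a).1 = h • a.1 := rfl

theorem covec_cotAct (h : K) (a : Cot E X) (v : E) : covec (cotAct h a) v =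
    covec a (tmap 𝓘(ℝ, E) 𝓘(ℝ, E) (fun x : X => h⁻¹ • x) (h • a.1) v) := rfl

section

variable (hρ : SmoothAct E X 𝔤 ρ)
include hρ

theorem SmoothAct.contMDiff (g : G) : ContMDiff 𝓘(ℝ, E) 𝓘(ℝ, E) ∞ (fun x : X => ρ g • x) :=
  ContMDiff.comp (g := fun p : G × X => ρ p.1 • p.2) hρ (contMDiff_const.prodMk contMDiff_id)

theorem SmoothAct.contMDiff_orbit (x : X) :
    ContMDiff 𝓘(ℝ, 𝔤) 𝓘(ℝ, E) ∞ (fun g : G => ρ g • x) :=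
  ContMDiff.comp (g := fun p : G × X => ρ p.1 • p.2) hρ (contMDiff_id.prodMk contMDiff_const)

theorem SmoothAct.mdiff (g : G) (x : X) :
    MDifferentiableAt 𝓘(ℝ, E) 𝓘(ℝ, E) (fun x : X => ρ g • x) x :=
  (hρ.contMDiff g).mdifferentiable (by simp) x

theorem SmoothAct.tact_mul (g g' : G) (x : X) (v : E) :
    tact (ρ (g * g')) x v = tact (ρ g) (ρ g' • x) (tact (ρ g') x v) := by
  unfold tact
  rw [← tmap_comp_apply (g := fun x : X => ρ g • x) (hρ.mdiff g _) (hρ.mdiff g' _)]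
  simp only [map_mul, mul_smul]

theorem tact_one' (x : X) (v : E) : tact (1 : K) x v = v := by
  unfold tact
  simp only [one_smul, tmap_id]; rfl

theorem SmoothAct.tact_inv_tact (g : G) (x : X) (v : E) :
    tact (ρ g)⁻¹ (ρ g • x) (tact (ρ g) x v) = v := by
  have := hρ.tact_mul g⁻¹ g x v
  rw [map_inv] at this
  rw [← this, inv_mul_cancel, map_one, tact_one' hρ]

theorem SmoothAct.tact_tact_inv (g : G) (x : X) (v : E) :
    tact (ρ g) x (tact (ρ g)⁻¹ (ρ g • x) v) = v := by
  have := hρ.tact_inv_tact g⁻¹ (ρ g • x) v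
  simpa only [map_inv, inv_inv, inv_smul_smul] using this

theorem SmoothAct.tact_bijective (g : G) (x : X) : Function.Bijective (tact (E := E) (ρ g) x) :=
  Function.bijective_iff_has_inverse.mpr
    ⟨_, hρ.tact_inv_tact g x, hρ.tact_tact_inv g x⟩

theorem SmoothAct.covec_cotAct_tact (g : G) (a : Cot E X) (v : E) :
    covec (cotAct (ρ g) a) (tact (ρ g) a.1 v) = covec a v := by
  rw [covec_cotAct]
  exact congrArg _ (hρ.tact_inv_tact g a.1 v)

theorem SmoothAct.cotAct_eq_iff {g : G} {a b : Cot E X} : cotAct (ρ g) a = b ↔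
    ρ g • a.1 = b.1 ∧ ∀ v, covec b (tact (ρ g) a.1 v) = covec a v := by
  constructor
  · rintro rfl
    exact ⟨rfl, hρ.covec_cotAct_tact g a⟩
  · rintro ⟨h1, h2⟩
    refine cot_ext h1 (ContinuousLinearMap.ext fun v => ?_)
    obtain ⟨u, rfl⟩ := (hρ.tact_bijective g a.1).2 v
    rw [hρ.covec_cotAct_tact, h2]

theorem SmoothAct.cotAct_one (a : Cot E X) : cotAct (1 : K) a = a := by
  rw [← map_one ρ, hρ.cotAct_eq_iff]
  simp [tact_one' hρ]

theorem SmoothAct.cotAct_mul (g g' : G) (a : Cot E X) :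
    cotAct (ρ g) (cotAct (ρ g') a) = cotAct (ρ (g * g')) a := by
  rw [hρ.cotAct_eq_iff]
  refine ⟨by simp [cotAct_fst, mul_smul], fun v => ?_⟩
  obtain ⟨u, rfl⟩ := (hρ.tact_bijective g' a.1).2 v
  rw [hρ.covec_cotAct_tact]
  have := hρ.covec_cotAct_tact (g * g') a u
  rw [hρ.tact_mul] at this
  exact this

theorem SmoothAct.cotAct_smooth :
    ContMDiff (𝓘(ℝ, 𝔤).prod (cotI E)) (cotI E) ∞
      (fun p : G × Cot E X => cotAct (ρ p.1) p.2) := by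
  have : IsManifold 𝓘(ℝ, 𝔤) ∞ G := ContMDiffMul.toIsManifold (I := 𝓘(ℝ, 𝔤))
  intro p₀
  have hb : ContMDiffAt (𝓘(ℝ, 𝔤).prod (cotI E)) 𝓘(ℝ, E) ∞
      (fun p : G × Cot E X => ρ p.1 • p.2.1) p₀ :=
    ContMDiffAt.comp p₀ (g := fun p : G × X => ρ p.1 • p.2) hρ.contMDiffAt
      (contMDiffAt_fst.prodMk ((smooth_pr p₀.2).comp p₀ contMDiffAt_snd))
  refine cotAt_of_apply hb fun z hz => ?_
  have h1 := SmAt.act (a := fun p : G × X => ρ p.1 • p.2) hρ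
    (g := fun p : G × Cot E X => p.1⁻¹) (contMDiffAt_fst.inv) hz
  refine covec_apply_smoothAt (α := fun p : G × Cot E X => p.2) contMDiffAt_snd
    (h1.congr (.of_forall fun p => ?_) (.of_forall fun p => ?_))
  · simp [cotAct_fst]
  · simp only [map_inv]; rfl

theorem SmoothAct.cotAct_smooth_right (g : G) :
    ContMDiff (cotI E) (cotI E) ∞ (cotAct (E := E) (X := X) (ρ g)) :=
  hρ.cotAct_smooth.comp (contMDiff_const.prodMk contMDiff_id)

theorem SmoothAct.cotAct_mdiff (g : G) (a : Cot E X) :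
    MDifferentiableAt (cotI E) (cotI E) (cotAct (E := E) (X := X) (ρ g)) a :=
  (hρ.cotAct_smooth_right g).mdifferentiable (by simp) a

theorem SmoothAct.tcotAct_fst (g : G) (a : Cot E X) (w : E × (E →L[ℝ] ℝ)) :
    (tmap (cotI E) (cotI E) (cotAct (ρ g)) a w).1 = tact (ρ g) a.1 w.1 := by
  have h1 := tmap_comp_apply (g := fun b : Cot E X => b.1) (f := cotAct (ρ g))
    ((smooth_pr (cotAct (ρ g) a)).mdifferentiableAt (by simp)) (hρ.cotAct_mdiff g a) w
  have h2 := tmap_comp_apply (g := fun x : X => ρ g • x) (f := fun b : Cot E X => b.1)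
    (x := a) (hρ.mdiff g a.1) ((smooth_pr a).mdifferentiableAt (by simp)) w
  have h3 := tτ_apply (cotAct (ρ g) a) (tmap (cotI E) (cotI E) (cotAct (ρ g)) a w)
  rw [← h3, ← tτ_apply a]
  exact h1.symm.trans h2

theorem SmoothAct.cgen_fst (a : Cot E X) (ξ : 𝔤) : (cgen ρ a ξ).1 = rgen ρ a.1 ξ := by
  have h1 := tmap_comp_apply (g := fun b : Cot E X => b.1) (f := fun g : G => cotAct (ρ g) a)
    (x := 1) ((smooth_pr (E := E) (X := X) _).mdifferentiableAt (by simp))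
    ((hρ.cotAct_smooth.comp (contMDiff_id.prodMk contMDiff_const)).mdifferentiable (by simp) _) ξ
  have h3 := tτ_apply (cotAct (ρ 1) a) (cgen ρ a ξ)
  rw [← h3]
  exact h1.symm

theorem SmoothAct.liouville_cgen (a : Cot E X) (ξ : 𝔤) :
    liouville a (cgen ρ a ξ) = covec a (rgen ρ a.1 ξ) := by
  rw [liouville_apply, hρ.cgen_fst]

theorem SmoothAct.liouville_invariant (g : G) (a : Cot E X) (w : E × (E →L[ℝ] ℝ)) :
    liouville (cotAct (ρ g) a) (tmap (cotI E) (cotI E) (cotAct (ρ g)) a w) = liouville a w := by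
  rw [liouville_apply, liouville_apply, hρ.tcotAct_fst, hρ.covec_cotAct_tact]

theorem SmoothAct.canonicalForm_invariant (g : G) (a : Cot E X) (u v : E × (E →L[ℝ] ℝ)) :
    canonicalForm (cotAct (ρ g) a) (tmap (cotI E) (cotI E) (cotAct (ρ g)) a u)
      (tmap (cotI E) (cotI E) (cotAct (ρ g)) a v) = canonicalForm a u v := by
  have := extD_pullback (f := cotAct (ρ g)) (liouville_formAt _) (liouville_formAt a)
    (hρ.cotAct_smooth_right g).contMDiffAt
    (.of_forall fun b w => (hρ.liouville_invariant g b w).symm) u v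
  rw [canonicalForm_eq, canonicalForm_eq, this]

theorem SmoothAct.canonicalForm_cgen (a : Cot E X) (ξ : 𝔤) (v : E × (E →L[ℝ] ℝ)) :
    canonicalForm a (cgen ρ a ξ) v =
      dfun (cotI E) (fun b : Cot E X => covec b (rgen ρ b.1 ξ)) a v := by
  have := extD_invariant_act (θ := liouville) (liouville_formAt a) hρ.cotAct_smooth
    (fun b => by simpa using hρ.cotAct_one b) (fun g => hρ.liouville_invariant g a v) ξ
  have h2 : (fun b : Cot E X => covec b (rgen ρ b.1 ξ)) = fun b => liouville b
      (agen (cotI E) (fun p : G × Cot E X => cotAct (ρ p.1) p.2) b ξ) :=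
    funext fun b => (hρ.liouville_cgen b ξ).symm
  rw [h2]
  rw [canonicalForm_eq]
  exact (neg_eq_iff_eq_neg.mpr this)

theorem SmoothAct.rgen_smoothAt {Y E' H' : Type*} [NormedAddCommGroup E'] [NormedSpace ℝ E']
    [TopologicalSpace H'] {I' : ModelWithCorners ℝ E' H'} [TopologicalSpace Y] [ChartedSpace H' Y]
    {f : Y → X} {ξ : Y → 𝔤} {y₀ : Y}
    (hf : ContMDiffAt I' 𝓘(ℝ, E) ∞ f y₀) (hξ : ContMDiffAt I' 𝓘(ℝ, 𝔤) ∞ ξ y₀) :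
    SmAt 𝓘(ℝ, E) I' f (fun y => rgen ρ (f y) (ξ y)) y₀ :=
  SmAt.agen (a := fun p : G × X => ρ p.1 • p.2) hρ (fun x => by simp) hf hξ

/-- Equivariance of the generators. -/
theorem SmoothAct.tact_rgen (g : G) (x : X) (ξ : 𝔤) :
    tact (ρ g) x (rgen (E := E) ρ x ξ) =
      rgen ρ (ρ g • x) (tmap 𝓘(ℝ, 𝔤) 𝓘(ℝ, 𝔤) (fun h : G => g * h * g⁻¹) 1 ξ) := by
  have h1 : MDifferentiableAt 𝓘(ℝ, 𝔤) 𝓘(ℝ, 𝔤) (fun h : G => g * h * g⁻¹) 1 :=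
    (((contMDiff_mul_left (I := 𝓘(ℝ, 𝔤)) (n := ∞) (a := g))).mul contMDiff_const).mdifferentiable
      (by simp) 1
  have h2 := tmap_comp_apply (I := 𝓘(ℝ, 𝔤)) (I' := 𝓘(ℝ, 𝔤)) (I'' := 𝓘(ℝ, E))
    (g := fun h : G => ρ h • ρ g • x) (f := fun h : G => g * h * g⁻¹)
    (x := 1) ((hρ.contMDiff_orbit (ρ g • x)).mdifferentiable (by simp) _) h1 ξ
  have h3 := tmap_comp_apply (I := 𝓘(ℝ, 𝔤)) (I' := 𝓘(ℝ, E)) (I'' := 𝓘(ℝ, E))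
    (g := fun y : X => ρ g • y) (f := fun h : G => ρ h • x)
    (x := 1) (hρ.mdiff g _) ((hρ.contMDiff_orbit x).mdifferentiable (by simp) 1) ξ
  simp only [mul_one, mul_inv_cancel] at h2
  simp only [map_one, one_smul] at h3
  rw [tact, rgen, ← h3, rgen, ← h2]
  simp only [map_mul, mul_smul, map_inv, inv_smul_smul]

end

end CotangentLift

/-! ### Free proper actions -/

section FreeAction

variable {E : Type*} [NormedAddCommGroup E] [NormedSpace ℝ E] [FiniteDimensional ℝ E]
  {Q : Type*} [TopologicalSpace Q] [ChartedSpace E Q] [IsManifold 𝓘(ℝ, E) ∞ Q]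
  {𝔤 : Type*} [NormedAddCommGroup 𝔤] [NormedSpace ℝ 𝔤] [FiniteDimensional ℝ 𝔤]
  {G : Type*} [Group G] [TopologicalSpace G] [ChartedSpace 𝔤 G] [LieGroup 𝓘(ℝ, 𝔤) ∞ G]
  [MulAction G Q] [ContMDiffSMul 𝓘(ℝ, 𝔤) 𝓘(ℝ, E) ∞ G Q]

variable (E Q 𝔤 G) in
theorem smoothAct_id : SmoothAct E Q 𝔤 (MonoidHom.id G) :=
  ContMDiffSMul.contMDiff_smul

theorem eventually_const_of_velocity_zero {c : ℝ → Q}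
    (h : ∀ᶠ t in 𝓝 (0 : ℝ), MDifferentiableAt 𝓘(ℝ, ℝ) 𝓘(ℝ, E) c t ∧
      tmap 𝓘(ℝ, ℝ) 𝓘(ℝ, E) c t 1 = 0) : ∀ᶠ t in 𝓝 (0 : ℝ), c t = c 0 := by
  have h0 : ContinuousAt c 0 := h.self_of_nhds.1.continuousAt
  have h1 := h0.eventually (eventually_mem_source E (c 0))
  obtain ⟨ε, hε, hb⟩ := Metric.eventually_nhds_iff_ball.mp (h.and h1)
  have hd : ∀ t ∈ Metric.ball (0 : ℝ) ε,
      HasFDerivAt (fun t => extChartAt 𝓘(ℝ, E) (c 0) (c t)) (0 : ℝ →L[ℝ] E) t := by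
    intro t ht
    obtain ⟨⟨hm, hz⟩, hs⟩ := hb t ht
    have h2 := mdiff_ext (I := 𝓘(ℝ, E)) hs
    have h3 := (h2.comp t hm).differentiableAt.hasFDerivAt
    refine HasFDerivAt.congr_fderiv (f := fun t => extChartAt 𝓘(ℝ, E) (c 0) (c t)) h3 ?_
    ext
    have h4 := tmap_comp_apply (g := extChartAt 𝓘(ℝ, E) (c 0)) (f := c) h2 hm 1
    rw [hz, map_zero, tmap_eq_fderiv] at h4
    exact h4
  filter_upwards [Metric.ball_mem_nhds (0 : ℝ) hε] with t ht
  have h5 := (convex_ball (0 : ℝ) ε).is_const_of_fderivWithin_eq_zero (𝕜 := ℝ)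
    (f := fun t => extChartAt 𝓘(ℝ, E) (c 0) (c t))
    (fun t ht => (hd t ht).differentiableAt.differentiableWithinAt)
    (fun t ht => by
      rw [fderivWithin_of_isOpen Metric.isOpen_ball ht]; exact (hd t ht).fderiv) ht
    (Metric.mem_ball_self hε)
  refine (extChartAt 𝓘(ℝ, E) (c 0)).injOn ?_ ?_ h5
  · rw [extChartAt_source]; exact (hb t ht).2
  · exact mem_extChartAt_source _

theorem gen_injective (hfree : ∀ (g : G) (q : Q), g • q = q → g = 1) (q : Q) :
    Function.Injective (gen (E := E) (𝔤 := 𝔤) G q) := by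
  have : IsManifold 𝓘(ℝ, 𝔤) ∞ G := ContMDiffMul.toIsManifold (I := 𝓘(ℝ, 𝔤))
  have : IsManifold 𝓘(ℝ, 𝔤) 1 G := .of_le (n := ∞) (by simp)
  refine (injective_iff_map_eq_zero _).mpr fun ξ hξ => ?_
  let v : G → 𝔤 := fun g => tmap 𝓘(ℝ, 𝔤) 𝓘(ℝ, 𝔤) (fun h => g * h) 1 ξ
  have hv : SmAt 𝓘(ℝ, 𝔤) 𝓘(ℝ, 𝔤) (fun g : G => g) v 1 := by
    refine (SmAt.act (a := fun p : G × G => p.1 * p.2) (f := fun _ => 1) (g := fun g => g)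
      (contMDiff_mul 𝓘(ℝ, 𝔤) ∞) contMDiffAt_id
      (SmAt.const contMDiffAt_const)).congr (.of_forall fun g => ?_) .rfl
    simp
  obtain ⟨γ, h0, hγ⟩ := exists_isMIntegralCurveAt_of_contMDiffAt_boundaryless (I := 𝓘(ℝ, 𝔤))
    (v := v) (t₀ := (0 : ℝ)) (x₀ := (1 : G)) (ContMDiffAt.of_le hv (by simp))
  have hvel : ∀ᶠ t in 𝓝 (0 : ℝ), MDifferentiableAt 𝓘(ℝ, ℝ) 𝓘(ℝ, 𝔤) γ t ∧
      tmap 𝓘(ℝ, ℝ) 𝓘(ℝ, 𝔤) γ t 1 = v (γ t) := by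
    filter_upwards [hγ] with t ht
    refine ⟨ht.mdifferentiableAt, ?_⟩
    have := ht.mfderiv
    refine (congrArg (fun L : ℝ →L[ℝ] 𝔤 => L 1) this).trans ?_
    exact one_smul _ _
  have ho := (smoothAct_id E Q 𝔤 G).contMDiff_orbit q
  have hq := eventually_const_of_velocity_zero (c := fun t => γ t • q) <| by
    filter_upwards [hvel] with t ht
    have hmo : MDifferentiableAt 𝓘(ℝ, 𝔤) 𝓘(ℝ, E) (fun g : G => g • q) (γ t) :=
      ho.mdifferentiable (by simp) _
    refine ⟨hmo.comp t ht.1, ?_⟩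
    rw [tmap_comp_apply (g := fun g : G => g • q) (f := γ) hmo ht.1, ht.2]
    have hl : MDifferentiableAt 𝓘(ℝ, 𝔤) 𝓘(ℝ, 𝔤) (fun h : G => γ t * h) 1 :=
      (contMDiff_mul_left (I := 𝓘(ℝ, 𝔤)) (n := ∞)).mdifferentiable (by simp) 1
    have h1 := tmap_comp_apply (I := 𝓘(ℝ, 𝔤)) (I' := 𝓘(ℝ, 𝔤)) (I'' := 𝓘(ℝ, E))
      (g := fun g : G => g • q) (f := fun h : G => γ t * h) (x := 1)
      (ho.mdifferentiable (by simp) _) hl ξ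
    have h2 := tmap_comp_apply (I := 𝓘(ℝ, 𝔤)) (I' := 𝓘(ℝ, E)) (I'' := 𝓘(ℝ, E))
      (g := fun x : Q => γ t • x) (f := fun h : G => h • q) (x := 1)
      ((smoothAct_id E Q 𝔤 G).mdiff (γ t) _) (ho.mdifferentiable (by simp) _) ξ
    simp only [mul_one, mul_smul] at h1
    rw [h1] at h2
    refine h2.trans ?_
    have h3 : tmap 𝓘(ℝ, 𝔤) 𝓘(ℝ, E) (fun h : G => h • q) 1 ξ = 0 := hξ
    rw [h3, map_zero]
  have hone : ∀ᶠ t in 𝓝 (0 : ℝ), γ t = 1 := by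
    filter_upwards [hq] with t ht
    refine hfree _ q ?_
    simpa [h0] using ht
  have h4 := hvel.self_of_nhds.2
  rw [tmap_congr (I := 𝓘(ℝ, ℝ)) (I' := 𝓘(ℝ, 𝔤)) hone, tmap_const, h0] at h4
  have h5 : v 1 = ξ := by simp only [v, one_mul, tmap_id]; rfl
  rw [← h5, ← h4]; rfl

theorem tmap_orbit_injective (hfree : ∀ (g : G) (q : Q), g • q = q → g = 1) (q : Q) (g : G) :
    Function.Injective (tmap 𝓘(ℝ, 𝔤) 𝓘(ℝ, E) (fun h : G => h • q) g) := by
  refine (injective_iff_map_eq_zero _).mpr fun u hu => ?_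
  have hr : ∀ a b : G, MDifferentiableAt 𝓘(ℝ, 𝔤) 𝓘(ℝ, 𝔤) (fun h : G => h * a) b := fun a b =>
    (contMDiff_mul_right (I := 𝓘(ℝ, 𝔤)) (n := ∞)).mdifferentiable (by simp) b
  have ho := (smoothAct_id E Q 𝔤 G).contMDiff_orbit
  have h1 := tmap_comp_apply (I := 𝓘(ℝ, 𝔤)) (I' := 𝓘(ℝ, 𝔤)) (I'' := 𝓘(ℝ, E))
    (g := fun h : G => h • (g • q)) (f := fun h : G => h * g⁻¹) (x := g)
    ((ho (g • q)).mdifferentiable (by simp) _) (hr g⁻¹ g) u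
  have h2 := tmap_comp_apply (I := 𝓘(ℝ, 𝔤)) (I' := 𝓘(ℝ, 𝔤)) (I'' := 𝓘(ℝ, 𝔤))
    (g := fun h : G => h * g) (f := fun h : G => h * g⁻¹) (x := g) (hr _ _) (hr g⁻¹ g) u
  have e : (fun h : G => (h * g⁻¹) • g • q) = fun h => h • q := by
    funext h; rw [smul_smul, inv_mul_cancel_right]
  rw [e, hu, mul_inv_cancel] at h1
  simp only [inv_mul_cancel_right, tmap_id, mul_inv_cancel] at h2
  have h3 := gen_injective (E := E) (𝔤 := 𝔤) hfree (g • q) (h1.symm.trans (map_zero _).symm)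
  rw [h3, map_zero] at h2
  exact h2

theorem isInducing_orbit [T2Space Q] [ProperSMul G Q]
    (hfree : ∀ (g : G) (q : Q), g • q = q → g = 1) (q : Q) :
    Topology.IsEmbedding (fun g : G => g • q) := by
  have hinj : Function.Injective (fun g : G => g • q) := by
    intro g h hgh
    have := hfree (h⁻¹ * g) q (by rw [mul_smul]; simp [show g • q = h • q from hgh])
    exact (inv_mul_eq_one.mp this).symm
  have h1 : Topology.IsClosedEmbedding (fun g : G => (g, q)) :=
    Topology.IsClosedEmbedding.of_continuous_injective_isClosedMap (by fun_prop)
      (fun a b h => (Prod.ext_iff.mp h).1) (fun s hs => by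
        have : (fun g : G => (g, q)) '' s = s ×ˢ {q} := by ext ⟨a, b⟩; simp [eq_comm]
        rw [this]; exact hs.prod isClosed_singleton)
  have h2 : IsProperMap (fun g : G => (g • q, q)) :=
    (ProperSMul.isProperMap_smul_pair (G := G) (X := Q)).comp h1.isProperMap
  have h3 : Topology.IsClosedEmbedding (fun g : G => (g • q, q)) :=
    Topology.IsClosedEmbedding.of_continuous_injective_isClosedMap h2.continuous
      (fun a b h => hinj (Prod.ext_iff.mp h).1) h2.isClosedMap
  refine ⟨?_, hinj⟩
  have hc : Continuous fun g : G => g • q := continuous_fst.comp h2.continuous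
  exact Topology.IsInducing.of_comp hc (by fun_prop : Continuous fun x : Q => (x, q)) h3.isInducing

theorem orbit_lift_smoothAt [T2Space Q] [ProperSMul G Q]
    (hfree : ∀ (g : G) (q : Q), g • q = q → g = 1) {Z E' H' : Type*} [NormedAddCommGroup E']
    [NormedSpace ℝ E'] [TopologicalSpace H'] {I' : ModelWithCorners ℝ E' H'} [TopologicalSpace Z]
    [ChartedSpace H' Z] {q : Q} {g : Z → G} {z₀ : Z}
    (h : ContMDiffAt I' 𝓘(ℝ, E) ∞ (fun z => g z • q) z₀) : ContMDiffAt I' 𝓘(ℝ, 𝔤) ∞ g z₀ := by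
  have : IsManifold 𝓘(ℝ, 𝔤) ∞ G := ContMDiffMul.toIsManifold (I := 𝓘(ℝ, 𝔤))
  refine contMDiffAt_of_immersion (f := fun h : G => h • q)
    ((smoothAct_id E Q 𝔤 G).contMDiff_orbit q).contMDiffAt (tmap_orbit_injective hfree q _) ?_ h
  rw [(isInducing_orbit hfree q).continuousAt_iff]
  exact h.continuousAt

end FreeAction

/-! ### Pointwise structure of the system -/

section Projections

variable {E : Type*} [NormedAddCommGroup E] [NormedSpace ℝ E] [FiniteDimensional ℝ E]
  {K R : Submodule ℝ E}

theorem projAlong_mem (h : IsCompl K R) (v : E) : projAlong K R v ∈ K := by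
  rw [projAlong, dif_pos h]; exact Submodule.projection_apply_mem h v

theorem projAlong_of_mem (h : IsCompl K R) {v : E} (hv : v ∈ K) : projAlong K R v = v := by
  rw [projAlong, dif_pos h]; exact Submodule.projection_apply_of_mem_left h hv

theorem projAlong_eq_zero (h : IsCompl K R) {v : E} : projAlong K R v = 0 ↔ v ∈ R := by
  rw [projAlong, dif_pos h]; exact Submodule.projection_apply_eq_zero_iff h

theorem sub_projAlong_mem (h : IsCompl K R) (v : E) : v - projAlong K R v ∈ R := by
  rw [← projAlong_eq_zero h, map_sub, projAlong_of_mem h (projAlong_mem h v), sub_self]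

theorem projAlong_unique (h : IsCompl K R) {u v : E} (hu : u ∈ K) (hv : v - u ∈ R) :
    projAlong K R v = u := by
  have := (projAlong_eq_zero h).mpr hv
  rw [map_sub, projAlong_of_mem h hu, sub_eq_zero] at this
  exact this

theorem projAlong_add (h : IsCompl K R) (v : E) : projAlong K R v + projAlong R K v = v := by
  have := projAlong_unique h.symm (v := v) (sub_projAlong_mem h v)
    (by rw [sub_sub_cancel]; exact projAlong_mem h v)
  rw [this]; abel

end Projections

section Metric

variable {E : Type*} [NormedAddCommGroup E] [NormedSpace ℝ E]
  {Q : Type*} [TopologicalSpace Q] [ChartedSpace E Q] [IsManifold 𝓘(ℝ, E) ∞ Q]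
  {sys : System E Q}

theorem metric_symm (q : Q) (u v : E) : sys.metric q u v = sys.metric q v u := sys.κ.symm q u v

theorem metric_pos (q : Q) {v : E} (hv : v ≠ 0) : 0 < sys.metric q v v := sys.κ.pos q v hv

theorem metric_definite {q : Q} {v : E} (hv : sys.metric q v v = 0) : v = 0 := by
  by_contra h
  exact (metric_pos q h).ne' hv

theorem metric_bijective [FiniteDimensional ℝ E] (q : Q) : Function.Bijective (sys.metric q) :=
  injective_bilin_bijective fun v h => metric_definite (h v)

theorem metric_inverse_apply [FiniteDimensional ℝ E] (q : Q) (l : E →L[ℝ] ℝ) :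
    sys.metric q ((sys.metric q).inverse l) = l := by
  obtain ⟨e, he⟩ := isInvertible_of_bijective (metric_bijective (sys := sys) q)
  rw [← he, ContinuousLinearMap.inverse_equiv]; simp

theorem inverse_metric_apply [FiniteDimensional ℝ E] (q : Q) (v : E) :
    (sys.metric q).inverse (sys.metric q v) = v :=
  (metric_bijective q).1 (metric_inverse_apply q _)

/-- The velocity that corresponds to a covector. -/
def System.vel (sys : System E Q) (α : Cot E Q) : E := (sys.metric α.1).inverse (covec α)

variable [FiniteDimensional ℝ E]

theorem metric_vel (α : Cot E Q) : sys.metric α.1 (sys.vel α) = covec α := metric_inverse_apply _ _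

theorem mem_M_iff {α : Cot E Q} : α ∈ sys.M ↔ sys.vel α ∈ sys.D α.1 := by
  constructor
  · rintro ⟨v, hv, hα⟩
    rwa [System.vel, ← hα, inverse_metric_apply]
  · intro h
    exact ⟨_, h, metric_vel α⟩

theorem vel_mkCot (q : Q) (v : E) : sys.vel (mkCot q (sys.metric q v)) = v :=
  inverse_metric_apply q v

theorem mkCot_metric_mem {q : Q} {v : E} (hv : v ∈ sys.D q) : mkCot q (sys.metric q v) ∈ sys.M :=
  ⟨v, hv, rfl⟩

theorem hamiltonian_eq (α : Cot E Q) :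
    sys.hamiltonian α = 1 / 2 * covec α (sys.vel α) + sys.U α.1 := by
  have := metric_vel (sys := sys) α
  simp only [System.hamiltonian, System.lagrangian]
  change covec α (sys.vel α) - (1 / 2 * sys.metric α.1 (sys.vel α) (sys.vel α) - sys.U α.1) = _
  rw [this]; ring

end Metric

section System

variable {E : Type*} [NormedAddCommGroup E] [NormedSpace ℝ E] [FiniteDimensional ℝ E]
  {Q : Type*} [TopologicalSpace Q] [ChartedSpace E Q] [IsManifold 𝓘(ℝ, E) ∞ Q]
  {𝔤 : Type*} [NormedAddCommGroup 𝔤] [NormedSpace ℝ 𝔤] [FiniteDimensional ℝ 𝔤]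
  {G : Type*} [Group G] [TopologicalSpace G] [ChartedSpace 𝔤 G] [LieGroup 𝓘(ℝ, 𝔤) ∞ G]
  [MulAction G Q] [ContMDiffSMul 𝓘(ℝ, 𝔤) 𝓘(ℝ, E) ∞ G Q]
  {sys : System E Q} {k : ℕ} {ζ : Fin k → Q → 𝔤} {W Hor : PlaneField E Q}

variable (hA : SmoothAct E Q 𝔤 (MonoidHom.id G))

theorem momentum_apply (α : Cot E Q) (ξ : 𝔤) : momentum G α ξ = covec α (gen G α.1 ξ) :=
  (smoothAct_id E Q 𝔤 G).liouville_cgen α ξ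

theorem momentumOf_apply (ξ : Q → 𝔤) (α : Cot E Q) :
    momentumOf G ξ α = covec α (gen G α.1 (ξ α.1)) := momentum_apply α _

/-- The adjoint representation. -/
def adj (g : G) : 𝔤 →L[ℝ] 𝔤 := tmap 𝓘(ℝ, 𝔤) 𝓘(ℝ, 𝔤) (fun h : G => g * h * g⁻¹) 1

theorem tact_gen (g : G) (q : Q) (ξ : 𝔤) :
    tact g q (gen (E := E) G q ξ) = gen G (g • q) (adj g ξ) :=
  (smoothAct_id E Q 𝔤 G).tact_rgen g q ξ

theorem U_invariant (hs : IsSymmetry G sys) (g : G) (q : Q) : sys.U (g • q) = sys.U q := by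
  have := hs.lagrangian g q 0
  simpa [System.lagrangian] using this

theorem metric_invariant (hs : IsSymmetry G sys) (g : G) (q : Q) (u v : E) :
    sys.metric (g • q) (tact g q u) (tact g q v) = sys.metric q u v := by
  have h : ∀ w, sys.metric (g • q) (tact g q w) (tact g q w) = sys.metric q w w := by
    intro w
    have := hs.lagrangian g q w
    simp only [System.lagrangian, U_invariant hs] at this
    linarith
  have h1 := h (u + v)
  simp only [map_add, add_apply] at h1
  rw [h, h, metric_symm (g • q) (tact g q v) (tact g q u), metric_symm q v u] at h1
  linarith

include hA in
theorem tact_mem_iff (D : PlaneField E Q) (hD : InvariantDistribution G D) (g : G) (q : Q) (v : E) :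
    tact g q v ∈ D (g • q) ↔ v ∈ D q := by
  refine ⟨fun h => ?_, hD g q v⟩
  have := hD g⁻¹ (g • q) _ h
  rw [inv_smul_smul] at this
  have h2 := hA.tact_inv_tact g q v
  rwa [← show tact g⁻¹ (g • q) (tact g q v) = v from h2]

include hA in
theorem cotAct_metric (hs : IsSymmetry G sys) (g : G) (q : Q) (v : E) :
    cotAct g (mkCot q (sys.metric q v)) = mkCot (g • q) (sys.metric (g • q) (tact g q v)) :=
  (hA.cotAct_eq_iff).mpr ⟨rfl, fun _ => metric_invariant hs g q _ _⟩

include hA in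
theorem vel_cotAct (hs : IsSymmetry G sys) (g : G) (α : Cot E Q) :
    sys.vel (cotAct g α) = tact g α.1 (sys.vel α) := by
  have : α = mkCot α.1 (sys.metric α.1 (sys.vel α)) := by rw [metric_vel]; rfl
  conv_lhs => rw [this]
  rw [cotAct_metric hA hs, vel_mkCot]

include hA in
theorem cotAct_mem_M (hs : IsSymmetry G sys) (g : G) {α : Cot E Q} (hα : α ∈ sys.M) :
    cotAct g α ∈ sys.M := by
  rw [mem_M_iff, vel_cotAct hA hs]
  exact hs.constraints g _ _ (mem_M_iff.mp hα)

include hA in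
theorem hamiltonian_invariant (hs : IsSymmetry G sys) (g : G) (α : Cot E Q) :
    sys.hamiltonian (cotAct g α) = sys.hamiltonian α := by
  rw [hamiltonian_eq, hamiltonian_eq, vel_cotAct hA hs, cotAct_fst, U_invariant hs]
  have := hA.covec_cotAct_tact g α (sys.vel α)
  rw [show covec (cotAct g α) (tact g α.1 (sys.vel α)) = covec α (sys.vel α) from this]

theorem gen_mem_vert (q : Q) (ξ : 𝔤) : gen (E := E) G q ξ ∈ vert (𝔤 := 𝔤) G q := ⟨ξ, rfl⟩

/-- The differential of the function on `T*Q` defined by a vector field. -/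
theorem dfun_covec {Z : Q → E} {a : Cot E Q} (hZ : SmAt 𝓘(ℝ, E) 𝓘(ℝ, E) (fun q : Q => q) Z a.1)
    (w : E × (E →L[ℝ] ℝ)) :
    dfun (cotI E) (fun b : Cot E Q => covec b (Z b.1)) a w =
      w.2 (Z a.1) + covec a (tmap 𝓘(ℝ, E) 𝓘(ℝ, E) (fun q => cf 𝓘(ℝ, E) a.1 q (Z q)) a.1 w.1) := by
  let z : Cot E Q → E := fun b => cf 𝓘(ℝ, E) a.1 b.1 (Z b.1)
  let p : Cot E Q → E →L[ℝ] ℝ := fun b => (extChartAt (cotI E) a b).2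
  have hz : ContMDiffAt (cotI E) 𝓘(ℝ, E) ∞ z a := ContMDiffAt.comp a
    (g := fun q => cf 𝓘(ℝ, E) a.1 q (Z q)) hZ.coord (smooth_pr a)
  have hext : MDifferentiableAt (cotI E) 𝓘(ℝ, E × (E →L[ℝ] ℝ)) (extChartAt (cotI E) a) a :=
    mdiff_ext (mem_chart_source _ a)
  have hp : HasMFDerivAt (cotI E) 𝓘(ℝ, E →L[ℝ] ℝ) p a (ContinuousLinearMap.snd ℝ E (E →L[ℝ] ℝ)) := by
    have h1 : HasMFDerivAt (cotI E) 𝓘(ℝ, E × (E →L[ℝ] ℝ)) (extChartAt (cotI E) a) a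
        (ContinuousLinearMap.id ℝ _) := by
      have := hext.hasMFDerivAt
      rwa [show mfderiv (cotI E) 𝓘(ℝ, E × (E →L[ℝ] ℝ)) (extChartAt (cotI E) a) a =
        ContinuousLinearMap.id ℝ _ from cf_self a] at this
    exact ((ContinuousLinearMap.snd ℝ E (E →L[ℝ] ℝ)).hasMFDerivAt (x := extChartAt (cotI E) a a)).comp
      a h1
  have hz' : HasMFDerivAt (cotI E) 𝓘(ℝ, E) z a (mfderiv (cotI E) 𝓘(ℝ, E) z a) :=
    (hz.mdifferentiableAt (by simp)).hasMFDerivAt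
  have hev : (fun b : Cot E Q => covec b (Z b.1)) =ᶠ[𝓝 a] fun b => p b (z b) := by
    filter_upwards [(smooth_pr a).continuousAt.eventually (eventually_mem_source E a.1)] with b hb
    simp only [p, z, cot_extChartAt hb, ContinuousLinearMap.comp_apply, cfi_cf hb]
  have hd : HasMFDerivAt (cotI E) 𝓘(ℝ, ℝ) (fun b => p b (z b)) a
      ((p a).comp (tmap (cotI E) 𝓘(ℝ, E) z a) +
        (ContinuousLinearMap.apply ℝ ℝ (z a)).comp (ContinuousLinearMap.snd ℝ E (E →L[ℝ] ℝ))) := by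
    refine ⟨hp.1.clm_apply hz'.1, ?_⟩
    have h3 := HasFDerivWithinAt.clm_apply hp.2 hz'.2
    have hp' : writtenInExtChartAt (cotI E) 𝓘(ℝ, E →L[ℝ] ℝ) a p (extChartAt (cotI E) a a) = p a :=
      congrArg p (extChartAt_to_inv (I := cotI E) a)
    have hz'' : writtenInExtChartAt (cotI E) 𝓘(ℝ, E) a z (extChartAt (cotI E) a a) = z a :=
      congrArg z (extChartAt_to_inv (I := cotI E) a)
    rw [hp', hz''] at h3
    exact h3
  have h2 : dfun (cotI E) (fun b : Cot E Q => covec b (Z b.1)) a w =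
      p a (tmap (cotI E) 𝓘(ℝ, E) z a w) + w.2 (z a) :=
    congrArg (fun L : E × (E →L[ℝ] ℝ) →L[ℝ] ℝ => L w)
      ((tmap_congr (I := cotI E) (I' := 𝓘(ℝ, ℝ)) hev).trans hd.mfderiv)
  rw [h2]
  have hza : z a = Z a.1 := by simp only [z, cf_self]; rfl
  have hpa : p a = covec a := by
    simp only [p, cot_extChartAt (mem_chart_source E a.1), cfi_self]; rfl
  have htz : tmap (cotI E) 𝓘(ℝ, E) z a w =
      tmap 𝓘(ℝ, E) 𝓘(ℝ, E) (fun q => cf 𝓘(ℝ, E) a.1 q (Z q)) a.1 w.1 := by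
    have := tmap_comp_apply (g := fun q => cf 𝓘(ℝ, E) a.1 q (Z q)) (f := fun b : Cot E Q => b.1)
      (x := a) (hZ.coord.mdifferentiableAt (by simp)) ((smooth_pr a).mdifferentiableAt (by simp)) w
    rw [← tτ_apply a w]; exact this
  rw [← htz, ← hza, ← hpa]
  exact add_comm _ _

end System

/-! ### The data of the reduction -/

section Setup

variable {E : Type*} [NormedAddCommGroup E] [NormedSpace ℝ E] [FiniteDimensional ℝ E]
  {Q : Type*} [TopologicalSpace Q] [ChartedSpace E Q] [IsManifold 𝓘(ℝ, E) ∞ Q] [T2Space Q]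
  {𝔤 : Type*} [NormedAddCommGroup 𝔤] [NormedSpace ℝ 𝔤] [FiniteDimensional ℝ 𝔤]
  {G : Type*} [Group G] [TopologicalSpace G] [ChartedSpace 𝔤 G] [LieGroup 𝓘(ℝ, 𝔤) ∞ G]
  [MulAction G Q] [ContMDiffSMul 𝓘(ℝ, 𝔤) 𝓘(ℝ, E) ∞ G Q] [ProperSMul G Q]
  {sys : System E Q} {k : ℕ} {ζ : Fin k → Q → 𝔤} {W Hor : PlaneField E Q}
  {N : Subgroup G} [N.Normal]
  {E₁ : Type*} [NormedAddCommGroup E₁] [NormedSpace ℝ E₁] [FiniteDimensional ℝ E₁]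
  [ChartedSpace E₁ (OrbitSpace Q N)] [IsManifold 𝓘(ℝ, E₁) ∞ (OrbitSpace Q N)]

variable (sys ζ W Hor N E₁) in
/-- The standing assumptions: symmetry, dimension assumption, horizontal gauge momenta, vertical
symmetry condition, and the manifold structure of the first orbit space. -/
structure Setup : Prop where
  sym : IsSymmetry G sys
  dim : DimensionAssumption 𝔤 G sys
  rank : ∀ q, Module.finrank ℝ (distS 𝔤 G sys q) = k
  gauge : IsGaugeMomenta G sys ζ
  compl : IsVerticalComplement 𝔤 G sys W
  vsym : VerticalSymmetry W N
  hor : IsHorizontal 𝔤 G sys Hor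
  proj : IsSubmersion 𝓘(ℝ, E) 𝓘(ℝ, E₁) (proj (Q := Q) N)

variable (h : Setup sys ζ W Hor N E₁)
include h

theorem Setup.gen_injective (q : Q) : Function.Injective (gen (E := E) (𝔤 := 𝔤) G q) :=
  NH.gen_injective h.sym.free q

theorem Setup.gaugeField_smooth (i : Fin k) (q : Q) :
    SmAt 𝓘(ℝ, E) 𝓘(ℝ, E) (fun q : Q => q) (fun q => gen G q (ζ i q)) q :=
  (smoothAct_id E Q 𝔤 G).rgen_smoothAt contMDiffAt_id (h.gauge.smooth i).contMDiffAt

theorem Setup.linearIndependent_gaugeField (q : Q) :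
    LinearIndependent ℝ fun i => gen (E := E) G q (ζ i q) := by
  refine Fintype.linearIndependent_iff.mpr fun c hc => ?_
  have hm : mkCot (E := E) q 0 ∈ sys.M := ⟨0, Submodule.zero_mem _, map_zero _⟩
  refine congrFun (h.gauge.independent _ hm c fun v _ => ?_)
  have h1 : ∀ i, dfun (cotI E) (momentumOf (E := E) G (ζ i)) (mkCot q 0) v = v.2 (gen (E := E) G q (ζ i q)) := by
    intro i
    have := dfun_covec (E := E) (Q := Q) (a := mkCot q 0) (h.gaugeField_smooth i q) v
    rw [covec_mkCot, zero_apply, add_zero] at this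
    rw [show momentumOf G (ζ i) = fun b : Cot E Q => covec b (gen G b.1 (ζ i b.1)) from
      funext fun b => momentumOf_apply (ζ i) b]
    exact this
  simpa [h1, map_sum] using congrArg v.2 hc

theorem Setup.span_gaugeField (q : Q) :
    Submodule.span ℝ (Set.range fun i => gen (E := E) G q (ζ i q)) = distS 𝔤 G sys q := by
  refine Submodule.eq_of_le_of_finrank_eq ?_ ?_
  · exact Submodule.span_le.mpr (by rintro _ ⟨i, rfl⟩; exact h.gauge.mem_S i q)
  · rw [finrank_span_eq_card (h.linearIndependent_gaugeField q), h.rank q, Fintype.card_fin]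

theorem Setup.gauge_mem_D (i : Fin k) (q : Q) : gen G q (ζ i q) ∈ sys.D q :=
  (h.gauge.mem_S i q).1

theorem Setup.gen_mem_W_iff (q : Q) (ξ : 𝔤) : gen G q ξ ∈ W q ↔ ξ ∈ lieN 𝔤 N := by
  have ho := (smoothAct_id E Q 𝔤 G).contMDiff_orbit q
  have hW : ∀ v, v ∈ W q ↔ v ∈ tangentTo 𝓘(ℝ, E) (MulAction.orbit N q) q := fun v =>
    Set.ext_iff.mp (h.vsym.tangent_orbit q) v
  constructor
  · intro hξ
    obtain ⟨γ, h1, h2, h3, h4⟩ := (hW _).mp hξ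
    choose n hn using h2
    have h5 : ∀ t, ((n t : N) : G) • q = γ t := hn
    have hs : ContMDiff 𝓘(ℝ, ℝ) 𝓘(ℝ, 𝔤) ∞ (fun t => ((n t : N) : G)) := fun t =>
      orbit_lift_smoothAt (E := E) h.sym.free (q := q) (by simpa only [h5] using h1 t)
    have h0 : ((n 0 : N) : G) = 1 := h.sym.free _ q (by rw [h5, h3])
    have hv : tmap 𝓘(ℝ, ℝ) 𝓘(ℝ, 𝔤) (fun t => ((n t : N) : G)) 0 1 = ξ := by
      apply h.gen_injective q
      have h6 := tmap_comp_apply (I := 𝓘(ℝ, ℝ)) (I' := 𝓘(ℝ, 𝔤)) (I'' := 𝓘(ℝ, E))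
        (g := fun g : G => g • q) (f := fun t => ((n t : N) : G)) (x := (0 : ℝ))
        (ho.mdifferentiable (by simp) _) (hs.mdifferentiable (by simp) _) 1
      rw [h0] at h6
      simp only [h5] at h6
      exact h6.symm.trans h4
    exact Submodule.subset_span ⟨_, hs, fun t => (n t).2, h0, hv⟩
  · intro hξ
    have : lieN 𝔤 N ≤ (W q).comap (gen (E := E) (𝔤 := 𝔤) G q).toLinearMap := by
      refine Submodule.span_le.mpr ?_
      rintro _ ⟨γ, h1, h2, h3, rfl⟩
      refine (hW _).mpr ⟨fun t => γ t • q, ho.comp h1, fun t => ⟨⟨γ t, h2 t⟩, rfl⟩, by simp [h3], ?_⟩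
      have h6 := tmap_comp_apply (I := 𝓘(ℝ, ℝ)) (I' := 𝓘(ℝ, 𝔤)) (I'' := 𝓘(ℝ, E))
        (g := fun g : G => g • q) (f := γ) (x := (0 : ℝ))
        (ho.mdifferentiable (by simp) _) (h1.mdifferentiable (by simp) _) 1
      rw [h3] at h6
      exact h6
    exact this hξ

theorem Setup.exists_gen_eq_of_mem_W {q : Q} {w : E} (hw : w ∈ W q) :
    ∃ ν ∈ lieN 𝔤 N, gen G q ν = w := by
  obtain ⟨ν, rfl⟩ := h.compl.le_vert q hw
  exact ⟨ν, (h.gen_mem_W_iff q ν).mp hw, rfl⟩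

theorem Setup.proj_mdiff (q : Q) : MDifferentiableAt 𝓘(ℝ, E) 𝓘(ℝ, E₁) (NH.proj N) q :=
  h.proj.1.mdifferentiable (by simp) q

theorem Setup.tproj_eq_zero_iff {q : Q} {v : E} : tproj (E₁ := E₁) N q v = 0 ↔ v ∈ W q := by
  rw [← SetLike.mem_coe, h.vsym.tangent_orbit q]
  constructor
  · intro hv
    obtain ⟨γ, h1, h2, h3, h4⟩ := exists_fibre_curve h.proj.1 q (h.proj.2 q) hv
    refine ⟨γ, h1, fun t => ?_, h3, h4⟩
    obtain ⟨n, hn, hq⟩ := (proj_eq_iff N (γ t) q).mp (h2 t)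
    exact ⟨⟨n, hn⟩, hq⟩
  · rintro ⟨γ, h1, h2, rfl, rfl⟩
    have h6 := tmap_comp_apply (I := 𝓘(ℝ, ℝ)) (I' := 𝓘(ℝ, E)) (I'' := 𝓘(ℝ, E₁))
        (g := NH.proj N) (f := γ) (x := (0 : ℝ)) (h.proj_mdiff _) (h1.mdifferentiable (by simp) _) 1
    refine h6.symm.trans ?_
    have : (fun t => NH.proj N (γ t)) = fun _ => NH.proj N (γ 0) := funext fun t =>
      (proj_eq_iff N _ _).mpr (by obtain ⟨n, hn⟩ := h2 t; exact ⟨n, n.2, hn⟩)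
    rw [this, tmap_const]; rfl

/-! The projection and the horizontal lift. -/

theorem Setup.tproj_surjective (q : Q) : Function.Surjective (tproj (E := E) (E₁ := E₁) N q) := h.proj.2 q

theorem Setup.PD_mem (q : Q) (v : E) : PD sys W q v ∈ sys.D q := projAlong_mem (h.compl.compl q) v

theorem Setup.sub_PD_mem (q : Q) (v : E) : v - PD sys W q v ∈ W q :=
  sub_projAlong_mem (h.compl.compl q) v

theorem Setup.PD_of_mem {q : Q} {v : E} (hv : v ∈ sys.D q) : PD sys W q v = v :=
  projAlong_of_mem (h.compl.compl q) hv

theorem Setup.PD_eq_zero {q : Q} {v : E} (hv : v ∈ W q) : PD sys W q v = 0 :=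
  (projAlong_eq_zero (h.compl.compl q)).mpr hv

theorem Setup.tproj_PD (q : Q) (v : E) :
    tproj (E₁ := E₁) N q (PD sys W q v) = tproj (E₁ := E₁) N q v := by
  have := h.tproj_eq_zero_iff.mpr (h.sub_PD_mem q v)
  rw [map_sub, sub_eq_zero] at this
  exact this.symm

theorem Setup.tproj_bijective_D (q : Q) :
    Function.Bijective ((tproj (E₁ := E₁) N q).comp (sys.D q).subtypeL) := by
  constructor
  · refine (injective_iff_map_eq_zero _).mpr fun v hv => ?_
    have h1 : (v : E) ∈ W q := h.tproj_eq_zero_iff.mp hv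
    exact Subtype.ext (Submodule.disjoint_def.mp (h.compl.compl q).disjoint v v.2 h1)
  · intro w
    obtain ⟨v, rfl⟩ := h.tproj_surjective q w
    exact ⟨⟨_, h.PD_mem q v⟩, h.tproj_PD q v⟩

theorem Setup.hlift_mem (q : Q) (w : E₁) : hlift sys N q w ∈ sys.D q := Subtype.coe_prop _

theorem Setup.tproj_hlift (q : Q) (w : E₁) : tproj N q (hlift sys N q w) = w := by
  obtain ⟨e, he⟩ := isInvertible_of_bijective (h.tproj_bijective_D q)
  have h1 : hlift sys N q w = (sys.D q).subtypeL (e.symm w) := by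
    rw [hlift, ← he, ContinuousLinearMap.inverse_equiv]; rfl
  rw [h1]
  change ((tproj (E₁ := E₁) N q).comp (sys.D q).subtypeL) (e.symm w) = w
  rw [← he]; exact e.apply_symm_apply w

theorem Setup.eq_of_tproj_eq {q : Q} {u v : E} (hu : u ∈ sys.D q) (hv : v ∈ sys.D q)
    (huv : tproj (E₁ := E₁) N q u = tproj (E₁ := E₁) N q v) : u = v := by
  have := (h.tproj_bijective_D q).1 (a₁ := ⟨u, hu⟩) (a₂ := ⟨v, hv⟩) huv
  exact congrArg Subtype.val this

theorem Setup.hlift_tproj (q : Q) (v : E) :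
    hlift sys N q (tproj (E₁ := E₁) N q v) = PD sys W q v :=
  h.eq_of_tproj_eq (h.hlift_mem q _) (h.PD_mem q v) (by rw [h.tproj_hlift, h.tproj_PD])

theorem Setup.hlift_tproj_of_mem {q : Q} {v : E} (hv : v ∈ sys.D q) :
    hlift sys N q (tproj (E₁ := E₁) N q v) = v := by
  rw [h.hlift_tproj, h.PD_of_mem hv]

/-! The action on the orbit space. -/

theorem Setup.smoothAct_quotient :
    SmoothAct E₁ (OrbitSpace Q N) 𝔤 (QuotientGroup.mk' N) := by
  rintro ⟨g₀, x₀⟩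
  induction x₀ using Quotient.inductionOn with
  | h q =>
  obtain ⟨r, hr⟩ := exists_right_inverse (h.proj.2 q)
  obtain ⟨s, U, hU, hqU, hs, hsU, -, -⟩ := exists_local_section h.proj.1 q hr
  have h1 : ContMDiffAt (𝓘(ℝ, 𝔤).prod 𝓘(ℝ, E₁)) 𝓘(ℝ, E₁) ∞
      (fun p : G × OrbitSpace Q N => NH.proj N (p.1 • s p.2)) (g₀, NH.proj N q) := by
    have h2 : ContMDiffAt (𝓘(ℝ, 𝔤).prod 𝓘(ℝ, E₁)) 𝓘(ℝ, E) ∞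
        (fun p : G × OrbitSpace Q N => s p.2) (g₀, NH.proj N q) :=
      ContMDiffAt.comp (g := s) (f := Prod.snd) _ (hs.contMDiffAt (hU.mem_nhds hqU)) contMDiffAt_snd
    exact ContMDiffAt.comp (g := NH.proj N) (f := fun p : G × OrbitSpace Q N => p.1 • s p.2) _
      h.proj.1.contMDiffAt (ContMDiffAt.comp
      (g := fun p : G × Q => p.1 • p.2) (f := fun p : G × OrbitSpace Q N => (p.1, s p.2)) _
      (smoothAct_id E Q 𝔤 G).contMDiffAt (contMDiffAt_fst.prodMk h2))
  refine h1.congr_of_eventuallyEq ?_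
  have : ∀ᶠ p : G × OrbitSpace Q N in 𝓝 (g₀, NH.proj N q), p.2 ∈ U :=
    continuousAt_snd.eventually (hU.mem_nhds hqU)
  filter_upwards [this] with p hp
  change (p.1 : G ⧸ N) • p.2 = (p.1 : G ⧸ N) • NH.proj N (s p.2)
  rw [hsU _ hp]

theorem Setup.tproj_gen (q : Q) (ξ : 𝔤) : tproj (E₁ := E₁) N q (gen (E := E) G q ξ) =
    rgen (QuotientGroup.mk' N) (NH.proj N q) ξ := by
  have h6 := tmap_comp_apply (I := 𝓘(ℝ, 𝔤)) (I' := 𝓘(ℝ, E)) (I'' := 𝓘(ℝ, E₁))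
    (g := NH.proj N) (f := fun g : G => g • q) (x := (1 : G)) (h.proj_mdiff _)
    (((smoothAct_id E Q 𝔤 G).contMDiff_orbit q).mdifferentiable (by simp) _) ξ
  rw [one_smul] at h6
  exact h6.symm

theorem Setup.tproj_tact (g : G) (q : Q) (v : E) : tproj (E₁ := E₁) N (g • q) (tact g q v) =
    tact (QuotientGroup.mk' N g) (NH.proj N q) (tproj N q v) := by
  have h6 := tmap_comp_apply (I := 𝓘(ℝ, E)) (I' := 𝓘(ℝ, E)) (I'' := 𝓘(ℝ, E₁))
    (g := NH.proj N) (f := fun q : Q => g • q) (x := q) (h.proj_mdiff _)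
    ((smoothAct_id E Q 𝔤 G).mdiff g q) v
  have h7 := tmap_comp_apply (I := 𝓘(ℝ, E)) (I' := 𝓘(ℝ, E₁)) (I'' := 𝓘(ℝ, E₁))
    (g := fun x : OrbitSpace Q N => QuotientGroup.mk' N g • x) (f := NH.proj N) (x := q)
    (h.smoothAct_quotient.mdiff g _) (h.proj_mdiff _) v
  exact h6.symm.trans h7

theorem proj_smul_of_mem {n : G} (hn : n ∈ N) (q : Q) : NH.proj N (n • q) = NH.proj N q :=
  (proj_eq_iff N _ _).mpr ⟨n, hn, rfl⟩

theorem Setup.adj_sub_mem {n : G} (hn : n ∈ N) (q : Q) (ξ : 𝔤) : adj n ξ - ξ ∈ lieN 𝔤 N := by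
  rw [← h.gen_mem_W_iff (n • q), ← h.tproj_eq_zero_iff, map_sub, map_sub, ← tact_gen, h.tproj_tact,
    h.tproj_gen, h.tproj_gen, proj_smul_of_mem h hn]
  have : QuotientGroup.mk' N n = 1 := (QuotientGroup.eq_one_iff n).mpr hn
  rw [this, tact_one' h.smoothAct_quotient, sub_self]

theorem Setup.adj_mem_lieN (g : G) {ν : 𝔤} (hν : ν ∈ lieN 𝔤 N) : adj g ν ∈ lieN 𝔤 N := by
  have : lieN 𝔤 N ≤ (lieN 𝔤 N).comap (adj (𝔤 := 𝔤) g).toLinearMap := by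
    refine Submodule.span_le.mpr ?_
    rintro _ ⟨γ, h1, h2, h3, rfl⟩
    have hc : ContMDiff 𝓘(ℝ, 𝔤) 𝓘(ℝ, 𝔤) ∞ (fun h : G => g * h * g⁻¹) :=
      (contMDiff_mul_left (I := 𝓘(ℝ, 𝔤)) (n := ∞) (a := g)).mul contMDiff_const
    refine Submodule.subset_span ⟨fun t => g * γ t * g⁻¹, hc.comp h1,
      fun t => Subgroup.Normal.conj_mem inferInstance _ (h2 t) g, by simp [h3], ?_⟩
    have h6 := tmap_comp_apply (I := 𝓘(ℝ, ℝ)) (I' := 𝓘(ℝ, 𝔤)) (I'' := 𝓘(ℝ, 𝔤))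
      (g := fun h : G => g * h * g⁻¹) (f := γ) (x := (0 : ℝ))
      (hc.mdifferentiable (by simp) _) (h1.mdifferentiable (by simp) _) 1
    rw [h3] at h6
    exact h6
  exact this hν

theorem Setup.tact_mem_W (g : G) {q : Q} {w : E} (hw : w ∈ W q) : tact g q w ∈ W (g • q) := by
  obtain ⟨ν, hν, rfl⟩ := h.exists_gen_eq_of_mem_W hw
  rw [tact_gen, h.gen_mem_W_iff]
  exact h.adj_mem_lieN g hν

theorem Setup.gauge_equivariant (g : G) (i : Fin k) (q : Q) :
    tact g q (gen G q (ζ i q)) = gen (E := E) G (g • q) (ζ i (g • q)) := by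
  have hA := smoothAct_id E Q 𝔤 G
  have hD : gen G (g • q) (ζ i (g • q)) - tact g q (gen G q (ζ i q)) ∈ sys.D (g • q) :=
    Submodule.sub_mem _ (h.gauge_mem_D i _) (h.sym.constraints g q _ (h.gauge_mem_D i q))
  obtain ⟨d, hd⟩ := (hA.tact_bijective g q).2
    (gen G (g • q) (ζ i (g • q)) - tact g q (gen G q (ζ i q)))
  have hd' : tact g q d = gen G (g • q) (ζ i (g • q)) - tact g q (gen G q (ζ i q)) := hd
  have hdD : d ∈ sys.D q := (tact_mem_iff hA sys.D h.sym.constraints g q d).mp (by rwa [hd'])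
  have h1 := h.gauge.invariant i g _ (mkCot_metric_mem hdD)
  rw [cotAct_metric hA h.sym, momentumOf_apply, momentumOf_apply] at h1
  simp only [covec_mkCot, mkCot_fst] at h1
  rw [← metric_invariant h.sym g q] at h1
  have h2 : sys.metric (g • q) (tact g q d) (tact g q d) = 0 := by
    conv_lhs => rw [show sys.metric (g • q) (tact g q d) (tact g q d) =
      sys.metric (g • q) (tact g q d) (gen G (g • q) (ζ i (g • q)) - tact g q (gen G q (ζ i q)))
      from congrArg _ hd']
    rw [map_sub, h1, sub_self]
  have := metric_definite h2
  rw [hd', sub_eq_zero] at this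
  exact this.symm

theorem Setup.adj_gauge (g : G) (i : Fin k) (q : Q) : adj g (ζ i q) = ζ i (g • q) :=
  h.gen_injective (g • q) (by rw [← tact_gen, h.gauge_equivariant])

theorem Setup.eta_proj (i : Fin k) (q : Q) :
    eta ζ i (NH.proj N q) = (Submodule.Quotient.mk (ζ i q) : lieF 𝔤 N) := by
  obtain ⟨n, hn, hq⟩ := (proj_eq_iff N (Quotient.out (NH.proj N q)) q).mp (Quotient.out_eq _)
  rw [eta, Submodule.Quotient.eq, ← hq, ← h.adj_gauge]
  exact h.adj_sub_mem hn q _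

end Setup

/-! ### Connection forms -/

section Frames

variable {E : Type*} [NormedAddCommGroup E] [NormedSpace ℝ E] [FiniteDimensional ℝ E]
  {H : Type*} [TopologicalSpace H] {I : ModelWithCorners ℝ E H} [I.Boundaryless]
  {X : Type*} [TopologicalSpace X] [ChartedSpace H X] [IsManifold I ∞ X]
  {V : Type*} [NormedAddCommGroup V] [NormedSpace ℝ V]

/-- A 1-form whose values on a smooth frame are smooth is smooth. -/
theorem FormAt.of_frame {ι : Type*} [Fintype ι] {F : ι → X → E} {θ : X → E →L[ℝ] V} {x₀ : X}
    (hF : ∀ i, SmAt I I (fun x => x) (F i) x₀) (hli : LinearIndependent ℝ fun i => F i x₀)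
    (hsp : ∀ᶠ x in 𝓝 x₀, ∀ v, ∃ c : ι → ℝ, v = ∑ i, c i • F i x)
    (hθ : ∀ i, ContMDiffAt I 𝓘(ℝ, V) ∞ (fun x => θ x (F i x)) x₀) : FormAt I θ x₀ := by
  refine FormAt.of_apply fun z hz => ?_
  have h1 : ∀ x, ∃ c : ι → ℝ, (∀ v, ∃ c : ι → ℝ, v = ∑ i, c i • F i x) → z x = ∑ i, c i • F i x := by
    intro x
    by_cases hx : ∀ v, ∃ c : ι → ℝ, v = ∑ i, c i • F i x
    · exact (hx (z x)).imp fun c hc _ => hc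
    · exact ⟨0, fun h => absurd h hx⟩
  choose c hc using h1
  have hev : ∀ᶠ x in 𝓝 x₀, z x = ∑ i, c x i • F i x := hsp.mono fun x hx => hc x hx
  have hcs : ∀ i, ContMDiffAt I 𝓘(ℝ, ℝ) ∞ (fun x => c x i) x₀ := fun i => by
    refine coeff_smoothAt (c := fun i x => c x i) contMDiffAt_id hF hli ?_
      (hz.congr .rfl (hev.mono fun x hx => hx.symm)) i
    intro v _
    obtain ⟨c, rfl⟩ := hsp.self_of_nhds v
    exact Submodule.sum_mem _ fun i _ => Submodule.smul_mem _ _ (Submodule.subset_span ⟨i, rfl⟩)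
  have h2 : ContMDiffAt I 𝓘(ℝ, V) ∞ (fun x => ∑ i, c x i • θ x (F i x)) x₀ :=
    contMDiffAt_finsetSum fun i _ => (hcs i).smul (hθ i)
  refine h2.congr_of_eventuallyEq (hev.mono fun x hx => ?_)
  simp only [← map_smul, ← map_sum]
  exact congrArg _ hx

end Frames

theorem quotient_mk_sum {R M ι : Type*} [Ring R] [AddCommGroup M] [Module R M] (p : Submodule R M)
    (s : Finset ι) (f : ι → M) :
    (Submodule.Quotient.mk (∑ i ∈ s, f i) : M ⧸ p) = ∑ i ∈ s, Submodule.Quotient.mk (f i) :=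
  map_sum p.mkQ f s

section ConnForm

variable {E : Type*} [NormedAddCommGroup E] [NormedSpace ℝ E] [FiniteDimensional ℝ E]
  {Q : Type*} [TopologicalSpace Q] [ChartedSpace E Q] [IsManifold 𝓘(ℝ, E) ∞ Q]
  {𝔤 : Type*} [NormedAddCommGroup 𝔤] [NormedSpace ℝ 𝔤] [FiniteDimensional ℝ 𝔤]
  {G : Type*} [Group G] [TopologicalSpace G] [ChartedSpace 𝔤 G] [LieGroup 𝓘(ℝ, 𝔤) ∞ G]
  [MulAction G Q] [ContMDiffSMul 𝓘(ℝ, 𝔤) 𝓘(ℝ, E) ∞ G Q]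
  {sys : System E Q} {k : ℕ} {ζ : Fin k → Q → 𝔤} {W Hor : PlaneField E Q}

theorem connForm_spec {K R : PlaneField E Q} {q : Q}
    (hinj : Function.Injective (gen (E := E) (𝔤 := 𝔤) G q)) (hc : IsCompl (K q) (R q)) :
    (∀ v ∈ K q, connForm (𝔤 := 𝔤) G K R q v = 0) ∧
      ∀ ξ : 𝔤, gen G q ξ ∈ R q → connForm G K R q (gen G q ξ) = ξ := by
  obtain ⟨r, hr⟩ := LinearMap.exists_leftInverse_of_injective
    (gen (E := E) (𝔤 := 𝔤) G q).toLinearMap (LinearMap.ker_eq_bot.mpr hinj)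
  refine Classical.epsilon_spec (p := fun A : E →L[ℝ] 𝔤 =>
    (∀ v ∈ K q, A v = 0) ∧ ∀ ξ : 𝔤, gen G q ξ ∈ R q → A (gen G q ξ) = ξ)
    ⟨r.toContinuousLinearMap.comp (projAlong (R q) (K q)), fun v hv => ?_, fun ξ hξ => ?_⟩
  · rw [ContinuousLinearMap.comp_apply, (projAlong_eq_zero hc.symm).mpr hv, map_zero]
  · rw [ContinuousLinearMap.comp_apply, projAlong_of_mem hc.symm hξ]
    exact LinearMap.congr_fun hr ξ

end ConnForm

section Setup

variable {E : Type*} [NormedAddCommGroup E] [NormedSpace ℝ E] [FiniteDimensional ℝ E]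
  {Q : Type*} [TopologicalSpace Q] [ChartedSpace E Q] [IsManifold 𝓘(ℝ, E) ∞ Q] [T2Space Q]
  {𝔤 : Type*} [NormedAddCommGroup 𝔤] [NormedSpace ℝ 𝔤] [FiniteDimensional ℝ 𝔤]
  {G : Type*} [Group G] [TopologicalSpace G] [ChartedSpace 𝔤 G] [LieGroup 𝓘(ℝ, 𝔤) ∞ G]
  [MulAction G Q] [ContMDiffSMul 𝓘(ℝ, 𝔤) 𝓘(ℝ, E) ∞ G Q] [ProperSMul G Q]
  {sys : System E Q} {k : ℕ} {ζ : Fin k → Q → 𝔤} {W Hor : PlaneField E Q}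
  {N : Subgroup G} [N.Normal]
  {E₁ : Type*} [NormedAddCommGroup E₁] [NormedSpace ℝ E₁] [FiniteDimensional ℝ E₁]
  [ChartedSpace E₁ (OrbitSpace Q N)] [IsManifold 𝓘(ℝ, E₁) ∞ (OrbitSpace Q N)]

variable (h : Setup sys ζ W Hor N E₁)
include h

theorem Setup.lie_decomp (q : Q) (ξ : 𝔤) :
    ∃ c : Fin k → ℝ, ∃ ν ∈ lieN 𝔤 N, ξ = ∑ i, c i • ζ i q + ν := by
  have h1 := h.sub_PD_mem q (gen G q ξ)
  obtain ⟨ν, hν, hν'⟩ := h.exists_gen_eq_of_mem_W h1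
  have h2 : PD sys W q (gen G q ξ) = gen G q (ξ - ν) := by rw [map_sub, hν']; abel
  have h3 : gen G q (ξ - ν) ∈ distS 𝔤 G sys q :=
    ⟨by rw [← h2]; exact h.PD_mem q _, gen_mem_vert q _⟩
  rw [← h.span_gaugeField q] at h3
  obtain ⟨c, hc⟩ := (Submodule.mem_span_range_iff_exists_fun ℝ).mp h3
  refine ⟨c, ν, hν, ?_⟩
  have h4 : ∑ i, c i • ζ i q = ξ - ν := h.gen_injective q (by rw [← hc]; simp [map_sum])
  rw [h4]; abel

theorem Setup.lie_independent {q : Q} {c : Fin k → ℝ} (hc : ∑ i, c i • ζ i q ∈ lieN 𝔤 N) :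
    c = 0 := by
  have h1 := (h.gen_mem_W_iff q _).mpr hc
  have h2 : gen G q (∑ i, c i • ζ i q) ∈ sys.D q := by
    rw [map_sum]
    refine Submodule.sum_mem _ fun i _ => ?_
    rw [map_smul]; exact Submodule.smul_mem _ _ (h.gauge_mem_D i q)
  have h3 := Submodule.disjoint_def.mp (h.compl.compl q).disjoint _ h2 h1
  rw [map_sum] at h3
  simp only [map_smul] at h3
  exact funext fun i => Fintype.linearIndependent_iff.mp (h.linearIndependent_gaugeField q) c h3 i

theorem Setup.linearIndependent_eta (x : OrbitSpace Q N) :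
    LinearIndependent ℝ fun i => eta (𝔤 := 𝔤) ζ i x := by
  refine Fintype.linearIndependent_iff.mpr fun c hc => congrFun ?_
  refine h.lie_independent (q := Quotient.out x) ((Submodule.Quotient.mk_eq_zero _).mp ?_)
  rw [← hc]
  simp only [eta, quotient_mk_sum, Submodule.Quotient.mk_smul]

theorem Setup.span_eta (x : OrbitSpace Q N) :
    ⊤ ≤ Submodule.span ℝ (Set.range fun i => eta (𝔤 := 𝔤) ζ i x) := by
  rintro ξ -
  induction ξ using Submodule.Quotient.induction_on with
  | H ξ =>
  obtain ⟨c, ν, hν, rfl⟩ := h.lie_decomp (Quotient.out x) ξ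
  rw [Submodule.Quotient.mk_add, (Submodule.Quotient.mk_eq_zero _).mpr hν, add_zero,
    quotient_mk_sum]
  exact Submodule.sum_mem _ fun i _ => Submodule.smul_mem _ (c i)
    (Submodule.subset_span (Set.mem_range_self i))

/-- The basis `η_1, …, η_k` of `𝔣`. -/
def Setup.etaBasis (x : OrbitSpace Q N) : Module.Basis (Fin k) ℝ (lieF 𝔤 N) :=
  Module.Basis.mk (h.linearIndependent_eta x) (h.span_eta x)

theorem Setup.etaBasis_apply (x : OrbitSpace Q N) (i : Fin k) :
    h.etaBasis x i = eta ζ i x := Module.Basis.mk_apply _ _ _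

theorem Setup.muDual_eta (i j : Fin k) (x : OrbitSpace Q N) :
    muDual ζ i x (eta (𝔤 := 𝔤) ζ j x) = if i = j then 1 else 0 := by
  refine Classical.epsilon_spec (p := fun l : Module.Dual ℝ (lieF 𝔤 N) =>
    ∀ j, l (eta ζ j x) = if i = j then 1 else 0) ⟨(h.etaBasis x).coord i, fun j => ?_⟩ j
  rw [← h.etaBasis_apply, Module.Basis.coord_apply, Module.Basis.repr_self, Finsupp.single_apply]
  simp only [eq_comm]

/-! The connection with horizontal space `D`. -/

theorem Setup.AW_of_mem {q : Q} {v : E} (hv : v ∈ sys.D q) : connForm (𝔤 := 𝔤) G sys.D W q v = 0 :=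
  (connForm_spec (h.gen_injective q) (h.compl.compl q)).1 v hv

theorem Setup.AW_gen (q : Q) {ν : 𝔤} (hν : ν ∈ lieN 𝔤 N) :
    connForm G sys.D W q (gen G q ν) = ν :=
  (connForm_spec (h.gen_injective q) (h.compl.compl q)).2 ν ((h.gen_mem_W_iff q ν).mpr hν)

theorem Setup.gen_AW (q : Q) (v : E) :
    gen G q (connForm (𝔤 := 𝔤) G sys.D W q v) = v - PD sys W q v := by
  obtain ⟨ν, hν, hν'⟩ := h.exists_gen_eq_of_mem_W (h.sub_PD_mem q v)
  have h1 : connForm (𝔤 := 𝔤) G sys.D W q v = ν := by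
    rw [← h.AW_gen q hν, hν', map_sub, h.AW_of_mem (h.PD_mem q v), sub_zero]
  rw [h1, hν']

theorem Setup.AW_mem (q : Q) (v : E) : connForm (𝔤 := 𝔤) G sys.D W q v ∈ lieN 𝔤 N := by
  rw [← h.gen_mem_W_iff q, h.gen_AW]
  exact h.sub_PD_mem q v

/-! The principal connection. -/

theorem Setup.A_of_mem {q : Q} {v : E} (hv : v ∈ Hor q) :
    connForm (𝔤 := 𝔤) G Hor (vert (𝔤 := 𝔤) G) q v = 0 :=
  (connForm_spec (h.gen_injective q) (h.hor.compl q)).1 v hv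

theorem Setup.A_gen (q : Q) (ξ : 𝔤) :
    connForm (𝔤 := 𝔤) G Hor (vert (𝔤 := 𝔤) G) q (gen G q ξ) = ξ :=
  (connForm_spec (h.gen_injective q) (h.hor.compl q)).2 ξ (gen_mem_vert q ξ)

theorem Setup.PH_mem (q : Q) (v : E) : PH 𝔤 G Hor q v ∈ Hor q := projAlong_mem (h.hor.compl q) v

theorem Setup.PH_of_mem {q : Q} {v : E} (hv : v ∈ Hor q) : PH 𝔤 G Hor q v = v :=
  projAlong_of_mem (h.hor.compl q) hv

theorem Setup.PH_gen (q : Q) (ξ : 𝔤) : PH 𝔤 G Hor q (gen G q ξ) = 0 :=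
  (projAlong_eq_zero (h.hor.compl q)).mpr (gen_mem_vert q ξ)

theorem Setup.gen_A (q : Q) (v : E) :
    gen G q (connForm (𝔤 := 𝔤) G Hor (vert (𝔤 := 𝔤) G) q v) = v - PH 𝔤 G Hor q v := by
  obtain ⟨ξ, hξ⟩ := sub_projAlong_mem (h.hor.compl q) v
  have hξ' : gen G q ξ = v - PH 𝔤 G Hor q v := hξ
  have h1 : connForm (𝔤 := 𝔤) G Hor (vert (𝔤 := 𝔤) G) q v = ξ := by
    rw [← h.A_gen q ξ, hξ', map_sub, h.A_of_mem (h.PH_mem q v), sub_zero]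
  rw [h1, hξ']

theorem Setup.decomp (q : Q) (v : E) : ∃ u ∈ Hor q, ∃ c : Fin k → ℝ, ∃ ν ∈ lieN 𝔤 N,
    v = u + ∑ i, c i • gen G q (ζ i q) + gen G q ν := by
  obtain ⟨c, ν, hν, hc⟩ := h.lie_decomp q (connForm (𝔤 := 𝔤) G Hor (vert (𝔤 := 𝔤) G) q v)
  refine ⟨_, h.PH_mem q v, c, ν, hν, ?_⟩
  have := h.gen_A q v
  rw [hc, map_add, map_sum] at this
  simp only [map_smul] at this
  rw [add_assoc, this]; abel

theorem Setup.form_ext {V : Type*} [NormedAddCommGroup V] [NormedSpace ℝ V] {q : Q} {θ θ' : E →L[ℝ] V}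
    (h1 : ∀ u ∈ Hor q, θ u = θ' u) (h2 : ∀ i, θ (gen G q (ζ i q)) = θ' (gen G q (ζ i q)))
    (h3 : ∀ ν ∈ lieN 𝔤 N, θ (gen G q ν) = θ' (gen G q ν)) (v : E) : θ v = θ' v := by
  obtain ⟨u, hu, c, ν, hν, rfl⟩ := h.decomp q v
  simp only [map_add, map_sum, map_smul, h1 u hu, h2, h3 ν hν]

theorem Setup.Yform_spec (i : Fin k) (q : Q) :
    (∀ v ∈ Hor q, Yform G W Hor ζ i q v = 0) ∧ (∀ v ∈ W q, Yform G W Hor ζ i q v = 0) ∧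
      ∀ j, Yform G W Hor ζ i q (gen G q (ζ j q)) = if i = j then 1 else 0 := by
  refine Classical.epsilon_spec (p := fun θ : E →L[ℝ] ℝ =>
    (∀ v ∈ Hor q, θ v = 0) ∧ (∀ v ∈ W q, θ v = 0) ∧
      ∀ j, θ (gen G q (ζ j q)) = if i = j then 1 else 0)
    ⟨((muDual ζ i (NH.proj N q)).comp (lieN 𝔤 N).mkQ).toContinuousLinearMap.comp
      (connForm (𝔤 := 𝔤) G Hor (vert (𝔤 := 𝔤) G) q), fun v hv => ?_, fun v hv => ?_, fun j => ?_⟩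
  · rw [ContinuousLinearMap.comp_apply, h.A_of_mem hv, map_zero]
  · obtain ⟨ν, hν, rfl⟩ := h.exists_gen_eq_of_mem_W hv
    rw [ContinuousLinearMap.comp_apply, h.A_gen]
    simp [(Submodule.Quotient.mk_eq_zero _).mpr hν]
  · rw [ContinuousLinearMap.comp_apply, h.A_gen]
    rw [← h.muDual_eta i j (NH.proj N q), h.eta_proj]
    rfl

theorem Setup.Y_Hor (i : Fin k) {q : Q} {v : E} (hv : v ∈ Hor q) : Yform G W Hor ζ i q v = 0 :=
  (h.Yform_spec i q).1 v hv

theorem Setup.Y_W (i : Fin k) {q : Q} {v : E} (hv : v ∈ W q) : Yform G W Hor ζ i q v = 0 :=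
  (h.Yform_spec i q).2.1 v hv

theorem Setup.Y_gauge (i j : Fin k) (q : Q) :
    Yform G W Hor ζ i q (gen G q (ζ j q)) = if i = j then 1 else 0 := (h.Yform_spec i q).2.2 j

theorem Setup.A_eq (q : Q) (v : E) : connForm (𝔤 := 𝔤) G Hor (vert (𝔤 := 𝔤) G) q v =
    connForm G sys.D W q v + ∑ i, Yform G W Hor ζ i q v • ζ i q := by
  have := h.form_ext (q := q) (θ := connForm (𝔤 := 𝔤) G Hor (vert (𝔤 := 𝔤) G) q)
    (θ' := connForm G sys.D W q + ∑ i, (Yform G W Hor ζ i q).smulRight (ζ i q))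
    (fun u hu => ?_) (fun i => ?_) (fun ν hν => ?_) v
  · simpa [sum_apply] using this
  · simp [sum_apply, h.A_of_mem hu, h.AW_of_mem (h.hor.le_D q hu), h.Y_Hor _ hu]
  · simp [sum_apply, h.A_gen, h.AW_of_mem (h.gauge_mem_D i q), h.Y_gauge]
  · simp [sum_apply, h.A_gen, h.AW_gen q hν, h.Y_W _ ((h.gen_mem_W_iff q ν).mpr hν)]

/-! Smoothness. -/

theorem Setup.formAt_of_frame {V : Type*} [NormedAddCommGroup V] [NormedSpace ℝ V]
    {θ : Q → E →L[ℝ] V} {q : Q}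
    (h1 : ∀ Z : Q → E, SmAt 𝓘(ℝ, E) 𝓘(ℝ, E) (fun x : Q => x) Z q → (∀ᶠ x in 𝓝 q, Z x ∈ Hor x) →
      ContMDiffAt 𝓘(ℝ, E) 𝓘(ℝ, V) ∞ (fun x => θ x (Z x)) q)
    (h2 : ∀ i, ContMDiffAt 𝓘(ℝ, E) 𝓘(ℝ, V) ∞ (fun x => θ x (gen G x (ζ i x))) q)
    (h3 : ∀ ν ∈ lieN 𝔤 N, ContMDiffAt 𝓘(ℝ, E) 𝓘(ℝ, V) ∞ (fun x => θ x (gen G x ν)) q) :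
    FormAt 𝓘(ℝ, E) θ q := by
  obtain ⟨r, hr⟩ := h.hor.distribution
  obtain ⟨s, hs, Z, hZ, hsp⟩ := hr q
  let b := Module.finBasis ℝ (lieN 𝔤 N)
  let F : Fin r ⊕ Fin k ⊕ Fin (Module.finrank ℝ (lieN 𝔤 N)) → Q → E :=
    Sum.elim Z (Sum.elim (fun i x => gen G x (ζ i x)) fun l x => gen G x (b l : 𝔤))
  have hZs : ∀ i, SmAt 𝓘(ℝ, E) 𝓘(ℝ, E) (fun x : Q => x) (Z i) q := fun i =>
    (hZ i).contMDiffAt hs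
  have hZm : ∀ x ∈ s, ∀ i, Z i x ∈ Hor x := fun x hx i => by
    rw [← (hsp x hx).2]; exact Submodule.subset_span ⟨i, rfl⟩
  refine FormAt.of_frame (F := F) ?_ ?_ ?_ ?_
  · rintro (i | i | l)
    · exact hZs i
    · exact h.gaugeField_smooth i q
    · exact (smoothAct_id E Q 𝔤 G).rgen_smoothAt contMDiffAt_id contMDiffAt_const
  · refine Fintype.linearIndependent_iff.mpr fun c hc => ?_
    simp only [Fintype.sum_sum_type, F, Sum.elim_inl, Sum.elim_inr] at hc
    have hq := mem_of_mem_nhds hs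
    have h4 := congrArg (PH 𝔤 G Hor q) hc
    simp only [map_add, map_sum, map_smul, h.PH_gen, h.PH_of_mem (hZm q hq _), smul_zero,
      Finset.sum_const_zero, add_zero, map_zero] at h4
    have h5 := Fintype.linearIndependent_iff.mp (hsp q hq).1 _ h4
    have h6 := congrArg (connForm (𝔤 := 𝔤) G Hor (vert (𝔤 := 𝔤) G) q) hc
    simp only [h5, zero_smul, Finset.sum_const_zero, zero_add, map_add, map_sum, map_smul, h.A_gen,
      map_zero] at h6
    have h7 : ∑ l, c (Sum.inr (Sum.inr l)) • (b l : 𝔤) ∈ lieN 𝔤 N :=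
      Submodule.sum_mem _ fun l _ => Submodule.smul_mem _ _ (b l).2
    have h8 := h.lie_independent (c := fun i => c (Sum.inr (Sum.inl i))) (q := q)
      (by rw [eq_neg_of_add_eq_zero_left h6]; exact Submodule.neg_mem _ h7)
    have h9 : ∑ l, c (Sum.inr (Sum.inr l)) • b l = 0 := by
      simp only [show ∀ i, c (Sum.inr (Sum.inl i)) = 0 from congrFun h8, zero_smul,
        Finset.sum_const_zero, zero_add] at h6
      exact Subtype.ext (by simpa using h6)
    have h10 := Fintype.linearIndependent_iff.mp b.linearIndependent _ h9
    rintro (i | i | l)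
    · exact h5 i
    · exact congrFun h8 i
    · exact h10 l
  · filter_upwards [hs] with x hx v
    obtain ⟨u, hu, c, ν, hν, rfl⟩ := h.decomp x v
    rw [← (hsp x hx).2] at hu
    obtain ⟨a, rfl⟩ := (Submodule.mem_span_range_iff_exists_fun ℝ).mp hu
    refine ⟨Sum.elim a (Sum.elim c fun l => b.repr ⟨ν, hν⟩ l), ?_⟩
    have h4 := congrArg (fun w : lieN 𝔤 N => gen (E := E) G x (w : 𝔤)) (b.sum_repr ⟨ν, hν⟩)
    simp only [Submodule.coe_sum, Submodule.coe_smul, map_sum, map_smul] at h4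
    simp only [Fintype.sum_sum_type, F, Sum.elim_inl, Sum.elim_inr, h4]
    abel
  · rintro (i | i | l)
    · exact h1 _ (hZs i) (by filter_upwards [hs] with x hx using hZm x hx i)
    · exact h2 i
    · exact h3 _ (b l).2

theorem Setup.A_formAt (q : Q) : FormAt 𝓘(ℝ, E) (connForm (𝔤 := 𝔤) G Hor (vert (𝔤 := 𝔤) G)) q := by
  refine h.formAt_of_frame (fun Z _ hZ => ?_) (fun i => ?_) (fun ν hν => ?_)
  · exact (contMDiffAt_const (c := 0)).congr_of_eventuallyEq (hZ.mono fun x hx => h.A_of_mem hx)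
  · simpa only [h.A_gen] using (h.gauge.smooth i).contMDiffAt
  · simpa only [h.A_gen] using contMDiffAt_const

theorem Setup.AW_formAt (q : Q) : FormAt 𝓘(ℝ, E) (connForm (𝔤 := 𝔤) G sys.D W) q := by
  refine h.formAt_of_frame (fun Z _ hZ => ?_) (fun i => ?_) (fun ν hν => ?_)
  · exact (contMDiffAt_const (c := 0)).congr_of_eventuallyEq
      (hZ.mono fun x hx => h.AW_of_mem (h.hor.le_D x hx))
  · simpa only [h.AW_of_mem (h.gauge_mem_D _ _)] using contMDiffAt_const
  · simpa only [h.AW_gen _ hν] using contMDiffAt_const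

theorem Setup.Y_formAt (i : Fin k) (q : Q) : FormAt 𝓘(ℝ, E) (Yform G W Hor ζ i) q := by
  refine h.formAt_of_frame (fun Z _ hZ => ?_) (fun j => ?_) (fun ν hν => ?_)
  · exact (contMDiffAt_const (c := 0)).congr_of_eventuallyEq (hZ.mono fun x hx => h.Y_Hor i hx)
  · simpa only [h.Y_gauge] using contMDiffAt_const
  · simpa only [h.Y_W i ((h.gen_mem_W_iff _ ν).mpr hν)] using contMDiffAt_const

/-! Equivariance. -/

theorem Setup.AW_equivariant (g : G) (q : Q) (v : E) :
    connForm (𝔤 := 𝔤) G sys.D W (g • q) (tact g q v) = adj g (connForm G sys.D W q v) := by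
  have h1 := h.gen_AW q v
  have h2 : v = PD sys W q v + gen G q (connForm (𝔤 := 𝔤) G sys.D W q v) := by rw [h1]; abel
  conv_lhs => rw [h2]
  rw [map_add, map_add, h.AW_of_mem (h.sym.constraints g q _ (h.PD_mem q v)), zero_add, tact_gen,
    h.AW_gen _ (h.adj_mem_lieN g (h.AW_mem q v))]

theorem Setup.Y_equivariant (i : Fin k) (g : G) (q : Q) (v : E) :
    Yform G W Hor ζ i (g • q) (tact g q v) = Yform G W Hor ζ i q v := by
  obtain ⟨u, hu, c, ν, hν, rfl⟩ := h.decomp q v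
  simp only [map_add, map_sum, map_smul, h.gauge_equivariant, h.Y_gauge,
    h.Y_Hor i hu, h.Y_Hor i (h.hor.invariant g q u hu),
    h.Y_W i ((h.gen_mem_W_iff q ν).mpr hν),
    h.Y_W i (h.tact_mem_W g ((h.gen_mem_W_iff q ν).mpr hν))]

theorem Setup.PD_equivariant (g : G) (q : Q) (v : E) :
    PD sys W (g • q) (tact g q v) = tact g q (PD sys W q v) :=
  projAlong_unique (h.compl.compl _) (h.sym.constraints g q _ (h.PD_mem q v))
    (by rw [← map_sub]; exact h.tact_mem_W g (h.sub_PD_mem q v))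

theorem Setup.PH_equivariant (g : G) (q : Q) (v : E) :
    PH 𝔤 G Hor (g • q) (tact g q v) = tact g q (PH 𝔤 G Hor q v) := by
  refine projAlong_unique (h.hor.compl _) (h.hor.invariant g q _ (h.PH_mem q v)) ?_
  rw [← map_sub, ← h.gen_A, tact_gen]
  exact gen_mem_vert _ _

end Setup

/-! ### Algebra of exterior derivatives -/

section ExtD

variable {E : Type*} [NormedAddCommGroup E] [NormedSpace ℝ E] [FiniteDimensional ℝ E]
  {H : Type*} [TopologicalSpace H] {I : ModelWithCorners ℝ E H} [I.Boundaryless]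
  {X : Type*} [TopologicalSpace X] [ChartedSpace H X] [IsManifold I ∞ X]
  {V : Type*} [NormedAddCommGroup V] [NormedSpace ℝ V]
  {V' : Type*} [NormedAddCommGroup V'] [NormedSpace ℝ V']

theorem FormAt.add {θ θ' : X → E →L[ℝ] V} {x : X} (h : FormAt I θ x) (h' : FormAt I θ' x) :
    FormAt I (fun x => θ x + θ' x) x :=
  FormAt.of_apply fun _ hz => (FormAt.apply (f := fun x => x) h hz).add
    (FormAt.apply (f := fun x => x) h' hz)

theorem FormAt.comp_left {θ : X → E →L[ℝ] V} {f : X → V →L[ℝ] V'} {x : X} (h : FormAt I θ x)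
    (hf : ContMDiffAt I 𝓘(ℝ, V →L[ℝ] V') ∞ f x) : FormAt I (fun x => (f x).comp (θ x)) x :=
  FormAt.of_apply fun _ hz => hf.clm_apply (FormAt.apply (f := fun x => x) h hz)

theorem extD_aux {θ : X → E →L[ℝ] V} {x : X} (h : FormAt I θ x) (b : E) :
    DifferentiableAt ℝ (fun y => θ ((extChartAt I x).symm y)
      (tmap 𝓘(ℝ, E) I (extChartAt I x).symm y b)) (extChartAt I x x) := by
  have hs := smooth_ext_symm (I := I) (mem_extChartAt_target (I := I) x)
  have h0 : (extChartAt I x).symm (extChartAt I x x) = x := extChartAt_to_inv x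
  have h1 : SmAt I 𝓘(ℝ, E) (fun y => (extChartAt I x).symm y)
      (fun y => tmap 𝓘(ℝ, E) I (extChartAt I x).symm y b) (extChartAt I x x) :=
    SmAt.tmap (f := fun y : E => y) hs
      (smAt_vectorSpace_iff.mpr ⟨contMDiffAt_id, contMDiffAt_const⟩)
  have h2 := FormAt.apply (f := fun y => (extChartAt I x).symm y) (y₀ := extChartAt I x x)
    (by simpa only [h0] using h) h1
  exact (h2.mdifferentiableAt (by simp)).differentiableAt

/-- The exterior derivative computed in the chart at the point. -/
theorem extD_eq {θ : X → E →L[ℝ] V} {x : X} (h : FormAt I θ x) (u v : E) : extD I θ x u v =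
    fderiv ℝ (fun y => θ ((extChartAt I x).symm y) (tmap 𝓘(ℝ, E) I (extChartAt I x).symm y v))
      (extChartAt I x x) u -
    fderiv ℝ (fun y => θ ((extChartAt I x).symm y) (tmap 𝓘(ℝ, E) I (extChartAt I x).symm y u))
      (extChartAt I x x) v := by
  have hs := smooth_ext_symm (I := I) (mem_extChartAt_target (I := I) x)
  have h0 : (extChartAt I x).symm (extChartAt I x x) = x := extChartAt_to_inv x
  have h1 := extD_param (c := (extChartAt I x).symm) (p := extChartAt I x x)
    (by simpa only [h0] using h) hs u v
  have h2 : ∀ w, tmap 𝓘(ℝ, E) I (extChartAt I x).symm (extChartAt I x x) w = w := fun w => by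
    have := cfi_self (I := I) x
    exact congrArg (fun L : E →L[ℝ] E => L w) this
  rw [h2, h2, h0] at h1
  exact h1

theorem extD_add {θ θ' : X → E →L[ℝ] V} {x : X} (h : FormAt I θ x) (h' : FormAt I θ' x) (u v : E) :
    extD I (fun x => θ x + θ' x) x u v = extD I θ x u v + extD I θ' x u v := by
  rw [extD_eq h, extD_eq h', extD_eq (h.add h')]
  simp only [add_apply]
  rw [fderiv_fun_add (extD_aux h v) (extD_aux h' v), fderiv_fun_add (extD_aux h u) (extD_aux h' u)]
  simp only [add_apply]
  abel

theorem FormAt.sum {ι : Type*} (s : Finset ι) {θ : ι → X → E →L[ℝ] V} {x : X}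
    (h : ∀ i, FormAt I (θ i) x) : FormAt I (fun x => ∑ i ∈ s, θ i x) x := by
  refine FormAt.of_apply fun z hz => ?_
  simp only [sum_apply]
  exact contMDiffAt_finsetSum fun i _ => FormAt.apply (f := fun x => x) (h i) hz

theorem extD_sum {ι : Type*} (s : Finset ι) {θ : ι → X → E →L[ℝ] V} {x : X}
    (h : ∀ i, FormAt I (θ i) x) (u v : E) :
    extD I (fun x => ∑ i ∈ s, θ i x) x u v = ∑ i ∈ s, extD I (θ i) x u v := by
  rw [extD_eq (FormAt.sum s h)]
  simp only [sum_apply, extD_eq (h _)]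
  rw [fderiv_fun_sum fun i _ => extD_aux (h i) v, fderiv_fun_sum fun i _ => extD_aux (h i) u]
  simp only [sum_apply, Finset.sum_sub_distrib]

/-- `d⟨f, θ⟩ = ⟨f, dθ⟩` on the kernel of `θ`. -/
theorem extD_comp_left {θ : X → E →L[ℝ] V} {f : X → V →L[ℝ] V'} {x : X} (h : FormAt I θ x)
    (hf : ContMDiffAt I 𝓘(ℝ, V →L[ℝ] V') ∞ f x) {u v : E} (hu : θ x u = 0) (hv : θ x v = 0) :
    extD I (fun x => (f x).comp (θ x)) x u v = f x (extD I θ x u v) := by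
  have hs := smooth_ext_symm (I := I) (mem_extChartAt_target (I := I) x)
  have h0 : (extChartAt I x).symm (extChartAt I x x) = x := extChartAt_to_inv x
  have h2 : ∀ w, tmap 𝓘(ℝ, E) I (extChartAt I x).symm (extChartAt I x x) w = w := fun w => by
    have := cfi_self (I := I) x
    exact congrArg (fun L : E →L[ℝ] E => L w) this
  have hfd : DifferentiableAt ℝ (fun y => f ((extChartAt I x).symm y)) (extChartAt I x x) := by
    have := ContMDiffAt.comp (extChartAt I x x) (g := f) (f := (extChartAt I x).symm)
      (by simpa only [h0] using hf) hs
    exact (this.mdifferentiableAt (by simp)).differentiableAt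
  rw [extD_eq h, extD_eq (h.comp_left hf)]
  simp only [ContinuousLinearMap.comp_apply]
  have key : ∀ a b : E, θ x b = 0 → fderiv ℝ (fun y => f ((extChartAt I x).symm y)
      (θ ((extChartAt I x).symm y) (tmap 𝓘(ℝ, E) I (extChartAt I x).symm y b)))
      (extChartAt I x x) a = f x (fderiv ℝ (fun y => θ ((extChartAt I x).symm y)
        (tmap 𝓘(ℝ, E) I (extChartAt I x).symm y b)) (extChartAt I x x) a) := by
    intro a b hb
    rw [fderiv_clm_apply hfd (extD_aux h b)]
    simp only [ContinuousLinearMap.comp_apply, h0, h2, hb,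
      map_zero, add_zero]
  rw [key u v hv, key v u hu, map_sub]

theorem extD_self (θ : X → E →L[ℝ] V) (x : X) (u : E) : extD I θ x u u = 0 := by
  simp [extD]

end ExtD

section Metric

variable {E : Type*} [NormedAddCommGroup E] [NormedSpace ℝ E] [FiniteDimensional ℝ E]
  {Q : Type*} [TopologicalSpace Q] [ChartedSpace E Q] [IsManifold 𝓘(ℝ, E) ∞ Q]
  {sys : System E Q}
  {E' : Type*} [NormedAddCommGroup E'] [NormedSpace ℝ E'] {H' : Type*} [TopologicalSpace H']
  {I' : ModelWithCorners ℝ E' H'} {Y : Type*} [TopologicalSpace Y] [ChartedSpace H' Y]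

theorem metric_form2At (q : Q) : Form2At 𝓘(ℝ, E) sys.metric q := by
  refine Form2At.of_apply fun z w hz hw => ?_
  have := ContMDiffAt.clm_bundle_apply₂ (F₁ := E) (E₁ := fun q : Q => TangentSpace 𝓘(ℝ, E) q)
    sys.κ.contMDiff.contMDiffAt hz hw
  rw [contMDiffAt_totalSpace] at this
  exact this.2

theorem vel_smoothAt {α : Y → Cot E Q} {y₀ : Y} (hα : ContMDiffAt I' (cotI E) ∞ α y₀) :
    SmAt 𝓘(ℝ, E) I' (fun y => (α y).1) (fun y => sys.vel (α y)) y₀ := by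
  refine SmAt.of_form2 (metric_form2At (sys := sys) _) (fun v hv => metric_definite (hv v))
    (cot_base hα) fun w hw => ?_
  simp only [metric_vel]
  exact covec_apply_smoothAt hα hw

theorem mkCot_smoothAt {f : Y → Q} {z : Y → E} {y₀ : Y} (hz : SmAt 𝓘(ℝ, E) I' f z y₀) :
    ContMDiffAt I' (cotI E) ∞ (fun y => mkCot (f y) (sys.metric (f y) (z y))) y₀ := by
  refine cotAt_of_apply hz.base fun w hw => ?_
  exact Form2At.apply (metric_form2At (sys := sys) _) hz hw

theorem hamiltonian_smoothAt (α : Cot E Q) : ContMDiffAt (cotI E) 𝓘(ℝ, ℝ) ∞ sys.hamiltonian α := by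
  have h1 := covec_apply_smoothAt (α := fun a : Cot E Q => a) contMDiffAt_id
    (vel_smoothAt (sys := sys) (y₀ := α) contMDiffAt_id)
  have h2 : ContMDiffAt (cotI E) 𝓘(ℝ, ℝ) ∞ (fun a : Cot E Q => sys.U a.1) α :=
    ContMDiffAt.comp α (g := sys.U) sys.U_smooth.contMDiffAt (smooth_pr α)
  refine ((contMDiffAt_const (I' := 𝓘(ℝ, ℝ)) (c := (1 / 2 : ℝ))).smul h1 |>.add h2).congr_of_eventuallyEq
    (.of_forall fun a => hamiltonian_eq a)

end Metric

/-! ### The first reduction -/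

section Setup

variable {E : Type*} [NormedAddCommGroup E] [NormedSpace ℝ E] [FiniteDimensional ℝ E]
  {Q : Type*} [TopologicalSpace Q] [ChartedSpace E Q] [IsManifold 𝓘(ℝ, E) ∞ Q] [T2Space Q]
  {𝔤 : Type*} [NormedAddCommGroup 𝔤] [NormedSpace ℝ 𝔤] [FiniteDimensional ℝ 𝔤]
  {G : Type*} [Group G] [TopologicalSpace G] [ChartedSpace 𝔤 G] [LieGroup 𝓘(ℝ, 𝔤) ∞ G]
  [MulAction G Q] [ContMDiffSMul 𝓘(ℝ, 𝔤) 𝓘(ℝ, E) ∞ G Q] [ProperSMul G Q]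
  {sys : System E Q} {k : ℕ} {ζ : Fin k → Q → 𝔤} {W Hor : PlaneField E Q}
  {N : Subgroup G} [N.Normal]
  {E₁ : Type*} [NormedAddCommGroup E₁] [NormedSpace ℝ E₁] [FiniteDimensional ℝ E₁]
  [ChartedSpace E₁ (OrbitSpace Q N)] [IsManifold 𝓘(ℝ, E₁) ∞ (OrbitSpace Q N)]

variable (h : Setup sys ζ W Hor N E₁)
include h

section Smooth

variable {E' : Type*} [NormedAddCommGroup E'] [NormedSpace ℝ E'] {H' : Type*} [TopologicalSpace H']
  {I' : ModelWithCorners ℝ E' H'} {Y : Type*} [TopologicalSpace Y] [ChartedSpace H' Y]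

theorem Setup.PD_smoothAt {f : Y → Q} {z : Y → E} {y₀ : Y} (hz : SmAt 𝓘(ℝ, E) I' f z y₀) :
    SmAt 𝓘(ℝ, E) I' f (fun y => PD sys W (f y) (z y)) y₀ := by
  have h1 : SmAt 𝓘(ℝ, E) I' f (fun y => gen G (f y) (connForm (𝔤 := 𝔤) G sys.D W (f y) (z y))) y₀ :=
    (smoothAct_id E Q 𝔤 G).rgen_smoothAt hz.base (FormAt.apply (h.AW_formAt _) hz)
  refine (hz.sub h1).congr .rfl (.of_forall fun y => ?_)
  simp only [h.gen_AW]; abel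

theorem Setup.PH_smoothAt {f : Y → Q} {z : Y → E} {y₀ : Y} (hz : SmAt 𝓘(ℝ, E) I' f z y₀) :
    SmAt 𝓘(ℝ, E) I' f (fun y => PH 𝔤 G Hor (f y) (z y)) y₀ := by
  have h1 : SmAt 𝓘(ℝ, E) I' f
      (fun y => gen G (f y) (connForm (𝔤 := 𝔤) G Hor (vert (𝔤 := 𝔤) G) (f y) (z y))) y₀ :=
    (smoothAct_id E Q 𝔤 G).rgen_smoothAt hz.base (FormAt.apply (h.A_formAt _) hz)
  refine (hz.sub h1).congr .rfl (.of_forall fun y => ?_)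
  simp only [h.gen_A]; abel

theorem Setup.hlift_smoothAt {f : Y → Q} {w : Y → E₁} {y₀ : Y} (hf : ContMDiffAt I' 𝓘(ℝ, E) ∞ f y₀)
    (hw : SmAt 𝓘(ℝ, E₁) I' (fun y => NH.proj N (f y)) w y₀) :
    SmAt 𝓘(ℝ, E) I' f (fun y => hlift sys N (f y) (w y)) y₀ := by
  obtain ⟨p, hp⟩ := LinearMap.exists_leftInverse_of_injective (lieN 𝔤 N).subtype
    (LinearMap.ker_eq_bot.mpr Subtype.val_injective)
  have hp' : ∀ ν (hν : ν ∈ lieN 𝔤 N), p.toContinuousLinearMap ν = ⟨ν, hν⟩ := fun ν hν =>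
    LinearMap.congr_fun hp ⟨ν, hν⟩
  let θ : Q → E →L[ℝ] E₁ × lieN 𝔤 N := fun q =>
    ((cf 𝓘(ℝ, E₁) (NH.proj N (f y₀)) (NH.proj N q)).comp (tproj N q)).prod
      (p.toContinuousLinearMap.comp (connForm (𝔤 := 𝔤) G sys.D W q))
  have hθ : FormAt 𝓘(ℝ, E) θ (f y₀) := by
    refine FormAt.of_apply fun z hz => ContMDiffAt.prodMk_space ?_ ?_
    · exact (SmAt.tmap (c := NH.proj N) (f := fun q : Q => q) (y₀ := f y₀) h.proj.1.contMDiffAt hz).coord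
    · exact p.toContinuousLinearMap.contMDiff.contMDiffAt.comp (f y₀)
        (FormAt.apply (f := fun q : Q => q) (h.AW_formAt _) hz)
  refine SmAt.of_form hθ ⟨?_, ?_⟩ hf (ContMDiffAt.prodMk_space ?_ ?_)
  · refine (injective_iff_map_eq_zero _).mpr fun v hv => ?_
    have h1 : tproj (E₁ := E₁) N (f y₀) v = 0 := by
      have := congrArg Prod.fst hv
      simpa [θ, cf_self] using this
    have h2 := congrArg Prod.snd hv
    have h3 : p.toContinuousLinearMap (connForm (𝔤 := 𝔤) G sys.D W (f y₀) v) = 0 := h2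
    rw [hp' _ (h.AW_mem _ v)] at h3
    have h4 := h.gen_AW (f y₀) v
    have h5 : connForm (𝔤 := 𝔤) G sys.D W (f y₀) v = 0 := congrArg Subtype.val h3
    rw [h5, h.PD_eq_zero (h.tproj_eq_zero_iff.mp h1)] at h4
    simpa using h4.symm
  · rintro ⟨w, ν⟩
    refine ⟨hlift sys N (f y₀) w + gen G (f y₀) (ν : 𝔤), Prod.ext ?_ ?_⟩
    · have h1 : tproj (E₁ := E₁) N (f y₀) (gen G (f y₀) (ν : 𝔤)) = 0 :=
        h.tproj_eq_zero_iff.mpr ((h.gen_mem_W_iff _ _).mpr ν.2)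
      simp [θ, cf_self, h.tproj_hlift, h1]
    · have h1 : connForm (𝔤 := 𝔤) G sys.D W (f y₀) (hlift sys N (f y₀) w + gen G (f y₀) (ν : 𝔤)) =
          ν := by
        rw [map_add, h.AW_of_mem (h.hlift_mem _ w), h.AW_gen _ ν.2, zero_add]
      exact (congrArg p.toContinuousLinearMap h1).trans (hp' _ ν.2)
  · refine hw.coord.congr_of_eventuallyEq (.of_forall fun y => ?_)
    change cf 𝓘(ℝ, E₁) _ _ (tproj N (f y) (hlift sys N (f y) (w y))) = _
    rw [h.tproj_hlift]
  · refine contMDiffAt_const (c := 0) |>.congr_of_eventuallyEq (.of_forall fun y => ?_)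
    change p.toContinuousLinearMap (connForm (𝔤 := 𝔤) G sys.D W (f y) (hlift sys N (f y) (w y))) = _
    rw [h.AW_of_mem (h.hlift_mem _ _), map_zero]

end Smooth

theorem Setup.hlift_equivariant (g : G) (q : Q) (w : E₁) :
    hlift sys N (g • q) (tact (QuotientGroup.mk' N g) (NH.proj N q) w) =
      tact g q (hlift sys N q w) :=
  h.eq_of_tproj_eq (h.hlift_mem _ _) (h.sym.constraints g q _ (h.hlift_mem q w))
    ((h.tproj_hlift (g • q) _).trans (by rw [h.tproj_tact, h.tproj_hlift]))

theorem Setup.covec_redMap (α : Cot E Q) (w : E₁) :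
    covec (redMap sys N α) w = covec α (hlift sys N α.1 w) := rfl

theorem Setup.redMap_smooth (α : Cot E Q) :
    ContMDiffAt (cotI E) (cotI E₁) ∞ (redMap (E₁ := E₁) sys N) α := by
  refine cotAt_of_apply (h.proj.1.contMDiffAt.comp α (smooth_pr α)) fun z hz => ?_
  exact covec_apply_smoothAt (α := fun a : Cot E Q => a) contMDiffAt_id
    (h.hlift_smoothAt (smooth_pr α) hz)

theorem Setup.redMap_cotAct (g : G) (α : Cot E Q) : redMap (E₁ := E₁) sys N (cotAct g α) =
    cotAct (QuotientGroup.mk' N g) (redMap sys N α) := by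
  refine (h.smoothAct_quotient.cotAct_eq_iff.mpr ⟨rfl, fun v => ?_⟩).symm
  rw [h.covec_redMap, h.covec_redMap]
  refine (congrArg (covec (cotAct g α)) (h.hlift_equivariant g α.1 v)).trans ?_
  exact (smoothAct_id E Q 𝔤 G).covec_cotAct_tact g α _

theorem Setup.eq_of_covec_hlift_eq {q : Q} {d d' : E} (hd : d ∈ sys.D q) (hd' : d' ∈ sys.D q)
    (h1 : ∀ w : E₁, sys.metric q d (hlift sys N q w) = sys.metric q d' (hlift sys N q w)) : d = d' := by
  have h4 : ∀ v ∈ sys.D q, sys.metric q (d - d') v = 0 := fun v hv => by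
    have := h1 (tproj N q v)
    rw [h.hlift_tproj_of_mem hv] at this
    rw [map_sub, sub_apply, this, sub_self]
  exact sub_eq_zero.mp (metric_definite (h4 _ (Submodule.sub_mem _ hd hd')))

theorem Setup.redMap_injOn {α β : Cot E Q} (hα : α ∈ sys.M) (hβ : β ∈ sys.M) (h1 : α.1 = β.1)
    (h2 : redMap (E₁ := E₁) sys N α = redMap (E₁ := E₁) sys N β) : α = β := by
  obtain ⟨q, l⟩ := α
  obtain ⟨q', l'⟩ := β
  obtain rfl : q = q' := h1
  obtain ⟨d, hd, hl⟩ := hα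
  obtain ⟨d', hd', hl'⟩ := hβ
  have h5 : d = d' := h.eq_of_covec_hlift_eq (q := q) hd hd' fun w => by
    have h3 : covec (redMap (E₁ := E₁) sys N ⟨q, l⟩) w = covec (redMap (E₁ := E₁) sys N ⟨q, l'⟩) w :=
      congrArg (fun a => covec a w) h2
    exact (congrArg (fun L : E →L[ℝ] ℝ => L _) hl).trans
      (h3.trans (congrArg (fun L : E →L[ℝ] ℝ => L _) hl').symm)
  subst h5
  exact cot_ext rfl (hl.symm.trans hl')

/-! A smooth section of the first reduction, over a section of `Q → Q/N`. -/

omit h in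
variable (sys W) in
/-- A metric for which `D` and `W` are orthogonal. -/
def splitMetric (q : Q) : E →L[ℝ] E →L[ℝ] ℝ :=
  (sys.metric q).bilinearComp (PD sys W q) (PD sys W q) +
    (sys.metric q).bilinearComp (ContinuousLinearMap.id ℝ E - PD sys W q)
      (ContinuousLinearMap.id ℝ E - PD sys W q)

omit h in
theorem splitMetric_apply (q : Q) (u v : E) : splitMetric sys W q u v =
    sys.metric q (PD sys W q u) (PD sys W q v) +
      sys.metric q (u - PD sys W q u) (v - PD sys W q v) := rfl

omit h in
theorem splitMetric_definite {q : Q} {v : E} (hv : splitMetric sys W q v v = 0) : v = 0 := by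
  have h1 : ∀ u, 0 ≤ sys.metric q u u := fun u => by
    by_cases hu : u = 0
    · simp [hu]
    · exact (metric_pos q hu).le
  rw [splitMetric_apply] at hv
  have h2 := metric_definite (q := q) (v := PD sys W q v) (by linarith [h1 (PD sys W q v), h1 (v - PD sys W q v)])
  have h3 := metric_definite (q := q) (v := v - PD sys W q v) (by linarith [h1 (PD sys W q v), h1 (v - PD sys W q v)])
  rwa [h2, sub_zero] at h3

theorem Setup.splitMetric_form2At (q : Q) : Form2At 𝓘(ℝ, E) (splitMetric sys W) q := by
  refine Form2At.of_apply fun z w hz hw => ?_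
  have h1 : ContMDiffAt 𝓘(ℝ, E) 𝓘(ℝ, ℝ) ∞
      (fun x => sys.metric x (PD sys W x (z x)) (PD sys W x (w x))) q :=
    Form2At.apply (f := fun q : Q => q) (metric_form2At (sys := sys) q) (h.PD_smoothAt hz)
      (h.PD_smoothAt hw)
  have h2 : ContMDiffAt 𝓘(ℝ, E) 𝓘(ℝ, ℝ) ∞
      (fun x => sys.metric x (z x - PD sys W x (z x)) (w x - PD sys W x (w x))) q :=
    Form2At.apply (f := fun q : Q => q) (metric_form2At (sys := sys) q) (hz.sub (h.PD_smoothAt hz))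
      (hw.sub (h.PD_smoothAt hw))
  simp only [splitMetric_apply]
  exact h1.add h2

omit h in
variable (sys W N) in
/-- The velocity in `D_q` that corresponds to a covector on the orbit space. -/
def liftVel (q : Q) (l : E₁ →L[ℝ] ℝ) : E :=
  (splitMetric sys W q).inverse (l.comp (tproj N q))

theorem Setup.splitMetric_liftVel (q : Q) (l : E₁ →L[ℝ] ℝ) (v : E) :
    splitMetric sys W q (liftVel sys W N q l) v = l (tproj N q v) := by
  obtain ⟨e, he⟩ := isInvertible_of_bijective
    (injective_bilin_bijective fun v hv => splitMetric_definite (sys := sys) (W := W) (hv v))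
  have : splitMetric sys W q (liftVel sys W N q l) = l.comp (tproj N q) := by
    rw [liftVel, ← he, ContinuousLinearMap.inverse_equiv]; simp
  rw [this]; rfl

theorem Setup.liftVel_mem (q : Q) (l : E₁ →L[ℝ] ℝ) : liftVel sys W N q l ∈ sys.D q := by
  set d := liftVel sys W N q l with hd
  have h1 := h.splitMetric_liftVel q l (d - PD sys W q d)
  have hw := h.sub_PD_mem q d
  rw [← hd, splitMetric_apply, h.PD_eq_zero hw, h.tproj_eq_zero_iff.mpr hw, map_zero, map_zero,
    zero_add, sub_zero] at h1
  have h2 := metric_definite h1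
  rw [sub_eq_zero.mp h2]
  exact h.PD_mem q d

theorem Setup.metric_liftVel (q : Q) (l : E₁ →L[ℝ] ℝ) (w : E₁) :
    sys.metric q (liftVel sys W N q l) (hlift sys N q w) = l w := by
  have h1 := h.splitMetric_liftVel q l (hlift sys N q w)
  rwa [splitMetric_apply, h.PD_of_mem (h.hlift_mem q w), h.PD_of_mem (h.liftVel_mem q l), sub_self,
    map_zero, zero_apply, add_zero, h.tproj_hlift] at h1

omit h in
variable (sys W N) in
/-- The point of `M` over `q` that corresponds to a covector on the orbit space. -/
def liftM (q : Q) (l : E₁ →L[ℝ] ℝ) : Cot E Q := mkCot q (sys.metric q (liftVel sys W N q l))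

theorem Setup.liftM_mem (q : Q) (l : E₁ →L[ℝ] ℝ) : liftM sys W N q l ∈ sys.M :=
  mkCot_metric_mem (h.liftVel_mem q l)

theorem Setup.redMap_liftM (q : Q) (l : E₁ →L[ℝ] ℝ) :
    redMap sys N (liftM sys W N q l) = mkCot (NH.proj N q) l :=
  cot_ext rfl (ContinuousLinearMap.ext fun w => h.metric_liftVel q l w)

theorem Setup.liftM_redMap {m : Cot E Q} (hm : m ∈ sys.M) :
    liftM sys W N m.1 (covec (redMap (E₁ := E₁) sys N m)) = m :=
  h.redMap_injOn (h.liftM_mem _ _) hm rfl (h.redMap_liftM _ _)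

theorem Setup.liftM_smoothAt {E' : Type*} [NormedAddCommGroup E'] [NormedSpace ℝ E'] {H' : Type*}
    [TopologicalSpace H'] {I' : ModelWithCorners ℝ E' H'} {Y : Type*} [TopologicalSpace Y]
    [ChartedSpace H' Y] {f : Y → Q} {a : Y → Cot E₁ (OrbitSpace Q N)} {y₀ : Y}
    (hf : ContMDiffAt I' 𝓘(ℝ, E) ∞ f y₀) (ha : ContMDiffAt I' (cotI E₁) ∞ a y₀)
    (hfa : ∀ᶠ y in 𝓝 y₀, NH.proj N (f y) = (a y).1) :
    ContMDiffAt I' (cotI E) ∞ (fun y => liftM sys W N (f y) (covec (a y))) y₀ := by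
  refine mkCot_smoothAt (SmAt.of_form2 (h.splitMetric_form2At _)
    (fun v hv => splitMetric_definite (hv v)) hf fun w hw => ?_)
  simp only [h.splitMetric_liftVel]
  refine covec_apply_smoothAt ha ?_
  exact (SmAt.tmap (h.proj.1.contMDiffAt (x := f y₀)) hw).congr
    (hfa.mono fun y hy => hy.symm) .rfl

theorem Setup.redMap_surjective (a : Cot E₁ (OrbitSpace Q N)) :
    ∃ m ∈ sys.M, redMap (E₁ := E₁) sys N m = a := by
  refine ⟨liftM sys W N (Quotient.out a.1) (covec a), h.liftM_mem _ _, ?_⟩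
  rw [h.redMap_liftM]
  exact cot_ext (Quotient.out_eq a.1) rfl

theorem Setup.redMap_eq_iff {m m' : Cot E Q} (hm : m ∈ sys.M) (hm' : m' ∈ sys.M) :
    redMap (E₁ := E₁) sys N m = redMap (E₁ := E₁) sys N m' ↔ ∃ n ∈ N, cotAct n m' = m := by
  constructor
  · intro hmm
    have h1 : NH.proj N m.1 = NH.proj N m'.1 := congrArg (fun a => a.1) hmm
    obtain ⟨n, hn, hq⟩ := (proj_eq_iff N _ _).mp h1
    refine ⟨n, hn, h.redMap_injOn (cotAct_mem_M (smoothAct_id E Q 𝔤 G) h.sym n hm') hm hq ?_⟩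
    rw [h.redMap_cotAct, (QuotientGroup.eq_one_iff n).mpr hn |> fun e : QuotientGroup.mk' N n = 1 => e,
      h.smoothAct_quotient.cotAct_one, hmm]
  · rintro ⟨n, hn, rfl⟩
    rw [h.redMap_cotAct, (QuotientGroup.eq_one_iff n).mpr hn |> fun e : QuotientGroup.mk' N n = 1 => e,
      h.smoothAct_quotient.cotAct_one]

/-! The tangent map of the reduction. -/

theorem Setup.redMap_mdiff (α : Cot E Q) :
    MDifferentiableAt (cotI E) (cotI E₁) (redMap (E₁ := E₁) sys N) α :=
  (h.redMap_smooth α).mdifferentiableAt (by simp)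

theorem Setup.tredMap_fst (α : Cot E Q) (u : E × (E →L[ℝ] ℝ)) :
    (tredMap (E₁ := E₁) sys N α u).1 = tproj N α.1 u.1 := by
  have h1 := tmap_comp_apply (g := fun b : Cot E₁ (OrbitSpace Q N) => b.1)
    (f := redMap (E₁ := E₁) sys N) ((smooth_pr _).mdifferentiableAt (by simp)) (h.redMap_mdiff α) u
  have h2 := tmap_comp_apply (g := NH.proj N) (f := fun b : Cot E Q => b.1)
    (x := α) (h.proj_mdiff α.1) ((smooth_pr α).mdifferentiableAt (by simp)) u
  rw [← tτ_apply (redMap (E₁ := E₁) sys N α) (tredMap sys N α u), ← tτ_apply α]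
  exact h1.symm.trans h2

theorem Setup.exists_C_lift {m : Cot E Q} (hm : m ∈ sys.M) (w : E₁ × (E₁ →L[ℝ] ℝ)) :
    ∃ u ∈ sys.C m, tredMap (E₁ := E₁) sys N m u = w := by
  obtain ⟨s, U, hU, hqU, hs, hsU, hs0, hsT⟩ :=
    exists_local_section h.proj.1 m.1 (r := hlift sys N m.1) (h.tproj_hlift m.1)
  have hO : (fun b : Cot E₁ (OrbitSpace Q N) => b.1) ⁻¹' U ∈ 𝓝 (redMap (E₁ := E₁) sys N m) :=
    (smooth_pr (redMap (E₁ := E₁) sys N m)).continuousAt.preimage_mem_nhds (hU.mem_nhds hqU)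
  obtain ⟨γ, h1, h2, h3, h4⟩ := exists_curve (I := cotI E₁) hO w
  have hb : ContMDiff 𝓘(ℝ, ℝ) 𝓘(ℝ, E₁) ∞ (fun t => (γ t).1) := fun t => cot_base (h1 t)
  have hsb : ContMDiff 𝓘(ℝ, ℝ) 𝓘(ℝ, E) ∞ (fun t => s (γ t).1) := fun t =>
    ContMDiffAt.comp t (g := s) (hs.contMDiffAt (hU.mem_nhds (h2 t))) (hb t)
  have hγ : ContMDiff 𝓘(ℝ, ℝ) (cotI E) ∞ (fun t => liftM sys W N (s (γ t).1) (covec (γ t))) :=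
    fun t => h.liftM_smoothAt (hsb t) (h1 t) (.of_forall fun t => hsU _ (h2 t))
  have h0 : liftM sys W N (s (γ 0).1) (covec (γ 0)) = m := by
    rw [h3]
    change liftM sys W N (s (NH.proj N m.1)) _ = m
    rw [hs0, h.liftM_redMap hm]
  have hR : ∀ t, redMap sys N (liftM sys W N (s (γ t).1) (covec (γ t))) = γ t := fun t => by
    rw [h.redMap_liftM]
    exact cot_ext (hsU _ (h2 t)) rfl
  refine ⟨tmap 𝓘(ℝ, ℝ) (cotI E) (fun t => liftM sys W N (s (γ t).1) (covec (γ t))) 0 1,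
    ⟨⟨_, hγ, fun t => h.liftM_mem _ _, h0, rfl⟩, ?_⟩, ?_⟩
  · have h5 := tmap_comp_apply (g := fun b : Cot E Q => b.1)
      (f := fun t => liftM sys W N (s (γ t).1) (covec (γ t))) (x := (0 : ℝ))
      ((smooth_pr _).mdifferentiableAt (by simp)) (hγ.mdifferentiable (by simp) 0) 1
    rw [h0] at h5
    have h6 := tmap_comp_apply (I := 𝓘(ℝ, ℝ)) (I' := 𝓘(ℝ, E₁)) (I'' := 𝓘(ℝ, E)) (g := s)
      (f := fun t => (γ t).1) (x := (0 : ℝ))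
      ((hs.contMDiffAt (hU.mem_nhds (h2 0))).mdifferentiableAt (by simp))
      (hb.mdifferentiable (by simp) 0) 1
    refine (congrArg (· ∈ sys.D m.1) (h5.symm.trans h6)).mpr ?_
    rw [h3]
    change tmap 𝓘(ℝ, E₁) 𝓘(ℝ, E) s (NH.proj N m.1) _ ∈ _
    rw [hsT]
    exact h.hlift_mem _ _
  · have h5 := tmap_comp_apply (g := redMap (E₁ := E₁) sys N)
      (f := fun t => liftM sys W N (s (γ t).1) (covec (γ t))) (x := (0 : ℝ))
      (h.redMap_mdiff _) (hγ.mdifferentiable (by simp) 0) 1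
    rw [h0] at h5
    refine h5.symm.trans ?_
    simp only [hR, h4]

/-! The pull-back of the canonical form. -/

theorem Setup.momentum_smoothAt (α : Cot E Q) :
    ContMDiffAt (cotI E) 𝓘(ℝ, 𝔤 →L[ℝ] ℝ) ∞ (momentum (E := E) (𝔤 := 𝔤) G) α := by
  refine contMDiffAt_clm_iff.mpr fun ξ => ?_
  simp only [momentum_apply]
  exact covec_apply_smoothAt (α := fun a : Cot E Q => a) contMDiffAt_id
    ((smoothAct_id E Q 𝔤 G).rgen_smoothAt (smooth_pr α) contMDiffAt_const)

theorem tτ_comp_formAt {V : Type*} [NormedAddCommGroup V] [NormedSpace ℝ V] {θ : Q → E →L[ℝ] V}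
    {α : Cot E Q} (hθ : FormAt 𝓘(ℝ, E) θ α.1) :
    FormAt (cotI E) (fun β : Cot E Q => (θ β.1).comp (tτ β)) α := by
  refine FormAt.of_apply fun z hz => ?_
  simp only [ContinuousLinearMap.comp_apply, tτ_apply]
  exact FormAt.apply (f := fun β : Cot E Q => β.1) hθ hz.fst

theorem extD_tτ_comp {V : Type*} [NormedAddCommGroup V] [NormedSpace ℝ V] {θ : Q → E →L[ℝ] V}
    {α : Cot E Q} (hθ : FormAt 𝓘(ℝ, E) θ α.1) (u v : E × (E →L[ℝ] ℝ)) :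
    extD (cotI E) (fun β : Cot E Q => (θ β.1).comp (tτ β)) α u v = extD 𝓘(ℝ, E) θ α.1 u.1 v.1 := by
  rw [extD_pullback (f := fun β : Cot E Q => β.1) hθ (tτ_comp_formAt h hθ) (smooth_pr α)
    (.of_forall fun β w => rfl)]
  exact congrArg₂ (fun a b => extD 𝓘(ℝ, E) θ α.1 a b) (tτ_apply α u) (tτ_apply α v)

theorem Setup.canonicalForm_redMap (α : Cot E Q) {u v : E × (E →L[ℝ] ℝ)}
    (hu : u.1 ∈ sys.D α.1) (hv : v.1 ∈ sys.D α.1) :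
    canonicalForm (redMap (E₁ := E₁) sys N α) (tredMap sys N α u) (tredMap sys N α v) =
      canonicalForm α u v + JKW (𝔤 := 𝔤) G sys W α u.1 v.1 := by
  let Φ : Cot E Q → E × (E →L[ℝ] ℝ) →L[ℝ] ℝ := fun β =>
    (momentum G β).comp ((connForm (𝔤 := 𝔤) G sys.D W β.1).comp (tτ β))
  let Ψ : Cot E Q → E × (E →L[ℝ] ℝ) →L[ℝ] ℝ := fun β =>
    (liouville (redMap (E₁ := E₁) sys N β)).comp (tredMap sys N β)
  have hA : FormAt (cotI E) (fun β : Cot E Q => (connForm (𝔤 := 𝔤) G sys.D W β.1).comp (tτ β)) α :=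
    tτ_comp_formAt h (h.AW_formAt α.1)
  have hΦ : FormAt (cotI E) Φ α := hA.comp_left (h.momentum_smoothAt α)
  have hΨ : FormAt (cotI E) Ψ α := by
    refine FormAt.of_apply fun z hz => ?_
    exact FormAt.apply (f := redMap (E₁ := E₁) sys N) (liouville_formAt _)
      (SmAt.tmap (h.redMap_smooth α) hz)
  have hsum : liouville (E := E) (X := Q) = fun β => Ψ β + Φ β := by
    funext β
    ext w
    · simp only [Ψ, Φ, add_apply, ContinuousLinearMap.comp_apply, ContinuousLinearMap.inl_apply,
        liouville_apply, h.tredMap_fst, h.covec_redMap, h.hlift_tproj, tτ_apply, momentum_apply]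
      rw [← map_add]
      congr 1
      have := h.gen_AW β.1 w
      change w = PD sys W β.1 w + gen G β.1 (connForm (𝔤 := 𝔤) G sys.D W β.1 w)
      rw [this]; abel
    · simp [Ψ, Φ, liouville_apply, h.tredMap_fst, tτ_apply]
  have h1 : extD (cotI E) (liouville (E := E) (X := Q)) α u v =
      extD (cotI E) Ψ α u v + extD (cotI E) Φ α u v := by
    rw [hsum]; exact extD_add hΨ hΦ u v
  have h2 : extD (cotI E) Ψ α u v = extD (cotI E₁) liouville (redMap (E₁ := E₁) sys N α)
      (tredMap sys N α u) (tredMap sys N α v) :=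
    extD_pullback (liouville_formAt _) hΨ (h.redMap_smooth α) (.of_forall fun β w => rfl) u v
  have h3 : extD (cotI E) Φ α u v = momentum G α (extD 𝓘(ℝ, E) (connForm (𝔤 := 𝔤) G sys.D W) α.1
      u.1 v.1) := by
    have := extD_comp_left hA (h.momentum_smoothAt α) (u := u) (v := v)
      (by rw [ContinuousLinearMap.comp_apply, tτ_apply, h.AW_of_mem hu])
      (by rw [ContinuousLinearMap.comp_apply, tτ_apply, h.AW_of_mem hv])
    rw [extD_tτ_comp h (h.AW_formAt α.1)] at this
    exact this
  have h4 : JKW (𝔤 := 𝔤) G sys W α u.1 v.1 = extD (cotI E) Φ α u v := by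
    rw [h3]
    change momentum G α (extD 𝓘(ℝ, E) (connForm (𝔤 := 𝔤) G sys.D W) α.1 (PD sys W α.1 u.1)
      (PD sys W α.1 v.1)) = _
    rw [h.PD_of_mem hu, h.PD_of_mem hv]
  rw [canonicalForm_eq, canonicalForm_eq, h1, ← h2, h4]
  ring

end Setup

/-! ### The 2-forms on the configuration space -/

section VectorValued

variable {E : Type*} [NormedAddCommGroup E] [NormedSpace ℝ E] [FiniteDimensional ℝ E]
  {H : Type*} [TopologicalSpace H] {I : ModelWithCorners ℝ E H} [I.Boundaryless]
  {X : Type*} [TopologicalSpace X] [ChartedSpace H X] [IsManifold I ∞ X]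
  {V : Type*} [NormedAddCommGroup V] [NormedSpace ℝ V]
  {V' : Type*} [NormedAddCommGroup V'] [NormedSpace ℝ V']

/-- The differential of a vector-valued function, computed in the chart at the point. -/
theorem hasFDerivAt_chart {f : X → V} {x : X} (hf : MDifferentiableAt I 𝓘(ℝ, V) f x) :
    HasFDerivAt (fun y => f ((extChartAt I x).symm y)) (tmap I 𝓘(ℝ, V) f x) (extChartAt I x x) := by
  have h0 : (extChartAt I x).symm (extChartAt I x x) = x := extChartAt_to_inv x
  have h1 := mdiff_ext_symm (I := I) (mem_extChartAt_target (I := I) x)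
  have h2 : MDifferentiableAt I 𝓘(ℝ, V) f ((extChartAt I x).symm (extChartAt I x x)) := by rwa [h0]
  have h3 := tmap_comp (g := f) (f := (extChartAt I x).symm) h2 h1
  have h4 : tmap 𝓘(ℝ, E) I (extChartAt I x).symm (extChartAt I x x) = ContinuousLinearMap.id ℝ E :=
    cfi_self (I := I) x
  rw [h4, h0, tmap_eq_fderiv] at h3
  have h5 := ((h2.comp _ h1).differentiableAt).hasFDerivAt
  exact HasFDerivAt.congr_fderiv (f := fun y => f ((extChartAt I x).symm y)) h5
    (h3.trans (ContinuousLinearMap.comp_id _))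

theorem tmap_eq_of_chart {f : X → V} {x : X} (hf : MDifferentiableAt I 𝓘(ℝ, V) f x) {L : E →L[ℝ] V}
    (hL : HasFDerivAt (fun y => f ((extChartAt I x).symm y)) L (extChartAt I x x)) :
    tmap I 𝓘(ℝ, V) f x = L := (hasFDerivAt_chart hf).unique hL

theorem extD_const_comp {θ : X → E →L[ℝ] V} {x : X} (h : FormAt I θ x) (L : V →L[ℝ] V') (u v : E) :
    extD I (fun x => L.comp (θ x)) x u v = L (extD I θ x u v) := by
  rw [extD_eq h, extD_eq (h.comp_left (f := fun _ => L) contMDiffAt_const)]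
  simp only [ContinuousLinearMap.comp_apply]
  have key : ∀ a b : E, fderiv ℝ (fun y => L
      (θ ((extChartAt I x).symm y) (tmap 𝓘(ℝ, E) I (extChartAt I x).symm y b)))
      (extChartAt I x x) a = L (fderiv ℝ (fun y => θ ((extChartAt I x).symm y)
        (tmap 𝓘(ℝ, E) I (extChartAt I x).symm y b)) (extChartAt I x x) a) := fun a b => by
    exact congrArg (fun M : E →L[ℝ] V' => M a) (HasFDerivAt.fderiv
      (f := fun y => L (θ ((extChartAt I x).symm y) (tmap 𝓘(ℝ, E) I (extChartAt I x).symm y b)))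
      (L.hasFDerivAt.comp _ (extD_aux h b).hasFDerivAt))
  rw [key, key, map_sub]

end VectorValued

section Setup

variable {E : Type*} [NormedAddCommGroup E] [NormedSpace ℝ E] [FiniteDimensional ℝ E]
  {Q : Type*} [TopologicalSpace Q] [ChartedSpace E Q] [IsManifold 𝓘(ℝ, E) ∞ Q] [T2Space Q]
  {𝔤 : Type*} [NormedAddCommGroup 𝔤] [NormedSpace ℝ 𝔤] [FiniteDimensional ℝ 𝔤]
  {G : Type*} [Group G] [TopologicalSpace G] [ChartedSpace 𝔤 G] [LieGroup 𝓘(ℝ, 𝔤) ∞ G]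
  [MulAction G Q] [ContMDiffSMul 𝓘(ℝ, 𝔤) 𝓘(ℝ, E) ∞ G Q] [ProperSMul G Q]
  {sys : System E Q} {k : ℕ} {ζ : Fin k → Q → 𝔤} {W Hor : PlaneField E Q}
  {N : Subgroup G} [N.Normal]
  {E₁ : Type*} [NormedAddCommGroup E₁] [NormedSpace ℝ E₁] [FiniteDimensional ℝ E₁]
  [ChartedSpace E₁ (OrbitSpace Q N)] [IsManifold 𝓘(ℝ, E₁) ∞ (OrbitSpace Q N)]

omit [T2Space Q] [ProperSMul G Q] [N.Normal] in
theorem KW_apply (q : Q) (u v : E) : KW G sys W q u v =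
    extD 𝓘(ℝ, E) (connForm (𝔤 := 𝔤) G sys.D W) q (PD sys W q u) (PD sys W q v) := rfl

theorem dDY_apply (i : Fin k) (q : Q) (u v : E) : dDY G sys W Hor ζ i q u v =
    extD 𝓘(ℝ, E) (Yform G W Hor ζ i) q (PD sys W q u) (PD sys W q v) := rfl

theorem Ktot_apply (q : Q) (u v : E) : Ktot G sys W Hor ζ q u v =
    KW G sys W q u v + ∑ i, dDY G sys W Hor ζ i q u v • ζ i q := by
  simp only [Ktot, add_apply, sum_apply]; rfl

theorem KW_self (q : Q) (u : E) : KW (𝔤 := 𝔤) G sys W q u u = 0 := by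
  rw [KW_apply]; exact extD_self _ _ _

theorem dDY_self (i : Fin k) (q : Q) (u : E) : dDY G sys W Hor ζ i q u u = 0 := by
  rw [dDY_apply]; exact extD_self _ _ _

theorem Ktot_self (q : Q) (u : E) : Ktot G sys W Hor ζ q u u = 0 := by
  simp only [Ktot_apply, KW_self, dDY_self, zero_smul, Finset.sum_const_zero, add_zero]

variable (h : Setup sys ζ W Hor N E₁)
include h

theorem Setup.smooth_tact (g : G) (q : Q) :
    ContMDiffAt 𝓘(ℝ, E) 𝓘(ℝ, E) ∞ (fun x : Q => g • x) q :=
  ((smoothAct_id E Q 𝔤 G).contMDiff g).contMDiffAt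

theorem Setup.KW_equivariant (g : G) (q : Q) (u v : E) :
    KW (𝔤 := 𝔤) G sys W (g • q) (tact g q u) (tact g q v) = adj g (KW G sys W q u v) := by
  rw [KW_apply, KW_apply, h.PD_equivariant, h.PD_equivariant,
    ← extD_const_comp (h.AW_formAt q) (adj g)]
  exact (extD_pullback (f := fun x : Q => g • x) (h.AW_formAt _)
    ((h.AW_formAt q).comp_left contMDiffAt_const) (h.smooth_tact g q)
    (.of_forall fun x v => (h.AW_equivariant g x v).symm) _ _).symm

theorem Setup.dDY_equivariant (i : Fin k) (g : G) (q : Q) (u v : E) :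
    dDY G sys W Hor ζ i (g • q) (tact g q u) (tact g q v) = dDY G sys W Hor ζ i q u v := by
  rw [dDY_apply, dDY_apply, h.PD_equivariant, h.PD_equivariant]
  exact (extD_pullback (f := fun x : Q => g • x) (h.Y_formAt i _) (h.Y_formAt i q)
    (h.smooth_tact g q) (.of_forall fun x v => (h.Y_equivariant i g x v).symm) _ _).symm

theorem Setup.Ktot_equivariant (g : G) (q : Q) (u v : E) :
    Ktot G sys W Hor ζ (g • q) (tact g q u) (tact g q v) = adj g (Ktot G sys W Hor ζ q u v) := by
  simp only [Ktot_apply, h.KW_equivariant, h.dDY_equivariant, map_add, map_sum, map_smul, h.adj_gauge]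

theorem Setup.KW_form2At (q : Q) : Form2At 𝓘(ℝ, E) (KW (𝔤 := 𝔤) G sys W) q := by
  refine Form2At.of_apply fun z w hz hw => ?_
  simp only [KW_apply]
  exact Form2At.apply (f := fun q : Q => q) (z := fun x => PD sys W x (z x))
    (w := fun x => PD sys W x (w x))
    (B := extD 𝓘(ℝ, E) (connForm (𝔤 := 𝔤) G sys.D W)) (Form2At.extD (fun x => h.AW_formAt x) q)
    (h.PD_smoothAt hz) (h.PD_smoothAt hw)

theorem Setup.dDY_form2At (i : Fin k) (q : Q) : Form2At 𝓘(ℝ, E) (dDY G sys W Hor ζ i) q := by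
  refine Form2At.of_apply fun z w hz hw => ?_
  simp only [dDY_apply]
  exact Form2At.apply (f := fun q : Q => q) (z := fun x => PD sys W x (z x))
    (w := fun x => PD sys W x (w x))
    (B := extD 𝓘(ℝ, E) (Yform G W Hor ζ i)) (Form2At.extD (fun x => h.Y_formAt i x) q)
    (h.PD_smoothAt hz) (h.PD_smoothAt hw)

theorem Setup.Ktot_form2At (q : Q) : Form2At 𝓘(ℝ, E) (Ktot G sys W Hor ζ) q := by
  refine Form2At.of_apply fun z w hz hw => ?_
  simp only [Ktot_apply]
  refine (Form2At.apply (f := fun q : Q => q) (h.KW_form2At q) hz hw).add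
    (contMDiffAt_finsetSum fun i _ => ?_)
  exact (Form2At.apply (f := fun q : Q => q) (h.dDY_form2At i q) hz hw).smul
    (h.gauge.smooth i).contMDiffAt

theorem Setup.Ktot_PD (q : Q) (u v : E) :
    Ktot G sys W Hor ζ q (PD sys W q u) (PD sys W q v) = Ktot G sys W Hor ζ q u v := by
  simp only [Ktot_apply, KW_apply, dDY_apply, h.PD_of_mem (h.PD_mem q _)]

theorem Setup.dHorA_eq (q : Q) (u v : E) : dHorA (𝔤 := 𝔤) G Hor q u v =
    Ktot G sys W Hor ζ q (PH 𝔤 G Hor q u) (PH 𝔤 G Hor q v) := by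
  set a := PH 𝔤 G Hor q u with ha
  set b := PH 𝔤 G Hor q v with hb
  have haH : a ∈ Hor q := h.PH_mem q u
  have hbH : b ∈ Hor q := h.PH_mem q v
  have h1 : ∀ i, ContMDiffAt 𝓘(ℝ, E) 𝓘(ℝ, ℝ →L[ℝ] 𝔤) ∞
      (fun x => ContinuousLinearMap.toSpanSingleton ℝ (ζ i x)) q := fun i => by
    refine contMDiffAt_clm_iff.mpr fun e => ?_
    exact (contMDiffAt_const (I' := 𝓘(ℝ, ℝ)) (c := e)).smul (h.gauge.smooth i).contMDiffAt
  have h2 : ∀ i, FormAt 𝓘(ℝ, E) (fun x =>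
      (ContinuousLinearMap.toSpanSingleton ℝ (ζ i x)).comp (Yform G W Hor ζ i x)) q := fun i =>
    (h.Y_formAt i q).comp_left (h1 i)
  have h3 : connForm (𝔤 := 𝔤) G Hor (vert (𝔤 := 𝔤) G) = fun x => connForm (𝔤 := 𝔤) G sys.D W x +
      ∑ i, (ContinuousLinearMap.toSpanSingleton ℝ (ζ i x)).comp (Yform G W Hor ζ i x) := by
    funext x
    ext w
    rw [h.A_eq, add_apply, sum_apply]
    rfl
  change extD 𝓘(ℝ, E) (connForm (𝔤 := 𝔤) G Hor (vert (𝔤 := 𝔤) G)) q a b = _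
  rw [h3, extD_add (h.AW_formAt q) (FormAt.sum _ h2), extD_sum _ h2, Ktot_apply, KW_apply,
    h.PD_of_mem (h.hor.le_D q haH), h.PD_of_mem (h.hor.le_D q hbH)]
  congr 1
  refine Finset.sum_congr rfl fun i _ => ?_
  rw [extD_comp_left (h.Y_formAt i q) (h1 i) (h.Y_Hor i haH) (h.Y_Hor i hbH), dDY_apply,
    h.PD_of_mem (h.hor.le_D q haH), h.PD_of_mem (h.hor.le_D q hbH)]
  rfl

/-- The contraction of `K_W + d^D Y^i ⊗ ζ_i` with a horizontal gauge symmetry. -/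
theorem Setup.Ktot_gauge (i : Fin k) {q : Q} {v : E} (hv : v ∈ sys.D q) :
    Ktot G sys W Hor ζ q (gen G q (ζ i q)) v = tmap 𝓘(ℝ, E) 𝓘(ℝ, 𝔤) (ζ i) q v := by
  set ξ := ζ i q with hξ
  have hA := smoothAct_id E Q 𝔤 G
  have hgen : SmAt 𝓘(ℝ, E) 𝓘(ℝ, E) (fun x : Q => x) (fun x => gen G x ξ) q :=
    hA.rgen_smoothAt contMDiffAt_id contMDiffAt_const
  have h1 : extD 𝓘(ℝ, E) (connForm (𝔤 := 𝔤) G sys.D W) q (gen G q ξ) v =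
      - tmap 𝓘(ℝ, E) 𝓘(ℝ, 𝔤) (fun x => connForm (𝔤 := 𝔤) G sys.D W x (gen G x ξ)) q v := by
    refine extD_invariant_act (a := fun p : G × Q => p.1 • p.2) (h.AW_formAt q) hA
      (fun x => one_smul _ x) (fun g => ?_) ξ
    refine (h.AW_equivariant g q v).trans ?_
    rw [h.AW_of_mem hv, map_zero]
  have h2 : ∀ j, extD 𝓘(ℝ, E) (Yform G W Hor ζ j) q (gen G q ξ) v =
      - tmap 𝓘(ℝ, E) 𝓘(ℝ, ℝ) (fun x => Yform G W Hor ζ j x (gen G x ξ)) q v := fun j =>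
    extD_invariant_act (a := fun p : G × Q => p.1 • p.2) (h.Y_formAt j q) hA
      (fun x => one_smul _ x) (fun g => h.Y_equivariant j g q v) ξ
  have m1 : MDifferentiableAt 𝓘(ℝ, E) 𝓘(ℝ, 𝔤)
      (fun x => connForm (𝔤 := 𝔤) G sys.D W x (gen G x ξ)) q :=
    (FormAt.apply (f := fun x : Q => x) (h.AW_formAt q) hgen).mdifferentiableAt (by simp)
  have m2 : ∀ j, MDifferentiableAt 𝓘(ℝ, E) 𝓘(ℝ, ℝ)
      (fun x => Yform G W Hor ζ j x (gen G x ξ)) q := fun j =>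
    (FormAt.apply (f := fun x : Q => x) (h.Y_formAt j q) hgen).mdifferentiableAt (by simp)
  have m3 : ∀ j, MDifferentiableAt 𝓘(ℝ, E) 𝓘(ℝ, 𝔤) (ζ j) q := fun j =>
    (h.gauge.smooth j).mdifferentiable (by simp) q
  have h3 := (hasFDerivAt_chart m1).add (HasFDerivAt.fun_sum (u := Finset.univ) fun j _ =>
    (hasFDerivAt_chart (m2 j)).smul (hasFDerivAt_chart (m3 j)))
  have h4 : HasFDerivAt (fun _ : E => ξ) (0 : E →L[ℝ] 𝔤) (extChartAt 𝓘(ℝ, E) q q) :=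
    hasFDerivAt_const _ _
  have h5 := h3.unique (h4.congr_of_eventuallyEq (.of_forall fun y => by
    have := h.A_eq ((extChartAt 𝓘(ℝ, E) q).symm y) (gen G ((extChartAt 𝓘(ℝ, E) q).symm y) ξ)
    rw [h.A_gen] at this
    exact this.symm))
  have h6 := congrArg (fun L : E →L[ℝ] 𝔤 => L v) h5
  simp only [add_apply, sum_apply, ContinuousLinearMap.smulRight_apply, zero_apply,
    extChartAt_to_inv, h.Y_gauge, hξ, ite_smul, one_smul, zero_smul, Finset.sum_add_distrib,
    Finset.sum_ite_eq', Finset.mem_univ, if_true] at h6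
  have hD : gen G q ξ ∈ sys.D q := h.gauge_mem_D i q
  rw [Ktot_apply, KW_apply, h.PD_of_mem hD, h.PD_of_mem hv, h1]
  simp only [dDY_apply, h.PD_of_mem hD, h.PD_of_mem hv]
  simp only [h2, neg_smul, Finset.sum_neg_distrib]
  rw [← neg_add, neg_eq_iff_add_eq_zero, ← h6]
  abel

end Setup

/-! ### The nonholonomic vector field and the momentum equation -/

section Calculus

variable {E : Type*} [NormedAddCommGroup E] [NormedSpace ℝ E] [FiniteDimensional ℝ E]
  {H : Type*} [TopologicalSpace H] {I : ModelWithCorners ℝ E H} [I.Boundaryless]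
  {X : Type*} [TopologicalSpace X] [ChartedSpace H X] [IsManifold I ∞ X]
  {V : Type*} [NormedAddCommGroup V] [NormedSpace ℝ V]
  {V' : Type*} [NormedAddCommGroup V'] [NormedSpace ℝ V']

/-- The product rule for the pairing of operators with vectors. -/
theorem tmap_clm_apply {L : X → V →L[ℝ] V'} {z : X → V} {x : X}
    (hL : MDifferentiableAt I 𝓘(ℝ, V →L[ℝ] V') L x) (hz : MDifferentiableAt I 𝓘(ℝ, V) z x) (v : E) :
    tmap I 𝓘(ℝ, V') (fun x => L x (z x)) x v =
      tmap I 𝓘(ℝ, V →L[ℝ] V') L x v (z x) + L x (tmap I 𝓘(ℝ, V) z x v) := by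
  have h1 := (hasFDerivAt_chart hL).clm_apply (hasFDerivAt_chart hz)
  have h2 : MDifferentiableAt I 𝓘(ℝ, V') (fun x => L x (z x)) x := hL.clm_apply hz
  have h3 := tmap_eq_of_chart h2 h1
  rw [h3, extChartAt_to_inv]
  simp only [add_apply, ContinuousLinearMap.comp_apply, ContinuousLinearMap.flip_apply]
  exact add_comm _ _

omit [FiniteDimensional ℝ E] [I.Boundaryless] [IsManifold I ∞ X] in
theorem hasDerivAt_curve {f : X → ℝ} {γ : ℝ → X} {x : X} (hf : MDifferentiableAt I 𝓘(ℝ, ℝ) f x)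
    (hγ : MDifferentiableAt 𝓘(ℝ, ℝ) I γ 0) (h0 : γ 0 = x) :
    HasDerivAt (fun t => f (γ t)) (dfun I f x (tmap 𝓘(ℝ, ℝ) I γ 0 1)) 0 := by
  subst h0
  have h1 := tmap_comp_apply (I := 𝓘(ℝ, ℝ)) (I' := I) (I'' := 𝓘(ℝ, ℝ)) (x := (0 : ℝ)) hf hγ 1
  have h2 : DifferentiableAt ℝ (fun t => f (γ t)) 0 := (hf.comp (0 : ℝ) hγ).differentiableAt
  rw [tmap_eq_fderiv] at h1
  have h3 := h2.hasFDerivAt.hasDerivAt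
  rwa [h1] at h3

end Calculus

section Vertical

variable {E : Type*} [NormedAddCommGroup E] [NormedSpace ℝ E] [FiniteDimensional ℝ E]
  {X : Type*} [TopologicalSpace X] [ChartedSpace E X] [IsManifold 𝓘(ℝ, E) ∞ X]

theorem vertical_curve (a : Cot E X) (p : E →L[ℝ] ℝ) :
    MDifferentiableAt 𝓘(ℝ, ℝ) (cotI E) (fun t : ℝ => mkCot (E := E) a.1 (covec a + t • p)) 0 ∧
    tmap 𝓘(ℝ, ℝ) (cotI E) (fun t : ℝ => mkCot (E := E) a.1 (covec a + t • p)) 0 1 = (0, p) := by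
  have hd : HasDerivAt (fun t : ℝ => (extChartAt 𝓘(ℝ, E) a.1 a.1, covec a + t • p)) ((0 : E), p) 0 := by
    have h1 : HasDerivAt (fun t : ℝ => covec a + t • p) p 0 := by
      simpa using ((hasDerivAt_id (0 : ℝ)).smul_const p).const_add (covec a)
    exact (hasDerivAt_const (0 : ℝ) (extChartAt 𝓘(ℝ, E) a.1 a.1)).prodMk h1
  have hf : (fun t : ℝ => mkCot (E := E) a.1 (covec a + t • p)) =
      fun t : ℝ => cotParam a.1 (extChartAt 𝓘(ℝ, E) a.1 a.1, covec a + t • p) := by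
    funext t
    exact (cotParam_center (mkCot a.1 (covec a + t • p))).symm
  have h0 : covec a + (0 : ℝ) • p = covec a := by simp
  have hc : MDifferentiableAt 𝓘(ℝ, E × (E →L[ℝ] ℝ)) (cotI E) (cotParam a.1)
      (extChartAt 𝓘(ℝ, E) a.1 a.1, covec a + (0 : ℝ) • p) :=
    (cotParam_smoothAt rfl).mdifferentiableAt (by simp)
  have hd' := hd.differentiableAt.mdifferentiableAt
  rw [hf]
  refine ⟨hc.comp (0 : ℝ) hd', ?_⟩
  have h1 := tmap_comp_apply (I := 𝓘(ℝ, ℝ)) (I' := 𝓘(ℝ, E × (E →L[ℝ] ℝ))) (I'' := cotI E)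
    (g := cotParam a.1) (f := fun t : ℝ => (extChartAt 𝓘(ℝ, E) a.1 a.1, covec a + t • p))
    (x := (0 : ℝ)) hc hd' 1
  refine h1.trans ?_
  rw [h0, tmap_cotParam, tmap_eq_fderiv, HasFDerivAt.fderiv
    (f := fun t : ℝ => (extChartAt 𝓘(ℝ, E) a.1 a.1, covec a + t • p)) hd.hasFDerivAt]
  simp

omit [FiniteDimensional ℝ E] in
theorem bilin_sub (B : E →L[ℝ] E →L[ℝ] ℝ) (x y w : E) : B (x - y) w = B x w - B y w := by
  rw [map_sub, sub_apply]

theorem canonicalForm_swap (a : Cot E X) (u v : E × (E →L[ℝ] ℝ)) :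
    canonicalForm a u v = - canonicalForm a v u := by
  simp only [canonicalForm_apply]; ring

/-- The sum of the canonical form and of a semi-basic form is nondegenerate. -/
theorem canonicalForm_add_nondegenerate (a : Cot E X) (b : E → E → ℝ) (hb : ∀ w, b 0 w = 0)
    {v : E × (E →L[ℝ] ℝ)} (hb' : ∀ v, b v 0 = 0)
    (hv : ∀ w, canonicalForm a v w + b v.1 w.1 = 0) : v = 0 := by
  have h1 : v.1 = 0 := by
    by_contra hne
    obtain ⟨p, -, hp⟩ := exists_dual_vector ℝ v.1 (norm_ne_zero_iff.mpr hne)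
    have := hv (0, p)
    rw [canonicalForm_apply] at this
    simp only [map_zero, sub_zero, hb', add_zero] at this
    rw [hp] at this
    simp at this
    exact hne this
  refine Prod.ext h1 (ContinuousLinearMap.ext fun w => ?_)
  have := hv (w, 0)
  rw [canonicalForm_apply, h1] at this
  simpa [hb] using this

end Vertical

section Setup

variable {E : Type*} [NormedAddCommGroup E] [NormedSpace ℝ E] [FiniteDimensional ℝ E]
  {Q : Type*} [TopologicalSpace Q] [ChartedSpace E Q] [IsManifold 𝓘(ℝ, E) ∞ Q] [T2Space Q]
  {𝔤 : Type*} [NormedAddCommGroup 𝔤] [NormedSpace ℝ 𝔤] [FiniteDimensional ℝ 𝔤]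
  {G : Type*} [Group G] [TopologicalSpace G] [ChartedSpace 𝔤 G] [LieGroup 𝓘(ℝ, 𝔤) ∞ G]
  [MulAction G Q] [ContMDiffSMul 𝓘(ℝ, 𝔤) 𝓘(ℝ, E) ∞ G Q] [ProperSMul G Q]
  {sys : System E Q} {k : ℕ} {ζ : Fin k → Q → 𝔤} {W Hor : PlaneField E Q}
  {N : Subgroup G} [N.Normal]
  {E₁ : Type*} [NormedAddCommGroup E₁] [NormedSpace ℝ E₁] [FiniteDimensional ℝ E₁]
  [ChartedSpace E₁ (OrbitSpace Q N)] [IsManifold 𝓘(ℝ, E₁) ∞ (OrbitSpace Q N)]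

variable (G sys W Hor ζ) in
/-- The vector-valued 2-form `(u, v) ↦ ((K_W + d^D Y^i ⊗ ζ_i)(u, v))_Q`. -/
def gyro (q : Q) : E →L[ℝ] E →L[ℝ] E := postcomp (gen G q) (Ktot G sys W Hor ζ q)

theorem gyro_apply (q : Q) (u v : E) :
    gyro G sys ζ W Hor q u v = gen G q (Ktot G sys W Hor ζ q u v) := rfl

theorem gyro_self (q : Q) (u : E) : gyro G sys ζ W Hor q u u = 0 := by
  rw [gyro_apply, Ktot_self, map_zero]

theorem gyro_swap (q : Q) (u v : E) : gyro G sys ζ W Hor q u v = - gyro G sys ζ W Hor q v u := by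
  have := gyro_self (G := G) (sys := sys) (W := W) (Hor := Hor) (ζ := ζ) q (u + v)
  simp only [map_add, add_apply, gyro_self, zero_add, add_zero] at this
  exact eq_neg_of_add_eq_zero_right this

variable (h : Setup sys ζ W Hor N E₁)
include h

theorem Setup.gyro_equivariant (g : G) (q : Q) (u v : E) :
    gyro G sys ζ W Hor (g • q) (tact g q u) (tact g q v) = tact g q (gyro G sys ζ W Hor q u v) := by
  rw [gyro_apply, h.Ktot_equivariant, gyro_apply, tact_gen]

theorem Setup.rep_spec (a : Cot E₁ (OrbitSpace Q N)) : rep sys N a ∈ sys.M ∧ redMap sys N (rep sys N a) = a :=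
  Classical.epsilon_spec (p := fun m => m ∈ sys.M ∧ redMap sys N m = a) (h.redMap_surjective a)

theorem Setup.hlift_smul_of_mem {n : G} (hn : n ∈ N) (q : Q) (w : E₁) :
    hlift sys N (n • q) w = tact n q (hlift sys N q w) := by
  have := h.hlift_equivariant n q w
  rwa [show QuotientGroup.mk' N n = 1 from (QuotientGroup.eq_one_iff n).mpr hn,
    tact_one' h.smoothAct_quotient] at this

theorem Setup.descend_apply {b : Cot E Q → E →L[ℝ] E →L[ℝ] ℝ}
    (hb : ∀ (g : G), ∀ m ∈ sys.M, ∀ u v,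
      b (cotAct g m) (tact g m.1 u) (tact g m.1 v) = b m u v) {m : Cot E Q} (hm : m ∈ sys.M)
    (u v : E₁ × (E₁ →L[ℝ] ℝ)) : descend sys N b (redMap sys N m) u v =
      b m (hlift sys N m.1 u.1) (hlift sys N m.1 v.1) := by
  obtain ⟨h1, h2⟩ := h.rep_spec (redMap (E₁ := E₁) sys N m)
  obtain ⟨n, hn, e⟩ := (h.redMap_eq_iff h1 hm).mp h2
  have key : ∀ r : Cot E Q, cotAct n m = r → b r (hlift sys N r.1 u.1) (hlift sys N r.1 v.1) =
      b m (hlift sys N m.1 u.1) (hlift sys N m.1 v.1) := by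
    rintro _ rfl
    rw [cotAct_fst, h.hlift_smul_of_mem hn, h.hlift_smul_of_mem hn, hb n m hm]
  refine Eq.trans ?_ (key _ e)
  exact congrArg₂ (fun x y => b (rep sys N (redMap (E₁ := E₁) sys N m)) (hlift sys N _ x) (hlift sys N _ y))
    (tτ_apply _ u) (tτ_apply _ v)

theorem Setup.JKW_invariant (g : G) (m : Cot E Q) (u v : E) :
    JKW (𝔤 := 𝔤) G sys W (cotAct g m) (tact g m.1 u) (tact g m.1 v) =
      JKW (𝔤 := 𝔤) G sys W m u v := by
  change momentum G (cotAct g m) (KW (𝔤 := 𝔤) G sys W (g • m.1) _ _) = momentum G m (KW G sys W m.1 u v)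
  rw [h.KW_equivariant, momentum_apply, momentum_apply, cotAct_fst,
    ← tact_gen]
  exact (smoothAct_id E Q 𝔤 G).covec_cotAct_tact g m _

theorem Setup.OmegaTilde_redMap {m : Cot E Q} (hm : m ∈ sys.M) {u v : E × (E →L[ℝ] ℝ)}
    (hu : u.1 ∈ sys.D m.1) (hv : v.1 ∈ sys.D m.1) :
    OmegaTilde (𝔤 := 𝔤) sys N W (redMap (E₁ := E₁) sys N m) (tredMap sys N m u) (tredMap sys N m v) =
      canonicalForm m u v := by
  change canonicalForm _ _ _ - descend sys N (JKW (𝔤 := 𝔤) G sys W) _ _ _ = _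
  rw [h.descend_apply (fun g m _ => h.JKW_invariant g m) hm, h.canonicalForm_redMap m hu hv,
    h.tredMap_fst, h.tredMap_fst, h.hlift_tproj_of_mem hu, h.hlift_tproj_of_mem hv, add_sub_cancel_right]

theorem Setup.Htilde_redMap {m : Cot E Q} (hm : m ∈ sys.M) :
    Htilde (E₁ := E₁) sys N (redMap sys N m) = sys.hamiltonian m := by
  obtain ⟨h1, h2⟩ := h.rep_spec (redMap (E₁ := E₁) sys N m)
  obtain ⟨n, hn, e⟩ := (h.redMap_eq_iff h1 hm).mp h2
  rw [Htilde, ← e, hamiltonian_invariant (smoothAct_id E Q 𝔤 G) h.sym]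

theorem Setup.exists_section (q : Q) : ∃ s : OrbitSpace Q N → Q, ∃ U : Set (OrbitSpace Q N),
    IsOpen U ∧ NH.proj N q ∈ U ∧ ContMDiffOn 𝓘(ℝ, E₁) 𝓘(ℝ, E) ∞ s U ∧
      (∀ x ∈ U, NH.proj N (s x) = x) ∧ s (NH.proj N q) = q ∧
      tmap 𝓘(ℝ, E₁) 𝓘(ℝ, E) s (NH.proj N q) = hlift sys N q := by
  obtain ⟨s, U, h1, h2, h3, h4, h5, h6⟩ :=
    exists_local_section h.proj.1 q (r := hlift sys N q) (h.tproj_hlift q)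
  exact ⟨s, U, h1, h2, h3, h4, h5, ContinuousLinearMap.ext h6⟩

/-- Smooth local sections of `M → T*Q̃`. -/
theorem Setup.exists_section_M (a : Cot E₁ (OrbitSpace Q N)) :
    ∃ σ : Cot E₁ (OrbitSpace Q N) → Cot E Q, ContMDiffAt (cotI E₁) (cotI E) ∞ σ a ∧
      (∀ b, σ b ∈ sys.M) ∧ ∀ᶠ b in 𝓝 a, redMap sys N (σ b) = b := by
  obtain ⟨x, l⟩ := a
  obtain ⟨q, rfl⟩ := Quotient.mk_surjective x
  obtain ⟨s, U, h1, h2, h3, h4, h5, -⟩ := h.exists_section q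
  have hU : ∀ᶠ b : Cot E₁ (OrbitSpace Q N) in 𝓝 ⟨NH.proj N q, l⟩, b.1 ∈ U :=
    (smooth_pr (E := E₁) (⟨NH.proj N q, l⟩ : Cot E₁ (OrbitSpace Q N))).continuousAt.preimage_mem_nhds
      (h1.mem_nhds h2)
  refine ⟨fun b => liftM sys W N (s b.1) (covec b), ?_, fun b => h.liftM_mem _ _, ?_⟩
  · refine h.liftM_smoothAt (f := fun b : Cot E₁ (OrbitSpace Q N) => s b.1) (a := fun b => b)
      (ContMDiffAt.comp _ (g := s) (h3.contMDiffAt (h1.mem_nhds h2)) (smooth_pr _)) contMDiffAt_id ?_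
    exact hU.mono fun b hb => h4 _ hb
  · refine hU.mono fun b hb => ?_
    rw [h.redMap_liftM]
    exact cot_ext (h4 _ hb) rfl

theorem Setup.Htilde_smooth : ContMDiff (cotI E₁) 𝓘(ℝ, ℝ) ∞ (Htilde (E₁ := E₁) sys N) := fun a => by
  obtain ⟨σ, h1, h2, h3⟩ := h.exists_section_M a
  refine (ContMDiffAt.comp a (g := sys.hamiltonian) (hamiltonian_smoothAt _) h1).congr_of_eventuallyEq ?_
  refine h3.mono fun b hb => ?_
  change _ = sys.hamiltonian (σ b)
  rw [← h.Htilde_redMap (h2 b), hb]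

theorem Setup.dfun_of_eq_on_M {f : Cot E₁ (OrbitSpace Q N) → ℝ} {F : Cot E Q → ℝ}
    (hfF : ∀ m ∈ sys.M, f (redMap sys N m) = F m) {m : Cot E Q}
    (hf : MDifferentiableAt (cotI E₁) 𝓘(ℝ, ℝ) f (redMap sys N m))
    (hF : MDifferentiableAt (cotI E) 𝓘(ℝ, ℝ) F m) {w : E × (E →L[ℝ] ℝ)}
    (hw : w ∈ tangentTo (cotI E) sys.M m) :
    dfun (cotI E₁) f (redMap sys N m) (tredMap sys N m w) = dfun (cotI E) F m w := by
  obtain ⟨γ, h1, h2, rfl, rfl⟩ := hw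
  have hγ : MDifferentiableAt 𝓘(ℝ, ℝ) (cotI E) γ 0 := h1.mdifferentiable (by simp) 0
  have h3 := hasDerivAt_curve hF hγ rfl
  have h4 := hasDerivAt_curve hf ((h.redMap_mdiff (γ 0)).comp (0 : ℝ) hγ) rfl
  have h5 : tmap 𝓘(ℝ, ℝ) (cotI E₁) (fun t => redMap (E₁ := E₁) sys N (γ t)) 0 1 =
      tredMap sys N (γ 0) (tmap 𝓘(ℝ, ℝ) (cotI E) γ 0 1) :=
    tmap_comp_apply (I := 𝓘(ℝ, ℝ)) (I' := cotI E) (I'' := cotI E₁) (x := (0 : ℝ))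
      (h.redMap_mdiff (γ 0)) hγ 1
  rw [← h5]
  exact h4.unique (h3.congr_of_eventuallyEq (.of_forall fun t => hfF _ (h2 t)))

theorem Setup.dHtilde_redMap {m : Cot E Q} {w : E × (E →L[ℝ] ℝ)}
    (hw : w ∈ tangentTo (cotI E) sys.M m) :
    dfun (cotI E₁) (Htilde (E₁ := E₁) sys N) (redMap sys N m) (tredMap sys N m w) =
      dfun (cotI E) sys.hamiltonian m w :=
  h.dfun_of_eq_on_M (fun m hm => h.Htilde_redMap hm) (h.Htilde_smooth.mdifferentiable (by simp) _)
    ((hamiltonian_smoothAt m).mdifferentiableAt (by simp)) hw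

omit h in
theorem C_fst_mem {m : Cot E Q} {w : E × (E →L[ℝ] ℝ)} (hw : w ∈ sys.C m) : w.1 ∈ sys.D m.1 := by
  have := hw.2
  rwa [tτ_apply] at this

theorem Setup.OmegaTilde_nondegenerate (a : Cot E₁ (OrbitSpace Q N)) {v : E₁ × (E₁ →L[ℝ] ℝ)}
    (hv : ∀ w, OmegaTilde (𝔤 := 𝔤) sys N W a v w = 0) : v = 0 := by
  obtain ⟨m, hm, rfl⟩ := h.redMap_surjective a
  refine canonicalForm_add_nondegenerate (redMap (E₁ := E₁) sys N m) (fun x y => - JKW (𝔤 := 𝔤) G sys W m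
    (hlift sys N m.1 x) (hlift sys N m.1 y)) (by simp) (by simp) fun w => ?_
  have := hv w
  change canonicalForm _ _ _ - descend sys N (JKW (𝔤 := 𝔤) G sys W) _ _ _ = _ at this
  rwa [h.descend_apply (fun g m _ => h.JKW_invariant g m) hm, sub_eq_add_neg] at this

theorem Setup.Xnh_spec {m : Cot E Q} (hm : m ∈ sys.M) : sys.Xnh m ∈ sys.C m ∧
    ∀ w ∈ sys.C m, canonicalForm m (sys.Xnh m) w = dfun (cotI E) sys.hamiltonian m w := by
  refine Classical.epsilon_spec (p := fun v => v ∈ sys.C m ∧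
    ∀ w ∈ sys.C m, canonicalForm m v w = dfun (cotI E) sys.hamiltonian m w) ?_
  obtain ⟨x, hx⟩ := (injective_bilin_bijective (B := OmegaTilde (𝔤 := 𝔤) sys N W (redMap (E₁ := E₁) sys N m))
    fun v hv => h.OmegaTilde_nondegenerate _ hv).2
    (dfun (cotI E₁) (Htilde (E₁ := E₁) sys N) (redMap sys N m))
  obtain ⟨u, hu, rfl⟩ := h.exists_C_lift hm x
  refine ⟨u, hu, fun w hw => ?_⟩
  rw [← h.OmegaTilde_redMap hm (C_fst_mem hu) (C_fst_mem hw), hx, h.dHtilde_redMap hw.1]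

theorem Setup.Xnh_fst_mem {m : Cot E Q} (hm : m ∈ sys.M) : (sys.Xnh m).1 ∈ sys.D m.1 :=
  C_fst_mem (h.Xnh_spec hm).1

theorem Setup.OmegaTilde_tredMap_Xnh {m : Cot E Q} (hm : m ∈ sys.M) (w : E₁ × (E₁ →L[ℝ] ℝ)) :
    OmegaTilde (𝔤 := 𝔤) sys N W (redMap (E₁ := E₁) sys N m) (tredMap sys N m (sys.Xnh m)) w =
      dfun (cotI E₁) (Htilde (E₁ := E₁) sys N) (redMap sys N m) w := by
  obtain ⟨u, hu, rfl⟩ := h.exists_C_lift hm w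
  rw [h.OmegaTilde_redMap hm (h.Xnh_fst_mem hm) (C_fst_mem hu), h.dHtilde_redMap hu.1,
    (h.Xnh_spec hm).2 u hu]

theorem Setup.Xtilde_redMap {m : Cot E Q} (hm : m ∈ sys.M) :
    Xtilde (E₁ := E₁) sys N (redMap sys N m) = tredMap sys N m (sys.Xnh m) := by
  obtain ⟨h1, h2⟩ := h.rep_spec (redMap (E₁ := E₁) sys N m)
  refine sub_eq_zero.mp (h.OmegaTilde_nondegenerate (redMap (E₁ := E₁) sys N m) fun w => ?_)
  have h3 := h.OmegaTilde_tredMap_Xnh h1 w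
  rw [h2] at h3
  rw [bilin_sub, h.OmegaTilde_tredMap_Xnh hm]
  exact sub_eq_zero.mpr h3

/-- The nonholonomic vector field is a second order equation. -/
theorem Setup.Xnh_fst {m : Cot E Q} (hm : m ∈ sys.M) : (sys.Xnh m).1 = sys.vel m := by
  have hU : sys.vel m ∈ sys.D m.1 := mem_M_iff.mp hm
  have key : ∀ d ∈ sys.D m.1, sys.metric m.1 d ((sys.Xnh m).1 - sys.vel m) = 0 := fun d hd => by
    obtain ⟨hc1, hc2⟩ := vertical_curve m (sys.metric m.1 d)
    have hval : ∀ t : ℝ, covec m + t • sys.metric m.1 d = sys.metric m.1 (sys.vel m + t • d) := fun t => by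
      rw [map_add, map_smul, metric_vel]
    simp only [hval] at hc1 hc2
    have hmem : ∀ t : ℝ, mkCot m.1 (sys.metric m.1 (sys.vel m + t • d)) ∈ sys.M := fun t =>
      mkCot_metric_mem (Submodule.add_mem _ hU (Submodule.smul_mem _ _ hd))
    have h0 : mkCot m.1 (sys.metric m.1 (sys.vel m + (0 : ℝ) • d)) = m := by
      rw [← hval, zero_smul, add_zero]; rfl
    have hsm : ContMDiff 𝓘(ℝ, ℝ) (cotI E) ∞
        (fun t : ℝ => mkCot m.1 (sys.metric m.1 (sys.vel m + t • d))) := by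
      intro t
      refine mkCot_smoothAt (f := fun _ : ℝ => m.1) (z := fun t : ℝ => sys.vel m + t • d) ?_
      exact SmAt.const (by
        exact (contDiff_const.add (contDiff_id.smul contDiff_const)).contMDiff.contMDiffAt)
    have hC : ((0 : E), sys.metric m.1 d) ∈ sys.C m :=
      ⟨⟨_, hsm, hmem, h0, hc2⟩, by rw [tτ_apply]; exact Submodule.zero_mem _⟩
    have h1 := (h.Xnh_spec hm).2 _ hC
    have h2 := hasDerivAt_curve (f := sys.hamiltonian) (x := m)
      ((hamiltonian_smoothAt m).mdifferentiableAt (by simp)) hc1 h0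
    rw [hc2, ← h1, canonicalForm_apply] at h2
    have h3 : HasDerivAt (fun t : ℝ => sys.hamiltonian
        (mkCot m.1 (sys.metric m.1 (sys.vel m + t • d)))) (sys.metric m.1 d (sys.vel m)) 0 := by
      have h4 : ∀ t : ℝ, sys.hamiltonian (mkCot m.1 (sys.metric m.1 (sys.vel m + t • d))) =
          1 / 2 * sys.metric m.1 (sys.vel m) (sys.vel m) + t * sys.metric m.1 d (sys.vel m) +
            t ^ 2 * (1 / 2 * sys.metric m.1 d d) + sys.U m.1 := fun t => by
        rw [hamiltonian_eq, vel_mkCot, covec_mkCot]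
        simp only [map_add, map_smul, add_apply, smul_apply, smul_eq_mul,
          metric_symm (sys := sys) m.1 (sys.vel m) d, mkCot_fst]
        ring
      simp only [h4]
      have h5 := (((hasDerivAt_id (0 : ℝ)).mul_const (sys.metric m.1 d (sys.vel m))).const_add
        (1 / 2 * sys.metric m.1 (sys.vel m) (sys.vel m))).add
        (((hasDerivAt_id (0 : ℝ)).pow 2).mul_const (1 / 2 * sys.metric m.1 d d)) |>.add_const (sys.U m.1)
      simpa using h5
    have h6 := h2.unique h3
    simp only [map_zero, sub_zero] at h6
    rw [map_sub, h6, sub_self]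
  exact sub_eq_zero.mp (metric_definite (key _ (Submodule.sub_mem _ (h.Xnh_fst_mem hm) hU)))

theorem Setup.cgen_mem_C {m : Cot E Q} (hm : m ∈ sys.M) {ξ : 𝔤} (hξ : gen G m.1 ξ ∈ sys.D m.1) :
    cgen (MonoidHom.id G) m ξ ∈ sys.C m := by
  have hA := smoothAct_id E Q 𝔤 G
  have : IsManifold 𝓘(ℝ, 𝔤) ∞ G := ContMDiffMul.toIsManifold (I := 𝓘(ℝ, 𝔤))
  obtain ⟨γ, h1, -, h3, h4⟩ := exists_curve (I := 𝓘(ℝ, 𝔤)) (x := (1 : G)) Filter.univ_mem ξ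
  have hs : ContMDiff 𝓘(ℝ, 𝔤) (cotI E) ∞ (fun g : G => cotAct (MonoidHom.id G g) m) :=
    hA.cotAct_smooth.comp (contMDiff_id.prodMk contMDiff_const)
  refine ⟨⟨fun t => cotAct (MonoidHom.id G (γ t)) m, hs.comp h1, fun t =>
    cotAct_mem_M hA h.sym _ hm, ?_, ?_⟩, ?_⟩
  · simp only [h3, map_one, hA.cotAct_one]
  · have h5 := tmap_comp_apply (I := 𝓘(ℝ, ℝ)) (I' := 𝓘(ℝ, 𝔤)) (I'' := cotI E)
      (g := fun g : G => cotAct (MonoidHom.id G g) m) (f := γ) (x := (0 : ℝ))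
      (hs.mdifferentiable (by simp) _) (h1.mdifferentiable (by simp) 0) 1
    rw [h3, h4] at h5
    exact h5
  · rw [tτ_apply, hA.cgen_fst]
    exact hξ

/-- The differential of the gauge momenta. -/
theorem Setup.dfun_momentumOf (i : Fin k) (m : Cot E Q) (w : E × (E →L[ℝ] ℝ)) :
    dfun (cotI E) (momentumOf G (ζ i)) m w =
      canonicalForm m (cgen (MonoidHom.id G) m (ζ i m.1)) w +
        covec m (gen G m.1 (tmap 𝓘(ℝ, E) 𝓘(ℝ, 𝔤) (ζ i) m.1 w.1)) := by
  have hJ : MDifferentiableAt (cotI E) 𝓘(ℝ, 𝔤 →L[ℝ] ℝ) (momentum (E := E) (𝔤 := 𝔤) G) m :=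
    (h.momentum_smoothAt m).mdifferentiableAt (by simp)
  have hζ : MDifferentiableAt 𝓘(ℝ, E) 𝓘(ℝ, 𝔤) (ζ i) m.1 := (h.gauge.smooth i).mdifferentiable (by simp) _
  have hp : MDifferentiableAt (cotI E) 𝓘(ℝ, E) (fun b : Cot E Q => b.1) m :=
    (smooth_pr m).mdifferentiableAt (by simp)
  have h1 := tmap_clm_apply hJ (z := fun b : Cot E Q => ζ i b.1) (hζ.comp m hp) w
  have h2 := tmap_clm_apply hJ (z := fun _ : Cot E Q => ζ i m.1) mdifferentiableAt_const w
  rw [tmap_const, zero_apply, map_zero, add_zero] at h2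
  have h3 : tmap (cotI E) 𝓘(ℝ, 𝔤) (fun b : Cot E Q => ζ i b.1) m w =
      tmap 𝓘(ℝ, E) 𝓘(ℝ, 𝔤) (ζ i) m.1 w.1 := by
    rw [← tτ_apply m w]
    exact tmap_comp_apply (g := ζ i) hζ hp w
  rw [← h2, h3, momentum_apply] at h1
  refine h1.trans (congrArg (· + _) ?_)
  rw [(smoothAct_id E Q 𝔤 G).canonicalForm_cgen]
  simp only [momentum_apply]
  rfl

/-- The momentum equation: the gauge momenta are conserved if and only if the reaction-annihilating
condition below holds. -/
theorem Setup.covec_gauge_deriv (i : Fin k) {m : Cot E Q} (hm : m ∈ sys.M) :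
    covec m (gen G m.1 (tmap 𝓘(ℝ, E) 𝓘(ℝ, 𝔤) (ζ i) m.1 (sys.vel m))) = 0 := by
  have hA := smoothAct_id E Q 𝔤 G
  have h1 := h.gauge.conserved i m hm
  have hC := h.cgen_mem_C hm (h.gauge_mem_D i m.1)
  rw [h.dfun_momentumOf, canonicalForm_swap, (h.Xnh_spec hm).2 _ hC, h.Xnh_fst hm] at h1
  have h2 : dfun (cotI E) sys.hamiltonian m (cgen (MonoidHom.id G) m (ζ i m.1)) = 0 := by
    have hs : ContMDiff 𝓘(ℝ, 𝔤) (cotI E) ∞ (fun g : G => cotAct (MonoidHom.id G g) m) :=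
      hA.cotAct_smooth.comp (contMDiff_id.prodMk contMDiff_const)
    have h3 := tmap_comp_apply (I := 𝓘(ℝ, 𝔤)) (I' := cotI E) (I'' := 𝓘(ℝ, ℝ)) (g := sys.hamiltonian)
      (f := fun g : G => cotAct (MonoidHom.id G g) m) (x := (1 : G))
      ((hamiltonian_smoothAt _).mdifferentiableAt (by simp)) (hs.mdifferentiable (by simp) _) (ζ i m.1)
    rw [map_one, hA.cotAct_one] at h3
    refine h3.symm.trans ?_
    simp only [MonoidHom.id_apply, hamiltonian_invariant hA h.sym, tmap_const]
    rfl
  rwa [h2, neg_zero, zero_add] at h1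

theorem Setup.metric_gyro_self {q : Q} {s u : E} (hs : s ∈ distS 𝔤 G sys q) (hu : u ∈ sys.D q) :
    sys.metric q u (gyro G sys ζ W Hor q s u) = 0 := by
  rw [← h.span_gaugeField] at hs
  induction hs using Submodule.span_induction with
  | mem x hx =>
    obtain ⟨i, rfl⟩ := hx
    have h1 := h.covec_gauge_deriv i (mkCot_metric_mem hu)
    rw [vel_mkCot, covec_mkCot, mkCot_fst] at h1
    rwa [gyro_apply, h.Ktot_gauge i hu]
  | zero => simp
  | add x y _ _ hx hy => rw [map_add, add_apply, map_add, hx, hy, add_zero]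
  | smul c x _ hx => rw [map_smul, smul_apply, map_smul, hx, smul_zero]

theorem Setup.metric_gyro_swap {q : Q} {s u v : E} (hs : s ∈ distS 𝔤 G sys q) (hu : u ∈ sys.D q)
    (hv : v ∈ sys.D q) :
    sys.metric q u (gyro G sys ζ W Hor q s v) = - sys.metric q v (gyro G sys ζ W Hor q s u) := by
  have := h.metric_gyro_self hs (Submodule.add_mem _ hu hv)
  simp only [map_add, add_apply, h.metric_gyro_self hs hu, h.metric_gyro_self hs hv] at this
  linarith

/-! The form `𝐁`. -/

theorem Setup.PV_eq_sub (q : Q) (v : E) : PV 𝔤 G Hor q v = v - PH 𝔤 G Hor q v :=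
  eq_sub_of_add_eq' (projAlong_add (h.hor.compl q) v)

theorem Setup.PV_equivariant (g : G) (q : Q) (v : E) :
    PV 𝔤 G Hor (g • q) (tact g q v) = tact g q (PV 𝔤 G Hor q v) := by
  rw [h.PV_eq_sub, h.PV_eq_sub, h.PH_equivariant, map_sub]

theorem Setup.formB_eq {m : Cot E Q} (hm : m ∈ sys.M) (u v : E) : formB G sys W Hor ζ m u v =
    sys.metric m.1 (sys.vel m) (gyro G sys ζ W Hor m.1 u v) -
    sys.metric m.1 (sys.vel m) (gyro G sys ζ W Hor m.1 (PH 𝔤 G Hor m.1 u) (PH 𝔤 G Hor m.1 v)) -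
    1 / 2 * (sys.metric m.1 (PH 𝔤 G Hor m.1 u)
        (gyro G sys ζ W Hor m.1 (PV 𝔤 G Hor m.1 (sys.vel m)) (PH 𝔤 G Hor m.1 v)) -
      sys.metric m.1 (PH 𝔤 G Hor m.1 v)
        (gyro G sys ζ W Hor m.1 (PV 𝔤 G Hor m.1 (sys.vel m)) (PH 𝔤 G Hor m.1 u))) := by
  have h1 : B1 G sys W Hor ζ m u v =
      sys.metric m.1 (sys.vel m) (gyro G sys ζ W Hor m.1 u v) := by
    rw [metric_vel, gyro_apply, ← momentum_apply, Ktot_apply, map_add, map_sum]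
    simp only [B1, add_apply, sum_apply, smul_apply, map_smul, smul_eq_mul]
    congr 1
    exact Finset.sum_congr rfl fun i _ => mul_comm _ _
  have h2 : postcomp (momentum G m) (- dHorA (𝔤 := 𝔤) G Hor m.1) u v =
      - sys.metric m.1 (sys.vel m)
        (gyro G sys ζ W Hor m.1 (PH 𝔤 G Hor m.1 u) (PH 𝔤 G Hor m.1 v)) := by
    rw [metric_vel, gyro_apply, ← momentum_apply, ← h.dHorA_eq, ← map_neg]
    rfl
  have h3 : tτ m (sys.Xnh m) = sys.vel m := by rw [tτ_apply, h.Xnh_fst hm]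
  rw [formB, add_apply, add_apply, h1, calB, h3]
  simp only [sub_apply, smul_apply, smul_eq_mul]
  rw [h2]
  simp only [wedgeκ, ContinuousLinearMap.bilinearComp_apply, sub_apply, ContinuousLinearMap.flip_apply,
    ContinuousLinearMap.comp_apply, ContinuousLinearMap.id_apply, gyro_apply]
  ring

theorem Setup.formB_self {m : Cot E Q} (hm : m ∈ sys.M) (u : E) : formB G sys W Hor ζ m u u = 0 := by
  rw [h.formB_eq hm, gyro_self, gyro_self]; simp

theorem Setup.formB_invariant (g : G) {m : Cot E Q} (hm : m ∈ sys.M) (u v : E) :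
    formB G sys W Hor ζ (cotAct g m) (tact g m.1 u) (tact g m.1 v) = formB G sys W Hor ζ m u v := by
  have hA := smoothAct_id E Q 𝔤 G
  rw [h.formB_eq hm, h.formB_eq (cotAct_mem_M hA h.sym g hm), vel_cotAct hA h.sym, cotAct_fst]
  simp only [h.PV_equivariant, h.PH_equivariant, h.gyro_equivariant, metric_invariant h.sym]

/-- The form `𝐁` does not change the dynamics. -/
theorem Setup.formB_vel {m : Cot E Q} (hm : m ∈ sys.M) {v : E} (hv : v ∈ sys.D m.1) :
    formB G sys W Hor ζ m (sys.vel m) v = 0 := by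
  rw [h.formB_eq hm]
  have hU : sys.vel m ∈ sys.D m.1 := mem_M_iff.mp hm
  set q := m.1
  set U := sys.vel m
  have hS : ∀ x ∈ sys.D q, PV 𝔤 G Hor q x ∈ distS 𝔤 G sys q := fun x hx =>
    ⟨by rw [h.PV_eq_sub]; exact Submodule.sub_mem _ hx (h.hor.le_D q (h.PH_mem q x)),
      projAlong_mem (h.hor.compl q).symm x⟩
  have hd : ∀ x, x = PH 𝔤 G Hor q x + PV 𝔤 G Hor q x := fun x => by rw [h.PV_eq_sub]; abel
  have hH : ∀ x, PH 𝔤 G Hor q x ∈ sys.D q := fun x => h.hor.le_D q (h.PH_mem q x)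
  have e1 := h.metric_gyro_self (hS v hv) hU
  rw [gyro_swap, map_neg, neg_eq_zero] at e1
  have e2 := h.metric_gyro_swap (hS U hU) (hH U) (hH v)
  have e3 := h.metric_gyro_swap (hS U hU) (hS U hU).1 (hH v)
  rw [gyro_self, map_zero, neg_zero] at e3
  have e4 : sys.metric q U (gyro G sys ζ W Hor q U v) =
      sys.metric q U (gyro G sys ζ W Hor q (PH 𝔤 G Hor q U) (PH 𝔤 G Hor q v)) +
      sys.metric q U (gyro G sys ζ W Hor q (PV 𝔤 G Hor q U) (PH 𝔤 G Hor q v)) := by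
    conv_lhs => rw [hd v, map_add, map_add, e1, add_zero]
    rw [← map_add, ← add_apply, ← map_add, ← hd U]
  have e5 : sys.metric q U (gyro G sys ζ W Hor q (PV 𝔤 G Hor q U) (PH 𝔤 G Hor q v)) =
      sys.metric q (PH 𝔤 G Hor q U) (gyro G sys ζ W Hor q (PV 𝔤 G Hor q U) (PH 𝔤 G Hor q v)) := by
    conv_lhs => rw [hd U, map_add (sys.metric q), add_apply]
    rw [← hd U, e3, add_zero]
  rw [e4, e5]
  linarith

theorem Setup.formB_gauge (i : Fin k) {m : Cot E Q} (hm : m ∈ sys.M) {v : E} (hv : v ∈ sys.D m.1) :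
    formB G sys W Hor ζ m (gen G m.1 (ζ i m.1)) v =
      covec m (gen G m.1 (tmap 𝓘(ℝ, E) 𝓘(ℝ, 𝔤) (ζ i) m.1 v)) := by
  rw [h.formB_eq hm, h.PH_gen, metric_vel, gyro_apply, h.Ktot_gauge i hv]
  simp

end Setup

/-! ### The partially reduced system -/

section FormSections

variable {E : Type*} [NormedAddCommGroup E] [NormedSpace ℝ E] [FiniteDimensional ℝ E]
  {H : Type*} [TopologicalSpace H] {I : ModelWithCorners ℝ E H} [I.Boundaryless]
  {X : Type*} [TopologicalSpace X] [ChartedSpace H X] [IsManifold I ∞ X]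

theorem contMDiff_form2_section {σ : X → E →L[ℝ] E →L[ℝ] ℝ} (hσ : ∀ x, Form2At I σ x) :
    ContMDiff I (I.prod 𝓘(ℝ, E →L[ℝ] E →L[ℝ] ℝ)) ∞
    (fun x => TotalSpace.mk' (E →L[ℝ] E →L[ℝ] ℝ)
      (E := fun x : X => TangentSpace I x →L[ℝ] TangentSpace I x →L[ℝ] ℝ) x (σ x)) := by
  intro x
  rw [contMDiffAt_totalSpace]
  refine ⟨contMDiffAt_id, (hσ x).congr_of_eventuallyEq ?_⟩
  filter_upwards [eventually_mem_source H x] with y hy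
  have h1 : (trivializationAt (E →L[ℝ] E →L[ℝ] ℝ)
      (fun x : X => TangentSpace I x →L[ℝ] TangentSpace I x →L[ℝ] ℝ) x
      (TotalSpace.mk' (E →L[ℝ] E →L[ℝ] ℝ)
      (E := fun x : X => TangentSpace I x →L[ℝ] TangentSpace I x →L[ℝ] ℝ) y (σ y))).2 =
      ContinuousLinearMap.inCoordinates E (TangentSpace I : X → Type _) (E →L[ℝ] ℝ)
        (fun x : X => TangentSpace I x →L[ℝ] (Bundle.Trivial X ℝ x)) x y x y (σ y) := rfl
  refine h1.trans ?_
  ext v w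
  have h2 := inCoordinates_apply_eq₂ (F₁ := E) (E₁ := (TangentSpace I : X → Type _)) (F₂ := E)
    (E₂ := (TangentSpace I : X → Type _)) (F₃ := ℝ) (E₃ := Bundle.Trivial X ℝ) (x₀ := x) (x := y)
    (ϕ := σ y) (v := v) (w := w) (by simpa using hy) (by simpa using hy) (by simp)
  refine h2.trans ?_
  have h3 : ∀ r : ℝ, (trivializationAt ℝ (Bundle.Trivial X ℝ) x).linearMapAt ℝ y r = r := fun r => by
    change (Bundle.Trivial.trivialization X ℝ).linearMapAt ℝ y r = r
    rw [Bundle.Trivial.linearMapAt_trivialization]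
    rfl
  refine (h3 _).trans ?_
  have h4 : ∀ v : E, (trivializationAt E (TangentSpace I : X → Type _) x).symm y v = cfi I x y v := fun v => by
    rw [← symmL_eq_cfi hy, Trivialization.symmL_apply]
    simpa using hy
  rw [h4, h4]
  rfl
end FormSections

section Setup

variable {E : Type*} [NormedAddCommGroup E] [NormedSpace ℝ E] [FiniteDimensional ℝ E]
  {Q : Type*} [TopologicalSpace Q] [ChartedSpace E Q] [IsManifold 𝓘(ℝ, E) ∞ Q] [T2Space Q]
  {𝔤 : Type*} [NormedAddCommGroup 𝔤] [NormedSpace ℝ 𝔤] [FiniteDimensional ℝ 𝔤]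
  {G : Type*} [Group G] [TopologicalSpace G] [ChartedSpace 𝔤 G] [LieGroup 𝓘(ℝ, 𝔤) ∞ G]
  [MulAction G Q] [ContMDiffSMul 𝓘(ℝ, 𝔤) 𝓘(ℝ, E) ∞ G Q] [ProperSMul G Q]
  {sys : System E Q} {k : ℕ} {ζ : Fin k → Q → 𝔤} {W Hor : PlaneField E Q}
  {N : Subgroup G} [N.Normal]
  {E₁ : Type*} [NormedAddCommGroup E₁] [NormedSpace ℝ E₁] [FiniteDimensional ℝ E₁]
  [ChartedSpace E₁ (OrbitSpace Q N)] [IsManifold 𝓘(ℝ, E₁) ∞ (OrbitSpace Q N)]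

variable (h : Setup sys ζ W Hor N E₁)
include h

theorem Setup.JKW_PD (m : Cot E Q) (u v : E) :
    JKW (𝔤 := 𝔤) G sys W m (PD sys W m.1 u) (PD sys W m.1 v) = JKW (𝔤 := 𝔤) G sys W m u v := by
  change momentum G m (KW (𝔤 := 𝔤) G sys W m.1 _ _) = momentum G m (KW (𝔤 := 𝔤) G sys W m.1 u v)
  rw [KW_apply, KW_apply, h.PD_of_mem (h.PD_mem _ _), h.PD_of_mem (h.PD_mem _ _)]

theorem Setup.JKW_self (m : Cot E Q) (u : E) : JKW (𝔤 := 𝔤) G sys W m u u = 0 := by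
  change momentum G m (KW (𝔤 := 𝔤) G sys W m.1 u u) = 0
  rw [KW_self, map_zero]

theorem Setup.PH_PD (q : Q) (u : E) : PH 𝔤 G Hor q (PD sys W q u) = PH 𝔤 G Hor q u := by
  have h1 : PH 𝔤 G Hor q (u - PD sys W q u) = 0 :=
    (projAlong_eq_zero (h.hor.compl q)).mpr (h.compl.le_vert q (h.sub_PD_mem q u))
  rw [map_sub] at h1
  exact (sub_eq_zero.mp h1).symm

theorem Setup.formB_PD {m : Cot E Q} (hm : m ∈ sys.M) (u v : E) :
    formB G sys W Hor ζ m (PD sys W m.1 u) (PD sys W m.1 v) = formB G sys W Hor ζ m u v := by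
  rw [h.formB_eq hm, h.formB_eq hm, gyro_apply, h.Ktot_PD, ← gyro_apply, h.PH_PD, h.PH_PD]

theorem Setup.descend_JKW {m : Cot E Q} (hm : m ∈ sys.M) (u v : E × (E →L[ℝ] ℝ)) :
    descend (E₁ := E₁) sys N (JKW (𝔤 := 𝔤) G sys W) (redMap sys N m) (tredMap sys N m u)
      (tredMap sys N m v) = JKW (𝔤 := 𝔤) G sys W m u.1 v.1 := by
  rw [h.descend_apply (fun g m _ => h.JKW_invariant g m) hm, h.tredMap_fst, h.tredMap_fst,
    h.hlift_tproj, h.hlift_tproj, h.JKW_PD]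

theorem Setup.descend_formB {m : Cot E Q} (hm : m ∈ sys.M) (u v : E × (E →L[ℝ] ℝ)) :
    descend (E₁ := E₁) sys N (formB G sys W Hor ζ) (redMap sys N m) (tredMap sys N m u)
      (tredMap sys N m v) = formB G sys W Hor ζ m u.1 v.1 := by
  rw [h.descend_apply (fun g m hm => h.formB_invariant g hm) hm, h.tredMap_fst, h.tredMap_fst,
    h.hlift_tproj, h.hlift_tproj, h.formB_PD hm]

theorem Setup.OmegaB_apply {m : Cot E Q} (hm : m ∈ sys.M) (u v : E₁ × (E₁ →L[ℝ] ℝ)) :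
    OmegaB sys N W Hor ζ (redMap sys N m) u v = canonicalForm (redMap sys N m) u v -
      JKW (𝔤 := 𝔤) G sys W m (hlift sys N m.1 u.1) (hlift sys N m.1 v.1) +
      formB G sys W Hor ζ m (hlift sys N m.1 u.1) (hlift sys N m.1 v.1) := by
  rw [← h.descend_apply (fun g m _ => h.JKW_invariant g m) hm,
    ← h.descend_apply (fun g m hm => h.formB_invariant g hm) hm]
  rfl

theorem Setup.OmegaB_redMap {m : Cot E Q} (hm : m ∈ sys.M) {u v : E × (E →L[ℝ] ℝ)}
    (hu : u.1 ∈ sys.D m.1) (hv : v.1 ∈ sys.D m.1) :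
    OmegaB sys N W Hor ζ (redMap (E₁ := E₁) sys N m) (tredMap sys N m u) (tredMap sys N m v) =
      canonicalForm m u v + formB G sys W Hor ζ m u.1 v.1 := by
  rw [← h.OmegaTilde_redMap hm hu hv, ← h.descend_formB hm]
  rfl

theorem Setup.OmegaB_self (a : Cot E₁ (OrbitSpace Q N)) (u : E₁ × (E₁ →L[ℝ] ℝ)) :
    OmegaB sys N W Hor ζ a u u = 0 := by
  obtain ⟨m, hm, rfl⟩ := h.redMap_surjective a
  rw [h.OmegaB_apply hm, h.JKW_self, h.formB_self hm, canonicalForm_apply]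
  ring

theorem Setup.OmegaB_nondegenerate (a : Cot E₁ (OrbitSpace Q N)) {v : E₁ × (E₁ →L[ℝ] ℝ)}
    (hv : ∀ w, OmegaB sys N W Hor ζ a v w = 0) : v = 0 := by
  obtain ⟨m, hm, rfl⟩ := h.redMap_surjective a
  refine canonicalForm_add_nondegenerate (redMap (E₁ := E₁) sys N m) (fun x y =>
    formB G sys W Hor ζ m (hlift sys N m.1 x) (hlift sys N m.1 y) - JKW (𝔤 := 𝔤) G sys W m
    (hlift sys N m.1 x) (hlift sys N m.1 y)) (by simp) (by simp) fun w => ?_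
  have := hv w
  rw [h.OmegaB_apply hm] at this
  rw [← this]
  ring

theorem Setup.formB_smoothAt {E' : Type*} [NormedAddCommGroup E'] [NormedSpace ℝ E'] {H' : Type*}
    [TopologicalSpace H'] {I' : ModelWithCorners ℝ E' H'} {Y : Type*} [TopologicalSpace Y]
    [ChartedSpace H' Y] {m : Y → Cot E Q} {z w : Y → E} {y₀ : Y}
    (hm : ContMDiffAt I' (cotI E) ∞ m y₀) (hM : ∀ y, m y ∈ sys.M)
    (hz : SmAt 𝓘(ℝ, E) I' (fun y => (m y).1) z y₀) (hw : SmAt 𝓘(ℝ, E) I' (fun y => (m y).1) w y₀) :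
    ContMDiffAt I' 𝓘(ℝ, ℝ) ∞ (fun y => formB G sys W Hor ζ (m y) (z y) (w y)) y₀ := by
  have hU := vel_smoothAt (sys := sys) hm
  have hPV : ∀ {z : Y → E}, SmAt 𝓘(ℝ, E) I' (fun y => (m y).1) z y₀ →
      SmAt 𝓘(ℝ, E) I' (fun y => (m y).1) (fun y => PV 𝔤 G Hor (m y).1 (z y)) y₀ := fun hz => by
    simp only [h.PV_eq_sub]
    exact hz.sub (h.PH_smoothAt hz)
  have hg : ∀ {u v : Y → E}, SmAt 𝓘(ℝ, E) I' (fun y => (m y).1) u y₀ →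
      SmAt 𝓘(ℝ, E) I' (fun y => (m y).1) v y₀ →
      SmAt 𝓘(ℝ, E) I' (fun y => (m y).1) (fun y => gyro G sys ζ W Hor (m y).1 (u y) (v y)) y₀ :=
    fun hu hv => (smoothAct_id E Q 𝔤 G).rgen_smoothAt hu.base
      (Form2At.apply (f := fun y => (m y).1) (h.Ktot_form2At _) hu hv)
  have hκ : ∀ {u v : Y → E}, SmAt 𝓘(ℝ, E) I' (fun y => (m y).1) u y₀ →
      SmAt 𝓘(ℝ, E) I' (fun y => (m y).1) v y₀ →
      ContMDiffAt I' 𝓘(ℝ, ℝ) ∞ (fun y => sys.metric (m y).1 (u y) (v y)) y₀ :=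
    fun hu hv => Form2At.apply (f := fun y => (m y).1) (metric_form2At (sys := sys) _) hu hv
  simp only [h.formB_eq (hM _)]
  have h1 := hκ hU (hg hz hw)
  have h2 := hκ hU (hg (h.PH_smoothAt hz) (h.PH_smoothAt hw))
  have h3 := hκ (h.PH_smoothAt hz) (hg (hPV hU) (h.PH_smoothAt hw))
  have h4 := hκ (h.PH_smoothAt hw) (hg (hPV hU) (h.PH_smoothAt hz))
  exact (h1.sub h2).sub ((contMDiffAt_const (I' := 𝓘(ℝ, ℝ)) (c := (1 / 2 : ℝ))).smul (h3.sub h4))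

theorem Setup.OmegaB_form2At (a : Cot E₁ (OrbitSpace Q N)) :
    Form2At (cotI E₁) (OmegaB sys N W Hor ζ) a := by
  refine Form2At.of_apply fun z w hz hw => ?_
  obtain ⟨σ, h1, h2, h3⟩ := h.exists_section_M a
  have hb := cot_base h1
  have hpr : ∀ᶠ b in 𝓝 a, NH.proj N (σ b).1 = b.1 := h3.mono fun b hb => congrArg (fun c => c.1) hb
  have hl : ∀ {z : Cot E₁ (OrbitSpace Q N) → E₁ × (E₁ →L[ℝ] ℝ)},
      SmAt (cotI E₁) (cotI E₁) (fun b => b) z a →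
      SmAt 𝓘(ℝ, E) (cotI E₁) (fun b => (σ b).1) (fun b => hlift sys N (σ b).1 (z b).1) a :=
    fun hz => h.hlift_smoothAt hb (hz.fst.congr hpr .rfl)
  have hJ : ContMDiffAt (cotI E₁) 𝓘(ℝ, ℝ) ∞ (fun b => JKW (𝔤 := 𝔤) G sys W (σ b)
      (hlift sys N (σ b).1 (z b).1) (hlift sys N (σ b).1 (w b).1)) a := by
    have h4 := (h.momentum_smoothAt (σ a)).comp a h1
    exact h4.clm_apply (Form2At.apply (f := fun b => (σ b).1) (h.KW_form2At _) (hl hz) (hl hw))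
  have hB := h.formB_smoothAt h1 h2 (hl hz) (hl hw)
  have hc : ContMDiffAt (cotI E₁) 𝓘(ℝ, ℝ) ∞ (fun b => canonicalForm b (z b) (w b)) a :=
    Form2At.apply (f := fun b : Cot E₁ (OrbitSpace Q N) => b) (canonicalForm_form2At a) hz hw
  refine ((hc.sub hJ).add hB).congr_of_eventuallyEq (h3.mono fun b hb => ?_)
  have := h.OmegaB_apply (h2 b) (z b) (w b)
  rw [hb] at this
  exact this

theorem Setup.isAlmostSymplectic_OmegaB :
    IsAlmostSymplectic (cotI E₁) (X := Cot E₁ (OrbitSpace Q N)) (OmegaB sys N W Hor ζ) where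
  smooth := contMDiff_form2_section (I := cotI E₁) h.OmegaB_form2At
  alt := h.OmegaB_self
  nondegenerate a _ hv := h.OmegaB_nondegenerate a hv

theorem Setup.OmegaB_Xtilde (a : Cot E₁ (OrbitSpace Q N)) (v : E₁ × (E₁ →L[ℝ] ℝ)) :
    OmegaB sys N W Hor ζ a (Xtilde sys N a) v = dfun (cotI E₁) (Htilde sys N) a v := by
  obtain ⟨m, hm, rfl⟩ := h.redMap_surjective a
  obtain ⟨u, hu, rfl⟩ := h.exists_C_lift hm v
  rw [h.Xtilde_redMap hm, h.OmegaB_redMap hm (h.Xnh_fst_mem hm) (C_fst_mem hu), h.Xnh_fst hm,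
    h.formB_vel hm (C_fst_mem hu), add_zero, (h.Xnh_spec hm).2 u hu, h.dHtilde_redMap hu.1]

theorem Setup.Htilde_invariant (f : G ⧸ N) (a : Cot E₁ (OrbitSpace Q N)) :
    Htilde sys N (cotAct f a) = Htilde sys N a := by
  obtain ⟨g, rfl⟩ := QuotientGroup.mk'_surjective N f
  obtain ⟨m, hm, rfl⟩ := h.redMap_surjective a
  have hA := smoothAct_id E Q 𝔤 G
  rw [← h.redMap_cotAct, h.Htilde_redMap hm, h.Htilde_redMap (cotAct_mem_M hA h.sym g hm),
    hamiltonian_invariant hA h.sym]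

theorem Setup.OmegaB_invariant (f : G ⧸ N) (a : Cot E₁ (OrbitSpace Q N))
    (u v : E₁ × (E₁ →L[ℝ] ℝ)) :
    OmegaB sys N W Hor ζ (cotAct f a) (tmap (cotI E₁) (cotI E₁) (cotAct f) a u)
      (tmap (cotI E₁) (cotI E₁) (cotAct f) a v) = OmegaB sys N W Hor ζ a u v := by
  obtain ⟨g, rfl⟩ := QuotientGroup.mk'_surjective N f
  obtain ⟨m, hm, rfl⟩ := h.redMap_surjective a
  have hA := smoothAct_id E Q 𝔤 G
  have hl : ∀ u : E₁ × (E₁ →L[ℝ] ℝ), hlift sys N (cotAct g m).1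
      (tmap (cotI E₁) (cotI E₁) (cotAct (QuotientGroup.mk' N g)) (redMap sys N m) u).1 =
      tact g m.1 (hlift sys N m.1 u.1) := fun u => by
    rw [h.smoothAct_quotient.tcotAct_fst]
    exact h.hlift_equivariant g m.1 u.1
  have h1 := h.OmegaB_apply (cotAct_mem_M hA h.sym g hm)
    (tmap (cotI E₁) (cotI E₁) (cotAct (QuotientGroup.mk' N g)) (redMap (E₁ := E₁) sys N m) u)
    (tmap (cotI E₁) (cotI E₁) (cotAct (QuotientGroup.mk' N g)) (redMap (E₁ := E₁) sys N m) v)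
  rw [hl, hl, h.JKW_invariant, h.formB_invariant g hm, h.redMap_cotAct,
    h.smoothAct_quotient.canonicalForm_invariant, ← h.OmegaB_apply hm] at h1
  exact h1

/-! The partially reduced horizontal gauge momenta. -/

omit h in
theorem genF_mk (a : Cot E₁ (OrbitSpace Q N)) (ξ : 𝔤) :
    genF 𝔤 N a (Submodule.Quotient.mk ξ) = cgen (QuotientGroup.mk' N) a ξ := rfl

theorem Setup.Jtilde_mk (a : Cot E₁ (OrbitSpace Q N)) (ξ : 𝔤) :
    Jtilde 𝔤 N a (Submodule.Quotient.mk ξ) = covec a (rgen (QuotientGroup.mk' N) a.1 ξ) :=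
  h.smoothAct_quotient.liouville_cgen a ξ

theorem Setup.Jt_apply (i : Fin k) (q : Q) (l : E₁ →L[ℝ] ℝ) :
    Jt N ζ i (mkCot (NH.proj N q) l) = l (tproj N q (gen (E := E) G q (ζ i q))) := by
  rw [Jt, mkCot_fst, h.eta_proj, h.Jtilde_mk, mkCot_fst, covec_mkCot, h.tproj_gen]

theorem Setup.Jt_redMap (i : Fin k) (m : Cot E Q) :
    Jt (E₁ := E₁) N ζ i (redMap sys N m) = momentumOf G (ζ i) m := by
  rw [redMap, h.Jt_apply, ContinuousLinearMap.comp_apply, h.hlift_tproj_of_mem (h.gauge_mem_D i _),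
    momentumOf_apply]

theorem Setup.momentumOf_smoothAt (i : Fin k) (m : Cot E Q) :
    ContMDiffAt (cotI E) 𝓘(ℝ, ℝ) ∞ (momentumOf G (ζ i)) m := by
  rw [show momentumOf G (ζ i) = fun b : Cot E Q => covec b (gen G b.1 (ζ i b.1)) from
    funext fun b => momentumOf_apply (ζ i) b]
  exact covec_apply_smoothAt (α := fun b : Cot E Q => b) contMDiffAt_id
    ((h.gaugeField_smooth i m.1).comp (g := fun b : Cot E Q => b.1) (smooth_pr m))

theorem Setup.Jt_smooth (i : Fin k) : ContMDiff (cotI E₁) 𝓘(ℝ, ℝ) ∞ (Jt (E₁ := E₁) N ζ i) := fun a => by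
  obtain ⟨σ, h1, h2, h3⟩ := h.exists_section_M a
  refine (ContMDiffAt.comp a (g := momentumOf G (ζ i)) (h.momentumOf_smoothAt i _) h1).congr_of_eventuallyEq ?_
  refine h3.mono fun b hb => ?_
  change _ = momentumOf G (ζ i) (σ b)
  rw [← h.Jt_redMap, hb]

theorem Setup.Jt_mdiff (i : Fin k) (a : Cot E₁ (OrbitSpace Q N)) :
    MDifferentiableAt (cotI E₁) 𝓘(ℝ, ℝ) (Jt (E₁ := E₁) N ζ i) a :=
  (h.Jt_smooth i).mdifferentiable (by simp) a

theorem Setup.Jt_invariant (i : Fin k) (f : G ⧸ N) (a : Cot E₁ (OrbitSpace Q N)) :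
    Jt N ζ i (cotAct f a) = Jt N ζ i a := by
  obtain ⟨g, rfl⟩ := QuotientGroup.mk'_surjective N f
  obtain ⟨m, hm, rfl⟩ := h.redMap_surjective a
  rw [← h.redMap_cotAct, h.Jt_redMap, h.Jt_redMap, h.gauge.invariant i g m hm]

theorem Setup.dJt_redMap (i : Fin k) {m : Cot E Q} {w : E × (E →L[ℝ] ℝ)}
    (hw : w ∈ tangentTo (cotI E) sys.M m) :
    dfun (cotI E₁) (Jt N ζ i) (redMap (E₁ := E₁) sys N m) (tredMap sys N m w) =
      dfun (cotI E) (momentumOf G (ζ i)) m w :=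
  h.dfun_of_eq_on_M (fun m _ => h.Jt_redMap (E₁ := E₁) i m) (h.Jt_mdiff i _)
    ((h.momentumOf_smoothAt i m).mdifferentiableAt (by simp)) hw

theorem Setup.dJt_Xtilde (i : Fin k) (a : Cot E₁ (OrbitSpace Q N)) :
    dfun (cotI E₁) (Jt N ζ i) a (Xtilde sys N a) = 0 := by
  obtain ⟨m, hm, rfl⟩ := h.redMap_surjective a
  rw [h.Xtilde_redMap hm, h.dJt_redMap i (h.Xnh_spec hm).1.1, h.gauge.conserved i m hm]

theorem Setup.dJt_vertical (i : Fin k) (q : Q) (l p : E₁ →L[ℝ] ℝ) :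
    dfun (cotI E₁) (Jt N ζ i) (mkCot (NH.proj N q) l) (0, p) =
      p (tproj N q (gen (E := E) G q (ζ i q))) := by
  obtain ⟨h1, h2⟩ := vertical_curve (mkCot (NH.proj N q) l) p
  have h3 := hasDerivAt_curve (h.Jt_mdiff i (mkCot (NH.proj N q) l)) h1
    (by rw [zero_smul, add_zero]; rfl)
  rw [h2] at h3
  simp only [mkCot_fst, covec_mkCot, h.Jt_apply, add_apply, smul_apply, smul_eq_mul] at h3
  refine h3.unique ?_
  simpa using ((hasDerivAt_id (0 : ℝ)).mul_const (p (tproj N q (gen (E := E) G q (ζ i q))))).const_add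
    (l (tproj N q (gen (E := E) G q (ζ i q))))

theorem Setup.dJt_independent (a : Cot E₁ (OrbitSpace Q N)) :
    LinearIndependent ℝ fun i => dfun (cotI E₁) (Jt N ζ i) a := by
  obtain ⟨x, l⟩ := a
  obtain ⟨q, rfl⟩ := Quotient.mk_surjective x
  refine Fintype.linearIndependent_iff.mpr fun c hc => ?_
  have h1 : tproj (E₁ := E₁) N q (∑ i, c i • gen (E := E) G q (ζ i q)) = 0 := by
    by_contra hne
    obtain ⟨p, -, hp⟩ := exists_dual_vector ℝ _ (norm_ne_zero_iff.mpr hne)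
    have h2 := congrArg (fun L : E₁ × (E₁ →L[ℝ] ℝ) →L[ℝ] ℝ => L (0, p)) hc
    simp only [sum_apply, smul_apply, zero_apply] at h2
    have h3 : ∑ i, c i • p (tproj N q (gen (E := E) G q (ζ i q))) = 0 := by
      rw [← h2]
      exact Finset.sum_congr rfl fun i _ => congrArg _ (h.dJt_vertical i q l p).symm
    rw [map_sum, map_sum] at hp
    simp only [map_smul] at hp
    rw [h3] at hp
    refine hne (norm_eq_zero.mp ?_)
    rw [map_sum]
    simp only [map_smul]
    exact_mod_cast hp.symm
  have hD : ∑ i, c i • gen (E := E) G q (ζ i q) ∈ sys.D q :=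
    Submodule.sum_mem _ fun i _ => Submodule.smul_mem _ _ (h.gauge_mem_D i q)
  have h4 := h.eq_of_tproj_eq (N := N) (E₁ := E₁) hD (Submodule.zero_mem _) (by rw [h1, map_zero])
  exact Fintype.linearIndependent_iff.mp (h.linearIndependent_gaugeField q) c h4

theorem Setup.tredMap_cgen (m : Cot E Q) (ξ : 𝔤) :
    tredMap sys N m (cgen (MonoidHom.id G) m ξ) =
      cgen (QuotientGroup.mk' N) (redMap (E₁ := E₁) sys N m) ξ := by
  have hA := smoothAct_id E Q 𝔤 G
  have hs : ContMDiff 𝓘(ℝ, 𝔤) (cotI E) ∞ (fun g : G => cotAct (MonoidHom.id G g) m) :=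
    hA.cotAct_smooth.comp (contMDiff_id.prodMk contMDiff_const)
  have h1 := tmap_comp_apply (I := 𝓘(ℝ, 𝔤)) (I' := cotI E) (I'' := cotI E₁)
    (g := redMap (E₁ := E₁) sys N) (f := fun g : G => cotAct (MonoidHom.id G g) m) (x := (1 : G))
    (h.redMap_mdiff _) (hs.mdifferentiable (by simp) _) ξ
  rw [map_one, hA.cotAct_one] at h1
  refine h1.symm.trans ?_
  simp only [MonoidHom.id_apply, h.redMap_cotAct]
  rfl

/-- The partially reduced gauge symmetries are the hamiltonian vector fields of the gauge momenta. -/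
theorem Setup.OmegaB_genF (i : Fin k) (a : Cot E₁ (OrbitSpace Q N)) (v : E₁ × (E₁ →L[ℝ] ℝ)) :
    OmegaB sys N W Hor ζ a (genF 𝔤 N a (eta ζ i a.1)) v = dfun (cotI E₁) (Jt N ζ i) a v := by
  obtain ⟨m, hm, rfl⟩ := h.redMap_surjective a
  obtain ⟨w, hw, rfl⟩ := h.exists_C_lift hm v
  have h1 : eta ζ i (redMap (E₁ := E₁) sys N m).1 = (Submodule.Quotient.mk (ζ i m.1) : lieF 𝔤 N) :=
    h.eta_proj i m.1
  have hC := h.cgen_mem_C hm (h.gauge_mem_D i m.1)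
  have hA := smoothAct_id E Q 𝔤 G
  rw [h1, genF_mk, ← h.tredMap_cgen, h.OmegaB_redMap hm (C_fst_mem hC) (C_fst_mem hw),
    h.dJt_redMap i hw.1, h.dfun_momentumOf, hA.cgen_fst]
  exact congrArg _ (h.formB_gauge i hm (C_fst_mem hw))

theorem Setup.mem_level_iff (c : Fin k → ℝ) (a : Cot E₁ (OrbitSpace Q N)) :
    a ∈ level N ζ c ↔ ∀ i, Jt N ζ i a = c i := by
  have h1 : ∀ i, (∑ j, c j • muDual ζ j a.1) (eta (𝔤 := 𝔤) ζ i a.1) = c i := fun i => by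
    rw [LinearMap.sum_apply]
    simp [LinearMap.smul_apply, h.muDual_eta]
  constructor
  · intro ha i
    rw [Jt, show Jtilde 𝔤 N a = ∑ i, c i • muDual ζ i a.1 from ha, h1]
  · intro ha
    refine (h.etaBasis a.1).ext fun i => ?_
    rw [h.etaBasis_apply, h1]
    exact ha i

theorem Setup.level_invariant (c : Fin k → ℝ) (f : G ⧸ N) {a : Cot E₁ (OrbitSpace Q N)}
    (ha : a ∈ level N ζ c) : cotAct f a ∈ level N ζ c := by
  rw [h.mem_level_iff] at ha ⊢
  exact fun i => (h.Jt_invariant i f a).trans (ha i)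

end Setup

/-! ### The second reduction -/

section Submersions

variable {E : Type*} [NormedAddCommGroup E] [NormedSpace ℝ E] [FiniteDimensional ℝ E]
  {H : Type*} [TopologicalSpace H] {I : ModelWithCorners ℝ E H} [I.Boundaryless]
  {X : Type*} [TopologicalSpace X] [ChartedSpace H X] [IsManifold I ∞ X]
  {E' : Type*} [NormedAddCommGroup E'] [NormedSpace ℝ E'] [FiniteDimensional ℝ E']
  {H' : Type*} [TopologicalSpace H'] {I' : ModelWithCorners ℝ E' H'} [I'.Boundaryless]
  {Y : Type*} [TopologicalSpace Y] [ChartedSpace H' Y] [IsManifold I' ∞ Y]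
  {E'' : Type*} [NormedAddCommGroup E''] [NormedSpace ℝ E'']
  {H'' : Type*} [TopologicalSpace H''] {I'' : ModelWithCorners ℝ E'' H''}
  {Z : Type*} [TopologicalSpace Z] [ChartedSpace H'' Z]

theorem IsSubmersion.exists_section {f : X → Y} (hf : IsSubmersion I I' f) (x : X) :
    ∃ s : Y → X, ContMDiffAt I' I ∞ s (f x) ∧ (∀ᶠ y in 𝓝 (f x), f (s y) = y) ∧ s (f x) = x := by
  obtain ⟨r, hr⟩ := exists_right_inverse (hf.2 x)
  obtain ⟨s, U, h1, h2, h3, h4, h5, -⟩ := exists_local_section hf.1 x hr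
  exact ⟨s, h3.contMDiffAt (h1.mem_nhds h2), Filter.mem_of_superset (h1.mem_nhds h2) h4, h5⟩

theorem IsSubmersion.contMDiff_of_comp {f : X → Y} (hf : IsSubmersion I I' f)
    (hs : Function.Surjective f) {g : Y → Z} (hg : ContMDiff I I'' ∞ (fun x => g (f x))) :
    ContMDiff I' I'' ∞ g := by
  intro y
  obtain ⟨x, rfl⟩ := hs y
  obtain ⟨s, h1, h2, h3⟩ := hf.exists_section x
  refine (ContMDiffAt.comp (f x) (g := fun x => g (f x)) hg.contMDiffAt h1).congr_of_eventuallyEq ?_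
  exact h2.mono fun y hy => congrArg g hy.symm

theorem IsSubmersion.isOpenMap {f : X → Y} (hf : IsSubmersion I I' f) : IsOpenMap f := by
  refine IsOpenMap.of_nhds_le fun x S hS => ?_
  obtain ⟨s, h1, h2, h3⟩ := hf.exists_section x
  have h4 : ∀ᶠ y in 𝓝 (f x), f (s y) ∈ S :=
    h1.continuousAt.eventually (by rw [h3]; exact hS)
  filter_upwards [h2, h4] with y hy hy'
  rwa [hy] at hy'

end Submersions

section Setup

variable {E : Type*} [NormedAddCommGroup E] [NormedSpace ℝ E] [FiniteDimensional ℝ E]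
  {Q : Type*} [TopologicalSpace Q] [ChartedSpace E Q] [IsManifold 𝓘(ℝ, E) ∞ Q] [T2Space Q]
  {𝔤 : Type*} [NormedAddCommGroup 𝔤] [NormedSpace ℝ 𝔤] [FiniteDimensional ℝ 𝔤]
  {G : Type*} [Group G] [TopologicalSpace G] [ChartedSpace 𝔤 G] [LieGroup 𝓘(ℝ, 𝔤) ∞ G]
  [MulAction G Q] [ContMDiffSMul 𝓘(ℝ, 𝔤) 𝓘(ℝ, E) ∞ G Q] [ProperSMul G Q]
  {sys : System E Q} {k : ℕ} {ζ : Fin k → Q → 𝔤} {W Hor : PlaneField E Q}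
  {N : Subgroup G} [N.Normal]
  {E₁ : Type*} [NormedAddCommGroup E₁] [NormedSpace ℝ E₁] [FiniteDimensional ℝ E₁]
  [ChartedSpace E₁ (OrbitSpace Q N)] [IsManifold 𝓘(ℝ, E₁) ∞ (OrbitSpace Q N)]

variable {E₂ : Type*} [NormedAddCommGroup E₂] [NormedSpace ℝ E₂] [FiniteDimensional ℝ E₂]
  [ChartedSpace E₂ (RedSpace Q N E₁)] [IsManifold 𝓘(ℝ, E₂) ∞ (RedSpace Q N E₁)]

theorem rhoF_surjective : Function.Surjective (rhoF (Q := Q) (E₁ := E₁) N) := Quot.mk_surjective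

variable (h : Setup sys ζ W Hor N E₁)
include h

theorem Setup.rhoF_eq_iff {a b : Cot E₁ (OrbitSpace Q N)} :
    rhoF N a = rhoF N b ↔ ∃ f : G ⧸ N, cotAct f a = b := by
  have hA := h.smoothAct_quotient
  have he : Equivalence fun a b : Cot E₁ (OrbitSpace Q N) => ∃ f : G ⧸ N, cotAct f a = b := by
    refine ⟨fun a => ⟨1, hA.cotAct_one a⟩, ?_, ?_⟩
    · rintro a _ ⟨f, rfl⟩
      obtain ⟨g, rfl⟩ := QuotientGroup.mk'_surjective N f
      refine ⟨QuotientGroup.mk' N g⁻¹, ?_⟩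
      rw [hA.cotAct_mul, inv_mul_cancel, map_one, hA.cotAct_one]
    · rintro a _ _ ⟨f, rfl⟩ ⟨f', rfl⟩
      obtain ⟨g, rfl⟩ := QuotientGroup.mk'_surjective N f
      obtain ⟨g', rfl⟩ := QuotientGroup.mk'_surjective N f'
      exact ⟨QuotientGroup.mk' N (g' * g), (hA.cotAct_mul g' g a).symm⟩
  rw [rhoF, rhoF, Quot.eq, he.eqvGen_iff]

theorem Setup.rhoF_cotAct (f : G ⧸ N) (a : Cot E₁ (OrbitSpace Q N)) :
    rhoF N (cotAct f a) = rhoF N a := (h.rhoF_eq_iff.mpr ⟨f, rfl⟩).symm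

theorem Setup.rhoF_out (a : Cot E₁ (OrbitSpace Q N)) :
    ∃ f : G ⧸ N, cotAct f a = Quot.out (rhoF N a) :=
  h.rhoF_eq_iff.mp (Quot.out_eq _).symm

theorem Setup.rhoF_redMap_eq_iff {m m' : Cot E Q} (hm : m ∈ sys.M) (hm' : m' ∈ sys.M) :
    rhoF N (redMap (E₁ := E₁) sys N m) = rhoF N (redMap (E₁ := E₁) sys N m') ↔
      ∃ g : G, cotAct g m' = m := by
  have hA := smoothAct_id E Q 𝔤 G
  constructor
  · intro he
    obtain ⟨f, hf⟩ := h.rhoF_eq_iff.mp he.symm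
    obtain ⟨g, rfl⟩ := QuotientGroup.mk'_surjective N f
    rw [← h.redMap_cotAct] at hf
    obtain ⟨n, -, hn⟩ := (h.redMap_eq_iff hm (cotAct_mem_M hA h.sym g hm')).mp hf.symm
    exact ⟨n * g, (hA.cotAct_mul n g m').symm.trans hn⟩
  · rintro ⟨g, rfl⟩
    rw [h.redMap_cotAct, h.rhoF_cotAct]

theorem Setup.Hred_rhoF (a : Cot E₁ (OrbitSpace Q N)) : Hred sys N (rhoF N a) = Htilde sys N a := by
  obtain ⟨f, hf⟩ := h.rhoF_out a
  rw [Hred, ← hf, h.Htilde_invariant]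

theorem Setup.cotAct_mdiff (f : G ⧸ N) (a : Cot E₁ (OrbitSpace Q N)) :
    MDifferentiableAt (cotI E₁) (cotI E₁) (cotAct f) a := by
  obtain ⟨g, rfl⟩ := QuotientGroup.mk'_surjective N f
  exact h.smoothAct_quotient.cotAct_mdiff g a

theorem Setup.tmap_cotAct_surjective (f : G ⧸ N) (a : Cot E₁ (OrbitSpace Q N)) :
    Function.Surjective (tmap (cotI E₁) (cotI E₁) (cotAct f) a) := by
  obtain ⟨g, rfl⟩ := QuotientGroup.mk'_surjective N f
  have hA := h.smoothAct_quotient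
  intro v
  have h1 := tmap_comp_apply (g := cotAct (QuotientGroup.mk' N g)) (f := cotAct (QuotientGroup.mk' N g⁻¹))
    (x := cotAct (QuotientGroup.mk' N g) a) (h.cotAct_mdiff _ _) (h.cotAct_mdiff _ _) v
  have h2 : ∀ b : Cot E₁ (OrbitSpace Q N),
      cotAct (QuotientGroup.mk' N g) (cotAct (QuotientGroup.mk' N g⁻¹) b) = b := fun b => by
    rw [hA.cotAct_mul, mul_inv_cancel, map_one, hA.cotAct_one]
  have h3 : cotAct (QuotientGroup.mk' N g⁻¹) (cotAct (QuotientGroup.mk' N g) a) = a := by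
    rw [hA.cotAct_mul, inv_mul_cancel, map_one, hA.cotAct_one]
  simp only [h2, h3, tmap_id] at h1
  exact ⟨_, h1.symm⟩

theorem Setup.Xtilde_equivariant (f : G ⧸ N) (a : Cot E₁ (OrbitSpace Q N)) :
    Xtilde sys N (cotAct f a) = tmap (cotI E₁) (cotI E₁) (cotAct f) a (Xtilde sys N a) := by
  refine sub_eq_zero.mp (h.OmegaB_nondegenerate (cotAct f a) fun w => ?_)
  obtain ⟨v, rfl⟩ := h.tmap_cotAct_surjective f a w
  rw [bilin_sub, h.OmegaB_Xtilde, h.OmegaB_invariant, h.OmegaB_Xtilde, sub_eq_zero]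
  have h1 := tmap_comp_apply (I'' := 𝓘(ℝ, ℝ)) (g := Htilde (E₁ := E₁) sys N) (f := cotAct f) (x := a)
    (h.Htilde_smooth.mdifferentiable (by simp) _) (h.cotAct_mdiff f a) v
  simp only [h.Htilde_invariant] at h1
  exact h1.symm

theorem Setup.exists_orbit_lift {γ : ℝ → Cot E₁ (OrbitSpace Q N)}
    (hγ : ContMDiffAt 𝓘(ℝ, ℝ) (cotI E₁) ∞ γ 0)
    (horb : ∀ t, rhoF N (γ t) = rhoF N (γ 0)) : ∃ g : ℝ → G, ContMDiffAt 𝓘(ℝ, ℝ) 𝓘(ℝ, 𝔤) ∞ g 0 ∧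
      g 0 = 1 ∧ ∀ᶠ t in 𝓝 0, cotAct (QuotientGroup.mk' N (g t)) (γ 0) = γ t := by
  obtain ⟨q, hq⟩ := Quotient.mk_surjective (γ 0).1
  have hq : NH.proj N q = (γ 0).1 := hq
  obtain ⟨s, U, h1, h2, h3, h4, h5, -⟩ := h.exists_section q
  rw [hq] at h2 h5
  have hU : ∀ᶠ t in 𝓝 (0 : ℝ), (γ t).1 ∈ U :=
    (cot_base hγ).continuousAt.preimage_mem_nhds (h1.mem_nhds h2)
  have key : ∀ t, ∃ g : G, (γ t).1 ∈ U →
      g • q = s (γ t).1 ∧ cotAct (QuotientGroup.mk' N g) (γ 0) = γ t := fun t => by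
    by_cases ht : (γ t).1 ∈ U
    swap
    · exact ⟨1, fun h => absurd h ht⟩
    obtain ⟨f, hf⟩ := h.rhoF_eq_iff.mp (horb t).symm
    obtain ⟨g, rfl⟩ := QuotientGroup.mk'_surjective N f
    have h6 : NH.proj N (s (γ t).1) = NH.proj N (g • q) := by
      rw [h4 _ ht, ← hf, cotAct_fst, ← hq]; rfl
    obtain ⟨n, hn, hnq⟩ := (proj_eq_iff N _ _).mp h6
    refine ⟨n * g, fun _ => ⟨by rw [mul_smul, hnq], ?_⟩⟩
    rw [← hf, map_mul, show QuotientGroup.mk' N n = 1 from (QuotientGroup.eq_one_iff n).mpr hn, one_mul]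
  choose g hg using key
  have hgs : ContMDiffAt 𝓘(ℝ, ℝ) 𝓘(ℝ, E) ∞ (fun t => g t • q) 0 :=
    (ContMDiffAt.comp (0 : ℝ) (g := s) (h3.contMDiffAt (h1.mem_nhds h2))
      (cot_base hγ)).congr_of_eventuallyEq (hU.mono fun t ht => (hg t ht).1)
  refine ⟨g, orbit_lift_smoothAt h.sym.free hgs, ?_, hU.mono fun t ht => (hg t ht).2⟩
  exact h.sym.free _ q ((hg 0 h2).1.trans h5)

variable (hr : IsSubmersion (cotI E₁) 𝓘(ℝ, E₂) (rhoF (Q := Q) (E₁ := E₁) N))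
include hr

theorem Setup.rhoF_mdiff (a : Cot E₁ (OrbitSpace Q N)) :
    MDifferentiableAt (cotI E₁) 𝓘(ℝ, E₂) (rhoF N) a := hr.1.mdifferentiable (by simp) a

theorem Setup.trhoF_cotAct (f : G ⧸ N) (a : Cot E₁ (OrbitSpace Q N)) (v : E₁ × (E₁ →L[ℝ] ℝ)) :
    tmap (cotI E₁) 𝓘(ℝ, E₂) (rhoF N) (cotAct f a) (tmap (cotI E₁) (cotI E₁) (cotAct f) a v) =
      tmap (cotI E₁) 𝓘(ℝ, E₂) (rhoF N) a v := by
  have h1 := tmap_comp_apply (g := rhoF N) (f := cotAct f) (x := a) (h.rhoF_mdiff hr _)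
    (h.cotAct_mdiff f a) v
  simp only [h.rhoF_cotAct] at h1
  exact h1.symm

theorem Setup.Xred_rhoF (a : Cot E₁ (OrbitSpace Q N)) :
    Xred (E₂ := E₂) sys N (rhoF N a) = tmap (cotI E₁) 𝓘(ℝ, E₂) (rhoF N) a (Xtilde sys N a) := by
  obtain ⟨f, hf⟩ := h.rhoF_out a
  rw [Xred, ← hf, h.Xtilde_equivariant, h.trhoF_cotAct hr]

theorem Setup.Hred_smooth : ContMDiff 𝓘(ℝ, E₂) 𝓘(ℝ, ℝ) ∞ (Hred (E₁ := E₁) sys N) :=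
  hr.contMDiff_of_comp rhoF_surjective (by simpa only [h.Hred_rhoF] using h.Htilde_smooth)

/-- The vertical space of the second reduction is spanned by the infinitesimal generators. -/
theorem Setup.trhoF_eq_zero_iff (a : Cot E₁ (OrbitSpace Q N)) (v : E₁ × (E₁ →L[ℝ] ℝ)) :
    tmap (cotI E₁) 𝓘(ℝ, E₂) (rhoF N) a v = 0 ↔ ∃ ν, genF 𝔤 N a ν = v := by
  have hA := h.smoothAct_quotient
  have hs : ContMDiff 𝓘(ℝ, 𝔤) (cotI E₁) ∞ (fun g : G => cotAct (QuotientGroup.mk' N g) a) :=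
    hA.cotAct_smooth.comp (contMDiff_id.prodMk contMDiff_const)
  have hs1 : cotAct (QuotientGroup.mk' N 1) a = a := by rw [map_one, hA.cotAct_one]
  constructor
  · intro hv
    obtain ⟨γ, h1, h2, h3, h4⟩ := exists_fibre_curve hr.1 a (hr.2 a) hv
    subst h3
    obtain ⟨g, hg1, hg2, hg3⟩ := h.exists_orbit_lift h1.contMDiffAt h2
    refine ⟨Submodule.Quotient.mk (tmap 𝓘(ℝ, ℝ) 𝓘(ℝ, 𝔤) g 0 1), ?_⟩
    rw [genF_mk, ← h4, ← tmap_congr hg3]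
    have h5 := tmap_comp_apply (I := 𝓘(ℝ, ℝ)) (I' := 𝓘(ℝ, 𝔤)) (I'' := cotI E₁)
      (g := fun g : G => cotAct (QuotientGroup.mk' N g) (γ 0)) (f := g) (x := (0 : ℝ))
      (hs.mdifferentiable (by simp) _) (hg1.mdifferentiableAt (by simp)) 1
    rw [hg2] at h5
    exact h5.symm
  · rintro ⟨ν, rfl⟩
    obtain ⟨ξ, rfl⟩ := Submodule.Quotient.mk_surjective _ ν
    have h5 := tmap_comp_apply (I := 𝓘(ℝ, 𝔤)) (I' := cotI E₁) (I'' := 𝓘(ℝ, E₂))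
      (g := rhoF N) (f := fun g : G => cotAct (QuotientGroup.mk' N g) a) (x := (1 : G))
      (h.rhoF_mdiff hr _) (hs.mdifferentiable (by simp) _) ξ
    simp only [h.rhoF_cotAct, tmap_const] at h5
    rw [hs1] at h5
    exact h5.symm

end Setup

/-! ### The topology of the reduced spaces -/

section CotTopology

variable {E : Type*} [NormedAddCommGroup E] [NormedSpace ℝ E] [FiniteDimensional ℝ E]
  {X : Type*} [TopologicalSpace X] [ChartedSpace E X] [IsManifold 𝓘(ℝ, E) ∞ X]

theorem mem_cot_source {a b : Cot E X} :
    b ∈ (chartAt (ModelProd E (E →L[ℝ] ℝ)) a).source ↔ b.1 ∈ (chartAt E a.1).source := by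
  rw [FiberBundle.chartedSpace_chartAt]
  simp only [mfld_simps]
  constructor
  · intro hb
    exact hb.2
  · intro hb
    refine ⟨?_, hb⟩
    simpa using hb

/-- Limits in the cotangent bundle are unique as soon as they lie over the same point. -/
theorem cot_eq_of_tendsto {ι : Type*} {F : Filter ι} [F.NeBot] {u : ι → Cot E X} {a b : Cot E X}
    (ha : Filter.Tendsto u F (𝓝 a)) (hb : Filter.Tendsto u F (𝓝 b)) (h : a.1 = b.1) : a = b := by
  let e := chartAt (ModelProd E (E →L[ℝ] ℝ)) a
  have h1 : a ∈ e.source := mem_chart_source _ a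
  have h2 : b ∈ e.source := mem_cot_source.mpr (h ▸ mem_chart_source E a.1)
  have h3 := tendsto_nhds_unique (X := E × (E →L[ℝ] ℝ)) ((e.continuousAt h1).tendsto.comp ha)
    ((e.continuousAt h2).tendsto.comp hb)
  exact e.injOn h1 h2 h3

theorem cot_secondCountable [SecondCountableTopology X] : SecondCountableTopology (Cot E X) := by
  obtain ⟨s, hs, hU⟩ := TopologicalSpace.countable_cover_nhds (fun x : X => chart_source_mem_nhds E x)
  have h1 : SecondCountableTopology (ModelProd E (E →L[ℝ] ℝ)) :=
    inferInstanceAs (SecondCountableTopology (E × (E →L[ℝ] ℝ)))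
  refine ChartedSpace.secondCountable_of_countable_cover (ModelProd E (E →L[ℝ] ℝ))
    (s := (fun x : X => mkCot (E := E) x 0) '' s) ?_ (hs.image _)
  refine Set.eq_univ_of_forall fun b => ?_
  have hb : b.1 ∈ ⋃ x ∈ s, (chartAt E x).source := hU ▸ Set.mem_univ _
  simp only [Set.mem_iUnion] at hb ⊢
  obtain ⟨x, hx, hb⟩ := hb
  exact ⟨mkCot x 0, ⟨x, hx, rfl⟩, mem_cot_source.mpr hb⟩

end CotTopology

section Setup

variable {E : Type*} [NormedAddCommGroup E] [NormedSpace ℝ E] [FiniteDimensional ℝ E]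
  {Q : Type*} [TopologicalSpace Q] [ChartedSpace E Q] [IsManifold 𝓘(ℝ, E) ∞ Q] [T2Space Q]
  {𝔤 : Type*} [NormedAddCommGroup 𝔤] [NormedSpace ℝ 𝔤] [FiniteDimensional ℝ 𝔤]
  {G : Type*} [Group G] [TopologicalSpace G] [ChartedSpace 𝔤 G] [LieGroup 𝓘(ℝ, 𝔤) ∞ G]
  [MulAction G Q] [ContMDiffSMul 𝓘(ℝ, 𝔤) 𝓘(ℝ, E) ∞ G Q] [ProperSMul G Q]
  {sys : System E Q} {k : ℕ} {ζ : Fin k → Q → 𝔤} {W Hor : PlaneField E Q}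
  {N : Subgroup G} [N.Normal]
  {E₁ : Type*} [NormedAddCommGroup E₁] [NormedSpace ℝ E₁] [FiniteDimensional ℝ E₁]
  [ChartedSpace E₁ (OrbitSpace Q N)] [IsManifold 𝓘(ℝ, E₁) ∞ (OrbitSpace Q N)]

variable {E₂ : Type*} [NormedAddCommGroup E₂] [NormedSpace ℝ E₂] [FiniteDimensional ℝ E₂]
  [ChartedSpace E₂ (RedSpace Q N E₁)] [IsManifold 𝓘(ℝ, E₂) ∞ (RedSpace Q N E₁)]

variable (h : Setup sys ζ W Hor N E₁)
include h

theorem Setup.isClosedEmbedding_act :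
    Topology.IsClosedEmbedding (fun p : G × Q => (p.1 • p.2, p.2)) := by
  have hp : IsProperMap (fun p : G × Q => (p.1 • p.2, p.2)) := ProperSMul.isProperMap_smul_pair
  refine .of_continuous_injective_isClosedMap hp.continuous ?_ hp.isClosedMap
  rintro ⟨g, q⟩ ⟨g', q'⟩ he
  obtain ⟨h1, h2⟩ := Prod.mk.inj he
  obtain rfl : q = q' := h2
  have := h.sym.free (g'⁻¹ * g) q (by
    rw [mul_smul, show g • q = g' • q from h1, inv_smul_smul])
  rw [inv_mul_eq_one.mp this]

theorem Setup.isClosed_orbitRel :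
    IsClosed {p : Cot E₁ (OrbitSpace Q N) × Cot E₁ (OrbitSpace Q N) | rhoF N p.1 = rhoF N p.2} := by
  refine isClosed_iff_ultrafilter.mpr fun ⟨a, b⟩ u hu hR => ?_
  have hA := h.smoothAct_quotient
  have ha : Filter.Tendsto Prod.fst (u : Filter (Cot E₁ (OrbitSpace Q N) × Cot E₁ (OrbitSpace Q N)))
      (𝓝 a) := continuous_fst.continuousAt.mono_left hu
  have hb : Filter.Tendsto Prod.snd (u : Filter (Cot E₁ (OrbitSpace Q N) × Cot E₁ (OrbitSpace Q N)))
      (𝓝 b) := continuous_snd.continuousAt.mono_left hu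
  have hsec : ∀ (c : Cot E₁ (OrbitSpace Q N)) {v : Cot E₁ (OrbitSpace Q N) × Cot E₁ (OrbitSpace Q N) →
      Cot E₁ (OrbitSpace Q N)}, Filter.Tendsto v u (𝓝 c) →
      ∃ (q : Q) (t : Cot E₁ (OrbitSpace Q N) × Cot E₁ (OrbitSpace Q N) → Q), NH.proj N q = c.1 ∧
        Filter.Tendsto t u (𝓝 q) ∧ ∀ᶠ p in (u : Filter _), NH.proj N (t p) = (v p).1 := by
    intro c v hv
    obtain ⟨q, hq⟩ := Quotient.mk_surjective c.1
    have hq : NH.proj N q = c.1 := hq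
    obtain ⟨s, U, h1, h2, h3, h4, h5, -⟩ := h.exists_section q
    have hv1 : Filter.Tendsto (fun p => (v p).1) u (𝓝 (NH.proj N q)) := by
      rw [hq]
      exact (smooth_pr c).continuousAt.tendsto.comp hv
    refine ⟨q, fun p => s (v p).1, hq, ?_, ?_⟩
    · have := (h3.contMDiffAt (h1.mem_nhds h2)).continuousAt.tendsto.comp hv1
      rwa [h5] at this
    · exact (hv1.eventually (h1.mem_nhds h2)).mono fun p hp => h4 _ hp
  obtain ⟨q, t, hq, ht, hpt⟩ := hsec a ha
  obtain ⟨q', t', hq', ht', hpt'⟩ := hsec b hb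
  have key : ∀ᶠ p in (u : Filter (Cot E₁ (OrbitSpace Q N) × Cot E₁ (OrbitSpace Q N))),
      ∃ g : G, g • t p = t' p ∧ cotAct (QuotientGroup.mk' N g) p.1 = p.2 := by
    filter_upwards [hR, hpt, hpt'] with p hp h1 h2
    obtain ⟨f, hf⟩ := h.rhoF_eq_iff.mp hp
    obtain ⟨g, rfl⟩ := QuotientGroup.mk'_surjective N f
    have h6 : NH.proj N (t' p) = NH.proj N (g • t p) := by
      rw [h2, ← hf, cotAct_fst, ← h1]; rfl
    obtain ⟨n, hn, hnq⟩ := (proj_eq_iff N _ _).mp h6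
    refine ⟨n * g, by rw [mul_smul, hnq], ?_⟩
    rw [← hf, map_mul, show QuotientGroup.mk' N n = 1 from (QuotientGroup.eq_one_iff n).mpr hn, one_mul]
  obtain ⟨g, hg⟩ := Filter.Eventually.choice key
  have hΦ := h.isClosedEmbedding_act
  have ht2 : Filter.Tendsto (fun p => (g p • t p, t p)) u (𝓝 (q', q)) :=
    (ht'.congr' (hg.mono fun p hp => hp.1.symm)).prodMk_nhds ht
  obtain ⟨⟨g₀, q₀⟩, hg₀⟩ : (q', q) ∈ Set.range (fun p : G × Q => (p.1 • p.2, p.2)) :=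
    hΦ.isClosed_range.mem_of_tendsto ht2 (.of_forall fun p => ⟨(g p, t p), rfl⟩)
  have ht3 : Filter.Tendsto (fun p => (g p, t p)) u (𝓝 (g₀, q₀)) := by
    refine hΦ.isInducing.tendsto_nhds_iff.mpr ?_
    rw [← hg₀] at ht2
    exact ht2
  have ht4 : Filter.Tendsto g u (𝓝 g₀) := (continuous_fst.tendsto _).comp ht3
  have ht5 : Filter.Tendsto (fun p : Cot E₁ (OrbitSpace Q N) × Cot E₁ (OrbitSpace Q N) =>
      cotAct (QuotientGroup.mk' N (g p)) p.1) u (𝓝 (cotAct (QuotientGroup.mk' N g₀) a)) :=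
    (hA.cotAct_smooth.continuous.tendsto (g₀, a)).comp (ht4.prodMk_nhds ha)
  have ht6 := ht5.congr' (hg.mono fun p hp => hp.2)
  obtain ⟨h1, h2⟩ := Prod.mk.inj hg₀
  have h3 : cotAct (QuotientGroup.mk' N g₀) a = b := cot_eq_of_tendsto ht6 hb (by
    rw [cotAct_fst, ← hq, ← hq', ← h1, ← h2]; rfl)
  exact h.rhoF_eq_iff.mpr ⟨_, h3⟩

variable (hr : IsSubmersion (cotI E₁) 𝓘(ℝ, E₂) (rhoF (Q := Q) (E₁ := E₁) N))
include hr

theorem Setup.isOpenQuotientMap_rhoF : IsOpenQuotientMap (rhoF (Q := Q) (E₁ := E₁) N) :=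
  ⟨rhoF_surjective, hr.1.continuous, hr.isOpenMap⟩

theorem Setup.t2Space_redSpace : T2Space (RedSpace Q N E₁) :=
  (t2Space_iff_of_isOpenQuotientMap (h.isOpenQuotientMap_rhoF hr)).mpr h.isClosed_orbitRel

theorem Setup.secondCountable_redSpace [SecondCountableTopology Q] :
    SecondCountableTopology (RedSpace Q N E₁) := by
  have h1 : IsOpenQuotientMap (NH.proj (Q := Q) N) :=
    ⟨Quotient.mk_surjective, h.proj.1.continuous, h.proj.isOpenMap⟩
  have h2 : SecondCountableTopology (OrbitSpace Q N) := h1.isQuotientMap.secondCountableTopology h1.isOpenMap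
  have h3 : SecondCountableTopology (Cot E₁ (OrbitSpace Q N)) := cot_secondCountable
  have h4 := h.isOpenQuotientMap_rhoF hr
  exact h4.isQuotientMap.secondCountableTopology h4.isOpenMap

theorem Setup.isEmbedding_iotaRed (c : Fin k → ℝ) :
    Topology.IsEmbedding (iotaRed (E₁ := E₁) N ζ c) := by
  have hval : ∀ a : level (E₁ := E₁) N ζ c, iotaRed N ζ c (rhoMu N ζ c a) = rhoF N a.1 := fun _ => rfl
  have hcont : Continuous (rhoMu (E₁ := E₁) N ζ c) := continuous_quot_mk
  refine ⟨⟨le_antisymm ?_ fun V hV => ?_⟩, ?_⟩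
  · rw [← continuous_iff_le_induced]
    exact continuous_quot_lift _ (hr.1.continuous.comp continuous_subtype_val)
  · obtain ⟨O, hO, hOV⟩ := isOpen_induced_iff.mp (hcont.isOpen_preimage V hV)
    refine isOpen_induced_iff.mpr ⟨rhoF N '' O, hr.isOpenMap O hO, ?_⟩
    ext z
    obtain ⟨a, rfl⟩ := Quot.mk_surjective z
    constructor
    · rintro ⟨b, hb, hba⟩
      obtain ⟨f, hf⟩ := h.rhoF_eq_iff.mp (hba.trans (hval a))
      obtain ⟨f', hf'⟩ := h.rhoF_eq_iff.mp (hba.trans (hval a)).symm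
      have hbl : b ∈ level N ζ c := by rw [← hf']; exact h.level_invariant c f' a.2
      have h1 : rhoMu N ζ c ⟨b, hbl⟩ = rhoMu N ζ c a := Quot.sound ⟨f, hf⟩
      have h2 : (⟨b, hbl⟩ : level (E₁ := E₁) N ζ c) ∈ Subtype.val ⁻¹' O := hb
      rw [hOV] at h2
      have h3 : rhoMu N ζ c ⟨b, hbl⟩ ∈ V := h2
      rw [h1] at h3
      exact h3
    · intro ha
      have h2 : a ∈ rhoMu (E₁ := E₁) N ζ c ⁻¹' V := ha
      rw [← hOV] at h2
      exact ⟨a.1, h2, rfl⟩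
  · intro z z' hzz
    obtain ⟨a, rfl⟩ := Quot.mk_surjective z
    obtain ⟨b, rfl⟩ := Quot.mk_surjective z'
    exact Quot.sound (h.rhoF_eq_iff.mp hzz)

end Setup

/-! ### The level sets of the gauge momenta and their reduction -/

section Independence

variable {F : Type*} [NormedAddCommGroup F] [NormedSpace ℝ F] {k : ℕ}

theorem surjective_of_linearIndependent {l : Fin k → F →L[ℝ] ℝ} (hl : LinearIndependent ℝ l)
    {A : F →L[ℝ] Fin k → ℝ} (hA : ∀ v i, A v i = l i v) : Function.Surjective A := by
  refine LinearMap.range_eq_top (f := A.toLinearMap).mp ?_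
  by_contra hne
  obtain ⟨f, hf, hle⟩ := Submodule.exists_le_ker_of_lt_top _ (lt_top_iff_ne_top.mpr hne)
  refine hf (LinearMap.pi_ext' fun i => LinearMap.ext_ring ?_)
  have h1 : ∑ i, f (Pi.single i 1) • l i = 0 := by
    ext v
    have h2 : f (A v) = 0 := hle ⟨v, rfl⟩
    rw [LinearMap.pi_apply_eq_sum_univ f] at h2
    simp only [sum_apply, smul_apply, zero_apply]
    rw [← h2]
    refine Finset.sum_congr rfl fun i _ => ?_
    rw [hA, smul_eq_mul, smul_eq_mul, mul_comm]
    congr 2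
    funext j
    by_cases hij : i = j <;> simp [hij, eq_comm]
  simpa using Fintype.linearIndependent_iff.mp hl _ h1 i

theorem exists_coeff_of_iInf_ker_le {l : Fin k → F →L[ℝ] ℝ} {f : F →L[ℝ] ℝ}
    (hf : ∀ v, (∀ i, l i v = 0) → f v = 0) : ∃ c : Fin k → ℝ, f = ∑ i, c i • l i := by
  have h1 : f.toLinearMap ∈ Submodule.span ℝ (Set.range fun i => (l i).toLinearMap) :=
    mem_span_of_iInf_ker_le_ker fun v hv => hf v fun i => by
      simp only [Submodule.mem_iInf] at hv
      exact hv i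
  obtain ⟨c, hc⟩ := (Submodule.mem_span_range_iff_exists_fun ℝ).mp h1
  refine ⟨c, ContinuousLinearMap.ext fun v => ?_⟩
  have := congrArg (fun L : F →ₗ[ℝ] ℝ => L v) hc
  simpa using this.symm

theorem bilin_swap {B : F →L[ℝ] F →L[ℝ] ℝ} (hB : ∀ x, B x x = 0) (x y : F) :
    B x y = -B y x := by
  have h1 := hB (x + y)
  simp only [map_add, add_apply, hB] at h1
  linarith

end Independence

section Setup

variable {E : Type*} [NormedAddCommGroup E] [NormedSpace ℝ E] [FiniteDimensional ℝ E]
  {Q : Type*} [TopologicalSpace Q] [ChartedSpace E Q] [IsManifold 𝓘(ℝ, E) ∞ Q] [T2Space Q]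
  {𝔤 : Type*} [NormedAddCommGroup 𝔤] [NormedSpace ℝ 𝔤] [FiniteDimensional ℝ 𝔤]
  {G : Type*} [Group G] [TopologicalSpace G] [ChartedSpace 𝔤 G] [LieGroup 𝓘(ℝ, 𝔤) ∞ G]
  [MulAction G Q] [ContMDiffSMul 𝓘(ℝ, 𝔤) 𝓘(ℝ, E) ∞ G Q] [ProperSMul G Q]
  {sys : System E Q} {k : ℕ} {ζ : Fin k → Q → 𝔤} {W Hor : PlaneField E Q}
  {N : Subgroup G} [N.Normal]
  {E₁ : Type*} [NormedAddCommGroup E₁] [NormedSpace ℝ E₁] [FiniteDimensional ℝ E₁]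
  [ChartedSpace E₁ (OrbitSpace Q N)] [IsManifold 𝓘(ℝ, E₁) ∞ (OrbitSpace Q N)]

variable {E₂ : Type*} [NormedAddCommGroup E₂] [NormedSpace ℝ E₂] [FiniteDimensional ℝ E₂]
  [ChartedSpace E₂ (RedSpace Q N E₁)] [IsManifold 𝓘(ℝ, E₂) ∞ (RedSpace Q N E₁)]

variable (E₁ N ζ) in
/-- The `k` partially reduced gauge momenta, as a map to `ℝ^k`. -/
def JtMap (a : Cot E₁ (OrbitSpace Q N)) : Fin k → ℝ := fun i => Jt N ζ i a

variable (E₁ N ζ) in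
/-- The `k` gauge momenta on the reduced space `T*Q̃/F`. -/
def JredMap (z : RedSpace Q N E₁) : Fin k → ℝ := JtMap ζ N E₁ (Quot.out z)

variable (h : Setup sys ζ W Hor N E₁)
include h

theorem Setup.JtMap_smooth : ContMDiff (cotI E₁) 𝓘(ℝ, Fin k → ℝ) ∞ (JtMap ζ N E₁) :=
  contMDiff_pi_space.mpr h.Jt_smooth

theorem Setup.JtMap_mdiff (a : Cot E₁ (OrbitSpace Q N)) :
    MDifferentiableAt (cotI E₁) 𝓘(ℝ, Fin k → ℝ) (JtMap ζ N E₁) a :=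
  h.JtMap_smooth.mdifferentiable (by simp) a

theorem Setup.tmap_JtMap (a : Cot E₁ (OrbitSpace Q N)) (v : E₁ × (E₁ →L[ℝ] ℝ)) (i : Fin k) :
    tmap (cotI E₁) 𝓘(ℝ, Fin k → ℝ) (JtMap ζ N E₁) a v i = dfun (cotI E₁) (Jt N ζ i) a v := by
  have hp : DifferentiableAt ℝ (fun x : Fin k → ℝ => x i) (JtMap ζ N E₁ a) :=
    (ContinuousLinearMap.proj (R := ℝ) (φ := fun _ : Fin k => ℝ) i).differentiableAt
  have h1 := tmap_comp_apply (I'' := 𝓘(ℝ, ℝ)) (g := fun x : Fin k → ℝ => x i) (f := JtMap ζ N E₁)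
    (x := a) hp.mdifferentiableAt (h.JtMap_mdiff a) v
  rw [tmap_eq_fderiv, HasFDerivAt.fderiv (f := fun x : Fin k → ℝ => x i)
    (ContinuousLinearMap.proj (R := ℝ) (φ := fun _ : Fin k => ℝ) i).hasFDerivAt] at h1
  exact h1.symm

theorem Setup.tmap_JtMap_eq_zero_iff (a : Cot E₁ (OrbitSpace Q N)) (v : E₁ × (E₁ →L[ℝ] ℝ)) :
    tmap (cotI E₁) 𝓘(ℝ, Fin k → ℝ) (JtMap ζ N E₁) a v = 0 ↔
      ∀ i, dfun (cotI E₁) (Jt N ζ i) a v = 0 := by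
  simp only [funext_iff, h.tmap_JtMap, Pi.zero_apply]

theorem Setup.tmap_JtMap_surjective (a : Cot E₁ (OrbitSpace Q N)) :
    Function.Surjective (tmap (cotI E₁) 𝓘(ℝ, Fin k → ℝ) (JtMap ζ N E₁) a) :=
  surjective_of_linearIndependent (h.dJt_independent a) (h.tmap_JtMap a)

theorem Setup.JredMap_rhoF (a : Cot E₁ (OrbitSpace Q N)) :
    JredMap ζ N E₁ (rhoF N a) = JtMap ζ N E₁ a := by
  obtain ⟨f, hf⟩ := h.rhoF_out a
  rw [JredMap, ← hf]
  exact funext fun i => h.Jt_invariant i f a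

theorem Setup.mem_level_iff' (c : Fin k → ℝ) (a : Cot E₁ (OrbitSpace Q N)) :
    a ∈ level N ζ c ↔ JtMap ζ N E₁ a = c := by
  rw [h.mem_level_iff, funext_iff]
  rfl

theorem Setup.range_iotaRed (c : Fin k → ℝ) :
    Set.range (iotaRed (E₁ := E₁) N ζ c) = {z | JredMap ζ N E₁ z = c} := by
  ext z
  constructor
  · rintro ⟨y, rfl⟩
    obtain ⟨a, rfl⟩ := Quot.mk_surjective y
    exact (h.JredMap_rhoF a.1).trans ((h.mem_level_iff' c a.1).mp a.2)
  · intro hz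
    obtain ⟨a, rfl⟩ := rhoF_surjective (N := N) (E₁ := E₁) z
    have ha : a ∈ level N ζ c := (h.mem_level_iff' c a).mpr ((h.JredMap_rhoF a).symm.trans hz)
    exact ⟨rhoMu N ζ c ⟨a, ha⟩, rfl⟩

theorem Setup.OmegaB_genF_eq_zero {a : Cot E₁ (OrbitSpace Q N)} {w : E₁ × (E₁ →L[ℝ] ℝ)}
    (hw : ∀ i, dfun (cotI E₁) (Jt N ζ i) a w = 0) (ν : lieF 𝔤 N) :
    OmegaB sys N W Hor ζ a (genF 𝔤 N a ν) w = 0 := by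
  have h1 : ((OmegaB sys N W Hor ζ a).flip w).toLinearMap ∘ₗ genF 𝔤 N a = 0 :=
    (h.etaBasis a.1).ext fun i => by
      rw [h.etaBasis_apply]
      exact (h.OmegaB_genF i a w).trans (hw i)
  exact LinearMap.congr_fun h1 ν

variable (hr : IsSubmersion (cotI E₁) 𝓘(ℝ, E₂) (rhoF (Q := Q) (E₁ := E₁) N))
include hr

theorem Setup.JredMap_smooth : ContMDiff 𝓘(ℝ, E₂) 𝓘(ℝ, Fin k → ℝ) ∞ (JredMap ζ N E₁) :=
  hr.contMDiff_of_comp rhoF_surjective (by simpa only [h.JredMap_rhoF] using h.JtMap_smooth)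

theorem Setup.tmap_JredMap (a : Cot E₁ (OrbitSpace Q N)) (v : E₁ × (E₁ →L[ℝ] ℝ)) :
    tmap 𝓘(ℝ, E₂) 𝓘(ℝ, Fin k → ℝ) (JredMap ζ N E₁) (rhoF N a)
      (tmap (cotI E₁) 𝓘(ℝ, E₂) (rhoF N) a v) =
      tmap (cotI E₁) 𝓘(ℝ, Fin k → ℝ) (JtMap ζ N E₁) a v := by
  have h1 := tmap_comp_apply (g := JredMap ζ N E₁) (f := rhoF N) (x := a)
    ((h.JredMap_smooth hr).mdifferentiable (by simp) _) (h.rhoF_mdiff hr a) v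
  simp only [h.JredMap_rhoF] at h1
  exact h1.symm

theorem Setup.tmap_JredMap_surjective (z : RedSpace Q N E₁) :
    Function.Surjective (tmap 𝓘(ℝ, E₂) 𝓘(ℝ, Fin k → ℝ) (JredMap ζ N E₁) z) := by
  obtain ⟨a, rfl⟩ := rhoF_surjective (N := N) (E₁ := E₁) z
  intro y
  obtain ⟨v, hv⟩ := h.tmap_JtMap_surjective a y
  exact ⟨_, (h.tmap_JredMap hr a v).trans hv⟩

/-- On vectors tangent to the level sets, `Ω̃_𝐁` only depends on the projections to `T*Q̃/F`. -/
theorem Setup.OmegaB_basic {a b : Cot E₁ (OrbitSpace Q N)} (hab : rhoF N a = rhoF N b)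
    {u v u' v' : E₁ × (E₁ →L[ℝ] ℝ)}
    (hu : tmap (cotI E₁) 𝓘(ℝ, E₂) (rhoF N) a u = tmap (cotI E₁) 𝓘(ℝ, E₂) (rhoF N) b u')
    (hv : tmap (cotI E₁) 𝓘(ℝ, E₂) (rhoF N) a v = tmap (cotI E₁) 𝓘(ℝ, E₂) (rhoF N) b v')
    (hu' : ∀ i, dfun (cotI E₁) (Jt N ζ i) b u' = 0) (hv' : ∀ i, dfun (cotI E₁) (Jt N ζ i) b v' = 0) :
    OmegaB sys N W Hor ζ a u v = OmegaB sys N W Hor ζ b u' v' := by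
  obtain ⟨f, rfl⟩ := h.rhoF_eq_iff.mp hab
  have hs := bilin_swap (h.OmegaB_self (cotAct f a))
  have hgen : ∀ {x y : E₁ × (E₁ →L[ℝ] ℝ)},
      tmap (cotI E₁) 𝓘(ℝ, E₂) (rhoF N) a x = tmap (cotI E₁) 𝓘(ℝ, E₂) (rhoF N) (cotAct f a) y →
      ∀ {w}, (∀ i, dfun (cotI E₁) (Jt N ζ i) (cotAct f a) w = 0) →
      OmegaB sys N W Hor ζ (cotAct f a) (tmap (cotI E₁) (cotI E₁) (cotAct f) a x) w =
        OmegaB sys N W Hor ζ (cotAct f a) y w := by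
    intro x y hxy w hw
    rw [← h.trhoF_cotAct hr f] at hxy
    have h1 : tmap (cotI E₁) 𝓘(ℝ, E₂) (rhoF N) (cotAct f a)
        (tmap (cotI E₁) (cotI E₁) (cotAct f) a x - y) = 0 := by rw [map_sub, hxy, sub_self]
    obtain ⟨ν, hν⟩ := (h.trhoF_eq_zero_iff hr _ _).mp h1
    rw [← sub_eq_zero, ← bilin_sub, ← hν]
    exact h.OmegaB_genF_eq_zero hw ν
  rw [← h.OmegaB_invariant f a]
  have hv2 : ∀ i, dfun (cotI E₁) (Jt N ζ i) (cotAct f a) (tmap (cotI E₁) (cotI E₁) (cotAct f) a v) = 0 := by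
    rw [← h.tmap_JtMap_eq_zero_iff, ← h.tmap_JredMap hr, h.trhoF_cotAct hr, hv, h.tmap_JredMap hr,
      h.tmap_JtMap_eq_zero_iff]
    exact hv'
  rw [hgen hu hv2, hs, hgen hv hu', hs, neg_neg]

end Setup

/-! ### The reduced almost symplectic form and the reduced dynamics -/

section Setup

variable {E : Type*} [NormedAddCommGroup E] [NormedSpace ℝ E] [FiniteDimensional ℝ E]
  {Q : Type*} [TopologicalSpace Q] [ChartedSpace E Q] [IsManifold 𝓘(ℝ, E) ∞ Q] [T2Space Q]
  {𝔤 : Type*} [NormedAddCommGroup 𝔤] [NormedSpace ℝ 𝔤] [FiniteDimensional ℝ 𝔤]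
  {G : Type*} [Group G] [TopologicalSpace G] [ChartedSpace 𝔤 G] [LieGroup 𝓘(ℝ, 𝔤) ∞ G]
  [MulAction G Q] [ContMDiffSMul 𝓘(ℝ, 𝔤) 𝓘(ℝ, E) ∞ G Q] [ProperSMul G Q]
  {sys : System E Q} {k : ℕ} {ζ : Fin k → Q → 𝔤} {W Hor : PlaneField E Q}
  {N : Subgroup G} [N.Normal]
  {E₁ : Type*} [NormedAddCommGroup E₁] [NormedSpace ℝ E₁] [FiniteDimensional ℝ E₁]
  [ChartedSpace E₁ (OrbitSpace Q N)] [IsManifold 𝓘(ℝ, E₁) ∞ (OrbitSpace Q N)]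

variable {E₂ : Type*} [NormedAddCommGroup E₂] [NormedSpace ℝ E₂] [FiniteDimensional ℝ E₂]
  [ChartedSpace E₂ (RedSpace Q N E₁)] [IsManifold 𝓘(ℝ, E₂) ∞ (RedSpace Q N E₁)]
  {c : Fin k → ℝ}
  {F₁ : Type*} [NormedAddCommGroup F₁] [NormedSpace ℝ F₁]
  [ChartedSpace F₁ (level (E₁ := E₁) N ζ c)]
  {F₂ : Type*} [NormedAddCommGroup F₂] [NormedSpace ℝ F₂] [FiniteDimensional ℝ F₂]
  [ChartedSpace F₂ (LevelQuot (E₁ := E₁) N ζ c)]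
  [IsManifold 𝓘(ℝ, F₂) ∞ (LevelQuot (E₁ := E₁) N ζ c)]

variable (h : Setup sys ζ W Hor N E₁)
  (hr : IsSubmersion (cotI E₁) 𝓘(ℝ, E₂) (rhoF (Q := Q) (E₁ := E₁) N))
  (hi : IsSmoothEmbedding 𝓘(ℝ, F₂) 𝓘(ℝ, E₂) (iotaRed (E₁ := E₁) N ζ c))
  (ht : ∀ z v, tmap 𝓘(ℝ, E₂) 𝓘(ℝ, Fin k → ℝ) (JredMap ζ N E₁) (iotaRed N ζ c z) v = 0 ↔
    ∃ u, tmap 𝓘(ℝ, F₂) 𝓘(ℝ, E₂) (iotaRed N ζ c) z u = v)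
include h hr ht

omit [FiniteDimensional ℝ F₂] [IsManifold 𝓘(ℝ, F₂) ∞ (LevelQuot (E₁ := E₁) N ζ c)] in
/-- A vector is tangent to the level set if its projection is tangent to the reduced level set. -/
theorem Setup.dJt_eq_zero_iff (a : level (E₁ := E₁) N ζ c) (u : E₁ × (E₁ →L[ℝ] ℝ)) :
    (∀ i, dfun (cotI E₁) (Jt N ζ i) a.1 u = 0) ↔
      ∃ p, tmap 𝓘(ℝ, F₂) 𝓘(ℝ, E₂) (iotaRed N ζ c) (rhoMu N ζ c a) p =
        tmap (cotI E₁) 𝓘(ℝ, E₂) (rhoF N) a.1 u := by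
  rw [← h.tmap_JtMap_eq_zero_iff, ← h.tmap_JredMap hr]
  exact ht (rhoMu N ζ c a) _

include hi

theorem Setup.isSubmersion_rhoMu
    (hv : IsSmoothEmbedding 𝓘(ℝ, F₁) (cotI E₁)
      (Subtype.val : level (E₁ := E₁) N ζ c → Cot E₁ (OrbitSpace Q N)))
    (htv : ∀ (a : level (E₁ := E₁) N ζ c) v,
      tmap (cotI E₁) 𝓘(ℝ, Fin k → ℝ) (JtMap ζ N E₁) a.1 v = 0 ↔
      ∃ u, tmap 𝓘(ℝ, F₁) (cotI E₁) Subtype.val a u = v) :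
    IsSubmersion 𝓘(ℝ, F₁) 𝓘(ℝ, F₂) (rhoMu (E₁ := E₁) N ζ c) ∧
      ∀ (a : level (E₁ := E₁) N ζ c) u, tmap 𝓘(ℝ, F₂) 𝓘(ℝ, E₂) (iotaRed N ζ c) (rhoMu N ζ c a)
        (tmap 𝓘(ℝ, F₁) 𝓘(ℝ, F₂) (rhoMu N ζ c) a u) =
        tmap (cotI E₁) 𝓘(ℝ, E₂) (rhoF N) a.1 (tmap 𝓘(ℝ, F₁) (cotI E₁) Subtype.val a u) := by
  have hs : ContMDiff 𝓘(ℝ, F₁) 𝓘(ℝ, F₂) ∞ (rhoMu (E₁ := E₁) N ζ c) := fun a =>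
    contMDiffAt_of_immersion (I' := 𝓘(ℝ, E₂)) (f := iotaRed N ζ c) (hi.1 _) (hi.2.1 _)
      continuous_quot_mk.continuousAt ((hr.1.comp hv.1) a)
  have hT : ∀ (a : level (E₁ := E₁) N ζ c) u, tmap 𝓘(ℝ, F₂) 𝓘(ℝ, E₂) (iotaRed N ζ c) (rhoMu N ζ c a)
        (tmap 𝓘(ℝ, F₁) 𝓘(ℝ, F₂) (rhoMu N ζ c) a u) =
        tmap (cotI E₁) 𝓘(ℝ, E₂) (rhoF N) a.1 (tmap 𝓘(ℝ, F₁) (cotI E₁) Subtype.val a u) :=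
    fun a u => by
      rw [← tmap_comp_apply (hi.1.mdifferentiable (by simp) _) (hs.mdifferentiable (by simp) a),
        ← tmap_comp_apply (h.rhoF_mdiff hr _) (hv.1.mdifferentiable (by simp) a)]
      rfl
  refine ⟨⟨hs, fun a p => ?_⟩, hT⟩
  obtain ⟨v, hv'⟩ := hr.2 a.1 (tmap 𝓘(ℝ, F₂) 𝓘(ℝ, E₂) (iotaRed N ζ c) (rhoMu N ζ c a) p)
  obtain ⟨u, hu⟩ := (htv a v).mp ((h.tmap_JtMap_eq_zero_iff a.1 v).mpr
    ((h.dJt_eq_zero_iff hr ht a v).mpr ⟨p, hv'.symm⟩))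
  exact ⟨u, hi.2.1 _ ((hT a u).trans ((congrArg _ hu).trans hv'))⟩

variable (sys W Hor E₂) in
/-- The form `σ` on `J̃⁻¹(μ)/F` is induced by `Ω̃_𝐁`. -/
def IsReducedForm (σ : LevelQuot (E₁ := E₁) N ζ c → F₂ →L[ℝ] F₂ →L[ℝ] ℝ) : Prop :=
  ∀ (a : level (E₁ := E₁) N ζ c) (p q : F₂) (u v : E₁ × (E₁ →L[ℝ] ℝ)),
    tmap 𝓘(ℝ, F₂) 𝓘(ℝ, E₂) (iotaRed N ζ c) (rhoMu N ζ c a) p =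
      tmap (cotI E₁) 𝓘(ℝ, E₂) (rhoF N) a.1 u →
    tmap 𝓘(ℝ, F₂) 𝓘(ℝ, E₂) (iotaRed N ζ c) (rhoMu N ζ c a) q =
      tmap (cotI E₁) 𝓘(ℝ, E₂) (rhoF N) a.1 v →
    σ (rhoMu N ζ c a) p q = OmegaB sys N W Hor ζ a.1 u v

omit hi in
theorem Setup.exists_isReducedForm :
    ∃ σ : LevelQuot (E₁ := E₁) N ζ c → F₂ →L[ℝ] F₂ →L[ℝ] ℝ, IsReducedForm sys W Hor E₂ σ := by
  choose r hrr using fun a => exists_right_inverse (hr.2 a)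
  let T : LevelQuot (E₁ := E₁) N ζ c → F₂ →L[ℝ] E₁ × (E₁ →L[ℝ] ℝ) := fun z =>
    (r (Quot.out z).1).comp (tmap 𝓘(ℝ, F₂) 𝓘(ℝ, E₂) (iotaRed N ζ c) z)
  refine ⟨fun z => (OmegaB sys N W Hor ζ (Quot.out z).1).bilinearComp (T z) (T z),
    fun a p q u v hu hv => ?_⟩
  have h1 : rhoF N (Quot.out (rhoMu N ζ c a)).1 = rhoF N a.1 :=
    congrArg (iotaRed N ζ c) (Quot.out_eq (rhoMu N ζ c a))
  refine h.OmegaB_basic hr h1 ?_ ?_ ((h.dJt_eq_zero_iff hr ht a u).mpr ⟨p, hu⟩)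
    ((h.dJt_eq_zero_iff hr ht a v).mpr ⟨q, hv⟩)
  · exact (hrr _ _).trans hu
  · exact (hrr _ _).trans hv

variable {σ : LevelQuot (E₁ := E₁) N ζ c → F₂ →L[ℝ] F₂ →L[ℝ] ℝ}
  (hσ : IsReducedForm sys W Hor E₂ σ)
include hσ

theorem Setup.reducedForm_form2At (z : LevelQuot (E₁ := E₁) N ζ c) : Form2At 𝓘(ℝ, F₂) σ z := by
  refine Form2At.of_apply fun x y hx hy => ?_
  obtain ⟨a, rfl⟩ : ∃ a, rhoMu N ζ c a = z := Quot.mk_surjective z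
  obtain ⟨r, hrr⟩ := exists_right_inverse (hr.2 a.1)
  obtain ⟨s, U, hU, haU, hs, hsU, hsa, -⟩ := exists_local_section hr.1 a.1 hrr
  have hsat : ∀ w ∈ U, ContMDiffAt 𝓘(ℝ, E₂) (cotI E₁) ∞ s w := fun w hw =>
    hs.contMDiffAt (hU.mem_nhds hw)
  have hT : ∀ w ∈ U, ∀ v, tmap (cotI E₁) 𝓘(ℝ, E₂) (rhoF N) (s w)
      (tmap 𝓘(ℝ, E₂) (cotI E₁) s w v) = v := fun w hw v => by
    rw [← tmap_comp_apply (h.rhoF_mdiff hr _) ((hsat w hw).mdifferentiableAt (by simp))]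
    have h1 : (fun w => rhoF N (s w)) =ᶠ[𝓝 w] fun w => w :=
      Filter.mem_of_superset (hU.mem_nhds hw) hsU
    have h2 : tmap 𝓘(ℝ, E₂) 𝓘(ℝ, E₂) (fun w => rhoF N (s w)) w =
        tmap 𝓘(ℝ, E₂) 𝓘(ℝ, E₂) (fun w => w) w := h1.mfderiv_eq
    exact (congrArg (fun L : E₂ →L[ℝ] E₂ => L v) h2).trans
      (congrArg (fun L : E₂ →L[ℝ] E₂ => L v) (mfderiv_id (I := 𝓘(ℝ, E₂)) (x := w)))
  have hb : ∀ {x : LevelQuot (E₁ := E₁) N ζ c → F₂},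
      SmAt 𝓘(ℝ, F₂) 𝓘(ℝ, F₂) (fun y => y) x (rhoMu N ζ c a) →
      SmAt (cotI E₁) 𝓘(ℝ, F₂) (fun y => s (iotaRed N ζ c y)) (fun y =>
        tmap 𝓘(ℝ, E₂) (cotI E₁) s (iotaRed N ζ c y)
          (tmap 𝓘(ℝ, F₂) 𝓘(ℝ, E₂) (iotaRed N ζ c) y (x y))) (rhoMu N ζ c a) :=
    fun hx => (hx.tmap (hi.1 _)).tmap (hsat _ haU)
  refine (Form2At.apply (h.OmegaB_form2At _) (hb hx) (hb hy)).congr_of_eventuallyEq ?_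
  filter_upwards [(hi.1.continuous.tendsto (rhoMu N ζ c a)).eventually (hU.mem_nhds haU)] with z hz
  have h1 : rhoF N (s (iotaRed N ζ c z)) = iotaRed N ζ c z := hsU _ hz
  have h2 : s (iotaRed N ζ c z) ∈ level N ζ c := by
    rw [h.mem_level_iff', ← h.JredMap_rhoF, h1]
    exact (h.range_iotaRed c).le ⟨z, rfl⟩
  have h3 : rhoMu N ζ c ⟨_, h2⟩ = z := hi.2.2.injective h1
  have h4 := hσ ⟨_, h2⟩ (x z) (y z) (tmap 𝓘(ℝ, E₂) (cotI E₁) s (iotaRed N ζ c z)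
      (tmap 𝓘(ℝ, F₂) 𝓘(ℝ, E₂) (iotaRed N ζ c) z (x z)))
    (tmap 𝓘(ℝ, E₂) (cotI E₁) s (iotaRed N ζ c z)
      (tmap 𝓘(ℝ, F₂) 𝓘(ℝ, E₂) (iotaRed N ζ c) z (y z)))
    (by rw [h3]; exact (hT _ hz _).symm) (by rw [h3]; exact (hT _ hz _).symm)
  rw [h3] at h4
  exact h4

theorem Setup.reducedForm_nondegenerate (z : LevelQuot (E₁ := E₁) N ζ c) {p : F₂}
    (hp : ∀ q, σ z p q = 0) : p = 0 := by
  obtain ⟨a, rfl⟩ : ∃ a, rhoMu N ζ c a = z := Quot.mk_surjective z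
  obtain ⟨u, hu⟩ := hr.2 a.1 (tmap 𝓘(ℝ, F₂) 𝓘(ℝ, E₂) (iotaRed N ζ c) (rhoMu N ζ c a) p)
  obtain ⟨b, hb⟩ := exists_coeff_of_iInf_ker_le (l := fun i => dfun (cotI E₁) (Jt N ζ i) a.1)
    (f := OmegaB sys N W Hor ζ a.1 u) fun v hv => by
      obtain ⟨q, hq⟩ := (h.dJt_eq_zero_iff hr ht a v).mp hv
      exact (hσ a p q u v hu.symm hq).symm.trans (hp q)
  have h1 : u = genF 𝔤 N a.1 (∑ i, b i • eta ζ i a.1.1) := by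
    refine sub_eq_zero.mp (h.OmegaB_nondegenerate a.1 fun w => ?_)
    rw [bilin_sub, hb, map_sum, map_sum, sum_apply, sum_apply, sub_eq_zero]
    refine Finset.sum_congr rfl fun i _ => ?_
    rw [map_smul, map_smul, smul_apply, smul_apply, h.OmegaB_genF]
  have h2 := (h.trhoF_eq_zero_iff hr a.1 u).mpr ⟨_, h1.symm⟩
  rw [hu] at h2
  exact hi.2.1 _ (h2.trans (map_zero _).symm)

theorem Setup.isAlmostSymplectic_reducedForm :
    IsAlmostSymplectic 𝓘(ℝ, F₂) (X := LevelQuot (E₁ := E₁) N ζ c) σ where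
  smooth := contMDiff_form2_section (h.reducedForm_form2At hr hi ht hσ)
  alt z p := by
    obtain ⟨a, rfl⟩ : ∃ a, rhoMu N ζ c a = z := Quot.mk_surjective z
    obtain ⟨u, hu⟩ := hr.2 a.1 (tmap 𝓘(ℝ, F₂) 𝓘(ℝ, E₂) (iotaRed N ζ c) (rhoMu N ζ c a) p)
    exact (hσ a p p u u hu.symm hu.symm).trans (h.OmegaB_self a.1 u)
  nondegenerate z _ hp := h.reducedForm_nondegenerate hr hi ht hσ z hp

omit ht hσ in
theorem Setup.Hred_iotaRed_smooth : ContMDiff 𝓘(ℝ, F₂) 𝓘(ℝ, ℝ) ∞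
    (fun z => Hred (E₁ := E₁) sys N (iotaRed (E₁ := E₁) N ζ c z)) :=
  (h.Hred_smooth hr).comp hi.1

omit hi hσ in
theorem Setup.exists_reducedField (z : LevelQuot (E₁ := E₁) N ζ c) :
    ∃ x, tmap 𝓘(ℝ, F₂) 𝓘(ℝ, E₂) (iotaRed (E₁ := E₁) N ζ c) z x =
      Xred sys N (iotaRed N ζ c z) := by
  obtain ⟨a, rfl⟩ : ∃ a, rhoMu N ζ c a = z := Quot.mk_surjective z
  obtain ⟨p, hp⟩ := (h.dJt_eq_zero_iff hr ht a (Xtilde sys N a.1)).mp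
    fun i => h.dJt_Xtilde i a.1
  exact ⟨p, hp.trans (h.Xred_rhoF hr a.1).symm⟩

variable {Z : LevelQuot (E₁ := E₁) N ζ c → F₂}
  (hZ : ∀ z, tmap 𝓘(ℝ, F₂) 𝓘(ℝ, E₂) (iotaRed (E₁ := E₁) N ζ c) z (Z z) =
    Xred sys N (iotaRed N ζ c z))
include hZ

theorem Setup.reducedForm_field (z : LevelQuot (E₁ := E₁) N ζ c) (v : F₂) :
    σ z (Z z) v = dfun 𝓘(ℝ, F₂)
      (fun z => Hred (E₁ := E₁) sys N (iotaRed (E₁ := E₁) N ζ c z)) z v := by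
  obtain ⟨a, rfl⟩ : ∃ a, rhoMu N ζ c a = z := Quot.mk_surjective z
  obtain ⟨u, hu⟩ := hr.2 a.1 (tmap 𝓘(ℝ, F₂) 𝓘(ℝ, E₂) (iotaRed N ζ c) (rhoMu N ζ c a) v)
  rw [hσ a _ v _ u ((hZ _).trans (h.Xred_rhoF hr a.1)) hu.symm, h.OmegaB_Xtilde]
  have h1 := tmap_comp_apply (I := 𝓘(ℝ, F₂)) (I' := 𝓘(ℝ, E₂)) (I'' := 𝓘(ℝ, ℝ))
    (g := Hred (E₁ := E₁) sys N) (f := iotaRed N ζ c) (x := rhoMu N ζ c a)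
    ((h.Hred_smooth hr).mdifferentiable (by simp) _) (hi.1.mdifferentiable (by simp) _) v
  have h2 := tmap_comp_apply (I := cotI E₁) (I' := 𝓘(ℝ, E₂)) (I'' := 𝓘(ℝ, ℝ))
    (g := Hred (E₁ := E₁) sys N) (f := rhoF N) (x := a.1)
    ((h.Hred_smooth hr).mdifferentiable (by simp) _) (h.rhoF_mdiff hr _) u
  simp only [h.Hred_rhoF] at h2
  rw [hu] at h2
  exact h2.trans h1.symm

theorem Setup.reducedField_smooth : IsSmoothVectorFieldOn 𝓘(ℝ, F₂) Z Set.univ := by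
  refine contMDiffOn_univ.mpr fun z => ?_
  refine SmAt.of_form2 (f := fun z : LevelQuot (E₁ := E₁) N ζ c => z)
    (h.reducedForm_form2At hr hi ht hσ z)
    (fun v hv => h.reducedForm_nondegenerate hr hi ht hσ z hv) contMDiffAt_id fun w hw => ?_
  simp only [h.reducedForm_field hr hi ht hσ hZ]
  exact (smAt_vectorSpace_iff.mp (hw.tmap (h.Hred_iotaRed_smooth hr hi z))).2

end Setup

end NH

end

set_option maxHeartbeats 4000000 in
set_option synthInstance.maxHeartbeats 400000 in
theorem theorem3p1
    -- the configuration manifold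
    {E : Type*} [NormedAddCommGroup E] [NormedSpace ℝ E] [FiniteDimensional ℝ E]
    {Q : Type*} [TopologicalSpace Q] [ChartedSpace E Q] [IsManifold 𝓘(ℝ, E) ∞ Q]
    [T2Space Q] [SecondCountableTopology Q]
    -- the Lie group and its proper action
    {𝔤 : Type*} [NormedAddCommGroup 𝔤] [NormedSpace ℝ 𝔤] [FiniteDimensional ℝ 𝔤]
    {G : Type*} [Group G] [TopologicalSpace G] [ChartedSpace 𝔤 G] [LieGroup 𝓘(ℝ, 𝔤) ∞ G]
    [T2Space G] [SecondCountableTopology G]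
    [MulAction G Q] [ContMDiffSMul 𝓘(ℝ, 𝔤) 𝓘(ℝ, E) ∞ G Q] [ProperSMul G Q]
    -- the nonholonomic system with symmetry and the dimension assumption
    (sys : System E Q) (hsym : IsSymmetry G sys) (hdim : DimensionAssumption 𝔤 G sys)
    -- `k = rank S` horizontal gauge momenta
    (k : ℕ) (hk : ∀ q, Module.finrank ℝ (distS 𝔤 G sys q) = k)
    (ζ : Fin k → Q → 𝔤) (hζ : IsGaugeMomenta G sys ζ)
    -- the vertical complement, the vertical symmetry condition, the horizontal space
    (W : PlaneField E Q) (hW : IsVerticalComplement 𝔤 G sys W)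
    (N : Subgroup G) [N.Normal] (hN : VerticalSymmetry W N)
    (Hor : PlaneField E Q) (hHor : IsHorizontal 𝔤 G sys Hor)
    -- the quotient manifold structure of `Q̃ = Q/N`
    {E₁ : Type*} [NormedAddCommGroup E₁] [NormedSpace ℝ E₁] [FiniteDimensional ℝ E₁]
    [ChartedSpace E₁ (OrbitSpace Q N)] [IsManifold 𝓘(ℝ, E₁) ∞ (OrbitSpace Q N)]
    (hproj : IsSubmersion 𝓘(ℝ, E) 𝓘(ℝ, E₁) (proj (Q := Q) N))
    -- the quotient manifold structure of `T*Q̃/F = M/G`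
    {E₂ : Type*} [NormedAddCommGroup E₂] [NormedSpace ℝ E₂] [FiniteDimensional ℝ E₂]
    [ChartedSpace E₂ (RedSpace Q N E₁)] [IsManifold 𝓘(ℝ, E₂) ∞ (RedSpace Q N E₁)]
    (hrho : IsSubmersion (cotI E₁) 𝓘(ℝ, E₂) (rhoF (Q := Q) (E₁ := E₁) N)) :
    -- `redMap` restricted to `M` is the orbit projection `M → M/N = T*Q̃`, the composition with
    -- `rhoF` is the orbit projection `M → M/G`, and the reduced objects are well defined
    ((∀ a, ∃ m ∈ sys.M, redMap (E₁ := E₁) sys N m = a) ∧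
      (∀ m ∈ sys.M, ∀ m' ∈ sys.M, redMap (E₁ := E₁) sys N m = redMap (E₁ := E₁) sys N m' ↔
        ∃ n ∈ N, cotAct n m' = m) ∧
      (∀ m ∈ sys.M, ∀ m' ∈ sys.M,
        rhoF (Q := Q) (E₁ := E₁) N (redMap (E₁ := E₁) sys N m) = rhoF (Q := Q) (E₁ := E₁) N (redMap (E₁ := E₁) sys N m') ↔
        ∃ g : G, cotAct g m' = m) ∧
      (∀ m ∈ sys.M, Htilde (E₁ := E₁) sys N (redMap (E₁ := E₁) sys N m) = sys.hamiltonian m) ∧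
      (∀ m ∈ sys.M, Xtilde (E₁ := E₁) sys N (redMap (E₁ := E₁) sys N m) = tredMap (E₁ := E₁) sys N m (sys.Xnh m)) ∧
      (∀ m ∈ sys.M, ∀ u ∈ tangentTo (cotI E) sys.M m, ∀ v ∈ tangentTo (cotI E) sys.M m,
        descend (E₁ := E₁) sys N (JKW (𝔤 := 𝔤) G sys W) (redMap (E₁ := E₁) sys N m)
            (tredMap (E₁ := E₁) sys N m u) (tredMap (E₁ := E₁) sys N m v) =
          JKW (𝔤 := 𝔤) G sys W m (tτ m u) (tτ m v)) ∧
      (∀ m ∈ sys.M, ∀ u ∈ tangentTo (cotI E) sys.M m, ∀ v ∈ tangentTo (cotI E) sys.M m,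
        descend (E₁ := E₁) sys N (formB G sys W Hor ζ) (redMap (E₁ := E₁) sys N m)
            (tredMap (E₁ := E₁) sys N m u) (tredMap (E₁ := E₁) sys N m v) =
          formB G sys W Hor ζ m (tτ m u) (tτ m v)) ∧
      (∀ i q, eta ζ i (proj N q) = (Submodule.Quotient.mk (ζ i q) : lieF 𝔤 N)) ∧
      (∀ (i j : Fin k) (x : OrbitSpace Q N), muDual ζ i x (eta ζ j x) = if i = j then 1 else 0) ∧
      (∀ a, Hred (E₁ := E₁) sys N (rhoF (Q := Q) (E₁ := E₁) N a) = Htilde (E₁ := E₁) sys N a) ∧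
      (∀ m ∈ sys.M, Xred (E₁ := E₁) (E₂ := E₂) sys N (rhoF (Q := Q) (E₁ := E₁) N (redMap (E₁ := E₁) sys N m)) =
        tmap (cotI E₁) 𝓘(ℝ, E₂) (rhoF (Q := Q) (E₁ := E₁) N) (redMap (E₁ := E₁) sys N m) (tredMap (E₁ := E₁) sys N m (sys.Xnh m)))) ∧
    -- (i) the partially reduced system
    ((IsAlmostSymplectic (cotI E₁) (X := Cot E₁ (OrbitSpace Q N)) (OmegaB sys N W Hor ζ) ∧
      ContMDiff (cotI E₁) 𝓘(ℝ, ℝ) ∞ (Htilde (E₁ := E₁) sys N) ∧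
      (∀ a v, OmegaB (E₁ := E₁) sys N W Hor ζ a (Xtilde (E₁ := E₁) sys N a) v =
        dfun (cotI E₁) (Htilde (E₁ := E₁) sys N) a v)) ∧
      -- it is `F`-invariant
      ((∀ (h : G ⧸ N) a, Htilde (E₁ := E₁) sys N (cotAct h a) = Htilde (E₁ := E₁) sys N a) ∧
      (∀ (h : G ⧸ N) a u v,
        OmegaB (E₁ := E₁) sys N W Hor ζ (cotAct h a)
            (tmap (cotI E₁) (cotI E₁) (cotAct h) a u) (tmap (cotI E₁) (cotI E₁) (cotAct h) a v) =
          OmegaB sys N W Hor ζ a u v)) ∧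
      -- it has `k` partially reduced horizontal gauge momenta
      (∀ i, ContMDiff (cotI E₁) 𝓘(ℝ, ℝ) ∞ (Jt (E₁ := E₁) N ζ i)) ∧
      (∀ i, ∀ m ∈ sys.M, Jt (E₁ := E₁) N ζ i (redMap (E₁ := E₁) sys N m) = momentumOf G (ζ i) m) ∧
      (∀ i (h : G ⧸ N) a, Jt (E₁ := E₁) N ζ i (cotAct h a) = Jt (E₁ := E₁) N ζ i a) ∧
      (∀ i a, dfun (cotI E₁) (Jt (E₁ := E₁) N ζ i) a (Xtilde (E₁ := E₁) sys N a) = 0) ∧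
      (∀ a, LinearIndependent ℝ fun i => dfun (cotI E₁) (Jt (E₁ := E₁) N ζ i) a)) ∧
    -- (ii), (iii), for all `μ = ∑ c_i μ^i`
    (∀ c : Fin k → ℝ,
      (∀ (h : G ⧸ N), ∀ a ∈ level (E₁ := E₁) N ζ c, cotAct h a ∈ level (E₁ := E₁) N ζ c) ∧
      -- manifold structures on `J̃⁻¹(μ)` and on `J̃⁻¹(μ)/F`
      ∃ (d e : ℕ)
        (_ : ChartedSpace (EuclideanSpace ℝ (Fin d)) (level (E₁ := E₁) N ζ c))
        (_ : IsManifold 𝓘(ℝ, EuclideanSpace ℝ (Fin d)) ∞ (level (E₁ := E₁) N ζ c))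
        (_ : ChartedSpace (EuclideanSpace ℝ (Fin e)) (LevelQuot (E₁ := E₁) N ζ c))
        (_ : IsManifold 𝓘(ℝ, EuclideanSpace ℝ (Fin e)) ∞ (LevelQuot (E₁ := E₁) N ζ c)),
        T2Space (LevelQuot (E₁ := E₁) N ζ c) ∧
        SecondCountableTopology (LevelQuot (E₁ := E₁) N ζ c) ∧
        IsSmoothEmbedding 𝓘(ℝ, EuclideanSpace ℝ (Fin d)) (cotI E₁)
          (Subtype.val : level (E₁ := E₁) N ζ c → Cot E₁ (OrbitSpace Q N)) ∧
        IsSubmersion 𝓘(ℝ, EuclideanSpace ℝ (Fin d)) 𝓘(ℝ, EuclideanSpace ℝ (Fin e))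
          (rhoMu (E₁ := E₁) N ζ c) ∧
        IsSmoothEmbedding 𝓘(ℝ, EuclideanSpace ℝ (Fin e)) 𝓘(ℝ, E₂)
          (iotaRed (E₁ := E₁) N ζ c) ∧
        -- the almost symplectic form on `J̃⁻¹(μ)/F`
        ∃ σ : LevelQuot (E₁ := E₁) N ζ c →
            EuclideanSpace ℝ (Fin e) →L[ℝ] EuclideanSpace ℝ (Fin e) →L[ℝ] ℝ,
          IsAlmostSymplectic 𝓘(ℝ, EuclideanSpace ℝ (Fin e)) (X := LevelQuot (E₁ := E₁) N ζ c) σ ∧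
          (∀ (a : level (E₁ := E₁) N ζ c) (u v : EuclideanSpace ℝ (Fin d)),
            OmegaB (E₁ := E₁) sys N W Hor ζ a.1
                (tmap 𝓘(ℝ, EuclideanSpace ℝ (Fin d)) (cotI E₁) Subtype.val a u)
                (tmap 𝓘(ℝ, EuclideanSpace ℝ (Fin d)) (cotI E₁) Subtype.val a v) =
              σ (rhoMu N ζ c a)
                (tmap 𝓘(ℝ, EuclideanSpace ℝ (Fin d)) 𝓘(ℝ, EuclideanSpace ℝ (Fin e))
                  (rhoMu (E₁ := E₁) N ζ c) a u)
                (tmap 𝓘(ℝ, EuclideanSpace ℝ (Fin d)) 𝓘(ℝ, EuclideanSpace ℝ (Fin e))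
                  (rhoMu (E₁ := E₁) N ζ c) a v)) ∧
          -- the reduced dynamics
          ContMDiff 𝓘(ℝ, EuclideanSpace ℝ (Fin e)) 𝓘(ℝ, ℝ) ∞
            (fun z => Hred (E₁ := E₁) sys N (iotaRed (E₁ := E₁) N ζ c z)) ∧
          ∃ Xμ : LevelQuot (E₁ := E₁) N ζ c → EuclideanSpace ℝ (Fin e),
            IsSmoothVectorFieldOn 𝓘(ℝ, EuclideanSpace ℝ (Fin e)) Xμ Set.univ ∧
            (∀ z, tmap 𝓘(ℝ, EuclideanSpace ℝ (Fin e)) 𝓘(ℝ, E₂) (iotaRed (E₁ := E₁) N ζ c) z (Xμ z)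
              = Xred sys N (iotaRed N ζ c z)) ∧
            (∀ z v, σ z (Xμ z) v = dfun 𝓘(ℝ, EuclideanSpace ℝ (Fin e))
              (fun z => Hred (E₁ := E₁) sys N (iotaRed (E₁ := E₁) N ζ c z)) z v)) := by
  have h : Setup sys ζ W Hor N E₁ := ⟨hsym, hdim, hk, hζ, hW, hN, hHor, hproj⟩
  refine ⟨⟨h.redMap_surjective, fun m hm m' hm' => h.redMap_eq_iff hm hm',
    fun m hm m' hm' => h.rhoF_redMap_eq_iff hm hm', fun m hm => h.Htilde_redMap hm,
    fun m hm => h.Xtilde_redMap hm, ?_, ?_, h.eta_proj, h.muDual_eta, h.Hred_rhoF, ?_⟩,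
    ⟨⟨h.isAlmostSymplectic_OmegaB, h.Htilde_smooth, h.OmegaB_Xtilde⟩,
      ⟨h.Htilde_invariant, h.OmegaB_invariant⟩, h.Jt_smooth, fun i m _ => h.Jt_redMap i m,
      h.Jt_invariant, h.dJt_Xtilde, h.dJt_independent⟩, fun c => ⟨fun f a ha => h.level_invariant c f ha, ?_⟩⟩
  · intro m hm u hu v hv
    rw [h.descend_JKW hm, tτ_apply, tτ_apply]
  · intro m hm u hu v hv
    rw [h.descend_formB hm, tτ_apply, tτ_apply]
  · intro m hm
    rw [h.Xred_rhoF hrho, h.Xtilde_redMap hm]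
  have hT2 := h.t2Space_redSpace hrho
  have hSC := h.secondCountable_redSpace hrho
  obtain ⟨cs₁, mf₁, hv, htv⟩ := exists_manifold_level
    (ι := (Subtype.val : level (E₁ := E₁) N ζ c → Cot E₁ (OrbitSpace Q N)))
    Topology.IsEmbedding.subtypeVal h.JtMap_smooth (c := c)
    (by
      ext a
      rw [Subtype.range_coe]
      exact h.mem_level_iff' c a)
    (fun a => h.tmap_JtMap_surjective a.1) rfl
  obtain ⟨cs₂, mf₂, hi, ht⟩ := exists_manifold_level (h.isEmbedding_iotaRed hrho c)
    (h.JredMap_smooth hrho) (h.range_iotaRed c) (fun z => h.tmap_JredMap_surjective hrho _) rfl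
  obtain ⟨hs, hT⟩ := h.isSubmersion_rhoMu hrho hi ht hv htv
  obtain ⟨σ, hσ⟩ := h.exists_isReducedForm hrho ht
  choose Z hZ using h.exists_reducedField hrho ht
  refine ⟨_, _, cs₁, mf₁, cs₂, mf₂, (h.isEmbedding_iotaRed hrho c).t2Space,
    (h.isEmbedding_iotaRed hrho c).secondCountableTopology, hv, hs, hi, σ,
    h.isAlmostSymplectic_reducedForm hrho hi ht hσ,
    fun a u v => (hσ a _ _ _ _ (hT a u) (hT a v)).symm, h.Hred_iotaRed_smooth hrho hi,
    Z, h.reducedField_smooth hrho hi ht hσ hZ, hZ, h.reducedForm_field hrho hi ht hσ hZ⟩
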